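/- Let $K=\mathbb F_5$. A pseudo-composition algebra over $K$ is a commutative, not necessarily associative $K$-algebra $A$ with a non-zero symmetric bilinear form $\varphi$ such that $x^3=\varphi(x,x)\,x$ for all $x\in A$. For a non-zero idempotent $a\in A$ let $A_\lambda(a)=\{x : ax=\lambda x\}$; then $A=(A_1(a)\oplus A_{-1}(a))\oplus A_{1/2}(a)$, and the Miyamoto involution $\tau_a$ is the linear map that is the identity on $A_1(a)\oplus A_{-1}(a)$ and $-1$ on $A_{1/2}(a)$. For $\alpha,\beta,\gamma,\psi\in K$, the universal algebra with these parameters is a pseudo-composition algebra $A$ over $K$, generated by three non-zero idempotents $a,b,c$ with $\varphi(a,b)=\alpha$, $\varphi(b,c)=\beta$, $\varphi(a,c)=\gamma$, $\varphi(b,ac)=\psi$, such that for every pseudo-composition algebra over $K$ generated by three non-zero idempotents $a',b',c'$ with the same four parameters there is a surjective algebra homomorphism from $A$ onto it taking $a,b,c$ to $a',b',c'$. Below, $N:H$ stands for a semidirect product $N\rtimes H$ with a non-trivial action of $H$ on $N$, $5^n$ for an elementary abelian group of order $5^n$, $2$ for the group of order $2$, and $PSU(3,5)$ for the projective special unitary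 group of degree $3$ with respect to $\mathbb F_{25}/\mathbb F_5$. **Proposition.** For all $\alpha,\beta,\gamma,\psi\in\mathbb F_5$ the universal algebra $A$ exists, and it has dimension $8$ with basis $a,\ b,\ c,\ ab,\ bc,\ ac,\ a(bc),\ b(ac)$. The group $T=\langle\tau_a,\tau_b,\tau_c\rangle$ is either solvable or isomorphic to a group of one of the forms $$5^5:A_5,\quad 5^5:S_5,\quad 5^2:(5^2:(SL(2,5):2)),\quad PSL(2,7),\quad PSL(3,5),\quad PSU(3,5),\quad A_6,\quad A_7,$$ and each of these eight cases occurs for some choice of the parameters. If $T$ is of one of these eight forms, then the Gram matrix of $\varphi$ in the above basis has rank $5$ in the first two cases, rank $4$ in the third case, and rank $8$ in the five remaining cases. -/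

import Mathlib

open scoped MatrixGroups

universe u

namespace PseudoComp

instance fact_prime_five : Fact (Nat.Prime 5) := ⟨by norm_num⟩

instance fact_prime_seven : Fact (Nat.Prime 7) := ⟨by norm_num⟩

section Algebras

set_option linter.unusedSectionVars false

variable {K : Type*} [Field K] {A : Type*} [NonUnitalNonAssocCommRing A] [Module K A]
  [IsScalarTower K A A] [SMulCommClass K A A]

/-- A commutative (not necessarily associative) `K`-algebra `A` with the bilinear form `φ` is a
pseudo-composition algebra: `φ` is nonzero, symmetric, and `x³ = φ(x, x) x` for all `x`.
(By commutativity `(x x) x = x (x x)`, so `x³` is unambiguous.) -/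
structure IsPseudoComposition (φ : LinearMap.BilinForm K A) : Prop where
  nonzero : φ ≠ 0
  symm : ∀ x y : A, φ x y = φ y x
  cube : ∀ x : A, x * x * x = φ x x • x

/-- `A` with the form `φ` is a pseudo-composition algebra which is generated, as an algebra, by the
three nonzero idempotents `a, b, c`. -/
structure IsGeneratedByIdempotents (φ : LinearMap.BilinForm K A) (a b c : A) : Prop where
  pseudoComposition : IsPseudoComposition φ
  idem_a : a * a = a
  idem_b : b * b = b
  idem_c : c * c = c
  a_ne_zero : a ≠ 0
  b_ne_zero : b ≠ 0
  c_ne_zero : c ≠ 0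
  generates : NonUnitalAlgebra.adjoin K ({a, b, c} : Set A) = ⊤

/-- The four parameters of the triple `a, b, c`:
`α = φ(a, b)`, `β = φ(b, c)`, `γ = φ(a, c)`, `ψ = φ(b, ac)`. -/
structure HasParameters (φ : LinearMap.BilinForm K A) (a b c : A) (α β γ ψ : K) : Prop where
  ab : φ a b = α
  bc : φ b c = β
  ac : φ a c = γ
  b_ac : φ b (a * c) = ψ

/-- The eight elements `a, b, c, ab, bc, ac, a(bc), b(ac)`. -/
def monomials (a b c : A) : Fin 8 → A :=
  ![a, b, c, a * b, b * c, a * c, a * (b * c), b * (a * c)]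

/-- The Gram matrix of the form `φ` on the elements
`a, b, c, ab, bc, ac, a(bc), b(ac)`. -/
def gramMatrix (φ : LinearMap.BilinForm K A) (a b c : A) : Matrix (Fin 8) (Fin 8) K :=
  Matrix.of fun i j => φ (monomials a b c i) (monomials a b c j)

variable (K) in
/-- `A_λ(a)`: the eigenspace of the multiplication by `a` for the eigenvalue `l`. -/
def eigen (a : A) (l : K) : Submodule K A :=
  Module.End.eigenspace (LinearMap.mulLeft K a) l

variable (K) in
/-- The even part `A_1(a) ⊕ A_{-1}(a)`. -/
def evenPart (a : A) : Submodule K A := eigen K a 1 ⊔ eigen K a (-1)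

variable (K) in
/-- The odd part `A_{1/2}(a)`. -/
def oddPart (a : A) : Submodule K A := eigen K a (1 / 2)

open Classical in
variable (K) in
/-- The Miyamoto involution `τ_a`: the linear bijection `x₊ + x₋ ↦ x₊ - x₋` attached to the
decomposition of `A` as the direct sum of `A_1(a) ⊕ A_{-1}(a)` and `A_{1/2}(a)`.
For an `a` without such a decomposition the value is the identity; by `isCompl_even_odd` below,
this does not occur for a nonzero idempotent of a pseudo-composition algebra
in characteristic not `2` or `3`. -/
noncomputable def miyamoto (a : A) : A ≃ₗ[K] A :=
  if h : IsCompl (evenPart K a) (oddPart K a) then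
    (Submodule.prodEquivOfIsCompl _ _ h).symm ≪≫ₗ
      ((LinearEquiv.refl K (evenPart K a)).prodCongr (LinearEquiv.neg K)) ≪≫ₗ
      Submodule.prodEquivOfIsCompl _ _ h
  else LinearEquiv.refl K A

variable (K) in
/-- The group `T = ⟨τ_a, τ_b, τ_c⟩` of linear transformations of `A`. -/
def miyamotoGroup (a b c : A) : Subgroup (A ≃ₗ[K] A) :=
  Subgroup.closure {miyamoto K a, miyamoto K b, miyamoto K c}

theorem mem_eigen (a x : A) (l : K) : x ∈ eigen K a l ↔ a * x = l • x := by
  simp [eigen]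

/-- The defining identity with two arguments equal to an idempotent `a`. -/
theorem idem_identity (h2 : (2 : K) ≠ 0) {φ : LinearMap.BilinForm K A}
    (hφ : IsPseudoComposition φ) {a : A} (ha : a * a = a) (ha0 : a ≠ 0) (y : A) :
    φ a a = 1 ∧ (2 : K) • (a * (a * y)) + a * y = (2 * φ a y) • a + y := by
  have h1 : φ a a = 1 := by
    have h := hφ.cube a
    rw [ha, ha] at h
    have h' : (φ a a - 1) • a = 0 := by rw [sub_smul, one_smul, ← h, sub_self]
    rcases smul_eq_zero.1 h' with h' | h'
    · exact sub_eq_zero.1 h'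
    · exact absurd h' ha0
  refine ⟨h1, ?_⟩
  have hp := hφ.cube (a + y)
  have hm := hφ.cube (a - y)
  have hy := hφ.cube y
  have hs := hφ.symm y a
  have e1 : a * y * a = a * (a * y) := mul_comm _ _
  have e2 : y * a = a * y := mul_comm _ _
  simp only [add_mul, mul_add, sub_mul, mul_sub, ha, e1, e2, hy, map_add, map_sub,
    LinearMap.add_apply, LinearMap.sub_apply, h1, hs] at hp hm
  have hd : (2 : K) • ((2 : K) • (a * (a * y)) + a * y) = (2 : K) • ((2 * φ a y) • a + y) := by
    have := congrArg₂ (· - ·) hp hm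
    simp only [smul_add, smul_sub, add_smul, sub_smul, one_smul] at this
    simp only [two_smul, two_mul, add_smul, smul_add]
    rw [← sub_eq_zero] at this ⊢
    rw [← this]
    abel
  exact smul_right_injective A h2 hd

/-- A nonzero idempotent of a pseudo-composition algebra decomposes the algebra into its even part
and its odd part. -/
theorem isCompl_even_odd (h2 : (2 : K) ≠ 0) (h3 : (3 : K) ≠ 0) {φ : LinearMap.BilinForm K A}
    (hφ : IsPseudoComposition φ) {a : A} (ha : a * a = a) (ha0 : a ≠ 0) :
    IsCompl (evenPart K a) (oddPart K a) := by
  have key := fun y => (idem_identity h2 hφ ha ha0 y).2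
  constructor
  · rw [Submodule.disjoint_def]
    intro x hx hx'
    obtain ⟨u, hu, v, hv, rfl⟩ := Submodule.mem_sup.1 hx
    rw [mem_eigen] at hu hv
    rw [oddPart, mem_eigen] at hx'
    have h : a * (u + v) = u - v := by rw [mul_add, hu, hv]; module
    have h' : u = (3 : K) • v := by
      have : (2 : K) • (u - v) = u + v := by
        rw [← h, hx', smul_smul, mul_one_div_cancel h2, one_smul]
      have t : u - (3 : K) • v = (2 : K) • (u - v) - (u + v) := by module
      rw [this, sub_self] at t
      exact sub_eq_zero.1 t
    have hv0 : ((2 : K) * 3) • v = 0 := by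
      have t : a * u = (3 : K) • (a * v) := by rw [h', mul_smul_comm]
      rw [hu, hv, h'] at t
      have t' : ((2 : K) * 3) • v = (1 : K) • (3 : K) • v - (3 : K) • (-1 : K) • v := by module
      rw [t', t, sub_self]
    have hv' : v = 0 := by
      rcases smul_eq_zero.1 hv0 with h | h
      · exact absurd h (mul_ne_zero h2 h3)
      · exact h
    rw [h', hv']
    simp
  · rw [codisjoint_iff, eq_top_iff]
    rintro y -
    set p := φ a y with hp
    have k := key y
    -- the components of `y` in `A_1`, `A_{-1}`, `A_{1/2}`
    have hw : a * (a * y) = (2 : K)⁻¹ • ((2 * p) • a + y - a * y) := by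
      rw [← k, add_sub_cancel_right, smul_smul, inv_mul_cancel₀ h2, one_smul]
    have d1 : p • a ∈ eigen K a (1 : K) := by
      rw [mem_eigen, mul_smul_comm, ha, one_smul]
    have d2 : (3 : K)⁻¹ • (y + p • a - (2 : K) • (a * y)) ∈ eigen K a (-1 : K) := by
      rw [mem_eigen, mul_smul_comm, mul_sub, mul_add, mul_smul_comm, mul_smul_comm, ha, hw]
      match_scalars <;> field_simp <;> ring
    have d3 : (3 : K)⁻¹ • ((2 : K) • y - (4 * p) • a + (2 : K) • (a * y)) ∈ oddPart K a := by
      rw [oddPart, mem_eigen, mul_smul_comm, mul_add, mul_sub, mul_smul_comm, mul_smul_comm,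
        mul_smul_comm, ha, hw]
      match_scalars <;> field_simp <;> ring
    have hy : y = (p • a + (3 : K)⁻¹ • (y + p • a - (2 : K) • (a * y))) +
        (3 : K)⁻¹ • ((2 : K) • y - (4 * p) • a + (2 : K) • (a * y)) := by
      match_scalars <;> field_simp <;> ring
    rw [hy]
    exact Submodule.add_mem_sup (Submodule.add_mem_sup d1 d2) d3

end Algebras

/-- `A` with the form `φ` and the generating idempotents `a, b, c` is the universal 3-generated
axial pseudo-composition algebra over `K` with the parameters `α, β, γ, ψ`: every
pseudo-composition algebra that is generated by three nonzero idempotents `a', b', c'` with the same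
parameters is the image of `A` under an algebra homomorphism which takes `a, b, c` to
`a', b', c'`. -/
structure IsUniversal {K : Type} [Field K] {A : Type u} [NonUnitalNonAssocCommRing A] [Module K A]
    [IsScalarTower K A A] [SMulCommClass K A A]
    (φ : LinearMap.BilinForm K A) (a b c : A) (α β γ ψ : K) : Prop where
  generated : IsGeneratedByIdempotents φ a b c
  parameters : HasParameters φ a b c α β γ ψ
  universal : ∀ (B : Type u) [NonUnitalNonAssocCommRing B] [Module K B] [IsScalarTower K B B]
    [SMulCommClass K B B] (φ' : LinearMap.BilinForm K B) (a' b' c' : B),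
    IsGeneratedByIdempotents φ' a' b' c' → HasParameters φ' a' b' c' α β γ ψ →
      ∃ f : A →ₙₐ[K] B, Function.Surjective f ∧ f a = a' ∧ f b = b' ∧ f c = c'

/-- The elementary abelian group `5ⁿ`. -/
abbrev Elem5 (n : ℕ) : Type := Multiplicative (Fin n → ZMod 5)

/-- The cyclic group of order two. -/
abbrev C2 : Type := Multiplicative (ZMod 2)

/-- The field with 25 elements. -/
abbrev F25 : Type := GaloisField 5 2

/-- The special unitary group `SU(3, 5)`: the matrices `g` over the field with 25 elements with
`det g = 1` and `g ḡᵀ = 1`, where the bar is the field automorphism `x ↦ x⁵` applied entrywise. -/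
def SU35 : Subgroup (Matrix.SpecialLinearGroup (Fin 3) F25) where
  carrier := {g | g.1 * (g.1.map (frobenius F25 5)).transpose = 1}
  one_mem' := by simp
  mul_mem' := by
    intro g h hg hh
    simp only [Set.mem_ofPred_eq, Matrix.SpecialLinearGroup.coe_mul] at *
    rw [Matrix.map_mul, Matrix.transpose_mul, mul_assoc, ← mul_assoc h.1, hh, one_mul, hg]
  inv_mem' := by
    intro g hg
    simp only [Set.mem_ofPred_eq] at *
    have h1 : (g⁻¹).1 * g.1 = 1 := by
      rw [← Matrix.SpecialLinearGroup.coe_mul, inv_mul_cancel, Matrix.SpecialLinearGroup.coe_one]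
    have h2 : (g⁻¹).1 = (g.1.map (frobenius F25 5)).transpose := left_inv_eq_right_inv h1 hg
    have h3 : ((g⁻¹).1.map (frobenius F25 5)).transpose * (g.1.map (frobenius F25 5)).transpose
        = 1 := by
      rw [← Matrix.transpose_mul, ← Matrix.map_mul, ← Matrix.SpecialLinearGroup.coe_mul,
        mul_inv_cancel]
      simp
    rw [h2] at h3 ⊢
    exact mul_eq_one_comm.1 h3

/-- `PSU(3, 5)`. -/
abbrev PSU35 : Type := SU35 ⧸ Subgroup.center SU35

/-- `G` has the form `N : H`, i.e. `G` is isomorphic to a semidirect product of `N` and `H` for an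
action of `H` on `N` which is not trivial. -/
def IsSplit (N H : Type*) [Group N] [Group H] (G : Type*) [Group G] : Prop :=
  ∃ θ : H →* MulAut N, θ ≠ 1 ∧ Nonempty (G ≃* N ⋊[θ] H)

/-- `G` has the form `5² : (5² : (SL(2, 5) : 2))`. -/
def IsIteratedSplit (G : Type*) [Group G] : Prop :=
  ∃ (θ₁ : C2 →* MulAut SL(2, ZMod 5))
    (θ₂ : (SL(2, ZMod 5) ⋊[θ₁] C2) →* MulAut (Elem5 2)),
    θ₁ ≠ 1 ∧ θ₂ ≠ 1 ∧ IsSplit (Elem5 2) (Elem5 2 ⋊[θ₂] (SL(2, ZMod 5) ⋊[θ₁] C2)) G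

/-- Names for the eight groups of the list. -/
inductive Listed where
  | e5A5
  | e5S5
  | iterated
  | psl27
  | psl35
  | psu35
  | a6
  | a7

/-- `L.Is G`: the group `G` is isomorphic to the member `L` of the list. -/
def Listed.Is (L : Listed) (G : Type*) [Group G] : Prop :=
  match L with
  | .e5A5 => IsSplit (Elem5 5) (alternatingGroup (Fin 5)) G
  | .e5S5 => IsSplit (Elem5 5) (Equiv.Perm (Fin 5)) G
  | .iterated => IsIteratedSplit G
  | .psl27 => Nonempty (G ≃* Matrix.ProjectiveSpecialLinearGroup (Fin 2) (ZMod 7))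
  | .psl35 => Nonempty (G ≃* Matrix.ProjectiveSpecialLinearGroup (Fin 3) (ZMod 5))
  | .psu35 => Nonempty (G ≃* PSU35)
  | .a6 => Nonempty (G ≃* alternatingGroup (Fin 6))
  | .a7 => Nonempty (G ≃* alternatingGroup (Fin 7))

/-- The rank of the Gram matrix that belongs to each member of the list. -/
def Listed.gramRank : Listed → ℕ
  | .e5A5 => 5
  | .e5S5 => 5
  | .iterated => 4
  | .psl27 => 8
  | .psl35 => 8
  | .psu35 => 8
  | .a6 => 8
  | .a7 => 8

end PseudoComp

open PseudoComp

/-! Let `a` be a nonzero idempotent. Linearizing `x³ = φ(x, x) x` gives an identity for the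
multiplication by `a` and enough of a fusion law to make `A_{-1}(a)` and `A_{1/2}(a)` orthogonal.
Hence this multiplication is self-adjoint for `φ` (`form_assoc`), and over `ZMod 5` also `φ(a, yz) =
φ(y, az)` (`form_mul_idem`). Together with a formula that shortens `a(y(az))` (`idem_mul_cross`),
this expresses the products of `a, b, c` with the eight monomials through these monomials, with
coefficients that depend only on the four parameters. So the monomials always span, and an algebra
in which they are independent maps onto every other one with the same parameters (`exists_hom`). For
existence it remains to verify, on a basis, that the forced structure constants satisfy the
linearized identity (`hasModel_of_basis`).

The 625 parameter values are reduced first. Since `τ_a` is an automorphism that preserves `φ`,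
permuting the idempotents or replacing `c` by `τ_a c` changes neither the algebra nor `T` nor the
rank. There remain 42 representatives. For 17 of them a polycyclic series shows that `T` is solvable
(`IsTriple.isSolvable`). The other 25 are connected, through further triples of conjugate
idempotents (`leads_of_words`), with eight values, one for each group of the list.

An element of `T` is an automorphism, so it is determined by the images of `a, b, c` (`ext_axes`).
To identify `T` with a known group `H`, generators of both are paired. If a relation that is
preserved by the pairs of generators identifies only the identities (or, for a quotient, only a
normal subgroup with the identity), then the subgroup of the product generated by the pairs yields
an isomorphism (`exists_mulEquiv_of_relation`, `mulEquiv_of_relation`). For `A_6`, `A_7` and `PSL(2,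
7)` the relation compares the orbits of the axes with involutions under conjugation. For `PSL(3, 5)`
and `PSU(3, 5)` it compares `A` with an eight-dimensional space of `3 × 3` matrices under
conjugation. In the other three cases a normal `5`-subgroup acts on the triple `(a, b, c)` by
translations, a complement acts regularly on a list of triples, and linear forms that vanish on the
translations show that the two meet trivially.

The claim on the rank concerns every listed group to which `T` happens to be isomorphic. Therefore
the listed groups are shown to be nonsolvable, and the rank is expressed through the order of the
group (`Listed.Is.not_isSolvable_and_gramRank_eq`). -/

namespace PseudoComp

/-! ### Identities for an idempotent of a pseudo-composition algebra. -/

section Abstract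

set_option linter.unusedSectionVars false

variable {K : Type*} [Field K] {A : Type*} [NonUnitalNonAssocCommRing A] [Module K A]
  [IsScalarTower K A A] [SMulCommClass K A A] {φ : LinearMap.BilinForm K A}

/-- The linearization of `x³ = φ(x, x) x`. -/
theorem IsPseudoComposition.linearized (h2 : (2 : K) ≠ 0) (hφ : IsPseudoComposition φ)
    (x y z : A) :
    x * y * z + y * z * x + x * z * y = φ x y • z + φ y z • x + φ x z • y := by
  have h1 := hφ.cube (x + y + z)
  have h2' := hφ.cube (x + y)
  have h3 := hφ.cube (y + z)
  have h4 := hφ.cube (x + z)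
  have h5 := hφ.cube x
  have h6 := hφ.cube y
  have h7 := hφ.cube z
  have e1 : y * x = x * y := mul_comm _ _
  have e2 : z * x = x * z := mul_comm _ _
  have e3 : z * y = y * z := mul_comm _ _
  simp only [add_mul, mul_add, map_add, LinearMap.add_apply, hφ.symm y x, hφ.symm z x,
    hφ.symm z y, add_smul, smul_add, e1, e2, e3] at h1 h2' h3 h4
  have : (2 : K) • (x * y * z + y * z * x + x * z * y) =
      (2 : K) • (φ x y • z + φ y z • x + φ x z • y) := by
    linear_combination (norm := module) h1 - h2' - h3 - h4 + h5 + h6 + h7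
  exact smul_right_injective A h2 this

/-- The identity `idem_identity` for `a * y`, and `a` times the identity for `y`, have the same left
side. Their right sides differ by `2 (φ(a, ay) - φ(a, y)) a`. -/
theorem IsPseudoComposition.form_idem_mul (h2 : (2 : K) ≠ 0) (hφ : IsPseudoComposition φ)
    {a : A} (ha : a * a = a) (ha0 : a ≠ 0) (y : A) : φ a (a * y) = φ a y := by
  have h := (idem_identity h2 hφ ha ha0 (a * y)).2
  have h' := congrArg (a * ·) (idem_identity h2 hφ ha ha0 y).2
  simp only [mul_add, mul_smul_comm, ha] at h'
  have : (2 * (φ a (a * y) - φ a y)) • a = 0 := by linear_combination (norm := module) h' - h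
  rcases smul_eq_zero.1 this with h0 | h0
  · exact sub_eq_zero.1 ((mul_eq_zero.1 h0).resolve_left h2)
  · exact absurd h0 ha0

/-- The eigenspaces of an idempotent for `-1` and `1/2` are orthogonal. -/
theorem IsPseudoComposition.form_neg_half (h2 : (2 : K) ≠ 0) (h3 : (3 : K) ≠ 0)
    (hφ : IsPseudoComposition φ) {a : A} (ha : a * a = a) (ha0 : a ≠ 0) {y z : A}
    (hy : a * y = -y) (hz : (2 : K) • (a * z) = z) : φ y z = 0 := by
  have fy : φ a y = 0 := by
    have h := hφ.form_idem_mul h2 ha ha0 y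
    rw [hy, map_neg] at h
    have : (2 : K) * φ a y = 0 := by linear_combination -h
    exact (mul_eq_zero.1 this).resolve_left h2
  have fhalf : ∀ w : A, (2 : K) • (a * w) = w → φ a w = 0 := fun w hw => by
    have h := hφ.form_idem_mul h2 ha ha0 w
    have h' := congrArg (φ a) hw
    rw [map_smul, h, smul_eq_mul] at h'
    linear_combination h'
  -- A fusion law: `y * w - 2 φ(y, w) a` lies again in `A_{1/2}(a)`.
  have fusion : ∀ w : A, (2 : K) • (a * w) = w →
      (2 : K) • (a * (y * w)) = y * w + (2 * φ y w) • a := fun w hw => by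
    have h := hφ.linearized h2 a y w
    rw [hy, fy, fhalf w hw, mul_comm (y * w) a, neg_mul, mul_comm (a * w) y] at h
    have h' : (2 : K) • (y * (a * w)) = y * w := by rw [← mul_smul_comm, hw]
    linear_combination (norm := module) (2 : K) • h - h'
  set q := φ y y with hq
  set u := φ y z with hu
  -- The linearization at `a, y, y` gives `a(yy) = 2 yy + q a`; inserted into `idem_identity` it
  -- makes `9 yy` a multiple of `a`.
  have hyy : y * y = -q • a := by
    have h := hφ.linearized h2 a y y
    rw [hy, fy, neg_mul, mul_comm (y * y) a, ← hq] at h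
    have e1 : a * (y * y) = (2 : K) • (y * y) + q • a := by linear_combination (norm := module) h
    have e2 := (idem_identity h2 hφ ha ha0 (y * y)).2
    rw [e1, mul_add, mul_smul_comm, mul_smul_comm, ha, e1] at e2
    have e3 : (3 * 3 : K) • (y * y) = (2 * φ a (y * y) - 7 * q) • a := by
      linear_combination (norm := module) e2
    have e4 : (3 * 3 : K) • (a * (y * y)) = (3 * 3 : K) • (y * y) := by
      rw [← mul_smul_comm, e3, mul_smul_comm, ha]
    have e5 : a * (y * y) = y * y := smul_right_injective A (mul_ne_zero h3 h3) e4
    linear_combination (norm := module) e5 - e1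
  set w := y * z - (2 * u) • a with hw
  have hyz : y * z = (2 * u) • a + w := by rw [hw]; abel
  have hw2 : (2 : K) • (a * w) = w := by
    have h := fusion z hz
    rw [hw, mul_sub, mul_smul_comm, ha, ← hu] at *
    linear_combination (norm := module) h
  have e1 := hφ.linearized h2 y y z
  rw [hyy, ← hq, ← hu, hyz, smul_mul_assoc, add_mul, smul_mul_assoc, hy, mul_comm w y] at e1
  -- Here `4 yw` has the `A_{-1}` component `12 u y`, whereas `fusion w` places `yw` in `A_{1/2}(a)
  -- + K a`. So `u y = 0`.
  have e2 : (4 : K) • (y * w) = (3 * q) • z + (12 * u) • y := by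
    linear_combination (norm := module) (2 : K) • e1 + q • hz
  have e3 := fusion w hw2
  have e4 : (4 : K) • (a * (y * w)) = (3 * q) • (a * z) - (12 * u) • y := by
    rw [← mul_smul_comm, e2, mul_add, mul_smul_comm, mul_smul_comm, hy]; module
  have e5 : (2 * (2 * (3 * 3)) * u) • y = -((2 * 2 * 2 * φ y w) • a) := by
    linear_combination (norm := module) (2 : K) • e4 - (4 : K) • e3 - e2 + (3 * q) • hz
  have e6 := congrArg (a * ·) e5
  simp only [mul_smul_comm, mul_neg, hy, ha] at e6
  have e7 : (2 * (2 * (2 * (3 * 3))) * u) • y = 0 := by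
    linear_combination (norm := module) e5 - e6
  rcases smul_eq_zero.1 e7 with h | h
  · exact (mul_eq_zero.1 h).resolve_left
      (mul_ne_zero h2 (mul_ne_zero h2 (mul_ne_zero h2 (mul_ne_zero h3 h3))))
  · rw [hu, h, map_zero, LinearMap.zero_apply]

/-- The form associates with a nonzero idempotent. -/
theorem IsPseudoComposition.form_assoc (h2 : (2 : K) ≠ 0) (h3 : (3 : K) ≠ 0)
    (hφ : IsPseudoComposition φ) {a : A} (ha : a * a = a) (ha0 : a ≠ 0) (x y : A) :
    φ (a * x) y = φ x (a * y) := by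
  have hh := fun y => (idem_identity h2 hφ ha ha0 y).2
  have hf := hφ.form_idem_mul h2 ha ha0
  -- Up to the factor `3`, these are the projections onto `A_{-1}(a)` and `A_{1/2}(a)`.
  set n : A → A := fun y => y + φ a y • a - (2 : K) • (a * y) with hn
  set z : A → A := fun y => (2 : K) • y - (4 * φ a y) • a + (2 : K) • (a * y) with hz
  have en : ∀ y, a * n y = -n y := fun y => by
    simp only [hn, mul_sub, mul_add, mul_smul_comm, ha]
    linear_combination (norm := module) -hh y
  have ez : ∀ y, (2 : K) • (a * z y) = z y := fun y => by
    simp only [hz, mul_sub, mul_add, mul_smul_comm, ha]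
    linear_combination (norm := module) (2 : K) • hh y
  have o := fun x y => hφ.form_neg_half h2 h3 ha ha0 (en x) (ez y)
  have o1 := o x y
  have o2 := o y x
  have f1 := (idem_identity h2 hφ ha ha0 y).1
  simp only [hn, hz, map_add, map_sub, map_smul, LinearMap.add_apply, LinearMap.sub_apply,
    LinearMap.smul_apply, smul_eq_mul, hf, f1, hφ.symm x a, hφ.symm y a, hφ.symm (a * y) a,
    hφ.symm (a * x) a, hφ.symm y x, hφ.symm (a * y) (a * x), hφ.symm y (a * x),
    hφ.symm (a * y) x] at o1 o2
  -- In the difference of the two orthogonality relations the symmetric terms cancel, and six times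
  -- the defect of associativity is left.
  have : (2 * 3 : K) * (φ (a * x) y - φ x (a * y)) = 0 := by
    linear_combination o2 - o1
  exact sub_eq_zero.1 ((mul_eq_zero.1 this).resolve_left (mul_ne_zero h2 h3))

end Abstract

/-! ### Products and form values of the eight monomials over `ZMod 5`. -/

section Table

theorem two_ne_zero_five : (2 : ZMod 5) ≠ 0 := by decide

theorem three_ne_zero_five : (3 : ZMod 5) ≠ 0 := by decide

set_option linter.unusedSectionVars false

variable {A : Type*} [NonUnitalNonAssocCommRing A] [Module (ZMod 5) A]
  [IsScalarTower (ZMod 5) A A] [SMulCommClass (ZMod 5) A A]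
  {φ : LinearMap.BilinForm (ZMod 5) A}

theorem five_smul (x : A) : (5 : ZMod 5) • x = 0 := by
  rw [show (5 : ZMod 5) = 0 by decide, zero_smul]

theorem IsPseudoComposition.idem_mul_mul (hφ : IsPseudoComposition φ)
    {x : A} (hx : x * x = x) (hx0 : x ≠ 0) (y : A) :
    x * (x * y) = φ x y • x + (3 : ZMod 5) • y + (2 : ZMod 5) • (x * y) := by
  have h := (idem_identity two_ne_zero_five hφ hx hx0 y).2
  linear_combination (norm := module) (3 : ZMod 5) • h - five_smul (x * (x * y)) +
    φ x y • five_smul x - five_smul (x * y)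

/-- Applying `φ a` to the linearization at `a, y, z`, for eigenvectors `y, z` with eigenvalues `l,
m`, gives the claim multiplied by `1 + l + m`. This factor is nonzero modulo `5` for all `l, m`
among `-1` and `1/2`. The eigenvalue `1` contributes only multiples of `a`, so bilinearity finishes
the proof. -/
theorem IsPseudoComposition.form_mul_idem (hφ : IsPseudoComposition φ) {a : A} (ha : a * a = a)
    (ha0 : a ≠ 0) (y z : A) : φ a (y * z) = φ y (a * z) := by
  have hi := fun y => (idem_identity two_ne_zero_five hφ ha ha0 y).2
  have hf := hφ.form_idem_mul two_ne_zero_five ha ha0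
  have as := hφ.form_assoc two_ne_zero_five three_ne_zero_five ha ha0
  have key : ∀ y z, φ a (a * y * z) + φ a (y * z) + φ a (a * z * y) =
      φ (a * y) (a * z) + φ y (a * z) + φ (a * y) (a * z) := fun y z => by
    have h1 := congrArg (φ a) (hφ.linearized two_ne_zero_five a y z)
    have h2 := congrArg (φ y) (hi z)
    simp only [map_add, map_smul, smul_eq_mul] at h1 h2
    rw [mul_comm (y * z) a, hf, (idem_identity two_ne_zero_five hφ ha ha0 a).1] at h1
    rw [← as, hφ.symm y a] at h2
    linear_combination h1 - h2
  have eig : ∀ l m : ZMod 5, 1 + l + m ≠ 0 → ∀ y z, a * y = l • y → a * z = m • z →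
      φ a (y * z) = φ y (a * z) := fun l m hlm y z hy hz => by
    have h := key y z
    rw [hy, hz, smul_mul_assoc, smul_mul_assoc, mul_comm z y] at h
    simp only [map_smul, LinearMap.smul_apply, smul_eq_mul] at h
    rw [hz, map_smul, smul_eq_mul]
    have h' := as y z
    rw [hy, hz, map_smul, map_smul, LinearMap.smul_apply, smul_eq_mul, smul_eq_mul] at h'
    have : (1 + l + m) * (φ a (y * z) - m * φ y z) = 0 := by linear_combination h + m * h'
    exact sub_eq_zero.1 ((mul_eq_zero.1 this).resolve_left hlm)
  -- Modulo `5` the eigenvalues `-1` and `1/2` are `4` and `3`, and `1/3` is `2`.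
  set n : A → A := fun y => y + φ a y • a - (2 : ZMod 5) • (a * y) with hn
  set w : A → A := fun y => (2 : ZMod 5) • y - (4 * φ a y) • a + (2 : ZMod 5) • (a * y) with hw
  have en : ∀ y, a * n y = (4 : ZMod 5) • n y := fun y => by
    simp only [hn, mul_sub, mul_add, mul_smul_comm, ha, hφ.idem_mul_mul ha ha0]
    match_scalars <;> ring_nf <;> reduce_mod_char <;> ring
  have ew : ∀ y, a * w y = (3 : ZMod 5) • w y := fun y => by
    simp only [hw, mul_sub, mul_add, mul_smul_comm, ha, hφ.idem_mul_mul ha ha0]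
    match_scalars <;> ring_nf <;> reduce_mod_char
  have h1 := eig 4 4 (by decide) _ _ (en y) (en z)
  have h2 := eig 4 3 (by decide) _ _ (en y) (ew z)
  have h3 := eig 3 4 (by decide) _ _ (ew y) (en z)
  have h4 := eig 3 3 (by decide) _ _ (ew y) (ew z)
  have d : ∀ y, y = φ a y • a + (2 : ZMod 5) • (n y + w y) := fun y => by
    simp only [hn, hw]
    match_scalars <;> ring_nf <;> reduce_mod_char
  have f1 := (idem_identity two_ne_zero_five hφ ha ha0 a).1
  have fa : ∀ z, φ a (a * (a * z)) = φ a z := fun z => by rw [hf, hf]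
  rw [d y, d z]
  simp only [mul_add, add_mul, smul_mul_assoc, mul_smul_comm, map_add, map_smul,
    LinearMap.add_apply, LinearMap.smul_apply, smul_eq_mul, ha, f1, h1, h2, h3, h4, hf,
    mul_comm (n y) a, mul_comm (w y) a, hφ.symm (n y) a, hφ.symm (w y) a]

/-- The linearizations at `x, y, xz` and `x, z, xy` share the product `(xy)(xz)`; their difference
contains `x(y(xz)) - x(z(xy))`. The sum of these two terms occurs in `x` times the linearization at
`x, y, z`, so twice `x(y(xz))` becomes known, and `3` is the inverse of `2`. This is what keeps the
span of the eight monomials closed under `a, b, c`. -/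
theorem IsPseudoComposition.idem_mul_cross (hφ : IsPseudoComposition φ)
    {x : A} (hx : x * x = x) (hx0 : x ≠ 0) (y z : A) :
    x * (y * (x * z)) = (4 * φ y z + 2 * φ y (x * z)) • x + (4 * φ x z) • y + (3 * φ x y) • z +
      (2 * φ x z) • (x * y) + y * z + (4 * φ x y) • (x * z) + (3 : ZMod 5) • (x * (y * z)) +
      (3 : ZMod 5) • (y * (x * z)) := by
  have as := hφ.form_assoc two_ne_zero_five three_ne_zero_five hx hx0
  have l1 := hφ.linearized two_ne_zero_five x y (x * z)
  have l2 := hφ.linearized two_ne_zero_five x z (x * y)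
  have l4 := congrArg (x * ·) (hφ.linearized two_ne_zero_five x y z)
  have l3 := hφ.linearized two_ne_zero_five x y z
  have i1 := congrArg (y * ·) (hφ.idem_mul_mul hx hx0 z)
  have i2 := congrArg (z * ·) (hφ.idem_mul_mul hx hx0 y)
  have i3 := hφ.idem_mul_mul hx hx0 (y * z)
  have s1 := hφ.form_mul_idem hx hx0 y z
  have s2 : φ z (x * y) = φ y (x * z) := by rw [← as, hφ.symm]
  have c1 : x * y * (x * z) = x * z * (x * y) := mul_comm _ _
  simp only [mul_add, mul_smul_comm, hx] at i1 i2 l4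
  rw [hφ.form_idem_mul two_ne_zero_five hx hx0, mul_comm (y * (x * z)) x, mul_comm (x * (x * z)) y] at l1
  rw [hφ.form_idem_mul two_ne_zero_five hx hx0, mul_comm (z * (x * y)) x, mul_comm (x * (x * y)) z, s2] at l2
  rw [mul_comm (x * y) z, mul_comm (y * z) x, mul_comm (x * z) y] at l4
  rw [mul_comm (x * y) z, mul_comm (y * z) x, mul_comm (x * z) y] at l3
  rw [mul_comm z x, mul_comm z y] at i2
  rw [mul_comm y x] at i1
  rw [s1] at i3
  linear_combination (norm := skip) (3 : ZMod 5) • (l1 - l2 + l4 - c1 + i2 - i1 - i3) + l3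
  match_scalars <;> ring_nf <;> reduce_mod_char

/-- The coordinates of `a m`, for the eight monomials `m`. -/
def colA (α β γ ψ : ZMod 5) : Fin 8 → Fin 8 → ZMod 5 := ![
  ![1, 0, 0, 0, 0, 0, 0, 0],
  ![0, 0, 0, 1, 0, 0, 0, 0],
  ![0, 0, 0, 0, 0, 1, 0, 0],
  ![α, 3, 0, 2, 0, 0, 0, 0],
  ![0, 0, 0, 0, 0, 0, 1, 0],
  ![γ, 0, 3, 0, 0, 2, 0, 0],
  ![ψ, 0, 0, 0, 3, 0, 2, 0],
  ![4 * β + 2 * ψ, 4 * γ, 3 * α, 2 * γ, 1, 4 * α, 3, 3]]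

/-- The coordinates of `b m`, for the eight monomials `m`. -/
def colB (α β γ ψ : ZMod 5) : Fin 8 → Fin 8 → ZMod 5 := ![
  ![0, 0, 0, 1, 0, 0, 0, 0],
  ![0, 1, 0, 0, 0, 0, 0, 0],
  ![0, 0, 0, 0, 1, 0, 0, 0],
  ![3, α, 0, 2, 0, 0, 0, 0],
  ![0, β, 3, 0, 2, 0, 0, 0],
  ![0, 0, 0, 0, 0, 0, 0, 1],
  ![4 * β, 4 * γ + 2 * ψ, 3 * α, 2 * β, 4 * α, 1, 3, 3],
  ![0, ψ, 0, 0, 0, 3, 0, 2]]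

/-- The coordinates of `c m`, for the eight monomials `m`. -/
def colC (α β γ ψ : ZMod 5) : Fin 8 → Fin 8 → ZMod 5 := ![
  ![0, 0, 0, 0, 0, 1, 0, 0],
  ![0, 0, 0, 0, 1, 0, 0, 0],
  ![0, 0, 1, 0, 0, 0, 0, 0],
  ![β, γ, α, 0, 0, 0, 4, 4],
  ![0, 3, β, 0, 2, 0, 0, 0],
  ![3, 0, γ, 0, 0, 2, 0, 0],
  ![2 * β, γ, 2 * α + 2 * ψ, 1, 4 * γ, 2 * β, 0, 2],
  ![β, 2 * γ, 2 * α + 2 * ψ, 1, 2 * γ, 4 * β, 2, 0]]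

/-- The values of the form on `a` and the monomials. -/
def rowA (α β γ ψ : ZMod 5) : Fin 8 → ZMod 5 :=
  ![1, α, γ, α, ψ, γ, ψ, α * γ + 3 * β + 2 * ψ]

/-- The values of the form on `b` and the monomials. -/
def rowB (α β γ ψ : ZMod 5) : Fin 8 → ZMod 5 :=
  ![α, 1, β, α, β, ψ, α * β + 3 * γ + 2 * ψ, ψ]

/-- The values of the form on `c` and the monomials. -/
def rowC (α β γ ψ : ZMod 5) : Fin 8 → ZMod 5 :=
  ![γ, β, 1, ψ, β, γ, 3 * α + β * γ + 2 * ψ, 3 * α + β * γ + 2 * ψ]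

variable {a b c : A} {α β γ ψ : ZMod 5}

/-- Moving idempotents across the form makes `ψ` symmetric in the three generators. -/
theorem IsGeneratedByIdempotents.forms (h : IsGeneratedByIdempotents φ a b c)
    (p : HasParameters φ a b c α β γ ψ) :
    φ a (b * c) = ψ ∧ φ c (a * b) = ψ := by
  have as := h.pseudoComposition.form_assoc two_ne_zero_five three_ne_zero_five h.idem_a h.a_ne_zero
  have bs := h.pseudoComposition.form_assoc two_ne_zero_five three_ne_zero_five h.idem_b h.b_ne_zero
  refine ⟨?_, ?_⟩
  · rw [← bs, mul_comm, as, p.b_ac]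
  · rw [← as, h.pseudoComposition.symm, p.b_ac]

theorem IsGeneratedByIdempotents.mul_a (h : IsGeneratedByIdempotents φ a b c)
    (p : HasParameters φ a b c α β γ ψ) (j : Fin 8) :
    a * monomials a b c j = ∑ i, colA α β γ ψ j i • monomials a b c i := by
  have hφ := h.pseudoComposition
  have i := hφ.idem_mul_mul h.idem_a h.a_ne_zero
  have cr := hφ.idem_mul_cross h.idem_a h.a_ne_zero b c
  have f := h.forms p
  fin_cases j <;> simp [monomials, colA, Fin.sum_univ_eight, h.idem_a, i, cr, p.ab, p.bc, p.ac,
    p.b_ac, f.1]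

theorem IsGeneratedByIdempotents.mul_b (h : IsGeneratedByIdempotents φ a b c)
    (p : HasParameters φ a b c α β γ ψ) (j : Fin 8) :
    b * monomials a b c j = ∑ i, colB α β γ ψ j i • monomials a b c i := by
  have hφ := h.pseudoComposition
  have i := hφ.idem_mul_mul h.idem_b h.b_ne_zero
  have cr := hφ.idem_mul_cross h.idem_b h.b_ne_zero a c
  have f := h.forms p
  have ba : φ b a = α := by rw [hφ.symm, p.ab]
  have e := i a
  rw [mul_comm b a, ba] at e
  fin_cases j <;> simp [monomials, colB, Fin.sum_univ_eight, h.idem_b, i, e, cr, ba, p.bc, p.ac,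
    p.b_ac, f.1, mul_comm b a] <;>
    (match_scalars <;> ring_nf)

theorem IsGeneratedByIdempotents.mul_c (h : IsGeneratedByIdempotents φ a b c)
    (p : HasParameters φ a b c α β γ ψ) (j : Fin 8) :
    c * monomials a b c j = ∑ i, colC α β γ ψ j i • monomials a b c i := by
  have hφ := h.pseudoComposition
  have i := hφ.idem_mul_mul h.idem_c h.c_ne_zero
  have cr := hφ.idem_mul_cross h.idem_c h.c_ne_zero a b
  have cr' := hφ.idem_mul_cross h.idem_c h.c_ne_zero b a
  have f := h.forms p
  have cb : φ c b = β := by rw [hφ.symm, p.bc]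
  have ba : φ b a = α := by rw [hφ.symm, p.ab]
  have ca : φ c a = γ := by rw [hφ.symm, p.ac]
  have l := hφ.linearized two_ne_zero_five a b c
  rw [mul_comm (a * b) c, mul_comm (b * c) a, mul_comm (a * c) b, p.ab, p.bc, p.ac] at l
  -- `c(ab)` is not among the eight monomials; the linearization at `a, b, c` eliminates it.
  have l' : c * (a * b) = α • c + β • a + γ • b - a * (b * c) - b * (a * c) := by
    rw [← l]; abel
  have e1 : c * a = a * c := mul_comm _ _
  have e2 : c * b = b * c := mul_comm _ _
  have e3 : b * a = a * b := mul_comm _ _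
  rw [e1, e2, l'] at cr
  rw [e1, e2, e3, l'] at cr'
  have ia := i a
  have ib := i b
  rw [e1, ca] at ia
  rw [e2, cb] at ib
  fin_cases j <;> simp [monomials, colC, Fin.sum_univ_eight, h.idem_c, e1, e2, l', ia, ib, cr, cr',
    cb, ca, ba, p.ab, p.b_ac, f.1] <;>
    (match_scalars <;> ring_nf <;> reduce_mod_char)

theorem IsGeneratedByIdempotents.form_a (h : IsGeneratedByIdempotents φ a b c)
    (p : HasParameters φ a b c α β γ ψ) (j : Fin 8) :
    φ a (monomials a b c j) = rowA α β γ ψ j := by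
  have hφ := h.pseudoComposition
  have i := hφ.idem_mul_mul h.idem_a h.a_ne_zero
  have as := hφ.form_assoc two_ne_zero_five three_ne_zero_five h.idem_a h.a_ne_zero
  have bs := hφ.form_assoc two_ne_zero_five three_ne_zero_five h.idem_b h.b_ne_zero
  have fm := hφ.form_idem_mul two_ne_zero_five h.idem_a h.a_ne_zero
  have f := h.forms p
  have f1 := (idem_identity two_ne_zero_five hφ h.idem_a h.a_ne_zero a).1
  have ba : φ b a = α := by rw [hφ.symm, p.ab]
  have e : φ a (b * (a * c)) = α * γ + 3 * β + 2 * ψ := by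
    rw [← bs, mul_comm b a, as, i]
    simp [p.bc, p.b_ac, p.ac, ba, mul_comm]
  fin_cases j <;> simp [monomials, rowA, f1, p.ab, p.ac, f.1, fm, e]

theorem IsGeneratedByIdempotents.form_b (h : IsGeneratedByIdempotents φ a b c)
    (p : HasParameters φ a b c α β γ ψ) (j : Fin 8) :
    φ b (monomials a b c j) = rowB α β γ ψ j := by
  have hφ := h.pseudoComposition
  have i := hφ.idem_mul_mul h.idem_b h.b_ne_zero
  have as := hφ.form_assoc two_ne_zero_five three_ne_zero_five h.idem_a h.a_ne_zero
  have bs := hφ.form_assoc two_ne_zero_five three_ne_zero_five h.idem_b h.b_ne_zero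
  have fm := hφ.form_idem_mul two_ne_zero_five h.idem_b h.b_ne_zero
  have f := h.forms p
  have f1 := (idem_identity two_ne_zero_five hφ h.idem_b h.b_ne_zero a).1
  have ba : φ b a = α := by rw [hφ.symm, p.ab]
  have e : φ b (a * (b * c)) = α * β + 3 * γ + 2 * ψ := by
    rw [← as, mul_comm a b, bs, i]
    simp [p.bc, p.ac, p.ab, f.1, mul_comm]
  have e' : φ b (a * b) = α := by rw [mul_comm, fm, ba]
  fin_cases j <;> simp [monomials, rowB, f1, ba, p.bc, p.b_ac, e', fm, e]

theorem IsGeneratedByIdempotents.form_c (h : IsGeneratedByIdempotents φ a b c)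
    (p : HasParameters φ a b c α β γ ψ) (j : Fin 8) :
    φ c (monomials a b c j) = rowC α β γ ψ j := by
  have hφ := h.pseudoComposition
  have i := hφ.idem_mul_mul h.idem_c h.c_ne_zero
  have as := hφ.form_assoc two_ne_zero_five three_ne_zero_five h.idem_a h.a_ne_zero
  have bs := hφ.form_assoc two_ne_zero_five three_ne_zero_five h.idem_b h.b_ne_zero
  have cs := hφ.form_assoc two_ne_zero_five three_ne_zero_five h.idem_c h.c_ne_zero
  have fm := hφ.form_idem_mul two_ne_zero_five h.idem_c h.c_ne_zero
  have f := h.forms p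
  have f1 := (idem_identity two_ne_zero_five hφ h.idem_c h.c_ne_zero a).1
  have cb : φ c b = β := by rw [hφ.symm, p.bc]
  have ca : φ c a = γ := by rw [hφ.symm, p.ac]
  have e : φ c (a * (b * c)) = 3 * α + β * γ + 2 * ψ := by
    rw [← as, mul_comm a c, cs, mul_comm b c, i]
    simp [p.ab, p.ac, cb, mul_comm c b, f.1]; ring
  have e' : φ c (b * (a * c)) = 3 * α + β * γ + 2 * ψ := by
    rw [← bs, mul_comm b c, cs, mul_comm a c, i]
    simp [p.bc, p.b_ac, ca, hφ.symm b a, p.ab, mul_comm c a]; ring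
  have e1 : φ c (b * c) = β := by rw [mul_comm, fm, cb]
  have e2 : φ c (a * c) = γ := by rw [mul_comm, fm, ca]
  fin_cases j <;> simp [monomials, rowC, f1, ca, cb, f.2, e1, e2, e, e']

end Table

/-! ### Miyamoto involutions are automorphisms and isometries. -/

section Automorphism

variable {A : Type*} [NonUnitalNonAssocCommRing A] [Module (ZMod 5) A]
  [IsScalarTower (ZMod 5) A A] [SMulCommClass (ZMod 5) A A]
  {φ : LinearMap.BilinForm (ZMod 5) A}

/-- The value of the Miyamoto involution in characteristic `5`. -/
theorem IsPseudoComposition.miyamoto_apply (hφ : IsPseudoComposition φ) {a : A}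
    (ha : a * a = a) (ha0 : a ≠ 0) (y : A) :
    miyamoto (ZMod 5) a y = (3 : ZMod 5) • y + φ a y • a + (2 : ZMod 5) • (a * y) := by
  have hc := isCompl_even_odd two_ne_zero_five three_ne_zero_five hφ ha ha0
  have hi := fun y => (idem_identity two_ne_zero_five hφ ha ha0 y).2
  have hf := hφ.form_idem_mul two_ne_zero_five ha ha0
  rw [miyamoto, dif_pos hc]
  obtain ⟨e, he, o, ho, rfl⟩ := Submodule.mem_sup.1
    (show y ∈ evenPart (ZMod 5) a ⊔ oddPart (ZMod 5) a by rw [hc.sup_eq_top]; trivial)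
  have h1 : (Submodule.prodEquivOfIsCompl _ _ hc).symm (e + o) = (⟨e, he⟩, ⟨o, ho⟩) := by
    rw [LinearEquiv.symm_apply_eq]; rfl
  simp only [LinearEquiv.trans_apply, h1, LinearEquiv.prodCongr_apply, LinearEquiv.refl_apply,
    LinearEquiv.neg_apply, Submodule.coe_prodEquivOfIsCompl', NegMemClass.coe_neg]
  have ho' : a * o = (3 : ZMod 5) • o := by
    rw [oddPart, mem_eigen] at ho
    rw [ho, show (1 / 2 : ZMod 5) = 3 by rw [div_eq_iff two_ne_zero_five]; rfl]
  have fo : φ a o = 0 := by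
    have h := hf o
    rw [ho', map_smul, smul_eq_mul] at h
    have h' : (2 : ZMod 5) * φ a o = 0 := by linear_combination h
    exact (mul_eq_zero.1 h').resolve_left two_ne_zero_five
  obtain ⟨u, hu, v, hv, rfl⟩ := Submodule.mem_sup.1 he
  rw [mem_eigen] at hu hv
  have fv : φ a v = 0 := by
    have h := hf v
    rw [hv, map_smul, smul_eq_mul] at h
    have h' : (2 : ZMod 5) * φ a v = 0 := by linear_combination -h
    exact (mul_eq_zero.1 h').resolve_left two_ne_zero_five
  -- For `u` in `A_1(a)` the identity says that `u = φ(a, u) a`.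
  have hu' := hi u
  rw [hu, mul_smul_comm, hu] at hu'
  simp only [map_add, mul_add, fo, fv, ho', hu, hv]
  rw [one_smul] at hu'
  linear_combination (norm := skip) (3 : ZMod 5) • hu'
  match_scalars <;> ring_nf <;> reduce_mod_char

variable {a : A}

/-- In the expansion of both sides the critical product is `(ax)(ay)`. The linearization at `a, x,
ay` yields it, once `idem_mul_cross` has reduced `a(x(ay))`; the linearization at `a, x, y` accounts
for the remaining shorter products. -/
theorem IsPseudoComposition.miyamoto_mul (hφ : IsPseudoComposition φ) (ha : a * a = a)
    (ha0 : a ≠ 0) (x y : A) : miyamoto (ZMod 5) a (x * y) =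
      miyamoto (ZMod 5) a x * miyamoto (ZMod 5) a y := by
  have hi := hφ.idem_mul_mul ha ha0
  have hm := hφ.form_mul_idem ha ha0 x y
  have cr := hφ.idem_mul_cross ha ha0 x y
  have l := hφ.linearized two_ne_zero_five a x (a * y)
  have l' := hφ.linearized two_ne_zero_five a x y
  rw [mul_comm (x * y) a, mul_comm (a * y) x] at l'
  rw [mul_comm (x * (a * y)) a, mul_comm (a * (a * y)) x, hi, hφ.form_idem_mul two_ne_zero_five ha ha0, cr] at l
  simp only [mul_add, mul_smul_comm, mul_comm x a] at l
  simp only [hφ.miyamoto_apply ha ha0, mul_add, add_mul, mul_smul_comm, smul_mul_assoc, ha, hi, mul_comm x a,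
    mul_comm (a * x) a, hm]
  linear_combination (norm := skip) l + (4 : ZMod 5) • l'
  match_scalars <;> ring_nf <;> reduce_mod_char

/-- The Miyamoto involution preserves the form. -/
theorem IsPseudoComposition.form_miyamoto (hφ : IsPseudoComposition φ) (ha : a * a = a)
    (ha0 : a ≠ 0) (x y : A) : φ (miyamoto (ZMod 5) a x) (miyamoto (ZMod 5) a y) = φ x y := by
  have hi := hφ.idem_mul_mul ha ha0 y
  have hf := hφ.form_idem_mul two_ne_zero_five ha ha0
  have as := hφ.form_assoc two_ne_zero_five three_ne_zero_five ha ha0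
  have f1 := (idem_identity two_ne_zero_five hφ ha ha0 a).1
  simp only [hφ.miyamoto_apply ha ha0, map_add, map_smul, LinearMap.add_apply,
    LinearMap.smul_apply, smul_eq_mul, as, f1, hi, hf, ha, hφ.symm x a]
  ring_nf
  reduce_mod_char

theorem IsPseudoComposition.miyamoto_miyamoto (hφ : IsPseudoComposition φ) (ha : a * a = a)
    (ha0 : a ≠ 0) (x : A) : miyamoto (ZMod 5) a (miyamoto (ZMod 5) a x) = x := by
  have hi := hφ.idem_mul_mul ha ha0
  have hf := hφ.form_idem_mul two_ne_zero_five ha ha0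
  have f1 := (idem_identity two_ne_zero_five hφ ha ha0 a).1
  simp only [hφ.miyamoto_apply ha ha0, map_add, map_smul, smul_eq_mul, f1, hi, hf, ha, mul_add,
    mul_smul_comm]
  match_scalars <;> ring_nf <;> reduce_mod_char

theorem IsPseudoComposition.miyamoto_self (hφ : IsPseudoComposition φ) (ha : a * a = a)
    (ha0 : a ≠ 0) : miyamoto (ZMod 5) a a = a := by
  rw [hφ.miyamoto_apply ha ha0, (idem_identity two_ne_zero_five hφ ha ha0 a).1, ha]
  match_scalars
  rfl

/-- The Miyamoto involution of the image of `a` under an automorphism. -/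
theorem IsPseudoComposition.miyamoto_map (hφ : IsPseudoComposition φ) (ha : a * a = a)
    (ha0 : a ≠ 0) (t : A ≃ₗ[ZMod 5] A) (ht : ∀ x y, t (x * y) = t x * t y)
    (hf : ∀ x y, φ (t x) (t y) = φ x y) :
    miyamoto (ZMod 5) (t a) = t * miyamoto (ZMod 5) a * t⁻¹ := by
  ext y
  obtain ⟨z, rfl⟩ := t.surjective y
  have e : t⁻¹ (t z) = z := t.symm_apply_apply z
  rw [LinearEquiv.mul_apply, LinearEquiv.mul_apply, e, hφ.miyamoto_apply ha ha0,
    hφ.miyamoto_apply (by rw [← ht, ha]) ((map_ne_zero_iff t t.injective).2 ha0), hf]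
  simp only [map_add, map_smul, ht]

end Automorphism

/-! ### Spanning by the monomials, and the universal property. -/

section Universal

variable {A : Type*} [NonUnitalNonAssocCommRing A] [Module (ZMod 5) A]
  [IsScalarTower (ZMod 5) A A] [SMulCommClass (ZMod 5) A A]
  {φ : LinearMap.BilinForm (ZMod 5) A} {a b c : A} {α β γ ψ : ZMod 5}

/-- The eight monomials span. -/
theorem IsGeneratedByIdempotents.span_monomials (h : IsGeneratedByIdempotents φ a b c)
    (p : HasParameters φ a b c α β γ ψ) :
    Submodule.span (ZMod 5) (Set.range (monomials a b c)) = ⊤ := by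
  set W := Submodule.span (ZMod 5) (Set.range (monomials a b c)) with hW
  have hm : ∀ i, monomials a b c i ∈ W := fun i => Submodule.subset_span ⟨i, rfl⟩
  have ext : ∀ x : A, (∀ j, x * monomials a b c j ∈ W) → ∀ y ∈ W, x * y ∈ W := fun x hx y hy => by
    induction hy using Submodule.span_induction with
    | mem y hy => obtain ⟨j, rfl⟩ := hy; exact hx j
    | zero => rw [mul_zero]; exact W.zero_mem
    | add y z _ _ hy hz => rw [mul_add]; exact W.add_mem hy hz
    | smul r y _ hy => rw [mul_smul_comm]; exact W.smul_mem r hy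
  have sum : ∀ f : Fin 8 → ZMod 5, ∑ i, f i • monomials a b c i ∈ W := fun f =>
    W.sum_mem fun i _ => W.smul_mem _ (hm i)
  have wa := ext a fun j => h.mul_a p j ▸ sum _
  have wb := ext b fun j => h.mul_b p j ▸ sum _
  have wc := ext c fun j => h.mul_c p j ▸ sum _
  -- The linearization expresses `(xy)w` through `x(yw)`, `y(xw)` and multiples of `x, y, w`.
  have prod : ∀ x ∈ W, ∀ y ∈ W, (∀ w ∈ W, x * w ∈ W) → (∀ w ∈ W, y * w ∈ W) →
      ∀ w ∈ W, x * y * w ∈ W := fun x hx y hy h1 h2 w hw => by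
    have e := h.pseudoComposition.linearized two_ne_zero_five x y w
    have e' : x * y * w = φ x y • w + φ y w • x + φ x w • y - x * (y * w) - y * (x * w) := by
      rw [← e, mul_comm (y * w) x, mul_comm (x * w) y]; abel
    rw [e']
    exact W.sub_mem (W.sub_mem (W.add_mem (W.add_mem (W.smul_mem _ hw) (W.smul_mem _ hx))
      (W.smul_mem _ hy)) (h1 _ (h2 _ hw))) (h2 _ (h1 _ hw))
  have ma : a ∈ W := hm 0
  have mb : b ∈ W := hm 1
  have mc : c ∈ W := hm 2
  have wab := prod a ma b mb wa wb
  have wbc := prod b mb c mc wb wc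
  have wac := prod a ma c mc wa wc
  have all : ∀ i, ∀ w ∈ W, monomials a b c i * w ∈ W := by
    intro i
    fin_cases i
    exacts [wa, wb, wc, wab, wbc, wac, prod a ma _ (hm 4) wa wbc, prod b mb _ (hm 5) wb wac]
  have closed : ∀ x ∈ W, ∀ y ∈ W, x * y ∈ W := fun x hx y hy => by
    rw [mul_comm]
    exact ext y (fun j => by rw [mul_comm]; exact all j y hy) x hx
  let S : NonUnitalSubalgebra (ZMod 5) A := { W with mul_mem' := fun hx hy => closed _ hx _ hy }
  have : NonUnitalAlgebra.adjoin (ZMod 5) ({a, b, c} : Set A) ≤ S :=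
    NonUnitalAlgebra.adjoin_le fun x hx => by
      rcases hx with rfl | rfl | rfl
      exacts [ma, mb, mc]
  rw [h.generates] at this
  rw [eq_top_iff]
  exact fun x _ => this (show x ∈ (⊤ : NonUnitalSubalgebra (ZMod 5) A) from trivial)

/-- If the monomials of `A` are linearly independent, then every algebra with the same parameters
is an image of `A`. -/
theorem IsGeneratedByIdempotents.exists_hom (h : IsGeneratedByIdempotents φ a b c)
    (p : HasParameters φ a b c α β γ ψ) (li : LinearIndependent (ZMod 5) (monomials a b c))
    {B : Type*} [NonUnitalNonAssocCommRing B] [Module (ZMod 5) B] [IsScalarTower (ZMod 5) B B]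
    [SMulCommClass (ZMod 5) B B] {φ' : LinearMap.BilinForm (ZMod 5) B} {a' b' c' : B}
    (h' : IsGeneratedByIdempotents φ' a' b' c') (p' : HasParameters φ' a' b' c' α β γ ψ) :
    ∃ f : A →ₙₐ[ZMod 5] B, Function.Surjective f ∧ f a = a' ∧ f b = b' ∧ f c = c' := by
  let bs := Module.Basis.mk li (h.span_monomials p).ge
  have hbs : ∀ i, bs i = monomials a b c i := fun i => Module.Basis.mk_apply ..
  let f : A →ₗ[ZMod 5] B := bs.constr (ZMod 5) (monomials a' b' c')
  have fm : ∀ i, f (monomials a b c i) = monomials a' b' c' i := fun i => by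
    rw [← hbs]; exact bs.constr_basis ..
  have fa : f a = a' := fm 0
  have fb : f b = b' := fm 1
  have fc : f c = c' := fm 2
  -- Multiplicativity and preservation of the form are carried along together, because the
  -- linearization for a product involves values of the form.
  let Ok : A → Prop := fun w =>
    (∀ x, f (w * x) = f w * f x) ∧ ∀ x, φ' (f w) (f x) = φ w x
  have base : ∀ w, (∀ j, f (w * monomials a b c j) = f w * f (monomials a b c j)) →
      (∀ j, φ' (f w) (f (monomials a b c j)) = φ w (monomials a b c j)) → Ok w := fun w h1 h2 => by
    constructor
    · have : f ∘ₗ LinearMap.mulLeft (ZMod 5) w = LinearMap.mulLeft (ZMod 5) (f w) ∘ₗ f :=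
        bs.ext fun i => by simpa [hbs] using h1 i
      exact fun x => by simpa using LinearMap.congr_fun this x
    · have : φ' (f w) ∘ₗ f = φ w := bs.ext fun i => by simpa [hbs] using h2 i
      exact fun x => LinearMap.congr_fun this x
  have oa : Ok a := base a
    (fun j => by rw [h.mul_a p, map_sum, fa, fm, h'.mul_a p']; simp only [map_smul, fm])
    (fun j => by rw [fa, fm, h.form_a p, h'.form_a p'])
  have ob : Ok b := base b
    (fun j => by rw [h.mul_b p, map_sum, fb, fm, h'.mul_b p']; simp only [map_smul, fm])
    (fun j => by rw [fb, fm, h.form_b p, h'.form_b p'])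
  have oc : Ok c := base c
    (fun j => by rw [h.mul_c p, map_sum, fc, fm, h'.mul_c p']; simp only [map_smul, fm])
    (fun j => by rw [fc, fm, h.form_c p, h'.form_c p'])
  have hφ := h.pseudoComposition
  have hφ' := h'.pseudoComposition
  have lin : ∀ x y w, x * y * w =
      φ x y • w + φ y w • x + φ x w • y - x * (y * w) - y * (x * w) := fun x y w => by
    rw [← hφ.linearized two_ne_zero_five x y w, mul_comm (y * w) x, mul_comm (x * w) y]; abel
  have lin' : ∀ x y w, x * y * w =
      φ' x y • w + φ' y w • x + φ' x w • y - x * (y * w) - y * (x * w) := fun x y w => by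
    rw [← hφ'.linearized two_ne_zero_five x y w, mul_comm (y * w) x, mul_comm (x * w) y]; abel
  -- The form must associate with the left factor; below, this factor is always `a` or `b`.
  have prod : ∀ x y, Ok x → Ok y → (∀ z w, φ (x * z) w = φ z (x * w)) →
      (∀ z w, φ' (f x * z) w = φ' z (f x * w)) → Ok (x * y) := fun x y hx hy s s' => by
    constructor
    · intro w
      rw [lin, hx.1 y, lin', hx.2, hy.2, hx.2]
      simp only [map_add, map_sub, map_smul, hx.1, hy.1]
    · intro w
      rw [hx.1, s', ← hx.1, hy.2, s]
  have as := hφ.form_assoc two_ne_zero_five three_ne_zero_five h.idem_a h.a_ne_zero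
  have bs' := hφ.form_assoc two_ne_zero_five three_ne_zero_five h.idem_b h.b_ne_zero
  have as' := hφ'.form_assoc two_ne_zero_five three_ne_zero_five h'.idem_a h'.a_ne_zero
  have bs'' := hφ'.form_assoc two_ne_zero_five three_ne_zero_five h'.idem_b h'.b_ne_zero
  rw [← fa] at as'
  rw [← fb] at bs''
  have all : ∀ i, Ok (monomials a b c i) := by
    intro i
    fin_cases i
    exacts [oa, ob, oc, prod a b oa ob as as', prod b c ob oc bs' bs'', prod a c oa oc as as',
      prod a _ oa (prod b c ob oc bs' bs'') as as', prod b _ ob (prod a c oa oc as as') bs' bs'']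
  have mul : ∀ x y, f (x * y) = f x * f y := fun x y => by
    have : f ∘ₗ LinearMap.mulRight (ZMod 5) y = LinearMap.mulRight (ZMod 5) (f y) ∘ₗ f :=
      bs.ext fun i => by simpa [hbs] using (all i).1 y
    simpa using LinearMap.congr_fun this x
  refine ⟨{ f with map_zero' := map_zero f, map_mul' := mul }, ?_, fa, fb, fc⟩
  have : LinearMap.range f = ⊤ := by
    rw [eq_top_iff, ← h'.span_monomials p', Submodule.span_le]
    rintro _ ⟨i, rfl⟩
    exact ⟨_, fm i⟩
  exact LinearMap.range_eq_top.1 this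

end Universal

/-! ### Universality from one model with independent monomials. -/

section Model

/-- There is a pseudo-composition algebra with the given parameters in which the eight monomials
are linearly independent. -/
def HasModel (α β γ ψ : ZMod 5) : Prop :=
  ∃ (A : Type u) (_ : NonUnitalNonAssocCommRing A) (_ : Module (ZMod 5) A)
    (_ : IsScalarTower (ZMod 5) A A) (_ : SMulCommClass (ZMod 5) A A)
    (φ : LinearMap.BilinForm (ZMod 5) A) (a b c : A), IsGeneratedByIdempotents φ a b c ∧
      HasParameters φ a b c α β γ ψ ∧ LinearIndependent (ZMod 5) (monomials a b c)

variable {A : Type u} [NonUnitalNonAssocCommRing A] [Module (ZMod 5) A]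
  [IsScalarTower (ZMod 5) A A] [SMulCommClass (ZMod 5) A A]
  {φ : LinearMap.BilinForm (ZMod 5) A} {a b c : A} {α β γ ψ : ZMod 5}

theorem IsGeneratedByIdempotents.isUniversal (h : IsGeneratedByIdempotents φ a b c)
    (p : HasParameters φ a b c α β γ ψ) (li : LinearIndependent (ZMod 5) (monomials a b c)) :
    IsUniversal φ a b c α β γ ψ :=
  ⟨h, p, fun _ _ _ _ _ _ _ _ _ h' p' => h.exists_hom p li h' p'⟩

/-- The homomorphism onto the model takes the monomials to independent vectors. -/
theorem IsUniversal.linearIndependent (h : IsUniversal φ a b c α β γ ψ)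
    (m : HasModel.{u} α β γ ψ) : LinearIndependent (ZMod 5) (monomials a b c) := by
  obtain ⟨B, _, _, _, _, φ', a', b', c', h', p', li⟩ := m
  obtain ⟨f, -, rfl, rfl, rfl⟩ := h.universal B φ' a' b' c' h' p'
  refine LinearIndependent.of_comp (f : A →ₗ[ZMod 5] B) ?_
  convert li using 1
  funext i
  fin_cases i <;> simp [monomials]

end Model

/-! ### Replacing the generators by conjugates under `T`. -/

section Conjugates

set_option linter.unusedSectionVars false

variable {A : Type*} [NonUnitalNonAssocCommRing A] [Module (ZMod 5) A]
  [IsScalarTower (ZMod 5) A A] [SMulCommClass (ZMod 5) A A]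
  {φ : LinearMap.BilinForm (ZMod 5) A} {a b c x y z : A} {α β γ ψ α' β' γ' ψ' : ZMod 5}

/-- `a, b, c` are nonzero idempotents. -/
structure AreAxes (a b c : A) : Prop where
  idem : ∀ i, ![a, b, c] i * ![a, b, c] i = ![a, b, c] i
  ne_zero : ∀ i, ![a, b, c] i ≠ 0

theorem IsGeneratedByIdempotents.areAxes (h : IsGeneratedByIdempotents φ a b c) :
    AreAxes a b c := by
  constructor <;> intro i <;> fin_cases i
  exacts [h.idem_a, h.idem_b, h.idem_c, h.a_ne_zero, h.b_ne_zero, h.c_ne_zero]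

/-- The three generators of the group `T`. -/
noncomputable def axisInvolution (a b c : A) (i : Fin 3) : A ≃ₗ[ZMod 5] A :=
  miyamoto (ZMod 5) (![a, b, c] i)

theorem miyamotoGroup_eq (a b c : A) :
    miyamotoGroup (ZMod 5) a b c = Subgroup.closure (Set.range (axisInvolution a b c)) := by
  rw [miyamotoGroup]
  congr 1
  ext t
  simp only [Set.mem_insert_iff, Set.mem_singleton_iff, Set.mem_range, axisInvolution,
    Fin.exists_fin_succ]
  simp [eq_comm]

theorem axisInvolution_mem (a b c : A) (i : Fin 3) :
    axisInvolution a b c i ∈ miyamotoGroup (ZMod 5) a b c := by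
  rw [miyamotoGroup_eq]; exact Subgroup.subset_closure ⟨i, rfl⟩

theorem miyamotoGroup_induction {a b c : A} (P : (A ≃ₗ[ZMod 5] A) → Prop)
    (h1 : P 1) (hm : ∀ s t, P s → P t → P (s * t)) (hi : ∀ s, P s → P s⁻¹)
    (hg : ∀ i, P (axisInvolution a b c i)) {t : A ≃ₗ[ZMod 5] A}
    (ht : t ∈ miyamotoGroup (ZMod 5) a b c) : P t := by
  rw [miyamotoGroup_eq] at ht
  induction ht using Subgroup.closure_induction with
  | mem x hx => obtain ⟨i, rfl⟩ := hx; exact hg i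
  | one => exact h1
  | mul s t _ _ h h' => exact hm s t h h'
  | inv s _ h => exact hi s h

theorem IsPseudoComposition.isAutomorphism (hφ : IsPseudoComposition φ) (ax : AreAxes a b c)
    {t : A ≃ₗ[ZMod 5] A} (ht : t ∈ miyamotoGroup (ZMod 5) a b c) :
    (∀ x y, t (x * y) = t x * t y) ∧ ∀ x y, φ (t x) (t y) = φ x y := by
  refine miyamotoGroup_induction (a := a) (b := b) (c := c) (fun t =>
    (∀ x y, t (x * y) = t x * t y) ∧ ∀ x y, φ (t x) (t y) = φ x y) (by simp) ?_ ?_ ?_ ht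
  · rintro s t ⟨h1, h2⟩ ⟨h3, h4⟩
    exact ⟨fun x y => by simp [LinearEquiv.mul_apply, h1, h3],
      fun x y => by simp [LinearEquiv.mul_apply, h2, h4]⟩
  · rintro s ⟨h1, h2⟩
    have e : ∀ x, s (s⁻¹ x) = x := s.apply_symm_apply
    exact ⟨fun x y => s.injective (by rw [h1, e, e, e]), fun x y => by rw [← h2, e, e]⟩
  · exact fun i => ⟨hφ.miyamoto_mul (ax.idem i) (ax.ne_zero i),
      hφ.form_miyamoto (ax.idem i) (ax.ne_zero i)⟩

/-- `x` is a conjugate of one of `a, b, c` under the group `T`. -/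
def IsConjugate (a b c x : A) : Prop :=
  ∃ t ∈ miyamotoGroup (ZMod 5) a b c, ∃ i, x = t (![a, b, c] i)

/-- By `miyamoto_map` the involution of `t x` is the conjugate by `t` of the involution of `x`,
hence again in `T`. -/
theorem IsPseudoComposition.axes_of_isConjugate (hφ : IsPseudoComposition φ)
    (ax : AreAxes a b c) (hc : ∀ i, IsConjugate a b c (![x, y, z] i)) :
    AreAxes x y z ∧ miyamotoGroup (ZMod 5) x y z ≤ miyamotoGroup (ZMod 5) a b c := by
  refine ⟨⟨fun i => ?_, fun i => ?_⟩, ?_⟩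
  · obtain ⟨t, ht, j, e⟩ := hc i
    rw [e, ← (hφ.isAutomorphism ax ht).1, ax.idem]
  · obtain ⟨t, ht, j, e⟩ := hc i
    rw [e]
    exact (map_ne_zero_iff t t.injective).2 (ax.ne_zero j)
  · rw [miyamotoGroup_eq x, Subgroup.closure_le]
    rintro _ ⟨i, rfl⟩
    obtain ⟨t, ht, j, e⟩ := hc i
    have h := hφ.isAutomorphism ax ht
    rw [axisInvolution, e, hφ.miyamoto_map (ax.idem j) (ax.ne_zero j) t h.1 h.2]
    exact mul_mem (mul_mem ht (axisInvolution_mem a b c j)) (inv_mem ht)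

/-- Since `τ_a y` is a combination of `y`, `a` and `ay`, the involution stabilizes every subalgebra
that contains `a`; the converse holds because it is its own inverse. -/
theorem IsPseudoComposition.adjoin_invariant (hφ : IsPseudoComposition φ) (ax : AreAxes a b c)
    {t : A ≃ₗ[ZMod 5] A} (ht : t ∈ miyamotoGroup (ZMod 5) a b c) (x : A) :
    t x ∈ NonUnitalAlgebra.adjoin (ZMod 5) ({a, b, c} : Set A) ↔
      x ∈ NonUnitalAlgebra.adjoin (ZMod 5) ({a, b, c} : Set A) := by
  set S := NonUnitalAlgebra.adjoin (ZMod 5) ({a, b, c} : Set A) with hS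
  have hm : ∀ i, ![a, b, c] i ∈ S := fun i => by
    apply NonUnitalAlgebra.subset_adjoin
    fin_cases i <;> simp
  have one : ∀ i x, x ∈ S → axisInvolution a b c i x ∈ S := fun i x hx => by
    rw [axisInvolution, hφ.miyamoto_apply (ax.idem i) (ax.ne_zero i)]
    exact add_mem (add_mem (SMulMemClass.smul_mem _ hx) (SMulMemClass.smul_mem _ (hm i)))
      (SMulMemClass.smul_mem _ (mul_mem (hm i) hx))
  refine miyamotoGroup_induction (a := a) (b := b) (c := c) (fun t => ∀ x, t x ∈ S ↔ x ∈ S)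
    (fun x => Iff.rfl) (fun s t hs ht x => (hs _).trans (ht _)) (fun s hs x => ?_) (fun i x => ?_)
    ht x
  · rw [← hs]
    exact iff_of_eq (congrArg (· ∈ S) (s.apply_symm_apply x))
  · refine ⟨fun h => ?_, one i x⟩
    have := one i _ h
    rwa [axisInvolution, hφ.miyamoto_miyamoto (ax.idem i) (ax.ne_zero i)] at this

/-- Three idempotents conjugate to `a, b, c`, to which `a, b, c` are conjugate in turn, generate the
same algebra and the same group. -/
theorem IsGeneratedByIdempotents.of_isConjugate (h : IsGeneratedByIdempotents φ a b c)
    (h1 : ∀ i, IsConjugate a b c (![x, y, z] i)) (h2 : ∀ i, IsConjugate x y z (![a, b, c] i)) :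
    IsGeneratedByIdempotents φ x y z ∧
      miyamotoGroup (ZMod 5) x y z = miyamotoGroup (ZMod 5) a b c := by
  have hφ := h.pseudoComposition
  obtain ⟨ax, le⟩ := hφ.axes_of_isConjugate h.areAxes h1
  refine ⟨⟨hφ, ax.idem 0, ax.idem 1, ax.idem 2, ax.ne_zero 0, ax.ne_zero 1, ax.ne_zero 2, ?_⟩,
    le_antisymm le (hφ.axes_of_isConjugate ax h2).2⟩
  rw [eq_top_iff, ← h.generates]
  apply NonUnitalAlgebra.adjoin_le
  have hm : ∀ i, ![x, y, z] i ∈ NonUnitalAlgebra.adjoin (ZMod 5) ({x, y, z} : Set A) := fun i => by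
    apply NonUnitalAlgebra.subset_adjoin
    fin_cases i <;> simp
  have ha : ∀ i, ![a, b, c] i ∈ NonUnitalAlgebra.adjoin (ZMod 5) ({x, y, z} : Set A) := fun i => by
    obtain ⟨t, ht, j, e⟩ := h2 i
    rw [e, hφ.adjoin_invariant ax ht]
    exact hm j
  rintro _ (rfl | rfl | rfl)
  exacts [ha 0, ha 1, ha 2]

/-- Both families are bases, so the two Gram matrices are congruent. -/
theorem gramMatrix_rank_eq (li : LinearIndependent (ZMod 5) (monomials a b c))
    (sp : Submodule.span (ZMod 5) (Set.range (monomials a b c)) = ⊤)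
    (li' : LinearIndependent (ZMod 5) (monomials x y z))
    (sp' : Submodule.span (ZMod 5) (Set.range (monomials x y z)) = ⊤) :
    (gramMatrix φ x y z).rank = (gramMatrix φ a b c).rank := by
  let v := Module.Basis.mk li sp.ge
  let w := Module.Basis.mk li' sp'.ge
  have e : gramMatrix φ a b c = LinearMap.BilinForm.toMatrix v φ := by
    ext i j; simp [gramMatrix, v]
  have e' : gramMatrix φ x y z = LinearMap.BilinForm.toMatrix w φ := by
    ext i j; simp [gramMatrix, w]
  rw [e, e', ← LinearMap.BilinForm.toMatrix_mul_basis_toMatrix v w φ]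
  have u : IsUnit (v.toMatrix w).det :=
    (Matrix.isUnit_iff_isUnit_det _).1 (IsUnit.of_mul_eq_one _ (v.toMatrix_mul_toMatrix_flip w))
  rw [Matrix.rank_mul_eq_left_of_isUnit_det _ _ u, Matrix.rank_mul_eq_right_of_isUnit_det]
  rwa [Matrix.det_transpose]

theorem linearIndependent_of_span (li : LinearIndependent (ZMod 5) (monomials a b c))
    (sp : Submodule.span (ZMod 5) (Set.range (monomials a b c)) = ⊤)
    (sp' : Submodule.span (ZMod 5) (Set.range (monomials x y z)) = ⊤) :
    LinearIndependent (ZMod 5) (monomials x y z) := by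
  have := Module.finrank_eq_card_basis (Module.Basis.mk li sp.ge)
  exact linearIndependent_of_top_le_span_of_card_eq_finrank sp'.ge this.symm

end Conjugates

/-! ### Moves between parameter values. -/

section Moves

/-- Every universal algebra with the given parameters has a group `T` and a Gram matrix whose rank
satisfy the property `R`. -/
def Holds (R : (G : Type u) → [Group G] → ℕ → Prop) (α β γ ψ : ZMod 5) : Prop :=
  ∀ (A : Type u) [NonUnitalNonAssocCommRing A] [Module (ZMod 5) A]
    [IsScalarTower (ZMod 5) A A] [SMulCommClass (ZMod 5) A A]
    (φ : LinearMap.BilinForm (ZMod 5) A) (a b c : A), IsGeneratedByIdempotents φ a b c →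
    HasParameters φ a b c α β γ ψ → LinearIndependent (ZMod 5) (monomials a b c) →
    R (miyamotoGroup (ZMod 5) a b c) (gramMatrix φ a b c).rank

/-- In a universal algebra with the parameters `α, β, γ, ψ` there are generating idempotents
with the parameters `α', β', γ', ψ'` and the same group. -/
def Leads (α β γ ψ α' β' γ' ψ' : ZMod 5) : Prop :=
  ∀ (A : Type u) [NonUnitalNonAssocCommRing A] [Module (ZMod 5) A]
    [IsScalarTower (ZMod 5) A A] [SMulCommClass (ZMod 5) A A]
    (φ : LinearMap.BilinForm (ZMod 5) A) (a b c : A), IsGeneratedByIdempotents φ a b c →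
    HasParameters φ a b c α β γ ψ → LinearIndependent (ZMod 5) (monomials a b c) →
    ∃ x y z : A, (∀ i, IsConjugate a b c (![x, y, z] i)) ∧
      (∀ i, IsConjugate x y z (![a, b, c] i)) ∧ HasParameters φ x y z α' β' γ' ψ'

variable {α β γ ψ α' β' γ' ψ' : ZMod 5}

/-- The new idempotents generate the same algebra and the same group, and their monomials form
another basis, so the rank of the Gram matrix is unchanged too. -/
theorem Leads.holds {R : (G : Type u) → [Group G] → ℕ → Prop}
    (l : Leads.{u} α β γ ψ α' β' γ' ψ') (hR : Holds R α' β' γ' ψ') : Holds R α β γ ψ := by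
  intro A _ _ _ _ φ a b c h p li
  obtain ⟨x, y, z, h1, h2, p'⟩ := l A φ a b c h p li
  obtain ⟨h', e⟩ := h.of_isConjugate h1 h2
  have sp := h.span_monomials p
  have sp' := h'.span_monomials p'
  have li' := linearIndependent_of_span li sp sp'
  have := hR A φ x y z h' p' li'
  rw [gramMatrix_rank_eq li sp li' sp'] at this
  rw [← e]
  exact this

theorem Leads.hasModel (l : Leads.{u} α β γ ψ α' β' γ' ψ') (m : HasModel.{u} α β γ ψ) :
    HasModel.{u} α' β' γ' ψ' := by
  obtain ⟨A, _, _, _, _, φ, a, b, c, h, p, li⟩ := m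
  obtain ⟨x, y, z, h1, h2, p'⟩ := l A φ a b c h p li
  obtain ⟨h', -⟩ := h.of_isConjugate h1 h2
  exact ⟨A, _, _, _, _, φ, x, y, z, h', p',
    linearIndependent_of_span li (h.span_monomials p) (h'.span_monomials p')⟩

theorem leads_swap_ab : Leads.{u} α β γ ψ α γ β ψ := by
  intro A _ _ _ _ φ a b c h p _
  have hs := h.pseudoComposition.symm
  refine ⟨b, a, c, fun i => ⟨1, one_mem _, ![1, 0, 2] i, ?_⟩,
    fun i => ⟨1, one_mem _, ![1, 0, 2] i, ?_⟩, ⟨by rw [hs, p.ab], p.ac, p.bc, (h.forms p).1⟩⟩ <;>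
  fin_cases i <;> rfl

theorem leads_swap_bc : Leads.{u} α β γ ψ γ β α ψ := by
  intro A _ _ _ _ φ a b c h p _
  have hs := h.pseudoComposition.symm
  refine ⟨a, c, b, fun i => ⟨1, one_mem _, ![0, 2, 1] i, ?_⟩,
    fun i => ⟨1, one_mem _, ![0, 2, 1] i, ?_⟩, ⟨p.ac, by rw [hs, p.bc], p.ab, (h.forms p).2⟩⟩ <;>
  fin_cases i <;> rfl

/-- Here `c` is replaced by `τ_a c`. The value `γ` is kept since `τ_a` is an isometry that fixes
`a`; the other two follow from the formula for `τ_a`. -/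
theorem leads_reflect : Leads.{u} α β γ ψ α (3 * β + γ * α + 2 * ψ) γ (β + 3 * γ * α + 2 * ψ) := by
  intro A _ _ _ _ φ a b c h p _
  have hφ := h.pseudoComposition
  have f1 := (idem_identity two_ne_zero_five hφ h.idem_a h.a_ne_zero a).1
  refine ⟨a, b, miyamoto (ZMod 5) a c, fun i => ?_, fun i => ?_, ⟨p.ab, ?_, ?_, ?_⟩⟩
  · fin_cases i
    exacts [⟨1, one_mem _, 0, rfl⟩, ⟨1, one_mem _, 1, rfl⟩,
      ⟨_, axisInvolution_mem a b c 0, 2, rfl⟩]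
  · fin_cases i
    exacts [⟨1, one_mem _, 0, rfl⟩, ⟨1, one_mem _, 1, rfl⟩,
      ⟨_, axisInvolution_mem a b _ 0, 2, (hφ.miyamoto_miyamoto h.idem_a h.a_ne_zero c).symm⟩]
  · rw [hφ.miyamoto_apply h.idem_a h.a_ne_zero]
    simp [p.bc, p.ac, p.b_ac, hφ.symm b a, p.ab]
  · rw [← p.ac, ← hφ.form_miyamoto h.idem_a h.a_ne_zero a c, hφ.miyamoto_self h.idem_a h.a_ne_zero]
  · rw [hφ.miyamoto_apply h.idem_a h.a_ne_zero]
    simp only [mul_add, mul_smul_comm, hφ.idem_mul_mul h.idem_a h.a_ne_zero, h.idem_a, map_add,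
      map_smul, smul_eq_mul, p.bc, p.ac, p.b_ac, hφ.symm b a, p.ab]
    ring_nf
    reduce_mod_char

end Moves

/-! ### Reduction of the 625 parameter values to 42 representatives. -/

section Reduction

/-- Four natural numbers, taken as parameters modulo `5`. -/
abbrev Code4 : Type := ℕ × ℕ × ℕ × ℕ

/-- The existence of a model and the properties of the universal algebras for the parameters `P`
follow from those for the parameters `Q`. -/
def Reduces (P Q : Code4) : Prop :=
  (HasModel.{u} Q.1 Q.2.1 Q.2.2.1 Q.2.2.2 → HasModel.{u} P.1 P.2.1 P.2.2.1 P.2.2.2) ∧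
  ∀ R : (G : Type u) → [Group G] → ℕ → Prop,
    Holds R Q.1 Q.2.1 Q.2.2.1 Q.2.2.2 → Holds R P.1 P.2.1 P.2.2.1 P.2.2.2

/-- The three moves: two transpositions of the idempotents, and the reflection of the third
idempotent in the first one. -/
def move (k : ℕ) (P : Code4) : Code4 :=
  match P with
  | (a, b, c, d) =>
    match k with
    | 1 => (a, c, b, d)
    | 2 => (c, b, a, d)
    | 3 => (a, (3 * b + c * a + 2 * d) % 5, c, (b + 3 * c * a + 2 * d) % 5)
    | _ => P

/-- The two clauses of `Reduces` need moves in opposite directions; both are available because every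
move is its own inverse. -/
theorem reduces_move (k : ℕ) (P : Code4) : Reduces.{u} P (move k P) := by
  obtain ⟨a, b, c, d⟩ := P
  unfold move
  match k with
  | 1 => exact ⟨leads_swap_ab.hasModel, fun R => leads_swap_ab.holds⟩
  | 2 => exact ⟨leads_swap_bc.hasModel, fun R => leads_swap_bc.holds⟩
  | 3 =>
    have e1 : (((3 * b + c * a + 2 * d) % 5 : ℕ) : ZMod 5) = 3 * b + c * a + 2 * d := by
      rw [ZMod.natCast_mod]; push_cast; rfl
    have e2 : (((b + 3 * c * a + 2 * d) % 5 : ℕ) : ZMod 5) = b + 3 * c * a + 2 * d := by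
      rw [ZMod.natCast_mod]; push_cast; rfl
    have l := leads_reflect.{u} (α := a) (β := b) (γ := c) (ψ := d)
    have l' := leads_reflect.{u} (α := a) (β := 3 * b + c * a + 2 * d) (γ := c)
      (ψ := b + 3 * c * a + 2 * d)
    -- Reflecting twice restores the parameters.
    have e3 : (3 * (3 * b + c * a + 2 * d) + c * a + 2 * (b + 3 * c * a + 2 * d) : ZMod 5) = b := by
      ring_nf; reduce_mod_char
    have e4 : (3 * b + c * a + 2 * d + 3 * c * a + 2 * (b + 3 * c * a + 2 * d) : ZMod 5) = d := by
      ring_nf; reduce_mod_char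
    rw [e3, e4, ← e1, ← e2] at l'
    rw [← e1, ← e2] at l
    exact ⟨l'.hasModel, fun R => l.holds⟩
  -- The digit `0` stands for no move, so surplus steps of `follow` at a representative do no harm.
  | 0 | _ + 4 => exact ⟨id, fun R => id⟩

/-- A table which holds, for every value of the parameters, a move towards a representative. -/
def moveTable : ℕ :=
  0x33cf77dfbfffb7fffae9dbebbb755b6eea5ebe7579eaf7ebaf95599695a56aafb95dad9e7eebf4cf2ffedfef97955eea6deeb6d576e7aeabe6655566695aabef5e577f5beac6cff77779bb8dddd3f35bfbf5f9dbf57bfbb96999555996aa3fed7fa57dfaa7dcefb677fea5ad9fa3f55eebd71d53ff0eff5a56966555aabf3dd7d5f57f5773cf777d5f757cdd33fdd7755f17c770ff5f5505111005000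

/-- The move that the table prescribes for `P`. -/
def tableMove (P : Code4) : ℕ :=
  moveTable / 4 ^ (125 * P.1 + 25 * P.2.1 + 5 * P.2.2.1 + P.2.2.2) % 4

/-- Follow the table for `n` steps. -/
def follow : ℕ → Code4 → Code4
  | 0, P => P
  | n + 1, P => follow n (move (tableMove P) P)

theorem reduces_follow (n : ℕ) : ∀ P, Reduces.{u} P (follow n P) := by
  induction n with
  | zero => exact fun P => ⟨id, fun R => id⟩
  | succ n ih =>
    intro P
    have h := reduces_move.{u} (tableMove P) P
    have h' := ih (move (tableMove P) P)
    exact ⟨fun m => h.1 (h'.1 m), fun R m => h.2 R (h'.2 R m)⟩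

/-- The representatives for which the group is not solvable. -/
def listedReps : List Code4 :=
  [(0, 0, 0, 0), (0, 0, 0, 4), (0, 0, 1, 3), (0, 0, 3, 0), (0, 1, 1, 4),
    (0, 0, 0, 1), (0, 0, 0, 3), (0, 0, 2, 1), (0, 0, 4, 0), (0, 0, 4, 1), (0, 1, 2, 0),
    (0, 2, 3, 0), (0, 3, 4, 0), (0, 0, 1, 4), (0, 1, 3, 0), (1, 1, 3, 4), (3, 3, 4, 0),
    (4, 4, 4, 0), (0, 0, 2, 3), (0, 2, 4, 0), (0, 0, 2, 0), (0, 0, 3, 2), (0, 1, 4, 0),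
    (1, 1, 1, 2), (1, 1, 2, 3)]

/-- The representatives for which the group is solvable. -/
def solvableReps : List Code4 :=
  [(0, 0, 0, 2), (0, 0, 1, 0), (0, 2, 2, 3), (0, 3, 3, 2), (0, 4, 4, 1), (1, 1, 1, 1),
    (1, 2, 2, 2), (1, 3, 3, 3), (1, 4, 4, 4), (2, 2, 2, 1), (2, 2, 3, 0), (2, 2, 4, 4),
    (2, 3, 3, 4), (2, 3, 4, 3), (3, 3, 3, 0), (3, 3, 3, 3), (4, 4, 4, 3)]

/-- All 625 tuples are evaluated; eighteen steps suffice for each of them. -/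
theorem follow_mem : ∀ a ∈ List.range 5, ∀ b ∈ List.range 5, ∀ c ∈ List.range 5,
    ∀ d ∈ List.range 5, follow 18 (a, b, c, d) ∈ listedReps ++ solvableReps := by
  decide +kernel

theorem exists_rep (α β γ ψ : ZMod 5) : ∃ Q ∈ listedReps ++ solvableReps,
    Reduces.{u} (α.val, β.val, γ.val, ψ.val) Q :=
  ⟨_, follow_mem _ (List.mem_range.2 α.val_lt) _ (List.mem_range.2 β.val_lt)
    _ (List.mem_range.2 γ.val_lt) _ (List.mem_range.2 ψ.val_lt), reduces_follow 18 _⟩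

end Reduction

/-! ### Vectors and matrices modulo `5` as natural numbers in base `1024`. -/

section Packed

/-- A list of digits as a number in base `1024`. -/
def pack : List ℕ → ℕ
  | [] => 0
  | a :: l => a + 1024 * pack l

/-- The first eight digits in base `1024`, reduced modulo `5`. -/
def unpack (n : ℕ) : List ℕ :=
  [n % 1024 % 5, n / 1024 % 1024 % 5, n / 1024 ^ 2 % 1024 % 5, n / 1024 ^ 3 % 1024 % 5,
    n / 1024 ^ 4 % 1024 % 5, n / 1024 ^ 5 % 1024 % 5, n / 1024 ^ 6 % 1024 % 5, n / 1024 ^ 7 % 1024 % 5]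

/-- The sum of the products of the entries of two lists. -/
def dotList : List ℕ → List ℕ → ℕ
  | a :: l, b :: m => a * b + dotList l m
  | _, _ => 0

/-- The product of a matrix modulo `5`, given by its packed columns, and a vector. -/
def app (M v : List ℕ) : List ℕ := unpack (dotList v M)

/-- The product of two matrices given by their packed columns. -/
def mulCode (M N : List ℕ) : List ℕ := N.map fun n => pack (app M (unpack n))

/-- A vector of eight digits modulo `5`. -/
def IsDigits (v : List ℕ) : Prop := v.length = 8 ∧ ∀ x ∈ v, x < 5

instance (v : List ℕ) : Decidable (IsDigits v) := inferInstanceAs (Decidable (_ ∧ _))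

/-- A matrix given by its packed columns. -/
def IsCode (M : List ℕ) : Prop := M.length = 8 ∧ ∀ m ∈ M, pack (unpack m) = m

instance (M : List ℕ) : Decidable (IsCode M) := inferInstanceAs (Decidable (_ ∧ _))

theorem isDigits_unpack (n : ℕ) : IsDigits (unpack n) := by
  refine ⟨rfl, fun x hx => ?_⟩
  simp only [unpack, List.mem_cons, List.not_mem_nil, or_false] at hx
  omega

theorem isDigits_app (M v : List ℕ) : IsDigits (app M v) := isDigits_unpack _

theorem pack_unpack (n : ℕ) : pack (unpack n) = ∑ i : Fin 8, (unpack n).getD i 0 * 1024 ^ (i : ℕ) := by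
  simp only [unpack, pack, Fin.sum_univ_eight]
  simp
  ring

/-- The bound excludes carries, so the coefficients `f i` are the digits in base `1024`. -/
theorem unpack_sum (f : Fin 8 → ℕ) (hf : ∀ i, f i < 1024) :
    unpack (∑ i, f i * 1024 ^ (i : ℕ)) = List.ofFn fun i => f i % 5 := by
  have h0 := hf 0
  have h1 := hf 1
  have h2 := hf 2
  have h3 := hf 3
  have h4 := hf 4
  have h5 := hf 5
  have h6 := hf 6
  have h7 := hf 7
  simp only [Fin.sum_univ_eight, List.ofFn_succ, List.ofFn_zero, unpack]
  simp
  refine ⟨?_, ?_, ?_, ?_, ?_, ?_, ?_, ?_⟩ <;> congr 1 <;> omega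

theorem unpack_pack {v : List ℕ} (hv : IsDigits v) : unpack (pack v) = v := by
  obtain ⟨h1, h2⟩ := hv
  match v, h1 with
  | [a, b, c, d, e, f, g, h], _ =>
    simp only [List.mem_cons, List.not_mem_nil, or_false, forall_eq_or_imp, forall_eq] at h2
    simp only [pack, unpack]
    simp
    omega

theorem isCode_mulCode {M N : List ℕ} (hN : IsCode N) : IsCode (mulCode M N) := by
  refine ⟨by simpa [mulCode] using hN.1, fun m hm => ?_⟩
  obtain ⟨v, hv, rfl⟩ := List.mem_map.1 hm
  rw [unpack_pack (isDigits_app _ _)]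

theorem dotList_eq (n : ℕ) : ∀ v M : List ℕ, v.length = n → M.length = n →
    dotList v M = ∑ j : Fin n, v.getD j 0 * M.getD j 0 := by
  induction n with
  | zero => intro v M hv hM; rw [List.length_eq_zero_iff.1 hv]; simp [dotList]
  | succ n ih =>
    intro v M hv hM
    match v, M with
    | a :: l, b :: m =>
      rw [dotList, ih l m (by simpa using hv) (by simpa using hM), Fin.sum_univ_succ]
      simp
    | [], _ => simp at hv
    | _ :: _, [] => simp at hM

theorem getD_lt_of_isDigits {v : List ℕ} (hv : IsDigits v) (i : ℕ) : v.getD i 0 < 5 := by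
  rcases lt_or_ge i v.length with h | h
  · rw [List.getD_eq_getElem _ _ h]
    exact hv.2 _ (List.getElem_mem h)
  · rw [List.getD_eq_default _ _ h]; norm_num

theorem dotList_eq_sum {M v : List ℕ} (hM : IsCode M) (hv : IsDigits v) :
    dotList v M = ∑ i : Fin 8,
      (∑ j : Fin 8, v.getD j 0 * (unpack (M.getD j 0)).getD i 0) * 1024 ^ (i : ℕ) := by
  rw [dotList_eq 8 v M hv.1 hM.1]
  simp only [Finset.sum_mul]
  rw [Finset.sum_comm]
  refine Finset.sum_congr rfl fun j _ => ?_
  have hj : (j : ℕ) < M.length := by rw [hM.1]; exact j.2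
  have : M.getD j 0 = pack (unpack (M.getD j 0)) := by
    rw [List.getD_eq_getElem _ _ hj]
    exact (hM.2 _ (List.getElem_mem hj)).symm
  conv_lhs => rw [this, pack_unpack, Finset.mul_sum]
  exact Finset.sum_congr rfl fun i _ => by ring

/-- Eight products of digits that are at most `4` stay far below the base. Hence a packed matrix is
applied to a vector by a single combination of natural numbers, and there is room to add a few such
results before reducing. -/
theorem dot_digits_le {v : List ℕ} (hv : IsDigits v) (M : List ℕ) (i : Fin 8) :
    ∑ j : Fin 8, v.getD j 0 * (unpack (M.getD j 0)).getD i 0 ≤ 128 :=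
  calc _ ≤ ∑ j : Fin 8, 4 * 4 := Finset.sum_le_sum fun j _ => Nat.mul_le_mul
          (Nat.le_of_lt_succ (getD_lt_of_isDigits hv _))
          (Nat.le_of_lt_succ (getD_lt_of_isDigits (isDigits_unpack _) _))
    _ ≤ 128 := by simp

theorem app_getD {M v : List ℕ} (hM : IsCode M) (hv : IsDigits v) (i : Fin 8) :
    (app M v).getD i 0 =
      (∑ j : Fin 8, v.getD j 0 * (unpack (M.getD j 0)).getD i 0) % 5 := by
  rw [app, dotList_eq_sum hM hv, unpack_sum]
  · rw [List.getD_eq_getElem _ _ (by simp)]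
    simp only [List.getElem_ofFn]
  · exact fun i => (dot_digits_le hv M i).trans_lt (by norm_num)

end Packed

/-! ### Linear maps and their packed matrices. -/

section Coordinates

variable {A : Type*} [AddCommGroup A] [Module (ZMod 5) A] (m : Fin 8 → A)

/-- The vector with the given coordinates with respect to the family `m`. -/
def vect (v : List ℕ) : A := ∑ i : Fin 8, ((v.getD i 0 : ℕ) : ZMod 5) • m i

/-- The linear map `t` has the given matrix with respect to the family `m`. -/
structure HasCode (t : A →ₗ[ZMod 5] A) (M : List ℕ) : Prop where
  isCode : IsCode M
  map : ∀ j : Fin 8, t (m j) = vect m (unpack (M.getD j 0))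

variable {m}

theorem HasCode.map_vect {t : A →ₗ[ZMod 5] A} {M : List ℕ} (h : HasCode m t M) {v : List ℕ}
    (hv : IsDigits v) : t (vect m v) = vect m (app M v) := by
  simp only [vect, map_sum, map_smul, h.map, Finset.smul_sum]
  rw [Finset.sum_comm]
  refine Finset.sum_congr rfl fun i _ => ?_
  rw [app_getD h.isCode hv, ZMod.natCast_mod, Nat.cast_sum, Finset.sum_smul]
  exact Finset.sum_congr rfl fun j _ => by rw [Nat.cast_mul, mul_smul]

theorem HasCode.mul {s t : A →ₗ[ZMod 5] A} {M N : List ℕ} (hs : HasCode m s M)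
    (ht : HasCode m t N) : HasCode m (s ∘ₗ t) (mulCode M N) := by
  refine ⟨isCode_mulCode ht.isCode, fun j => ?_⟩
  have hj : (j : ℕ) < N.length := by rw [ht.isCode.1]; exact j.2
  have hj' : (j : ℕ) < (mulCode M N).length := by simpa [mulCode] using hj
  rw [LinearMap.comp_apply, ht.map, hs.map_vect (isDigits_unpack _),
    List.getD_eq_getElem _ _ hj', List.getD_eq_getElem _ _ hj]
  simp only [mulCode, List.getElem_map]
  rw [unpack_pack (isDigits_app _ _)]

theorem vect_injective (li : LinearIndependent (ZMod 5) m) {v w : List ℕ} (hv : IsDigits v)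
    (hw : IsDigits w) (h : vect m v = vect m w) : v = w := by
  have := Fintype.linearIndependent_iff.1 li
    (fun i => ((v.getD i 0 : ℕ) : ZMod 5) - ((w.getD i 0 : ℕ) : ZMod 5))
    (by simp only [sub_smul, Finset.sum_sub_distrib]; exact sub_eq_zero.2 h)
  refine List.ext_getElem (hv.1.trans hw.1.symm) fun i h1 h2 => ?_
  have e := sub_eq_zero.1 (this ⟨i, by rw [← hv.1]; exact h1⟩)
  rw [ZMod.natCast_eq_natCast_iff', Nat.mod_eq_of_lt (getD_lt_of_isDigits hv _),
    Nat.mod_eq_of_lt (getD_lt_of_isDigits hw _)] at e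
  rw [List.getD_eq_getElem _ _ h1, List.getD_eq_getElem _ _ h2] at e
  exact e

/-- The `i`-th unit vector. -/
def unitVec (i : ℕ) : List ℕ := (List.range 8).map fun j => if j = i then 1 else 0

theorem getD_map_range {n i : ℕ} (h : i < n) (f : ℕ → ℕ) :
    ((List.range n).map f).getD i 0 = f i := by
  rw [List.getD_eq_getElem _ _ (by simpa using h)]
  simp

theorem isDigits_unitVec (i : ℕ) : IsDigits (unitVec i) := by
  refine ⟨by simp [unitVec], fun x hx => ?_⟩
  obtain ⟨j, -, rfl⟩ := List.mem_map.1 hx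
  split_ifs <;> norm_num

theorem vect_unitVec (i : Fin 8) : vect m (unitVec i) = m i := by
  have : ∀ j : Fin 8, (unitVec i).getD j 0 = if j = i then 1 else 0 := fun j => by
    rw [unitVec, getD_map_range j.2]
    simp [Fin.ext_iff]
  simp only [vect, this, Nat.cast_ite, Nat.cast_one, Nat.cast_zero, ite_smul, one_smul, zero_smul]
  simp

end Coordinates

/-! ### Packed matrices of the multiplications by `a, b, c` and of their involutions. -/

section Codes

/-- The matrices of the multiplications by `a`, `b`, `c`, as lists of columns. -/
def mulList (al be ga ps : ℕ) : ℕ → List (List ℕ)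
  | 0 => [[1, 0, 0, 0, 0, 0, 0, 0], [0, 0, 0, 1, 0, 0, 0, 0], [0, 0, 0, 0, 0, 1, 0, 0],
      [al, 3, 0, 2, 0, 0, 0, 0], [0, 0, 0, 0, 0, 0, 1, 0], [ga, 0, 3, 0, 0, 2, 0, 0],
      [ps, 0, 0, 0, 3, 0, 2, 0],
      [4 * be + 2 * ps, 4 * ga, 3 * al, 2 * ga, 1, 4 * al, 3, 3]]
  | 1 => [[0, 0, 0, 1, 0, 0, 0, 0], [0, 1, 0, 0, 0, 0, 0, 0], [0, 0, 0, 0, 1, 0, 0, 0],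
      [3, al, 0, 2, 0, 0, 0, 0], [0, be, 3, 0, 2, 0, 0, 0], [0, 0, 0, 0, 0, 0, 0, 1],
      [4 * be, 4 * ga + 2 * ps, 3 * al, 2 * be, 4 * al, 1, 3, 3], [0, ps, 0, 0, 0, 3, 0, 2]]
  | _ => [[0, 0, 0, 0, 0, 1, 0, 0], [0, 0, 0, 0, 1, 0, 0, 0], [0, 0, 1, 0, 0, 0, 0, 0],
      [be, ga, al, 0, 0, 0, 4, 4], [0, 3, be, 0, 2, 0, 0, 0], [3, 0, ga, 0, 0, 2, 0, 0],
      [2 * be, ga, 2 * al + 2 * ps, 1, 4 * ga, 2 * be, 0, 2],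
      [be, 2 * ga, 2 * al + 2 * ps, 1, 2 * ga, 4 * be, 2, 0]]

/-- The values of the form on `a`, `b`, `c` and the monomials. -/
def formList (al be ga ps : ℕ) : ℕ → List ℕ
  | 0 => [1, al, ga, al, ps, ga, ps, al * ga + 3 * be + 2 * ps]
  | 1 => [al, 1, be, al, be, ps, al * be + 3 * ga + 2 * ps, ps]
  | _ => [ga, be, 1, ps, be, ga, 3 * al + be * ga + 2 * ps, 3 * al + be * ga + 2 * ps]

/-- The matrix of the multiplication by `a`, `b` or `c`. -/
def axisCode (P : Code4) (k : ℕ) : List ℕ :=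
  (mulList P.1 P.2.1 P.2.2.1 P.2.2.2 k).map fun v => pack (v.map (· % 5))

/-- The matrix of the Miyamoto involution of `a`, `b` or `c`. -/
def tauCode (P : Code4) (k : ℕ) : List ℕ :=
  (List.range 8).map fun j => pack ((List.range 8).map fun i =>
    (3 * (if i = j then 1 else 0) +
      (if i = k then (formList P.1 P.2.1 P.2.2.1 P.2.2.2 k).getD j 0 else 0) +
      2 * ((mulList P.1 P.2.1 P.2.2.1 P.2.2.2 k).getD j []).getD i 0) % 5)

variable {A : Type*} [NonUnitalNonAssocCommRing A] [Module (ZMod 5) A]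
  [IsScalarTower (ZMod 5) A A] [SMulCommClass (ZMod 5) A A]
  {φ : LinearMap.BilinForm (ZMod 5) A} {a b c : A} {P : Code4}

/-- `a, b, c` generate `A`, and have the parameters `P`. -/
structure IsTriple (φ : LinearMap.BilinForm (ZMod 5) A) (a b c : A) (P : Code4) : Prop where
  gen : IsGeneratedByIdempotents φ a b c
  par : HasParameters φ a b c P.1 P.2.1 P.2.2.1 P.2.2.2

theorem IsTriple.mul_eq (h : IsTriple φ a b c P) (k : Fin 3) (j : Fin 8) :
    ![a, b, c] k * monomials a b c j =
      vect (monomials a b c) ((mulList P.1 P.2.1 P.2.2.1 P.2.2.2 k).getD j []) := by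
  fin_cases k
  · refine (h.gen.mul_a h.par j).trans ?_
    fin_cases j <;> simp [vect, colA, mulList, Fin.sum_univ_eight]
  · refine (h.gen.mul_b h.par j).trans ?_
    fin_cases j <;> simp [vect, colB, mulList, Fin.sum_univ_eight]
  · refine (h.gen.mul_c h.par j).trans ?_
    fin_cases j <;> simp [vect, colC, mulList, Fin.sum_univ_eight]

theorem IsTriple.form_eq (h : IsTriple φ a b c P) (k : Fin 3) (j : Fin 8) :
    φ (![a, b, c] k) (monomials a b c j) =
      (((formList P.1 P.2.1 P.2.2.1 P.2.2.2 k).getD j 0 : ℕ) : ZMod 5) := by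
  fin_cases k
  · refine (h.gen.form_a h.par j).trans ?_
    fin_cases j <;> simp [rowA, formList]
  · refine (h.gen.form_b h.par j).trans ?_
    fin_cases j <;> simp [rowB, formList]
  · refine (h.gen.form_c h.par j).trans ?_
    fin_cases j <;> simp [rowC, formList]

theorem mulList_length (al be ga ps k : ℕ) : (mulList al be ga ps k).length = 8 ∧
    ∀ v ∈ mulList al be ga ps k, v.length = 8 := by
  match k with
  | 0 | 1 | _ + 2 => simp [mulList]

theorem IsTriple.hasCode_mul (h : IsTriple φ a b c P) (k : Fin 3) :
    HasCode (monomials a b c) (LinearMap.mulLeft (ZMod 5) (![a, b, c] k)) (axisCode P k) := by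
  obtain ⟨l1, l2⟩ := mulList_length P.1 P.2.1 P.2.2.1 P.2.2.2 k
  have hd : ∀ v ∈ mulList P.1 P.2.1 P.2.2.1 P.2.2.2 k, IsDigits (v.map (· % 5)) := fun v hv => by
    refine ⟨by simpa using l2 v hv, fun x hx => ?_⟩
    obtain ⟨y, -, rfl⟩ := List.mem_map.1 hx
    exact Nat.mod_lt _ (by norm_num)
  refine ⟨⟨by simpa [axisCode] using l1, fun n hn => ?_⟩, fun j => ?_⟩
  · obtain ⟨v, hv, rfl⟩ := List.mem_map.1 hn
    rw [unpack_pack (hd v hv)]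
  · have hj : (j : ℕ) < (mulList P.1 P.2.1 P.2.2.1 P.2.2.2 k).length := by rw [l1]; exact j.2
    rw [LinearMap.mulLeft_apply, h.mul_eq, List.getD_eq_getElem _ _ hj,
      List.getD_eq_getElem _ _ (by simpa [axisCode] using hj)]
    simp only [axisCode, List.getElem_map]
    rw [unpack_pack (hd _ (List.getElem_mem hj))]
    refine Finset.sum_congr rfl fun i _ => ?_
    have hi : (i : ℕ) < ((mulList P.1 P.2.1 P.2.2.1 P.2.2.2 k)[(j : ℕ)]).length := by
      rw [l2 _ (List.getElem_mem hj)]; exact i.2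
    rw [List.getD_eq_getElem _ _ hi, List.getD_eq_getElem _ _ (by simpa using hi)]
    simp

theorem IsTriple.hasCode_tau (h : IsTriple φ a b c P) (k : Fin 3) :
    HasCode (monomials a b c) (axisInvolution a b c k).toLinearMap (tauCode P k) := by
  have hd : ∀ f : ℕ → ℕ, IsDigits ((List.range 8).map fun i => f i % 5) := fun f => by
    refine ⟨by simp, fun x hx => ?_⟩
    obtain ⟨y, -, rfl⟩ := List.mem_map.1 hx
    exact Nat.mod_lt _ (by norm_num)
  refine ⟨⟨by simp [tauCode], fun n hn => ?_⟩, fun j => ?_⟩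
  · obtain ⟨v, hv, rfl⟩ := List.mem_map.1 hn
    rw [unpack_pack (hd _)]
  · rw [List.getD_eq_getElem _ _ (by simp [tauCode])]
    simp only [tauCode, List.getElem_map, List.getElem_range]
    rw [unpack_pack (hd _)]
    have hx := h.gen.areAxes
    rw [LinearEquiv.coe_coe, axisInvolution,
      h.gen.pseudoComposition.miyamoto_apply (hx.idem k) (hx.ne_zero k), h.mul_eq, h.form_eq]
    have e : ![a, b, c] k = monomials a b c (Fin.castLE (by norm_num) k) := by
      fin_cases k <;> rfl
    rw [← vect_unitVec (m := monomials a b c) j, e,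
      ← vect_unitVec (m := monomials a b c) (Fin.castLE (by norm_num) k)]
    simp only [vect, Finset.smul_sum, ← Finset.sum_add_distrib]
    refine Finset.sum_congr rfl fun i _ => ?_
    rw [unitVec, unitVec, getD_map_range i.2, getD_map_range i.2, getD_map_range i.2]
    simp only [ZMod.natCast_mod, smul_smul, ← add_smul, Fin.val_castLE]
    congr 1
    push_cast
    split_ifs <;> simp_all

end Codes

/-! ### An algebra from structure constants on a basis. -/

section Existence

/-- The linearized identity is trilinear, so basis vectors suffice; for equal arguments it is three
times the cube identity, and `3` is invertible. The remaining equations make the basis the family of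
monomials in its first three members, which gives generation and independence. -/
theorem hasModel_of_basis {V : Type u} [AddCommGroup V] [Module (ZMod 5) V]
    (bs : Module.Basis (Fin 8) (ZMod 5) V) (B : V →ₗ[ZMod 5] V →ₗ[ZMod 5] V)
    (φ : LinearMap.BilinForm (ZMod 5) V) (hB : ∀ i j, B (bs i) (bs j) = B (bs j) (bs i))
    (hφ : ∀ i j, φ (bs i) (bs j) = φ (bs j) (bs i))
    (hc : ∀ i j k, B (B (bs i) (bs j)) (bs k) + B (B (bs j) (bs k)) (bs i) +
      B (B (bs k) (bs i)) (bs j) = φ (bs i) (bs j) • bs k + φ (bs j) (bs k) • bs i +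
        φ (bs k) (bs i) • bs j)
    (h00 : B (bs 0) (bs 0) = bs 0) (h11 : B (bs 1) (bs 1) = bs 1) (h22 : B (bs 2) (bs 2) = bs 2)
    (h01 : B (bs 0) (bs 1) = bs 3) (h12 : B (bs 1) (bs 2) = bs 4) (h02 : B (bs 0) (bs 2) = bs 5)
    (h04 : B (bs 0) (bs 4) = bs 6) (h15 : B (bs 1) (bs 5) = bs 7) (f00 : φ (bs 0) (bs 0) = 1) :
    HasModel.{u} (φ (bs 0) (bs 1)) (φ (bs 1) (bs 2)) (φ (bs 0) (bs 2)) (φ (bs 1) (bs 5)) := by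
  have comm : ∀ x y, B x y = B y x := by
    intro x y
    have : B = B.flip := bs.ext fun i => bs.ext fun j => by rw [LinearMap.flip_apply, hB]
    conv_lhs => rw [this, LinearMap.flip_apply]
  have symm : ∀ x y, φ x y = φ y x := by
    intro x y
    have : φ = LinearMap.flip φ := bs.ext fun i => bs.ext fun j => by rw [LinearMap.flip_apply, hφ]
    conv_lhs => rw [this, LinearMap.flip_apply]
  have lin : ∀ x y z, B (B x y) z + B (B y z) x + B (B z x) y =
      φ x y • z + φ y z • x + φ z x • y := by
    let F : V → V → V → V := fun x y z => B (B x y) z + B (B y z) x + B (B z x) y -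
      (φ x y • z + φ y z • x + φ z x • y)
    -- Cyclic symmetry reduces the linear extension in three arguments to the extension in the first
    -- one.
    have cyc : ∀ x y z, F x y z = F y z x := fun x y z => by simp only [F]; abel
    have ext : ∀ y z, (∀ i, F (bs i) y z = 0) → ∀ x, F x y z = 0 := fun y z h x => by
      have hx : x ∈ Submodule.span (ZMod 5) (Set.range bs) := by rw [bs.span_eq]; trivial
      induction hx using Submodule.span_induction with
      | mem x hx => obtain ⟨i, rfl⟩ := hx; exact h i
      | zero => simp [F]
      | add x x' _ _ h h' =>
        have : F (x + x') y z = F x y z + F x' y z := by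
          simp only [F, map_add, LinearMap.add_apply, add_smul, smul_add]; abel
        rw [this, h, h', add_zero]
      | smul r x _ h =>
        have : F (r • x) y z = r • F x y z := by
          simp only [F, map_smul, LinearMap.smul_apply, smul_eq_mul]; module
        rw [this, h, smul_zero]
    have key : ∀ x y z, F x y z = 0 := fun x y z => ext y z (fun i => by
      rw [cyc]
      refine ext z (bs i) (fun j => ?_) y
      rw [cyc]
      refine ext (bs i) (bs j) (fun k => ?_) z
      rw [cyc]
      exact sub_eq_zero.2 (hc i j k)) x
    exact fun x y z => sub_eq_zero.1 (key x y z)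
  let mulV : Mul V := ⟨fun x y => B x y⟩
  have mul_def : ∀ x y : V, x * y = B x y := fun _ _ => rfl
  let ringV : NonUnitalNonAssocCommRing V :=
    { left_distrib := fun x y z => map_add (B x) y z
      right_distrib := fun x y z => by
        rw [mul_def, mul_def, mul_def, map_add, LinearMap.add_apply]
      zero_mul := fun x => by rw [mul_def, map_zero, LinearMap.zero_apply]
      mul_zero := fun x => by rw [mul_def, map_zero]
      mul_comm := comm }
  have tower : IsScalarTower (ZMod 5) V V :=
    ⟨fun r x y => by rw [smul_eq_mul, smul_eq_mul, mul_def, mul_def, map_smul, LinearMap.smul_apply]⟩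
  have sc : SMulCommClass (ZMod 5) V V :=
    ⟨fun r x y => by rw [smul_eq_mul, smul_eq_mul, mul_def, mul_def, map_smul]⟩
  have mon : monomials (bs 0) (bs 1) (bs 2) = bs := by
    funext i
    fin_cases i <;> simp [monomials, mul_def, h01, h12, h02, h04, h15]
  have pc : IsPseudoComposition φ := by
    refine ⟨fun h => ?_, symm, fun x => ?_⟩
    · rw [h] at f00
      simp at f00
    · have h := lin x x x
      have h3 : (3 : ZMod 5) • (x * x * x) = (3 : ZMod 5) • φ x x • x := by
        simp only [mul_def]
        have e : (3 : ZMod 5) • (B (B x x) x - φ x x • x) = 0 := by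
          rw [← sub_eq_zero.2 h]; module
        rw [smul_sub] at e
        exact sub_eq_zero.1 e
      -- `2` is the inverse of `3`.
      have := congrArg ((2 : ZMod 5) • ·) h3
      simpa only [smul_smul, ← mul_assoc, show (2 * 3 : ZMod 5) = 1 from by decide, one_mul,
        one_smul] using this
  refine ⟨V, ringV, inferInstance, tower, sc, φ, bs 0, bs 1, bs 2,
    ⟨pc, h00, h11, h22, bs.ne_zero 0, bs.ne_zero 1, bs.ne_zero 2, ?_⟩,
    ⟨rfl, rfl, rfl, by rw [mul_def, h02]⟩, by rw [mon]; exact bs.linearIndependent⟩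
  set S := NonUnitalAlgebra.adjoin (ZMod 5) ({bs 0, bs 1, bs 2} : Set V) with hS
  have m0 : bs 0 ∈ S := NonUnitalAlgebra.subset_adjoin _ (by simp)
  have m1 : bs 1 ∈ S := NonUnitalAlgebra.subset_adjoin _ (by simp)
  have m2 : bs 2 ∈ S := NonUnitalAlgebra.subset_adjoin _ (by simp)
  have m4 : bs 4 ∈ S := by rw [← h12]; exact mul_mem m1 m2
  have m5 : bs 5 ∈ S := by rw [← h02]; exact mul_mem m0 m2
  have hm : ∀ i, bs i ∈ S := fun i => by
    fin_cases i
    exacts [m0, m1, m2, by rw [← mul_def] at h01; exact h01 ▸ mul_mem m0 m1, m4, m5,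
      by rw [← mul_def] at h04; exact h04 ▸ mul_mem m0 m4,
      by rw [← mul_def] at h15; exact h15 ▸ mul_mem m1 m5]
  rw [eq_top_iff]
  rintro x -
  rw [← bs.sum_repr x]
  exact sum_mem fun i _ => SMulMemClass.smul_mem _ (hm i)

end Existence

/-! ### Verification of the models for the representatives. -/

section ModelCheck

/-- The multiplications by the elements of a list and the rows of the Gram matrix are extended by
the product of the elements `k` and `l`. -/
def extendTable (s : List (List ℕ) × List (List ℕ)) (k l : ℕ) : List (List ℕ) × List (List ℕ) :=
  let Lk := s.1.getD k []
  let Ll := s.1.getD l []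
  let fk := s.2.getD k []
  let fl := s.2.getD l []
  (s.1 ++ [(List.range 8).map fun j => pack ((List.range 8).map fun i =>
    (4 * (app Lk (unpack (Ll.getD j 0))).getD i 0 + 4 * (app Ll (unpack (Lk.getD j 0))).getD i 0 +
    (if i = j then fk.getD l 0 else 0) + (if i = k then fl.getD j 0 else 0) +
    (if i = l then fk.getD j 0 else 0)) % 5)],
   s.2 ++ [(List.range 8).map fun j => dotList fl (unpack (Lk.getD j 0)) % 5])

/-- The linearization solved for `(kl)w`, and `φ(kl, w) = φ(l, kw)`, determine the rows of a product
from those of its factors. The pairs append `ab, bc, ac, a(bc), b(ac)` as the entries `3` to `7`,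
and each factor is already in the table when it is used. -/
def tableOf (P : Code4) : List (List ℕ) × List (List ℕ) :=
  extendTable (extendTable (extendTable (extendTable (extendTable
    ((List.range 3).map (axisCode P),
      (List.range 3).map fun k => (formList P.1 P.2.1 P.2.2.1 P.2.2.2 k).map (· % 5)) 0 1) 1 2) 0 2)
    0 4) 1 5

/-- The product of the elements `i` and `j`. -/
def tmul (T : List (List ℕ)) (i j : ℕ) : List ℕ := unpack ((T.getD i []).getD j 0)

/-- Both sides are added in packed form and reduced only once: in the intended use the digits are at
most `3 * 128` on the left and `3 * 4` on the right, so there are no carries. -/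
def cubeCheck (T G : List (List ℕ)) (i j k : ℕ) : Bool :=
  unpack (dotList (tmul T i j) (T.getD k []) + dotList (tmul T j k) (T.getD i []) +
      dotList (tmul T k i) (T.getD j [])) ==
    unpack ((G.getD i []).getD j 0 * 1024 ^ k + (G.getD j []).getD k 0 * 1024 ^ i +
      (G.getD k []).getD i 0 * 1024 ^ j)

/-- Once product and form are symmetric, the cube identity is needed only for `k ≤ j ≤ i`. -/
def modelCheck (s : List (List ℕ) × List (List ℕ)) : Bool :=
  ((List.range 8).all fun i => (List.range i).all fun j =>
    ((s.1.getD i []).getD j 0 == (s.1.getD j []).getD i 0) &&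
    ((s.2.getD i []).getD j 0 == (s.2.getD j []).getD i 0)) &&
  (List.range 8).all fun i => (List.range (i + 1)).all fun j => (List.range (j + 1)).all fun k =>
    cubeCheck s.1 s.2 i j k

theorem exists_dotList {A : Type*} [AddCommGroup A] [Module (ZMod 5) A] {m : Fin 8 → A}
    {t : A →ₗ[ZMod 5] A} {M : List ℕ} (h : HasCode m t M) {v : List ℕ} (hv : IsDigits v) :
    ∃ f : Fin 8 → ℕ, (∀ i, f i ≤ 128) ∧ dotList v M = ∑ i, f i * 1024 ^ (i : ℕ) ∧
      t (vect m v) = ∑ i, (f i : ZMod 5) • m i := by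
  refine ⟨_, dot_digits_le hv M, dotList_eq_sum h.isCode hv, ?_⟩
  rw [h.map_vect hv, vect]
  refine Finset.sum_congr rfl fun i _ => ?_
  rw [app_getD h.isCode hv, ZMod.natCast_mod]

theorem cast_eq_of_unpack_eq {f g : Fin 8 → ℕ} (hf : ∀ i, f i < 1024) (hg : ∀ i, g i < 1024)
    (h : unpack (∑ i, f i * 1024 ^ (i : ℕ)) = unpack (∑ i, g i * 1024 ^ (i : ℕ))) (i : Fin 8) :
    (f i : ZMod 5) = g i := by
  rw [unpack_sum f hf, unpack_sum g hg] at h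
  rw [ZMod.natCast_eq_natCast_iff']
  exact congrFun (List.ofFn_injective h) i

theorem hasModel_of_modelCheck {T G : List (List ℕ)} (h : modelCheck (T, G) = true)
    (hT : ∀ i : Fin 8, IsCode (T.getD i [])) (hG : ∀ i j : Fin 8, (G.getD i []).getD j 0 < 5)
    (ht : ∀ p ∈ [(0, 0, 0), (1, 1, 1), (2, 2, 2), (0, 1, 3), (1, 2, 4), (0, 2, 5), (0, 4, 6),
      (1, 5, 7)], tmul T p.1 p.2.1 = unitVec p.2.2) (h00 : (G.getD 0 []).getD 0 0 = 1) :
    HasModel.{u} ((G.getD 0 []).getD 1 0 : ℕ) ((G.getD 1 []).getD 2 0 : ℕ)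
      ((G.getD 0 []).getD 2 0 : ℕ) ((G.getD 1 []).getD 5 0 : ℕ) := by
  -- The coordinate space is lifted to the universe over which universality quantifies.
  let bs : Module.Basis (Fin 8) (ZMod 5) (ULift.{u} (Fin 8 → ZMod 5)) :=
    (Pi.basisFun (ZMod 5) (Fin 8)).map ULift.moduleEquiv.symm
  let B := bs.constr (ZMod 5) fun i => bs.constr (ZMod 5) fun j => vect bs (tmul T i j)
  let φ : LinearMap.BilinForm (ZMod 5) (ULift.{u} (Fin 8 → ZMod 5)) :=
    bs.constr (ZMod 5) fun i => bs.constr (ZMod 5) fun j => (((G.getD i []).getD j 0 : ℕ) : ZMod 5)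
  have eB : ∀ i j, B (bs i) (bs j) = vect bs (tmul T i j) := fun i j => by
    simp only [B, Module.Basis.constr_basis]
  have eφ : ∀ i j, φ (bs i) (bs j) = (((G.getD i []).getD j 0 : ℕ) : ZMod 5) := fun i j => by
    simp only [φ, Module.Basis.constr_basis]
  have code : ∀ i, HasCode bs (B (bs i)) (T.getD i []) := fun i => ⟨hT i, eB i⟩
  simp only [modelCheck, Bool.and_eq_true, List.all_eq_true, List.mem_range, beq_iff_eq] at h
  obtain ⟨hs, hc⟩ := h
  have hB : ∀ i j, B (bs i) (bs j) = B (bs j) (bs i) := fun i j => by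
    rw [eB, eB, tmul, tmul]
    rcases lt_trichotomy i j with l | l | l
    · rw [(hs j j.2 i l).1]
    · rw [l]
    · rw [(hs i i.2 j l).1]
  have hφ : ∀ i j, φ (bs i) (bs j) = φ (bs j) (bs i) := fun i j => by
    rw [eφ, eφ]
    rcases lt_trichotomy i j with l | l | l
    · rw [(hs j j.2 i l).2]
    · rw [l]
    · rw [(hs i i.2 j l).2]
  have comm : ∀ x i, B x (bs i) = B (bs i) x := fun x i => by
    have : B.flip (bs i) = B (bs i) := bs.ext fun j => by rw [LinearMap.flip_apply, hB]
    rw [← this, LinearMap.flip_apply]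
  have key : ∀ i j k : Fin 8, j ≤ i → k ≤ j → B (B (bs i) (bs j)) (bs k) +
      B (B (bs j) (bs k)) (bs i) + B (B (bs k) (bs i)) (bs j) = φ (bs i) (bs j) • bs k +
        φ (bs j) (bs k) • bs i + φ (bs k) (bs i) • bs j := fun i j k l1 l2 => by
    have h := hc i i.2 j (Nat.lt_succ_of_le l1) k (Nat.lt_succ_of_le l2)
    rw [cubeCheck, beq_iff_eq] at h
    obtain ⟨f1, b1, d1, e1⟩ := exists_dotList (code k) (isDigits_unpack ((T.getD i []).getD j 0))
    obtain ⟨f2, b2, d2, e2⟩ := exists_dotList (code i) (isDigits_unpack ((T.getD j []).getD k 0))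
    obtain ⟨f3, b3, d3, e3⟩ := exists_dotList (code j) (isDigits_unpack ((T.getD k []).getD i 0))
    rw [comm (B (bs i) (bs j)) k, comm (B (bs j) (bs k)) i, comm (B (bs k) (bs i)) j, eB, eB, eB,
      eφ, eφ, eφ]
    simp only [tmul] at h ⊢
    rw [e1, e2, e3]
    rw [d1, d2, d3] at h
    have single : ∀ (l : Fin 8) (n : ℕ), n * 1024 ^ (l : ℕ) =
        ∑ i : Fin 8, (if i = l then n else 0) * 1024 ^ (i : ℕ) := fun l n => by simp
    have single' : ∀ (l : Fin 8) (n : ℕ), (n : ZMod 5) • bs l =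
        ∑ i : Fin 8, ((if i = l then n else 0 : ℕ) : ZMod 5) • bs i := fun l n => by
      simp [Nat.cast_ite]
    rw [single k, single i, single j, ← Finset.sum_add_distrib, ← Finset.sum_add_distrib,
      ← Finset.sum_add_distrib, ← Finset.sum_add_distrib] at h
    simp only [← add_mul] at h
    rw [single' k, single' i, single' j]
    simp only [← Finset.sum_add_distrib, ← add_smul, ← Nat.cast_add]
    refine Finset.sum_congr rfl fun l _ => congrArg (· • bs l) (cast_eq_of_unpack_eq ?_ ?_ h l)
    · intro i
      have := b1 i
      have := b2 i
      have := b3 i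
      omega
    · intro l
      have := hG i j
      have := hG j k
      have := hG k i
      split_ifs <;> omega
  have hc' : ∀ i j k : Fin 8, B (B (bs i) (bs j)) (bs k) +
      B (B (bs j) (bs k)) (bs i) + B (B (bs k) (bs i)) (bs j) = φ (bs i) (bs j) • bs k +
        φ (bs j) (bs k) • bs i + φ (bs k) (bs i) • bs j := fun i j k => by
    -- A transposition and a three-cycle of the indices generate all permutations of them, so the
    -- ordered case suffices.
    have sw : ∀ i j k : Fin 8, B (B (bs i) (bs j)) (bs k) +
      B (B (bs j) (bs k)) (bs i) + B (B (bs k) (bs i)) (bs j) = φ (bs i) (bs j) • bs k +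
        φ (bs j) (bs k) • bs i + φ (bs k) (bs i) • bs j → B (B (bs j) (bs i)) (bs k) +
      B (B (bs i) (bs k)) (bs j) + B (B (bs k) (bs j)) (bs i) = φ (bs j) (bs i) • bs k +
        φ (bs i) (bs k) • bs j + φ (bs k) (bs j) • bs i := fun i j k h => by
      rw [hB j i, hB i k, hB k j, hφ j i, hφ i k, hφ k j, add_right_comm, h, add_right_comm]
    have cy : ∀ i j k : Fin 8, B (B (bs i) (bs j)) (bs k) +
      B (B (bs j) (bs k)) (bs i) + B (B (bs k) (bs i)) (bs j) = φ (bs i) (bs j) • bs k +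
        φ (bs j) (bs k) • bs i + φ (bs k) (bs i) • bs j → B (B (bs j) (bs k)) (bs i) +
      B (B (bs k) (bs i)) (bs j) + B (B (bs i) (bs j)) (bs k) = φ (bs j) (bs k) • bs i +
        φ (bs k) (bs i) • bs j + φ (bs i) (bs j) • bs k := fun i j k h => by
      rw [add_comm _ (B (B (bs i) (bs j)) (bs k)), ← add_assoc, h]; abel
    rcases le_total i j with l | l <;> rcases le_total j k with l' | l' <;>
      rcases le_total i k with l'' | l''
    · exact sw _ _ _ (cy _ _ _ (key k j i l' l))
    · exact sw _ _ _ (cy _ _ _ (key k j i l' l))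
    · exact cy _ _ _ (cy _ _ _ (key j k i l' l'')) |> cy _ _ _ |> cy _ _ _ |> cy _ _ _
    · exact sw _ _ _ (key j i k l l'')
    · exact cy _ _ _ (key k i j l'' l)
    · exact sw _ _ _ (cy _ _ _ (cy _ _ _ (key i k j l'' l')))
    · exact key i j k l l'
    · exact key i j k l l'
  have ht' : ∀ p ∈ [(0, 0, 0), (1, 1, 1), (2, 2, 2), (0, 1, 3), (1, 2, 4), (0, 2, 5), (0, 4, 6),
      ((1, 5, 7) : Fin 8 × Fin 8 × Fin 8)], B (bs p.1) (bs p.2.1) = bs p.2.2 := fun p hp => by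
    rw [eB, ← vect_unitVec (m := bs) p.2.2]
    congr 1
    exact ht (p.1, p.2.1, p.2.2) (by simp at hp; rcases hp with rfl | rfl | rfl | rfl | rfl | rfl | rfl | rfl <;> simp)
  have := hasModel_of_basis bs B φ hB hφ hc' (ht' (0, 0, 0) (by simp)) (ht' (1, 1, 1) (by simp))
    (ht' (2, 2, 2) (by simp)) (ht' (0, 1, 3) (by simp)) (ht' (1, 2, 4) (by simp))
    (ht' (0, 2, 5) (by simp)) (ht' (0, 4, 6) (by simp)) (ht' (1, 5, 7) (by simp))
    (by rw [eφ]; exact (congrArg Nat.cast h00).trans Nat.cast_one)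
  rw [eφ, eφ, eφ, eφ] at this
  exact this

/-- All the conditions under which the multiplication table for the parameters `P` gives a model. -/
def tableCheck (P : Code4) : Bool :=
  let s := tableOf P
  modelCheck s && ((List.range 8).all fun i => decide (IsCode (s.1.getD i [])) &&
    (List.range 8).all fun j => Nat.blt ((s.2.getD i []).getD j 0) 5) &&
  ([(0, 0, 0), (1, 1, 1), (2, 2, 2), (0, 1, 3), (1, 2, 4), (0, 2, 5), (0, 4, 6), (1, 5, 7)].all
    fun p => tmul s.1 p.1 p.2.1 == unitVec p.2.2) &&
  [(0, 0, 1), (0, 1, P.1), (1, 2, P.2.1), (0, 2, P.2.2.1), (1, 5, P.2.2.2)].all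
    fun p => (s.2.getD p.1 []).getD p.2.1 0 == p.2.2

theorem hasModel_of_tableCheck {P : Code4} (h : tableCheck P = true) :
    HasModel.{u} P.1 P.2.1 P.2.2.1 P.2.2.2 := by
  simp only [tableCheck, Bool.and_eq_true, List.all_eq_true, List.mem_range, beq_iff_eq,
    Nat.blt_eq, decide_eq_true_eq] at h
  obtain ⟨⟨⟨h1, h2⟩, h3⟩, h4⟩ := h
  have := hasModel_of_modelCheck.{u} (T := (tableOf P).1) (G := (tableOf P).2) h1
    (fun i => (h2 i i.2).1) (fun i j => (h2 i i.2).2 j j.2) h3 (h4 (0, 0, 1) (by simp))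
  rwa [h4 (0, 1, P.1) (by simp), h4 (1, 2, P.2.1) (by simp), h4 (0, 2, P.2.2.1) (by simp),
    h4 (1, 5, P.2.2.2) (by simp)] at this

theorem tableCheck_reps : ∀ P ∈ listedReps ++ solvableReps, tableCheck P = true := by
  decide +kernel

theorem hasModel (α β γ ψ : ZMod 5) : HasModel.{u} α β γ ψ := by
  obtain ⟨Q, hQ, r, -⟩ := exists_rep.{u} α β γ ψ
  have := r (hasModel_of_tableCheck (tableCheck_reps Q hQ))
  simpa using this

end ModelCheck

/-! ### Words in the three involutions. -/

section Words

set_option linter.unusedSectionVars false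

/-- The product of the involutions of `a, b, c` along a word. -/
noncomputable def word {A : Type*} [NonUnitalNonAssocCommRing A] [Module (ZMod 5) A]
    [IsScalarTower (ZMod 5) A A] [SMulCommClass (ZMod 5) A A] (a b c : A) (w : List (Fin 3)) :
    A ≃ₗ[ZMod 5] A := (w.map (axisInvolution a b c)).prod

/-- The code of the identity. -/
def oneCode : List ℕ := (List.range 8).map fun i => 1024 ^ i

/-- The matrix of a word. -/
def wordCode (P : Code4) (w : List (Fin 3)) : List ℕ :=
  w.foldr (fun k M => mulCode (tauCode P k) M) oneCode

/-- The image of a vector under a word. -/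
def appWord (P : Code4) (w : List (Fin 3)) (v : List ℕ) : List ℕ :=
  w.foldr (fun k v => app (tauCode P k) v) v

variable {A : Type*} [NonUnitalNonAssocCommRing A] [Module (ZMod 5) A]
  [IsScalarTower (ZMod 5) A A] [SMulCommClass (ZMod 5) A A]
  {φ : LinearMap.BilinForm (ZMod 5) A} {a b c : A} {P : Code4}

theorem word_append (a b c : A) (w w' : List (Fin 3)) :
    word a b c (w ++ w') = word a b c w * word a b c w' := by
  simp [word]

theorem word_cons (a b c : A) (k : Fin 3) (w : List (Fin 3)) :
    word a b c (k :: w) = axisInvolution a b c k * word a b c w := by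
  simp [word]

theorem word_mem (a b c : A) (w : List (Fin 3)) :
    word a b c w ∈ miyamotoGroup (ZMod 5) a b c :=
  list_prod_mem fun t ht => by
    obtain ⟨k, -, rfl⟩ := List.mem_map.1 ht
    exact axisInvolution_mem a b c k

theorem IsTriple.axisInvolution_mul_self (h : IsTriple φ a b c P) (k : Fin 3) :
    axisInvolution a b c k * axisInvolution a b c k = 1 := by
  ext x
  exact h.gen.pseudoComposition.miyamoto_miyamoto (h.gen.areAxes.idem k) (h.gen.areAxes.ne_zero k) x

theorem IsTriple.word_reverse (h : IsTriple φ a b c P) (w : List (Fin 3)) :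
    word a b c w.reverse = (word a b c w)⁻¹ := by
  induction w with
  | nil => simp [word]
  | cons k w ih =>
    rw [List.reverse_cons, word_append, ih, word_cons, word_cons, mul_inv_rev,
      show word a b c [] = 1 from rfl, mul_one]
    congr 1
    exact (inv_eq_of_mul_eq_one_left (h.axisInvolution_mul_self k)).symm

theorem hasCode_one (m : Fin 8 → A) : HasCode m LinearMap.id oneCode := by
  refine ⟨by decide +kernel, fun j => ?_⟩
  have : ∀ j : Fin 8, unpack (oneCode.getD j 0) = unitVec j := by decide +kernel
  rw [this, vect_unitVec, LinearMap.id_apply]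

theorem IsTriple.hasCode_word (h : IsTriple φ a b c P) (w : List (Fin 3)) :
    HasCode (monomials a b c) (word a b c w).toLinearMap (wordCode P w) := by
  induction w with
  | nil => exact hasCode_one _
  | cons k w ih =>
    rw [word_cons]
    exact (h.hasCode_tau k).mul ih

theorem IsTriple.word_vect (h : IsTriple φ a b c P) (w : List (Fin 3)) {v : List ℕ}
    (hv : IsDigits v) : IsDigits (appWord P w v) ∧
      word a b c w (vect (monomials a b c) v) = vect (monomials a b c) (appWord P w v) := by
  induction w with
  | nil => exact ⟨hv, rfl⟩
  | cons k w ih =>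
    refine ⟨isDigits_app _ _, ?_⟩
    rw [word_cons, LinearEquiv.mul_apply, ih.2]
    exact (h.hasCode_tau k).map_vect ih.1

theorem IsTriple.span (h : IsTriple φ a b c P) :
    Submodule.span (ZMod 5) (Set.range (monomials a b c)) = ⊤ := h.gen.span_monomials h.par

theorem axis_eq_vect (a b c : A) (k : Fin 3) :
    ![a, b, c] k = vect (monomials a b c) (unitVec k) := by
  have := vect_unitVec (m := monomials a b c) (Fin.castLE (by norm_num) k)
  rw [Fin.val_castLE] at this
  rw [this]
  fin_cases k <;> rfl

/-- The value of the form on one of `a, b, c` and a vector. -/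
def formVal (P : Code4) (k : Fin 3) (v : List ℕ) : ℕ :=
  dotList (formList P.1 P.2.1 P.2.2.1 P.2.2.2 k) v

theorem IsTriple.form_vect (h : IsTriple φ a b c P) (k : Fin 3) {v : List ℕ} (hv : IsDigits v) :
    φ (![a, b, c] k) (vect (monomials a b c) v) = (formVal P k v : ZMod 5) := by
  have hl : (formList P.1 P.2.1 P.2.2.1 P.2.2.2 k).length = 8 := by
    fin_cases k <;> rfl
  rw [formVal, dotList_eq 8 _ _ hl hv.1, vect, map_sum, Nat.cast_sum]
  refine Finset.sum_congr rfl fun i _ => ?_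
  rw [map_smul, h.form_eq, smul_eq_mul, mul_comm, Nat.cast_mul]

/-- Three conjugates of the axes: one of `a, b, c`, and two images of these under words. -/
structure TripleWords where
  i : Fin 3
  j : Fin 3
  k : Fin 3
  v : List (Fin 3)
  w : List (Fin 3)

namespace TripleWords

/-- The words which take an axis to one of the three conjugates. -/
def conj (s : TripleWords) : Fin 3 → List (Fin 3) := ![[], s.v, s.w]

/-- The axes of which the conjugates are taken. -/
def axis (s : TripleWords) : Fin 3 → Fin 3 := ![s.i, s.j, s.k]

/-- The word for the involution of one of the three conjugates. -/
def inv (s : TripleWords) (r : Fin 3) : List (Fin 3) :=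
  s.conj r ++ s.axis r :: (s.conj r).reverse

/-- The coordinates of the three conjugates. -/
def vec (P : Code4) (s : TripleWords) (r : Fin 3) : List ℕ :=
  appWord P (s.conj r) (unitVec (s.axis r))

/-- The parameters of the three conjugates. -/
def params (P : Code4) (s : TripleWords) : Code4 :=
  (formVal P s.i (s.vec P 1) % 5, formVal P s.j (appWord P s.v.reverse (s.vec P 2)) % 5,
    formVal P s.i (s.vec P 2) % 5,
    formVal P s.j (appWord P s.v.reverse (app (axisCode P s.i) (s.vec P 2))) % 5)

end TripleWords

theorem vec_three_eta {α : Type*} (x : Fin 3 → α) : ![x 0, x 1, x 2] = x := by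
  funext r
  fin_cases r <;> rfl

/-- Three conjugates of `a, b, c` have the parameters `Q`, if `a, b, c` are in turn conjugates of
them. -/
theorem leads_of_words {P Q : Code4} (s : TripleWords) (u : Fin 3 → List (Fin 3) × Fin 3)
    (hp : s.params P = Q)
    (hu : ∀ r, appWord P ((u r).1.flatMap s.inv) (s.vec P (u r).2) = unitVec r) :
    Leads.{u} P.1 P.2.1 P.2.2.1 P.2.2.2 Q.1 Q.2.1 Q.2.2.1 Q.2.2.2 := by
  intro A _ _ _ _ φ a b c hg hpar _
  have h : IsTriple φ a b c P := ⟨hg, hpar⟩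
  have hφ := h.gen.pseudoComposition
  have ax := h.gen.areAxes
  obtain ⟨x, hx⟩ : ∃ x : Fin 3 → A, ∀ r, x r = word a b c (s.conj r) (![a, b, c] (s.axis r)) :=
    ⟨_, fun _ => rfl⟩
  have hv : ∀ r, IsDigits (s.vec P r) ∧ x r = vect (monomials a b c) (s.vec P r) := fun r => by
    have := h.word_vect (s.conj r) (isDigits_unitVec (s.axis r))
    rw [← axis_eq_vect, ← hx] at this
    exact this
  have ex := vec_three_eta x
  -- The involution of a conjugate is the conjugated involution, and a word is inverted by reversing
  -- it.
  have tau : ∀ r, axisInvolution (x 0) (x 1) (x 2) r = word a b c (s.inv r) := fun r => by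
    have ht := hφ.isAutomorphism ax (word_mem a b c (s.conj r))
    rw [axisInvolution, ex, hx, hφ.miyamoto_map (ax.idem _) (ax.ne_zero _) _ ht.1 ht.2,
      TripleWords.inv, word_append, word_cons, h.word_reverse, mul_assoc, axisInvolution]
  have tauw : ∀ w : List (Fin 3), word (x 0) (x 1) (x 2) w = word a b c (w.flatMap s.inv) := by
    intro w
    induction w with
    | nil => simp [word]
    | cons k w ih => rw [word_cons, ih, tau, List.flatMap_cons, word_append]
  refine ⟨x 0, x 1, x 2, fun r => ⟨_, word_mem a b c (s.conj r), s.axis r, by rw [ex, hx]⟩,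
    fun r => ⟨_, word_mem (x 0) (x 1) (x 2) (u r).1, (u r).2, ?_⟩, ?_⟩
  · rw [tauw, ex, (hv _).2, (h.word_vect _ (hv _).1).2, hu, axis_eq_vect]
  · have x0 : x 0 = ![a, b, c] s.i := by
      rw [hx]
      simp [TripleWords.conj, TripleWords.axis, word]
    have f1 : ∀ r, φ (x 0) (x r) = (formVal P s.i (s.vec P r) : ZMod 5) := fun r => by
      rw [x0, (hv r).2, h.form_vect _ (hv r).1]
    -- The second conjugate is pulled back to its axis by an isometry, so that only the known values
    -- of the form on `a, b, c` are needed.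
    have f2 : ∀ {v : List ℕ}, IsDigits v → φ (x 1) (vect (monomials a b c) v) =
        (formVal P s.j (appWord P s.v.reverse v) : ZMod 5) := fun {v} hd => by
      have ht := hφ.isAutomorphism ax (word_mem a b c s.v.reverse)
      have e : word a b c s.v.reverse (x 1) = ![a, b, c] s.j := by
        rw [h.word_reverse, hx]
        exact (word a b c s.v).symm_apply_apply _
      rw [← ht.2, e, (h.word_vect _ hd).2, h.form_vect _ (h.word_vect _ hd).1]
    have e3 : x 0 * x 2 = vect (monomials a b c) (app (axisCode P s.i) (s.vec P 2)) := by
      rw [(hv 2).2, x0]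
      exact (h.hasCode_mul s.i).map_vect (hv 2).1
    obtain ⟨q1, q2, q3, q4⟩ := Q
    rw [TripleWords.params] at hp
    simp only [Prod.mk.injEq] at hp
    obtain ⟨p1, p2, p3, p4⟩ := hp
    refine ⟨?_, ?_, ?_, ?_⟩
    · rw [f1, ← p1, ZMod.natCast_mod]
    · rw [(hv 2).2, f2 (hv 2).1, ← p2, ZMod.natCast_mod]
    · rw [f1, ← p3, ZMod.natCast_mod]
    · rw [e3, f2 (isDigits_app _ _), ← p4, ZMod.natCast_mod]

end Words

/-! ### Further identifications among the representatives. -/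

section Links

/-- All the properties of the group `T` and the rank for the parameters `Q` hold for `P`. -/
def Linked (P Q : Code4) : Prop :=
  ∀ R : (G : Type u) → [Group G] → ℕ → Prop,
    Holds R Q.1 Q.2.1 Q.2.2.1 Q.2.2.2 → Holds R P.1 P.2.1 P.2.2.1 P.2.2.2

theorem Linked.refl (P : Code4) : Linked.{u} P P := fun _ => id

theorem Linked.trans {P Q S : Code4} (h : Linked.{u} P Q) (h' : Linked.{u} Q S) :
    Linked.{u} P S := fun R hR => h R (h' R hR)

theorem linked_of_words {P Q : Code4} (s : TripleWords) (u : Fin 3 → List (Fin 3) × Fin 3)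
    (hp : follow 18 (s.params P) = Q)
    (hu : ∀ r, appWord P ((u r).1.flatMap s.inv) (s.vec P (u r).2) = unitVec r) :
    Linked.{u} P Q := fun R hR => by
  refine (leads_of_words s u rfl hu).holds ((reduces_follow 18 (s.params P)).2 R ?_)
  rw [hp]
  exact hR

/-- In this and the following certificates the first datum describes three conjugate idempotents.
The second one recovers `a, b, c`: each of them is the image of a new idempotent under a word in the
new involutions. The new parameters are finally brought to a representative by `follow`. -/
theorem linked_0013_0004 : Linked.{u} (0, 0, 1, 3) (0, 0, 0, 4) :=
  linked_of_words ⟨0, 1, 0, [], [2]⟩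
    ![([], 0), ([], 1), ([0, 2], 0)] (by decide +kernel)
    (by decide +kernel)

theorem linked_0030_0004 : Linked.{u} (0, 0, 3, 0) (0, 0, 0, 4) :=
  linked_of_words ⟨0, 1, 1, [], [2]⟩
    ![([], 0), ([], 1), ([1, 0, 2, 1, 0, 2, 1, 0, 2, 1], 0)] (by decide +kernel)
    (by decide +kernel)

theorem linked_0114_0030 : Linked.{u} (0, 1, 1, 4) (0, 0, 3, 0) :=
  linked_of_words ⟨0, 2, 2, [], [1]⟩
    ![([], 0), ([1, 2], 1), ([], 1)] (by decide +kernel)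
    (by decide +kernel)

theorem linked_0000_0030 : Linked.{u} (0, 0, 0, 0) (0, 0, 3, 0) :=
  linked_of_words ⟨0, 2, 2, [], [1]⟩
    ![([], 0), ([0, 1, 2, 0, 1, 2, 0, 1, 2, 0], 1), ([], 1)] (by decide +kernel)
    (by decide +kernel)

theorem linked_0120_0003 : Linked.{u} (0, 1, 2, 0) (0, 0, 0, 3) :=
  linked_of_words ⟨0, 2, 2, [], [1]⟩
    ![([], 0), ([1, 2], 1), ([], 1)] (by decide +kernel)
    (by decide +kernel)

theorem linked_0340_0003 : Linked.{u} (0, 3, 4, 0) (0, 0, 0, 3) :=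
  linked_of_words ⟨0, 2, 0, [], [2, 1]⟩
    ![([], 0), ([0, 2, 0, 2, 0, 2, 1, 2, 1, 0, 2], 0), ([], 1)] (by decide +kernel)
    (by decide +kernel)

theorem linked_0001_0340 : Linked.{u} (0, 0, 0, 1) (0, 3, 4, 0) :=
  linked_of_words ⟨0, 2, 2, [], [1]⟩
    ![([], 0), ([0, 1, 2, 0, 1, 0, 2, 0], 2), ([], 1)] (by decide +kernel)
    (by decide +kernel)

theorem linked_0230_0001 : Linked.{u} (0, 2, 3, 0) (0, 0, 0, 1) :=
  linked_of_words ⟨1, 2, 1, [], [0]⟩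
    ![([0, 1, 2, 0, 1, 2, 0], 1), ([], 0), ([], 1)] (by decide +kernel)
    (by decide +kernel)

theorem linked_0021_0230 : Linked.{u} (0, 0, 2, 1) (0, 2, 3, 0) :=
  linked_of_words ⟨1, 2, 0, [], [0, 2]⟩
    ![([1, 2, 1], 2), ([], 0), ([], 1)] (by decide +kernel)
    (by decide +kernel)

theorem linked_0040_0021 : Linked.{u} (0, 0, 4, 0) (0, 0, 2, 1) :=
  linked_of_words ⟨0, 2, 2, [], [1]⟩
    ![([], 0), ([0, 2, 1, 0, 1, 2, 1, 0, 2, 0], 2), ([], 1)] (by decide +kernel)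
    (by decide +kernel)

theorem linked_0041_0040 : Linked.{u} (0, 0, 4, 1) (0, 0, 4, 0) :=
  linked_of_words ⟨0, 1, 1, [], [2]⟩
    ![([], 0), ([], 1), ([0, 1, 0, 1, 2, 0, 1, 0, 1, 2], 0)] (by decide +kernel)
    (by decide +kernel)

theorem linked_0014_0130 : Linked.{u} (0, 0, 1, 4) (0, 1, 3, 0) :=
  linked_of_words ⟨0, 1, 0, [], [2]⟩
    ![([], 0), ([], 1), ([0, 2], 0)] (by decide +kernel)
    (by decide +kernel)

theorem linked_1134_3340 : Linked.{u} (1, 1, 3, 4) (3, 3, 4, 0) :=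
  linked_of_words ⟨0, 2, 2, [], [1]⟩
    ![([], 0), ([1, 2], 1), ([], 1)] (by decide +kernel)
    (by decide +kernel)

theorem linked_0023_0240 : Linked.{u} (0, 0, 2, 3) (0, 2, 4, 0) :=
  linked_of_words ⟨1, 2, 0, [], [0, 2]⟩
    ![([1, 2, 1], 2), ([], 0), ([], 1)] (by decide +kernel)
    (by decide +kernel)

theorem linked_0140_0020 : Linked.{u} (0, 1, 4, 0) (0, 0, 2, 0) :=
  linked_of_words ⟨0, 2, 2, [], [1]⟩
    ![([], 0), ([1, 2], 1), ([], 1)] (by decide +kernel)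
    (by decide +kernel)

theorem linked_0032_0140 : Linked.{u} (0, 0, 3, 2) (0, 1, 4, 0) :=
  linked_of_words ⟨0, 1, 1, [], [0, 2]⟩
    ![([], 0), ([], 1), ([0, 2, 1, 2, 1, 0, 1, 2, 1, 0, 1, 2, 1, 2], 0)] (by decide +kernel)
    (by decide +kernel)

theorem linked_1112_1123 : Linked.{u} (1, 1, 1, 2) (1, 1, 2, 3) :=
  linked_of_words ⟨0, 2, 2, [], [1]⟩
    ![([], 0), ([1, 2], 1), ([], 1)] (by decide +kernel)
    (by decide +kernel)

/-- Representatives of the parameters for the eight groups of the list. -/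
def Listed.params : Listed → Code4
  | .e5A5 => (1, 1, 2, 3)
  | .e5S5 => (0, 0, 2, 0)
  | .iterated => (0, 2, 4, 0)
  | .psl27 => (4, 4, 4, 0)
  | .psl35 => (0, 0, 0, 3)
  | .psu35 => (0, 0, 0, 4)
  | .a6 => (3, 3, 4, 0)
  | .a7 => (0, 1, 3, 0)

theorem exists_linked : ∀ P ∈ listedReps, ∃ L : Listed, Linked.{u} P L.params := by
  have h1 := linked_0340_0003.{u}
  have h2 := linked_0001_0340.{u}.trans h1
  have h3 := linked_0230_0001.trans h2
  have h4 := linked_0021_0230.trans h3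
  have h5 := linked_0040_0021.trans h4
  simp only [listedReps, List.forall_mem_cons]
  exact ⟨⟨.psu35, linked_0000_0030.trans linked_0030_0004⟩, ⟨.psu35, .refl _⟩,
    ⟨.psu35, linked_0013_0004⟩, ⟨.psu35, linked_0030_0004⟩,
    ⟨.psu35, linked_0114_0030.trans linked_0030_0004⟩, ⟨.psl35, h2⟩, ⟨.psl35, .refl _⟩,
    ⟨.psl35, h4⟩, ⟨.psl35, h5⟩, ⟨.psl35, linked_0041_0040.trans h5⟩, ⟨.psl35, linked_0120_0003⟩,
    ⟨.psl35, h3⟩, ⟨.psl35, h1⟩, ⟨.a7, linked_0014_0130⟩, ⟨.a7, .refl _⟩, ⟨.a6, linked_1134_3340⟩,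
    ⟨.a6, .refl _⟩, ⟨.psl27, .refl _⟩, ⟨.iterated, linked_0023_0240⟩, ⟨.iterated, .refl _⟩,
    ⟨.e5S5, .refl _⟩, ⟨.e5S5, linked_0032_0140.trans linked_0140_0020⟩, ⟨.e5S5, linked_0140_0020⟩,
    ⟨.e5A5, linked_1112_1123⟩, ⟨.e5A5, .refl _⟩, by simp⟩

end Links

/-! ### Solvability from a chain of normalizing generators. -/

section Solvable

/-- The subgroup generated by a solvable subgroup and an element which normalizes it is solvable. -/
theorem isSolvable_closure_insert {G : Type*} [Group G] [Finite G] {s : Set G} {x : G}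
    (hs : Group.IsSolvable (Subgroup.closure s))
    (hx : ∀ y ∈ s, x * y * x⁻¹ ∈ Subgroup.closure s) :
    Group.IsSolvable (Subgroup.closure (insert x s)) := by
  set K := Subgroup.closure s with hK
  set H := Subgroup.closure (insert x s) with hH
  have hKH : K ≤ H := Subgroup.closure_mono (Set.subset_insert x s)
  have hxH : x ∈ H := Subgroup.subset_closure (Set.mem_insert x s)
  have hxK : x ∈ Subgroup.normalizer (K : Set G) := by
    have h1 : K.map (MulAut.conj x).toMonoidHom ≤ K := by
      rw [Subgroup.map_le_iff_le_comap, hK, Subgroup.closure_le]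
      intro y hy
      exact hx y hy
    -- By finiteness, conjugation by `x` maps `K` onto `K` as soon as it maps `K` into `K`.
    have h2 : K.map (MulAut.conj x).toMonoidHom = K :=
      Subgroup.eq_of_le_of_card_ge h1
        (Nat.card_congr (K.equivMapOfInjective _ (MulAut.conj x).injective).toEquiv).le
    rw [Subgroup.mem_normalizer_iff]
    intro y
    constructor
    · intro hy
      exact h1 ⟨y, hy, rfl⟩
    · intro hy
      rw [← h2] at hy
      obtain ⟨z, hz, e⟩ := hy
      have : z = y := by simpa using e
      rwa [← this]
  have hHN : H ≤ Subgroup.normalizer (K : Set G) := by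
    rw [hH, Subgroup.closure_le]
    rintro y (rfl | hy)
    · exact hxK
    · exact Subgroup.le_normalizer (Subgroup.subset_closure hy)
  have normal : (K.subgroupOf H).Normal := Subgroup.normal_subgroupOf_iff_le_normalizer hKH |>.2 hHN
  -- The quotient of `H` by `K` is cyclic, generated by the class of `x`.
  have top : ∀ q : H ⧸ K.subgroupOf H, q ∈ Subgroup.zpowers
      (QuotientGroup.mk' (K.subgroupOf H) ⟨x, hxH⟩) := by
    intro q
    obtain ⟨⟨y, hy⟩, rfl⟩ := QuotientGroup.mk'_surjective _ q
    induction hy using Subgroup.closure_induction with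
    | mem y hy =>
      rcases hy with rfl | hy
      · exact Subgroup.mem_zpowers _
      · have : QuotientGroup.mk' (K.subgroupOf H) ⟨y, hKH (Subgroup.subset_closure hy)⟩ = 1 :=
          (QuotientGroup.eq_one_iff _).2 (Subgroup.subset_closure hy)
        rw [this]
        exact one_mem _
    | one => exact one_mem _
    | mul y z hy hz h1 h2 => exact mul_mem h1 h2
    | inv y hy h => exact inv_mem h
  have solQ : Group.IsSolvable (H ⧸ K.subgroupOf H) := Group.isSolvable_of_comm fun p q => by
    obtain ⟨i, rfl⟩ := top p
    obtain ⟨j, rfl⟩ := top q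
    exact (Commute.refl _).zpow_zpow i j
  exact Group.isSolvable_of_ker_le_range (Subgroup.inclusion hKH) (QuotientGroup.mk' (K.subgroupOf H))
    (by
      rw [QuotientGroup.ker_mk']
      exact fun y hy => ⟨⟨y, hy⟩, rfl⟩)

theorem isSolvable_of_chain {G : Type*} [Group G] [Finite G] (x : ℕ → G) (n : ℕ)
    (h : ∀ j < n, ∀ i < j, x j * x i * (x j)⁻¹ ∈ Subgroup.closure (x '' Set.Iio j)) :
    Group.IsSolvable (Subgroup.closure (x '' Set.Iio n)) := by
  induction n with
  | zero =>
    have : Subgroup.closure (x '' Set.Iio 0) = ⊥ := by simp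
    rw [this]
    infer_instance
  | succ n ih =>
    have e : x '' Set.Iio (n + 1) = insert (x n) (x '' Set.Iio n) := by
      rw [← Set.image_insert_eq]
      congr 1
      ext i
      simp only [Set.mem_Iio, Set.mem_insert_iff]
      omega
    rw [e]
    refine isSolvable_closure_insert (ih fun j hj => h j (by omega)) ?_
    rintro _ ⟨i, hi, rfl⟩
    exact h n (by omega) i hi

end Solvable

/-! ### Polycyclic certificates for the solvable cases. -/

section Certificates

variable {A : Type*} [NonUnitalNonAssocCommRing A] [Module (ZMod 5) A]
  [IsScalarTower (ZMod 5) A A] [SMulCommClass (ZMod 5) A A]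
  {φ : LinearMap.BilinForm (ZMod 5) A} {a b c : A} {P : Code4}

/-- Elements of `T` are algebra automorphisms and `a, b, c` generate the algebra, so an equality in
`T` is an equality of three vectors. The comparison of words by `agree` rests on this. -/
theorem IsTriple.ext_axes (h : IsTriple φ a b c P) {s t : A ≃ₗ[ZMod 5] A}
    (hs : s ∈ miyamotoGroup (ZMod 5) a b c) (ht : t ∈ miyamotoGroup (ZMod 5) a b c)
    (e : ∀ k, s (![a, b, c] k) = t (![a, b, c] k)) : s = t := by
  have ms := (h.gen.pseudoComposition.isAutomorphism h.gen.areAxes hs).1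
  have mt := (h.gen.pseudoComposition.isAutomorphism h.gen.areAxes ht).1
  have e0 : s a = t a := e 0
  have e1 : s b = t b := e 1
  have e2 : s c = t c := e 2
  refine LinearEquiv.toLinearMap_injective (LinearMap.ext_on h.span ?_)
  rintro _ ⟨j, rfl⟩
  fin_cases j <;> simp [monomials, ms, mt, e0, e1, e2]

theorem IsTriple.finite (h : IsTriple φ a b c P) : Finite (A ≃ₗ[ZMod 5] A) := by
  have : Module.Finite (ZMod 5) A :=
    ⟨Submodule.fg_def.2 ⟨_, Set.finite_range (monomials a b c), h.span⟩⟩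
  have : Finite A := Module.finite_of_finite (ZMod 5)
  exact Finite.of_injective (fun t : A ≃ₗ[ZMod 5] A => (t : A → A)) DFunLike.coe_injective

/-- The image of a vector under a product of the matrices in a list. -/
def appList (C : List (List ℕ)) (w : List ℕ) (v : List ℕ) : List ℕ :=
  w.foldr (fun i v => app (C.getD i oneCode) v) v

/-- The product of words in a list. -/
noncomputable def wordList (a b c : A) (xs : List (List (Fin 3))) (w : List ℕ) : A ≃ₗ[ZMod 5] A :=
  (w.map fun i => word a b c (xs.getD i [])).prod

theorem wordList_append (xs : List (List (Fin 3))) (w w' : List ℕ) :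
    wordList a b c xs (w ++ w') = wordList a b c xs w * wordList a b c xs w' := by
  simp [wordList]

theorem wordList_mem (xs : List (List (Fin 3))) (w : List ℕ) :
    wordList a b c xs w ∈ miyamotoGroup (ZMod 5) a b c :=
  list_prod_mem fun t ht => by
    obtain ⟨i, -, rfl⟩ := List.mem_map.1 ht
    exact word_mem a b c _

theorem IsTriple.wordList_vect (h : IsTriple φ a b c P) (xs : List (List (Fin 3))) (w : List ℕ)
    {v : List ℕ} (hv : IsDigits v) : IsDigits (appList (xs.map (wordCode P)) w v) ∧
      wordList a b c xs w (vect (monomials a b c) v) =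
        vect (monomials a b c) (appList (xs.map (wordCode P)) w v) := by
  induction w with
  | nil => exact ⟨hv, by simp [wordList, appList]⟩
  | cons i w ih =>
    refine ⟨isDigits_app _ _, ?_⟩
    have e : (xs.map (wordCode P)).getD i oneCode = wordCode P (xs.getD i []) :=
      List.getD_map xs [] (wordCode P)
    have e2 : wordList a b c xs (i :: w) = word a b c (xs.getD i []) * wordList a b c xs w := by
      simp [wordList]
    have e3 : appList (xs.map (wordCode P)) (i :: w) v =
        app (wordCode P (xs.getD i [])) (appList (xs.map (wordCode P)) w v) := by
      rw [← e]
      simp [appList]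
    rw [e2, e3, LinearEquiv.mul_apply, ih.2]
    exact (h.hasCode_word _).map_vect ih.1

/-- The two products of words in a list agree on `a, b, c`. -/
def agree (C : List (List ℕ)) (w w' : List ℕ) : Bool :=
  (List.range 3).all fun k => appList C w (unitVec k) == appList C w' (unitVec k)

theorem IsTriple.wordList_eq (h : IsTriple φ a b c P) {xs : List (List (Fin 3))} {w w' : List ℕ}
    (e : agree (xs.map (wordCode P)) w w' = true) :
    wordList a b c xs w = wordList a b c xs w' := by
  refine h.ext_axes (wordList_mem xs w) (wordList_mem xs w') fun k => ?_
  simp only [agree, List.all_eq_true, List.mem_range, beq_iff_eq] at e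
  rw [axis_eq_vect, (h.wordList_vect xs w (isDigits_unitVec k)).2,
    (h.wordList_vect xs w' (isDigits_unitVec k)).2, e k k.2]

/-- The words in `xs` form a polycyclic series of a group which contains the words in `ts`. -/
def polycyclicCheck (C : List (List ℕ)) (n : ℕ) (rel : List (List (List ℕ)))
    (ts : List (List ℕ)) : Bool :=
  ((List.range n).all fun j => (List.range j).all fun i =>
    ((rel.getD j []).getD i []).all (Nat.blt · j) &&
      agree C ((rel.getD j []).getD i [] ++ [j]) [j, i]) &&
  (List.range 3).all fun k => (ts.getD k []).all (Nat.blt · n) && agree C (ts.getD k []) [n + k]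

theorem IsTriple.isSolvable (h : IsTriple φ a b c P) (xs : List (List (Fin 3)))
    (rel : List (List (List ℕ))) (ts : List (List ℕ))
    (e : polycyclicCheck ((xs ++ [[0], [1], [2]]).map (wordCode P)) xs.length rel ts = true) :
    Group.IsSolvable (miyamotoGroup (ZMod 5) a b c) := by
  have := h.finite
  set ys := xs ++ [[0], [1], [2]] with hys
  set x : ℕ → A ≃ₗ[ZMod 5] A := fun i => word a b c (ys.getD i []) with hx
  have one : ∀ i, wordList a b c ys [i] = x i := fun i => by simp [wordList, hx]
  have mem : ∀ (n : ℕ) (w : List ℕ), (∀ i ∈ w, i < n) →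
      wordList a b c ys w ∈ Subgroup.closure (x '' Set.Iio n) := fun n w hw =>
    list_prod_mem fun t ht => by
      obtain ⟨i, hi, rfl⟩ := List.mem_map.1 ht
      exact Subgroup.subset_closure ⟨i, hw i hi, rfl⟩
  simp only [polycyclicCheck, Bool.and_eq_true, List.all_eq_true, List.mem_range,
    Nat.blt_eq] at e
  obtain ⟨e1, e2⟩ := e
  have sol := isSolvable_of_chain x xs.length fun j hj i hi => by
    obtain ⟨l, r⟩ := e1 j hj i hi
    have r' := h.wordList_eq r
    rw [wordList_append, one, show [j, i] = [j] ++ [i] from rfl, wordList_append, one, one] at r'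
    rw [← r', mul_inv_cancel_right]
    exact mem j _ l
  have le : miyamotoGroup (ZMod 5) a b c ≤ Subgroup.closure (x '' Set.Iio xs.length) := by
    rw [miyamotoGroup_eq, Subgroup.closure_le]
    rintro _ ⟨k, rfl⟩
    obtain ⟨l, r⟩ := e2 k k.2
    have r' := h.wordList_eq r
    have : x (xs.length + k) = axisInvolution a b c k := by
      have : ys.getD (xs.length + k) [] = [k] := by
        rw [hys, List.getD_append_right _ _ _ _ (by omega)]
        fin_cases k <;> simp
      rw [hx]
      simp only [this]
      simp [word]
    rw [one, this] at r'
    rw [← r']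
    exact mem _ _ l
  exact Group.isSolvable_of_isSolvable_injective (Subgroup.inclusion_injective le)

/-- The property of the group that it is solvable. -/
def SolvableGroup (G : Type u) [Group G] (_ : ℕ) : Prop := Group.IsSolvable G

theorem holds_solvable {P : Code4} (xs : List (List (Fin 3)))
    (rel : List (List (List ℕ))) (ts : List (List ℕ))
    (e : polycyclicCheck ((xs ++ [[0], [1], [2]]).map (wordCode P)) xs.length rel ts = true) :
    Holds.{u} SolvableGroup P.1 P.2.1 P.2.2.1 P.2.2.2 :=
  fun _ _ _ _ _ _ _ _ _ hg hp _ => (IsTriple.mk hg hp).isSolvable xs rel ts e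

/-- In each of these certificates the first list gives generators `x_0, x_1, …` as words. The entry
`(j, i)` of the second list writes `x_j x_i x_j⁻¹` through generators with indices below `j`. The
third list writes `τ_a, τ_b, τ_c` through the generators. -/
theorem solvable_0002 :
    Holds.{u} SolvableGroup 0 0 0 2 := by
  have := holds_solvable.{u} (P := (0, 0, 0, 2))
    [[2, 1, 0, 1, 2, 0, 1, 0], [1, 2, 0, 1, 0, 2, 1, 0], [2, 0, 1, 2, 0, 2, 1, 0], [2, 1, 2,
      0, 1, 2, 1, 0], [1, 0, 1, 0, 1, 0], [2, 0, 1, 0], [1, 2, 1, 0], [1, 0], [0]]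
    [[], [[0]], [[0], [1]], [[0], [1], [2]], [[0, 0, 0, 0], [1, 1, 1, 1], [2, 2, 2, 2], [3, 3,
      3, 3]], [[4, 1, 0, 4, 3], [4, 3, 4, 2, 0], [4, 3, 1, 4, 2], [4, 1, 0, 4, 2], [3, 4, 1]],
      [[4, 3, 1, 4, 2], [4, 2, 4, 1, 0], [4, 5, 5], [4, 3, 4, 2, 0], [1, 1, 0, 4, 2], [2, 5,
      4, 0]], [[4, 6, 6, 0], [4, 5, 5], [4, 3, 4, 2], [2], [4], [5, 4, 6, 0], [5, 4, 0, 4]],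
      [[4, 2, 4, 1], [4, 1, 4], [4, 1, 0, 4], [5, 5, 2, 4, 1], [4], [6, 4, 1, 5], [6, 6, 6],
      [7, 7, 4]]]
    [[8], [7, 8], [5, 8, 7]]
    (by decide +kernel)
  simpa using this

theorem solvable_0010 :
    Holds.{u} SolvableGroup 0 0 1 0 := by
  have := holds_solvable.{u} (P := (0, 0, 1, 0))
    [[2, 1, 0, 2, 1, 2, 0, 1, 2, 0, 1, 0], [1, 0, 2, 1, 0, 2, 1, 2, 0, 1, 2, 0], [2, 0], [1,
      2, 0, 1], [0, 1, 2, 0, 1, 0], [1, 0, 1, 2, 0, 1, 0, 1], [1, 0, 1, 0], [0], [1]]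
    [[], [[0]], [[0], [1]], [[0], [1], [2, 1]], [[0], [1], [2, 0], [3]], [[0], [1], [2], [3,
      1, 1, 1, 1, 0], [4, 1, 1, 1, 1]], [[1, 0, 0, 0, 0], [0, 0, 0, 0], [5, 5, 5, 5], [4, 3,
      3, 3, 3], [3, 3, 3, 3], [5, 5, 5, 5, 2]], [[1, 1, 1, 1], [0, 0, 0, 0], [2, 2, 2, 2],
      [4], [3], [6, 6, 2, 6], [6, 6]], [[7, 0, 7, 0], [7, 0, 7], [3], [2], [5], [4], [6, 6],
      [6, 7]]]
    [[7], [8], [2, 7]]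
    (by decide +kernel)
  simpa using this

theorem solvable_0223 :
    Holds.{u} SolvableGroup 0 2 2 3 := by
  have := holds_solvable.{u} (P := (0, 2, 2, 3))
    [[2, 0, 2, 1, 2, 1, 0, 2, 0, 2, 1, 2, 1, 0], [2, 1, 2, 1, 0, 2, 0, 2, 1, 2, 1, 0, 2, 0],
      [2, 0, 2, 0], [2, 1, 2, 1], [2, 0, 1, 2, 1, 0], [2, 1, 0, 2, 0, 1], [2, 1, 0], [0], [1]]
    [[], [[0]], [[0], [1]], [[0], [1], [2, 1, 1, 1, 1]], [[0], [1], [2, 0], [3, 1]], [[0],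
      [1], [2, 1, 1, 1, 1], [3, 1, 1, 1, 1, 0], [4]], [[1, 0, 0, 0, 0], [0, 0, 0, 0], [5, 3,
      3, 3, 3], [4, 4, 4, 3, 4, 3, 3, 3, 2], [5], [5, 5, 5, 5, 4, 4, 4, 4]], [[1], [0], [2, 2,
      2, 2], [6, 6, 3, 6], [2, 2, 2, 2, 3], [4, 6, 2, 6, 6, 0], [6, 6, 3]], [[0, 0, 0, 0], [6,
      0, 6, 6], [3, 3, 3, 3, 5], [3, 3, 3, 3], [7, 3, 7, 5], [3, 3, 3, 3, 2], [6, 3, 6, 3, 5],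
      [7, 6, 5]]]
    [[7], [8], [6, 7, 8]]
    (by decide +kernel)
  simpa using this

theorem solvable_0332 :
    Holds.{u} SolvableGroup 0 3 3 2 := by
  have := holds_solvable.{u} (P := (0, 3, 3, 2))
    [[1, 0, 1, 0, 1, 0], [2, 1, 0, 2, 1, 0], [1, 0], [2, 0], [0]]
    [[], [[0]], [[0], [1]], [[1, 0], [0], [2, 1]], [[0], [1, 0], [2, 2, 0], [3, 3]]]
    [[4], [2, 4], [3, 4]]
    (by decide +kernel)
  simpa using this

theorem solvable_0441 :
    Holds.{u} SolvableGroup 0 4 4 1 := by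
  have := holds_solvable.{u} (P := (0, 4, 4, 1))
    [[2, 0, 1, 2, 1, 0], [1, 2, 1, 0, 2, 0], [2, 1, 0, 2, 0, 1], [2, 1, 2, 0, 1, 0, 1, 0], [1,
      0], [0], [2]]
    [[], [[0]], [[0], [1]], [[0], [1], [2]], [[2, 2, 2, 2], [3, 3, 3, 3, 2, 1, 0], [2, 0], [1,
      0]], [[1, 1, 1, 1], [0, 0, 0, 0], [4, 4, 4, 4, 4, 1, 4], [4, 4, 4, 4, 4, 3, 4], [4, 4,
      4, 4, 4]], [[5, 1, 5], [1], [2, 2, 2, 2], [5, 4, 1, 5, 1, 4], [2, 4], [5, 3, 4, 4, 4,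
      1]]]
    [[5], [4, 5], [6]]
    (by decide +kernel)
  simpa using this

theorem solvable_1111 :
    Holds.{u} SolvableGroup 1 1 1 1 := by
  have := holds_solvable.{u} (P := (1, 1, 1, 1))
    [[2, 1, 0, 2, 1, 0], [1, 2, 0, 1, 2, 0], [2, 0, 1, 2, 0, 1], [1, 0], [2, 0], [0]]
    [[], [[0]], [[0], [1]], [[2, 2, 2, 2], [2, 1, 0], [2, 2, 0]], [[2, 2, 2, 2, 1, 0], [2],
      [2, 2, 1, 1, 1, 1], [2, 3]], [[1, 1, 1, 1], [0, 0, 0, 0], [3, 3, 3, 3, 1, 3], [3, 3, 3,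
      3], [4, 4, 4, 4]]]
    [[5], [3, 5], [4, 5]]
    (by decide +kernel)
  simpa using this

theorem solvable_1222 :
    Holds.{u} SolvableGroup 1 2 2 2 := by
  have := holds_solvable.{u} (P := (1, 2, 2, 2))
    [[2, 0, 2, 1, 0, 2, 0, 2, 1, 0], [2, 1, 2, 1, 0, 2, 1, 2, 1, 0], [2, 1, 0, 2, 0, 2, 1, 0,
      2, 0], [1, 2, 0, 2, 0, 1, 2, 0, 2, 0], [1, 0], [2, 0, 2, 0], [2, 1, 2, 0], [0], [2]]
    [[], [[0]], [[0], [1]], [[0], [1], [2]], [[3, 3, 3, 3], [3, 3, 3, 3, 1, 0, 0, 0, 0], [3,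
      3, 3, 2, 0, 0, 0], [3, 3, 0]], [[0], [3, 1, 0], [2], [3], [3, 4]], [[4, 4, 0, 4, 4, 4],
      [4, 1, 4, 4, 4, 4], [4, 4, 4, 2, 4, 4], [3, 3, 3, 0, 0], [4, 1, 1, 1, 1], [5, 2, 2, 2,
      2]], [[3, 3, 3, 3], [1], [3, 2, 0], [0, 0, 0, 0], [4, 4, 4, 4], [5, 5, 5, 5], [6, 6, 6,
      6]], [[3, 2, 0], [7, 6, 4, 7, 2, 6, 4, 0], [7, 0, 7], [2, 2, 2, 2], [6, 7, 5, 7], [7, 5,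
      7], [4, 7, 5, 7], [5, 7]]]
    [[7], [4, 7], [8]]
    (by decide +kernel)
  simpa using this

theorem solvable_1333 :
    Holds.{u} SolvableGroup 1 3 3 3 := by
  have := holds_solvable.{u} (P := (1, 3, 3, 3))
    [[1, 0], [2, 1, 0, 2], [2, 0], [0]]
    [[], [[0]], [[1, 1, 1, 1], [1, 1, 1, 1, 0]], [[0, 0, 0, 0], [2, 2, 0, 2], [2, 2]]]
    [[3], [0, 3], [2, 3]]
    (by decide +kernel)
  simpa using this

theorem solvable_1444 :
    Holds.{u} SolvableGroup 1 4 4 4 := by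
  have := holds_solvable.{u} (P := (1, 4, 4, 4))
    [[2, 0, 1, 2, 1, 0], [1, 2, 1, 0, 2, 0], [2, 1, 0, 2, 0, 1], [0, 2, 1, 0, 2, 0, 1, 0], [1,
      0], [2, 0, 2, 0], [0], [2]]
    [[], [[0]], [[0], [1]], [[0], [1], [2]], [[2, 2, 2, 2], [3, 3, 3, 3, 1, 1], [2, 2, 0],
      [1]], [[0, 0, 0, 0], [1, 1, 1, 1], [2, 2, 2, 2], [3, 3, 3, 3], [3, 3, 2, 4, 1, 1]], [[5,
      1, 5], [5, 0, 5], [3], [2], [4, 4, 4, 4], [5]], [[5, 0, 5], [1], [5, 2, 5], [3], [2, 4],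
      [5], [6, 5]]]
    [[6], [4, 6], [7]]
    (by decide +kernel)
  simpa using this

theorem solvable_2221 :
    Holds.{u} SolvableGroup 2 2 2 1 := by
  have := holds_solvable.{u} (P := (2, 2, 2, 1))
    [[2, 0, 1, 0, 1, 2, 1, 0, 1, 0], [1, 2, 1, 0, 1, 0, 2, 0, 1, 0], [2, 0, 2, 1, 2, 0, 2, 0,
      1, 0], [2, 1, 0], [1, 2, 0], [2, 0, 1], [0], [1]]
    [[], [[0]], [[0], [1]], [[0], [1], [2]], [[0], [1], [2], [3, 2, 2, 2, 2, 0]], [[0], [1],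
      [2], [3, 0, 0, 0, 0], [4, 2, 1, 1, 1, 1, 0, 0, 0, 0]], [[1], [0], [2, 2, 2, 2, 1, 0],
      [4, 4, 4, 4], [3, 3, 3, 3], [5, 5, 5, 4, 5, 4, 4, 4, 3]], [[1, 1, 1, 1], [0, 0, 0, 0],
      [2, 2, 2, 2], [4, 6, 4, 6, 5], [5], [4], [4, 6, 5]]]
    [[6], [7], [7, 4, 6]]
    (by decide +kernel)
  simpa using this

theorem solvable_2230 :
    Holds.{u} SolvableGroup 2 2 3 0 := by
  have := holds_solvable.{u} (P := (2, 2, 3, 0))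
    [[2, 1, 2, 1, 0, 1, 0, 2, 1, 2, 1, 0, 1, 0], [1, 0, 2, 1, 2, 1, 0, 1, 0, 2, 1, 2, 1, 0],
      [1, 0, 1, 0], [2, 1, 2, 1], [0, 2, 1, 2, 1, 0], [2, 0, 1, 0, 2, 1], [2, 0], [0], [1]]
    [[], [[0]], [[0], [1]], [[0], [1], [2, 0, 0, 0, 0]], [[0], [1], [2, 1], [3]], [[0], [1],
      [2, 0, 0, 0, 0], [3, 1, 1, 1, 1, 0, 0, 0, 0], [4, 0, 0, 0, 0]], [[1], [1, 1, 1, 1, 0, 0,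
      0, 0], [5, 3, 3, 3, 3], [4, 3, 3, 3, 3], [3, 3, 3, 3], [5, 5, 5, 5, 4, 2, 2, 2, 2]],
      [[1], [0], [2, 2, 2, 2], [4], [3], [6, 3, 6, 6, 5, 2], [6, 6]], [[0], [1], [7, 2, 7],
      [3, 3, 3, 3], [4, 4, 4, 4, 1], [5, 5, 5, 5], [5, 5, 5, 5, 6], [2, 7]]]
    [[7], [8], [6, 7]]
    (by decide +kernel)
  simpa using this

theorem solvable_2244 :
    Holds.{u} SolvableGroup 2 2 4 4 := by
  have := holds_solvable.{u} (P := (2, 2, 4, 4))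
    [[1, 2, 0, 2, 1, 0, 1, 2, 0, 2, 1, 0], [2, 0, 1, 2, 1, 0, 2, 0, 1, 2, 1, 0], [1, 0, 1, 0],
      [2, 1, 2, 1], [2, 0, 2, 1, 0], [2, 0, 1, 2, 0], [1], [0], [2]]
    [[], [[0]], [[0], [1]], [[0], [1], [2, 1, 1, 1, 1, 0]], [[0], [1], [2, 0], [3, 0, 0, 0,
      0]], [[0], [1], [2, 1, 1, 1, 1], [3, 0, 0, 0, 0], [4, 1, 1, 1, 1]], [[0], [1], [2, 2, 2,
      2], [3, 3, 3, 3], [4, 4, 4, 4, 0], [5, 5, 5, 5]], [[0, 0, 0, 0], [1], [6, 2, 6], [6, 5,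
      6, 4], [4, 6, 2, 6], [6, 2, 3, 6, 4], [6, 2]], [[0], [1, 1, 1, 1], [3, 6, 5, 4, 6, 2],
      [6, 3, 6], [6, 5, 6], [4, 4, 4, 4], [3, 6], [4, 7, 6]]]
    [[7], [6], [8]]
    (by decide +kernel)
  simpa using this

theorem solvable_2334 :
    Holds.{u} SolvableGroup 2 3 3 4 := by
  have := holds_solvable.{u} (P := (2, 3, 3, 4))
    [[1, 0], [2, 1, 0, 2], [2, 0], [0]]
    [[], [[0]], [[1, 1, 1, 1, 1, 1, 1, 1, 1], [1, 1, 1, 1, 1, 1, 1, 1, 1, 0]], [[2, 2, 1, 2],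
      [2, 2, 0, 2], [2, 2]]]
    [[3], [0, 3], [2, 3]]
    (by decide +kernel)
  simpa using this

theorem solvable_2343 :
    Holds.{u} SolvableGroup 2 3 4 3 := by
  have := holds_solvable.{u} (P := (2, 3, 4, 3))
    [[1, 0, 1, 0], [2, 1, 0, 1, 0, 2], [0, 2, 1, 0, 1, 0, 2, 0], [0], [2, 0, 2], [2, 1], [1]]
    [[], [[0]], [[0], [1]], [[0, 0, 0, 0], [2], [1]], [[2, 1, 1, 1, 1, 0], [1, 1, 1, 1], [2,
      2, 2, 2], [3]], [[4, 1, 4], [4, 1, 4, 0], [2, 0], [1, 4], [4, 3, 2, 2, 1, 1]], [[3, 0,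
      3], [3, 0, 3, 1], [2, 0], [0, 3], [5, 5, 3, 5], [5, 5]]]
    [[3], [6], [5, 6]]
    (by decide +kernel)
  simpa using this

theorem solvable_3330 :
    Holds.{u} SolvableGroup 3 3 3 0 := by
  have := holds_solvable.{u} (P := (3, 3, 3, 0))
    [[1, 0], [2, 0], [0]]
    [[], [[0]], [[0, 0], [1, 1]]]
    [[2], [0, 2], [1, 2]]
    (by decide +kernel)
  simpa using this

theorem solvable_3333 :
    Holds.{u} SolvableGroup 3 3 3 3 := by
  have := holds_solvable.{u} (P := (3, 3, 3, 3))
    [[2, 0, 1, 0], [1, 2, 1, 0], [1, 0], [0]]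
    [[], [[0]], [[1, 0, 0, 0], [0, 0, 0]], [[1, 1, 1, 0], [1, 1, 1], [2, 2]]]
    [[3], [2, 3], [0, 3, 2]]
    (by decide +kernel)
  simpa using this

theorem solvable_4443 :
    Holds.{u} SolvableGroup 4 4 4 3 := by
  have := holds_solvable.{u} (P := (4, 4, 4, 3))
    [[2, 1, 2, 0, 1, 0], [1, 2, 0, 2, 1, 0], [2, 0, 1, 2, 1, 0], [1, 2, 1, 0, 2, 0], [1, 0, 1,
      0], [0], [1], [2]]
    [[], [[0]], [[0], [1]], [[0], [1], [2]], [[0, 0, 0, 0], [1, 1, 1, 1], [2, 2, 2, 2], [3, 3,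
      3, 3]], [[4, 3, 2, 4, 0], [4, 1, 4], [4, 3, 4], [4, 2, 4], [4]], [[0], [4, 3, 4, 0], [5,
      0, 5, 1], [4, 1, 4, 0], [4], [5, 4]], [[4, 2, 4, 1], [4, 2, 4, 0], [4, 2, 4], [3], [2,
      0, 4, 1], [5, 0, 4, 3], [6, 0, 4]]]
    [[5], [6], [7]]
    (by decide +kernel)
  simpa using this

end Certificates

/-! ### Nonsolvability from elements of coprime orders. -/

section NotSolvable

/-- A group with nontrivial elements `x`, `y`, `xy` of pairwise coprime orders is not solvable. -/
theorem not_isSolvable_of_triple {G : Type*} [Group G] {x y : G} {l m n : ℕ} (hx : x ^ l = 1)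
    (hy : y ^ m = 1) (hxy : (x * y) ^ n = 1) (lm : l.Coprime m) (ln : l.Coprime n)
    (mn : m.Coprime n) (h1 : x ≠ 1) : ¬ Group.IsSolvable G := by
  suffices h : ∀ k, x ∈ derivedSeries G k ∧ y ∈ derivedSeries G k from
    not_isSolvable_of_mem_derivedSeries h1 fun k => (h k).1
  intro k
  induction k with
  | zero => simp
  | succ k ih =>
    set D := derivedSeries G k
    have key : ∀ g : D, Abelianization.of g = 1 → (g : G) ∈ ⁅D, D⁆ := fun g hg => by
      have : g ∈ commutator D := by
        rw [← Abelianization.ker_of]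
        exact hg
      rw [commutator_def] at this
      have h := Subgroup.mem_map_of_mem D.subtype this
      rw [Subgroup.map_commutator, ← MonoidHom.range_eq_map, Subgroup.range_subtype] at h
      exact h
    -- In the abelianization of `D` the class `X` is killed by `l`, and by `m n` as the quotient of
    -- `XY` by `Y`. Coprimality gives `X = 1`, and then `Y = 1`. So `x` and `y` stay in all terms of
    -- the derived series.
    let X : Abelianization D := Abelianization.of ⟨x, ih.1⟩
    let Y : Abelianization D := Abelianization.of ⟨y, ih.2⟩
    have hX : X ^ l = 1 := by
      rw [← map_pow, ← map_one Abelianization.of]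
      exact congrArg _ (Subtype.ext hx)
    have hY : Y ^ m = 1 := by
      rw [← map_pow, ← map_one Abelianization.of]
      exact congrArg _ (Subtype.ext hy)
    have hXY : (X * Y) ^ n = 1 := by
      rw [← map_mul, ← map_pow, ← map_one Abelianization.of]
      exact congrArg _ (Subtype.ext hxy)
    have pow_one : ∀ {Z : Abelianization D} {i j : ℕ}, i.Coprime j → Z ^ i = 1 → Z ^ j = 1 →
        Z = 1 := fun {Z i j} hij hi hj => by
      rw [← orderOf_eq_one_iff, ← Nat.dvd_one, ← Nat.coprime_iff_gcd_eq_one.1 hij]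
      exact Nat.dvd_gcd (orderOf_dvd_of_pow_eq_one hi) (orderOf_dvd_of_pow_eq_one hj)
    have X1 : X = 1 := by
      refine pow_one (Nat.Coprime.mul_right lm ln) hX ?_
      have : (X * Y) ^ (m * n) = 1 := by rw [mul_comm m, pow_mul, hXY, one_pow]
      rwa [mul_pow, pow_mul Y, hY, one_pow, mul_one] at this
    have Y1 : Y = 1 := by
      rw [X1, one_mul] at hXY
      exact pow_one mn hY hXY
    exact ⟨key _ X1, key _ Y1⟩

variable {A : Type*} [NonUnitalNonAssocCommRing A] [Module (ZMod 5) A]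
  [IsScalarTower (ZMod 5) A A] [SMulCommClass (ZMod 5) A A]
  {φ : LinearMap.BilinForm (ZMod 5) A} {a b c : A} {P : Code4}

theorem IsTriple.wordList_ne (h : IsTriple φ a b c P)
    (li : LinearIndependent (ZMod 5) (monomials a b c)) {xs : List (List (Fin 3))} {w w' : List ℕ}
    (e : agree (xs.map (wordCode P)) w w' = false) :
    wordList a b c xs w ≠ wordList a b c xs w' := by
  intro he
  have : agree (xs.map (wordCode P)) w w' = true := by
    simp only [agree, List.all_eq_true, beq_iff_eq]
    intro k _
    have h1 := h.wordList_vect xs w (isDigits_unitVec k)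
    have h2 := h.wordList_vect xs w' (isDigits_unitVec k)
    refine vect_injective li h1.1 h2.1 ?_
    rw [← h1.2, ← h2.2, he]
  rw [this] at e
  exact absurd e (by decide)

/-- The words `x`, `y` are of orders `2` and `3`, and `xy` is of order `n`. -/
def triangleCheck (P : Code4) (x y : List (Fin 3)) (n : ℕ) : Bool :=
  let C := [x, y].map (wordCode P)
  agree C [0, 0] [] && agree C [1, 1, 1] [] && agree C (List.replicate n [0, 1]).flatten [] &&
    !agree C [0] [] && !agree C [0, 1] []

/-- The orders `2, 3, n` of `x, y, xy` exclude solvability, and the prime order `n` divides the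
order of `T`. Both facts are transported later to listed groups, so that the orders of the linear
and unitary groups need not be computed. -/
theorem IsTriple.triangle (h : IsTriple φ a b c P)
    (li : LinearIndependent (ZMod 5) (monomials a b c)) {x y : List (Fin 3)} {n : ℕ}
    (e : triangleCheck P x y n = true) (h2 : Nat.Coprime 2 n) (h3 : Nat.Coprime 3 n)
    (hn : n.Prime) : ¬ Group.IsSolvable (miyamotoGroup (ZMod 5) a b c) ∧
      n ∣ Nat.card (miyamotoGroup (ZMod 5) a b c) := by
  have fin := h.finite
  simp only [triangleCheck, Bool.and_eq_true, Bool.not_eq_true'] at e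
  obtain ⟨⟨⟨⟨e1, e2⟩, e3⟩, e4⟩, e5⟩ := e
  have o0 : wordList a b c [x, y] [0] = word a b c x := by simp [wordList]
  have o1 : wordList a b c [x, y] [1] = word a b c y := by simp [wordList]
  have o01 : wordList a b c [x, y] [0, 1] = word a b c x * word a b c y := by simp [wordList]
  have on : wordList a b c [x, y] [] = 1 := by simp [wordList]
  have opow : ∀ n, wordList a b c [x, y] (List.replicate n [0, 1]).flatten =
      (word a b c x * word a b c y) ^ n := fun n => by
    induction n with
    | zero => simp [wordList]
    | succ n ih =>
      rw [List.replicate_succ, List.flatten_cons, wordList_append, ih, o01, pow_succ']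
  have f1 := h.wordList_eq e1
  have f2 := h.wordList_eq e2
  have f3 := h.wordList_eq e3
  have f4 := h.wordList_ne li e4
  have f5 := h.wordList_ne li e5
  rw [on] at f1 f2 f3 f4 f5
  rw [opow] at f3
  rw [o0] at f4
  rw [o01] at f5
  rw [show [0, 0] = [0] ++ [0] from rfl, wordList_append, o0] at f1
  rw [show [1, 1, 1] = [1] ++ [1] ++ [1] from rfl, wordList_append, wordList_append, o1] at f2
  let X : miyamotoGroup (ZMod 5) a b c := ⟨_, word_mem a b c x⟩
  let Y : miyamotoGroup (ZMod 5) a b c := ⟨_, word_mem a b c y⟩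
  have hXY : (X * Y) ^ n = 1 := Subtype.ext f3
  constructor
  · refine not_isSolvable_of_triple (x := X) (y := Y) (l := 2) (m := 3) (n := n) ?_ ?_ hXY
      (by norm_num) h2 h3 fun hX => f4 (congrArg Subtype.val hX)
    · rw [pow_two]
      exact Subtype.ext f1
    · rw [pow_succ, pow_two]
      exact Subtype.ext f2
  · have : Fact n.Prime := ⟨hn⟩
    rw [← orderOf_eq_prime hXY fun hX => f5 (congrArg Subtype.val hX)]
    exact orderOf_dvd_natCard _

theorem triangle_psl27 : triangleCheck (4, 4, 4, 0) [0] [2, 0, 1, 0] 7 = true := by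
  decide +kernel

theorem triangle_psl35 : triangleCheck (0, 0, 0, 3) [2] [1, 0, 1, 0] 31 = true := by
  decide +kernel

theorem triangle_psu35 : triangleCheck (0, 0, 0, 4) [2] [1, 0, 1, 0] 7 = true := by
  decide +kernel

theorem triangle_a6 : triangleCheck (3, 3, 4, 0) [2] [1, 0] 5 = true := by
  decide +kernel

theorem triangle_a7 : triangleCheck (0, 1, 3, 0) [1] [2, 0] 7 = true := by
  decide +kernel

end NotSolvable

/-! ### Ranks of the Gram matrices. -/

section GramRank

/-- The functional `f` composed with the matrix `M`. -/
def compRow (f M : List ℕ) : List ℕ :=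
  (List.range 8).map fun j => dotList f (unpack (M.getD j 0)) % 5

/-- The rows of the Gram matrix. -/
def gramCode (P : Code4) : List (List ℕ) :=
  let g := formList P.1 P.2.1 P.2.2.1 P.2.2.2
  let g4 := compRow (g 2) (axisCode P 1)
  let g5 := compRow (g 2) (axisCode P 0)
  [g 0, g 1, g 2, compRow (g 1) (axisCode P 0), g4, g5, compRow g4 (axisCode P 0),
    compRow g5 (axisCode P 1)]

/-- The Gram matrix for the parameters `P`. -/
def gramMat (P : Code4) : Matrix (Fin 8) (Fin 8) (ZMod 5) :=
  Matrix.of fun i j => ((((gramCode P).getD i []).getD j 0 : ℕ) : ZMod 5)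

variable {A : Type*} [NonUnitalNonAssocCommRing A] [Module (ZMod 5) A]
  [IsScalarTower (ZMod 5) A A] [SMulCommClass (ZMod 5) A A]
  {φ : LinearMap.BilinForm (ZMod 5) A} {a b c : A} {P : Code4}

/-- Associativity moves the idempotent to the other argument, where it acts by its multiplication
matrix. -/
theorem IsTriple.form_comp (h : IsTriple φ a b c P) (k : Fin 3) {y : A} {f : List ℕ}
    (hl : f.length = 8)
    (hf : ∀ j, φ y (monomials a b c j) = ((f.getD j 0 : ℕ) : ZMod 5)) (j : Fin 8) :
    φ (![a, b, c] k * y) (monomials a b c j) =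
      (((compRow f (axisCode P k)).getD j 0 : ℕ) : ZMod 5) := by
  rw [h.gen.pseudoComposition.form_assoc two_ne_zero_five three_ne_zero_five
    (h.gen.areAxes.idem k)
    (h.gen.areAxes.ne_zero k)]
  have := (h.hasCode_mul k).map j
  rw [LinearMap.mulLeft_apply] at this
  rw [this, compRow, getD_map_range j.2, ZMod.natCast_mod, vect, map_sum,
    dotList_eq 8 _ _ hl (isDigits_unpack _).1, Nat.cast_sum]
  refine Finset.sum_congr rfl fun i _ => ?_
  rw [map_smul, hf, smul_eq_mul, mul_comm, Nat.cast_mul]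

theorem IsTriple.gramMatrix_eq (h : IsTriple φ a b c P) : gramMatrix φ a b c = gramMat P := by
  have l : ∀ k : Fin 3, (formList P.1 P.2.1 P.2.2.1 P.2.2.2 k).length = 8 := fun k => by
    fin_cases k <;> rfl
  have lc : ∀ f M : List ℕ, (compRow f M).length = 8 := fun f M => by simp [compRow]
  have g0 := h.form_eq 0
  have g1 := h.form_eq 1
  have g2 := h.form_eq 2
  have g3 := h.form_comp 0 (l 1) g1
  have g4 := h.form_comp 1 (l 2) g2
  have g5 := h.form_comp 0 (l 2) g2
  have g6 := h.form_comp 0 (lc _ _) g4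
  have g7 := h.form_comp 1 (lc _ _) g5
  ext i j
  rw [gramMatrix, gramMat, Matrix.of_apply, Matrix.of_apply]
  fin_cases i
  exacts [g0 j, g1 j, g2 j, g3 j, g4 j, g5 j, g6 j, g7 j]

/-- A factorization through dimension `r` bounds the rank from above; an identity matrix of size `r`
obtained by multiplying from both sides bounds it from below. -/
theorem rank_eq_of_factor {n r : ℕ} {M : Matrix (Fin n) (Fin n) (ZMod 5)}
    (C : Matrix (Fin n) (Fin r) (ZMod 5)) (D : Matrix (Fin r) (Fin n) (ZMod 5))
    (E : Matrix (Fin r) (Fin n) (ZMod 5)) (F : Matrix (Fin n) (Fin r) (ZMod 5))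
    (h1 : M = C * D) (h2 : E * M * F = 1) : M.rank = r := by
  apply le_antisymm
  · rw [h1]
    exact (Matrix.rank_mul_le_right C D).trans (D.rank_le_height)
  · calc r = (1 : Matrix (Fin r) (Fin r) (ZMod 5)).rank := by simp
      _ = (E * M * F).rank := by rw [h2]
      _ ≤ (E * M).rank := Matrix.rank_mul_le_left _ _
      _ ≤ M.rank := Matrix.rank_mul_le_right _ _

theorem rank_gram_e5A5 : (gramMat (1, 1, 2, 3)).rank = 5 :=
  rank_eq_of_factor
    !![1, 1, 2, 1, 3; 1, 1, 1, 1, 1; 2, 1, 1, 3, 1; 1, 1, 3, 1, 3; 3, 1, 1, 3, 1; 2, 3, 2, 1, 1; 3, 3, 1, 2, 3; 1, 3, 1, 1, 1]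
    !![1, 0, 0, 0, 0, 4, 2, 0; 0, 1, 0, 0, 0, 0, 1, 0; 0, 0, 1, 0, 0, 4, 4, 0; 0, 0, 0, 1, 0, 0, 3, 4; 0, 0, 0, 0, 1, 0, 3, 4]
    !![0, 0, 4, 0, 1, 0, 0, 0; 0, 2, 0, 2, 2, 0, 0, 0; 4, 0, 0, 1, 0, 0, 0, 0; 0, 2, 1, 0, 2, 0, 0, 0; 1, 2, 0, 2, 0, 0, 0, 0]
    !![1, 0, 0, 0, 0; 0, 1, 0, 0, 0; 0, 0, 1, 0, 0; 0, 0, 0, 1, 0; 0, 0, 0, 0, 1; 0, 0, 0, 0, 0; 0, 0, 0, 0, 0; 0, 0, 0, 0, 0]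
    (by decide +kernel) (by decide +kernel)

theorem rank_gram_e5S5 : (gramMat (0, 0, 2, 0)).rank = 5 :=
  rank_eq_of_factor
    !![1, 0, 2, 0, 0; 0, 1, 0, 0, 0; 2, 0, 1, 0, 0; 0, 0, 0, 3, 1; 0, 0, 0, 1, 3; 2, 0, 2, 0, 0; 0, 1, 0, 2, 2; 0, 0, 0, 1, 1]
    !![1, 0, 0, 0, 0, 4, 0, 0; 0, 1, 0, 0, 0, 0, 1, 0; 0, 0, 1, 0, 0, 4, 0, 0; 0, 0, 0, 1, 0, 0, 3, 4; 0, 0, 0, 0, 1, 0, 3, 4]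
    !![3, 0, 4, 0, 0, 0, 0, 0; 0, 1, 0, 0, 0, 0, 0, 0; 4, 0, 3, 0, 0, 0, 0, 0; 0, 0, 0, 1, 3, 0, 0, 0; 0, 0, 0, 3, 1, 0, 0, 0]
    !![1, 0, 0, 0, 0; 0, 1, 0, 0, 0; 0, 0, 1, 0, 0; 0, 0, 0, 1, 0; 0, 0, 0, 0, 1; 0, 0, 0, 0, 0; 0, 0, 0, 0, 0; 0, 0, 0, 0, 0]
    (by decide +kernel) (by decide +kernel)

theorem rank_gram_iterated : (gramMat (0, 2, 4, 0)).rank = 4 :=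
  rank_eq_of_factor
    !![1, 0, 4, 0; 0, 1, 2, 0; 4, 2, 1, 0; 0, 0, 0, 3; 0, 2, 2, 2; 4, 0, 4, 1; 0, 2, 3, 0; 1, 0, 3, 4]
    !![1, 0, 0, 0, 3, 2, 4, 0; 0, 1, 0, 0, 1, 4, 4, 2; 0, 0, 1, 0, 3, 3, 4, 4; 0, 0, 0, 1, 4, 2, 0, 3]
    !![2, 3, 1, 0, 0, 0, 0, 0; 3, 0, 3, 0, 0, 0, 0, 0; 1, 3, 1, 0, 0, 0, 0, 0; 0, 0, 0, 2, 0, 0, 0, 0]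
    !![1, 0, 0, 0; 0, 1, 0, 0; 0, 0, 1, 0; 0, 0, 0, 1; 0, 0, 0, 0; 0, 0, 0, 0; 0, 0, 0, 0; 0, 0, 0, 0]
    (by decide +kernel) (by decide +kernel)

/-- In the five nonsingular cases the certificate is the inverse matrix. -/
theorem rank_gram_psl27 : (gramMat (4, 4, 4, 0)).rank = 8 :=
  rank_eq_of_factor (gramMat (4, 4, 4, 0)) 1
    !![1, 4, 4, 1, 0, 3, 4, 4; 4, 1, 4, 1, 3, 0, 4, 4; 4, 4, 1, 3, 3, 3, 4, 4; 1, 1, 3, 4, 2, 2, 3, 3; 0, 3, 3, 2, 4, 2, 2, 0; 3, 0, 3, 2, 2, 4, 0, 2; 4, 4, 4, 3, 2, 0, 3, 4; 4, 4, 4, 3, 0, 2, 4, 3]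
    1 (by decide +kernel) (by decide +kernel)

theorem rank_gram_psl35 : (gramMat (0, 0, 0, 3)).rank = 8 :=
  rank_eq_of_factor (gramMat (0, 0, 0, 3)) 1
    !![4, 3, 3, 0, 2, 0, 2, 0; 3, 4, 3, 0, 0, 2, 0, 2; 3, 3, 4, 2, 0, 0, 3, 3; 0, 0, 2, 3, 4, 4, 2, 2; 2, 0, 0, 4, 3, 4, 3, 0; 0, 2, 0, 4, 4, 3, 0, 3; 2, 0, 3, 2, 3, 0, 4, 2; 0, 2, 3, 2, 0, 3, 2, 4]
    1 (by decide +kernel) (by decide +kernel)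

theorem rank_gram_psu35 : (gramMat (0, 0, 0, 4)).rank = 8 :=
  rank_eq_of_factor (gramMat (0, 0, 0, 4)) 1
    !![4, 2, 2, 0, 2, 0, 1, 0; 2, 4, 2, 0, 0, 2, 0, 1; 2, 2, 4, 2, 0, 0, 4, 4; 0, 0, 2, 3, 2, 2, 1, 1; 2, 0, 0, 2, 3, 2, 4, 0; 0, 2, 0, 2, 2, 3, 0, 4; 1, 0, 4, 1, 4, 0, 1, 3; 0, 1, 4, 1, 0, 4, 3, 1]
    1 (by decide +kernel) (by decide +kernel)

theorem rank_gram_a6 : (gramMat (3, 3, 4, 0)).rank = 8 :=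
  rank_eq_of_factor (gramMat (3, 3, 4, 0)) 1
    !![1, 1, 1, 4, 4, 2, 4, 3; 1, 1, 2, 3, 4, 2, 0, 1; 1, 2, 0, 2, 1, 2, 1, 4; 4, 3, 2, 0, 0, 1, 4, 0; 4, 4, 1, 0, 0, 1, 1, 1; 2, 2, 2, 1, 1, 4, 0, 0; 4, 0, 1, 4, 1, 0, 0, 0; 3, 1, 4, 0, 1, 0, 0, 3]
    1 (by decide +kernel) (by decide +kernel)

theorem rank_gram_a7 : (gramMat (0, 1, 3, 0)).rank = 8 :=
  rank_eq_of_factor (gramMat (0, 1, 3, 0)) 1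
    !![1, 2, 0, 4, 1, 2, 3, 3; 2, 0, 3, 0, 4, 1, 1, 2; 0, 3, 3, 1, 4, 2, 0, 0; 4, 0, 1, 0, 4, 0, 0, 1; 1, 4, 4, 4, 2, 0, 0, 4; 2, 1, 2, 0, 0, 4, 3, 0; 3, 1, 0, 0, 0, 3, 1, 1; 3, 2, 0, 1, 4, 0, 1, 4]
    1 (by decide +kernel) (by decide +kernel)

theorem gramMat_rank (L : Listed) : (gramMat L.params).rank = L.gramRank := by
  cases L
  exacts [rank_gram_e5A5, rank_gram_e5S5, rank_gram_iterated, rank_gram_psl27, rank_gram_psl35,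
    rank_gram_psu35, rank_gram_a6, rank_gram_a7]

end GramRank

/-! ### Isomorphisms of generated groups from an invariant relation. -/

section Relations

/-- In a finite group, a property which is preserved by the multiplications by the generators from
the left holds for all elements of the group. -/
theorem closure_induction_left_of_finite {G : Type*} [Group G] [Finite G] {s : Set G}
    {Q : G → Prop} (one : Q 1) (mul : ∀ x ∈ s, ∀ y, Q y → Q (x * y)) {x : G}
    (hx : x ∈ Subgroup.closure s) : Q x := by
  have pow : ∀ x ∈ s, ∀ (n : ℕ) (y : G), Q y → Q (x ^ n * y) := fun x hx n y hy => by
    induction n with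
    | zero => simpa using hy
    | succ n ih =>
      rw [pow_succ', mul_assoc]
      exact mul x hx _ ih
  induction hx using Subgroup.closure_induction_left with
  | one => exact one
  | mul_left x hx y _ h => exact mul x hx y h
  | inv_mul_cancel x hx y _ h =>
    have : x⁻¹ = x ^ (orderOf x - 1) := by
      rw [inv_eq_iff_mul_eq_one, ← pow_succ',
        Nat.sub_add_cancel (orderOf_pos x), pow_orderOf_eq_one]
    rw [this]
    exact pow x hx _ y h

variable {G H ι : Type*} [Group G] [Group H] [Finite G] [Finite H] (t : ι → G) (g : ι → H)

/-- The subgroup generated by the pairs of generators. -/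
def pairClosure : Subgroup (G × H) := Subgroup.closure (Set.range fun i => (t i, g i))

omit [Finite G] [Finite H] in
theorem map_fst_pairClosure :
    (pairClosure t g).map (MonoidHom.fst G H) = Subgroup.closure (Set.range t) := by
  rw [pairClosure, MonoidHom.map_closure, ← Set.range_comp]
  rfl

omit [Finite G] [Finite H] in
theorem map_snd_pairClosure :
    (pairClosure t g).map (MonoidHom.snd G H) = Subgroup.closure (Set.range g) := by
  rw [pairClosure, MonoidHom.map_closure, ← Set.range_comp]
  rfl

/-- A group generated by the `t i` is a quotient of one generated by the `g i`, if the relation `Q`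
which is preserved by the pairs of generators identifies exactly `N` with the identity. -/
theorem mulEquiv_of_relation (N : Subgroup H) [N.Normal] (Q : G → H → Prop) (one : Q 1 1)
    (mul : ∀ i x y, Q x y → Q (t i * x) (g i * y)) (hN : ∀ y, Q 1 y → y ∈ N)
    (hN' : ∀ x, ∀ y ∈ N, Q x y → x = 1) (gen : Subgroup.closure (Set.range g) ⊔ N = ⊤) :
    Nonempty (Subgroup.closure (Set.range t) ≃* H ⧸ N) := by
  -- The relation spreads along words to the whole subgroup generated by the pairs; finiteness makes
  -- inverses of generators unnecessary.
  have hQ : ∀ p ∈ pairClosure t g, Q p.1 p.2 := fun p hp =>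
    closure_induction_left_of_finite (Q := fun p : G × H => Q p.1 p.2) one (by
      rintro _ ⟨i, rfl⟩ y h
      exact mul i _ _ h) hp
  let f1 : pairClosure t g →* G := (MonoidHom.fst G H).comp (pairClosure t g).subtype
  let f2 : pairClosure t g →* H ⧸ N :=
    (QuotientGroup.mk' N).comp ((MonoidHom.snd G H).comp (pairClosure t g).subtype)
  have r1 : f1.range = Subgroup.closure (Set.range t) := by
    rw [← map_fst_pairClosure t g, MonoidHom.range_eq_map, ← Subgroup.map_map,
      ← MonoidHom.range_eq_map, Subgroup.range_subtype]
  have r2 : f2.range = ⊤ := by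
    rw [MonoidHom.range_eq_map, ← Subgroup.map_map, ← Subgroup.map_map, ← MonoidHom.range_eq_map,
      Subgroup.range_subtype, map_snd_pairClosure, eq_top_iff]
    have h := congrArg (Subgroup.map (QuotientGroup.mk' N)) gen
    rw [Subgroup.map_sup, QuotientGroup.map_mk'_self, sup_bot_eq,
      ← MonoidHom.range_eq_map, QuotientGroup.range_mk'] at h
    exact h.ge
  -- The maps of the subgroup of pairs to `G` and to `H ⧸ N` have the same kernel, so their images
  -- are isomorphic.
  have hk : f1.ker = f2.ker := by
    ext ⟨⟨x, y⟩, hp⟩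
    have h := hQ _ hp
    constructor
    · intro h1
      have h1 : x = 1 := h1
      subst h1
      exact (QuotientGroup.eq_one_iff y).2 (hN y h)
    · intro h1
      exact hN' x y ((QuotientGroup.eq_one_iff y).1 h1) h
  exact ⟨(MulEquiv.subgroupCongr r1).symm.trans <|
    (QuotientGroup.quotientKerEquivRange f1).symm.trans <|
    (QuotientGroup.quotientMulEquivOfEq hk).trans <|
    (QuotientGroup.quotientKerEquivRange f2).trans <|
    (MulEquiv.subgroupCongr r2).trans Subgroup.topEquiv⟩

/-- The groups generated by the `t i` and by the `g i` are isomorphic, if the relation `Q`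
which is preserved by the pairs of generators identifies only the identities with each other. -/
theorem exists_mulEquiv_of_relation (Q : G → H → Prop) (one : Q 1 1)
    (mul : ∀ i x y, Q x y → Q (t i * x) (g i * y)) (h1 : ∀ y, Q 1 y → y = 1)
    (h2 : ∀ x, Q x 1 → x = 1) :
    ∃ f : Subgroup.closure (Set.range t) ≃* Subgroup.closure (Set.range g),
      ∀ i, f ⟨t i, Subgroup.subset_closure ⟨i, rfl⟩⟩ = ⟨g i, Subgroup.subset_closure ⟨i, rfl⟩⟩ := by
  have hQ : ∀ p ∈ pairClosure t g, Q p.1 p.2 := fun p hp =>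
    closure_induction_left_of_finite (Q := fun p : G × H => Q p.1 p.2) one (by
      rintro _ ⟨i, rfl⟩ y h
      exact mul i _ _ h) hp
  let f1 : pairClosure t g →* G := (MonoidHom.fst G H).comp (pairClosure t g).subtype
  let f2 : pairClosure t g →* H := (MonoidHom.snd G H).comp (pairClosure t g).subtype
  have r1 : f1.range = Subgroup.closure (Set.range t) := by
    rw [← map_fst_pairClosure t g, MonoidHom.range_eq_map, ← Subgroup.map_map,
      ← MonoidHom.range_eq_map, Subgroup.range_subtype]
  have r2 : f2.range = Subgroup.closure (Set.range g) := by
    rw [← map_snd_pairClosure t g, MonoidHom.range_eq_map, ← Subgroup.map_map,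
      ← MonoidHom.range_eq_map, Subgroup.range_subtype]
  -- Both projections are injective: the subgroup of pairs is the graph of an isomorphism.
  have i1 : Function.Injective f1 := by
    rw [injective_iff_map_eq_one]
    rintro ⟨⟨x, y⟩, hp⟩ hx
    have hx : x = 1 := hx
    subst hx
    have := h1 y (hQ _ hp)
    subst this
    rfl
  have i2 : Function.Injective f2 := by
    rw [injective_iff_map_eq_one]
    rintro ⟨⟨x, y⟩, hp⟩ hy
    have hy : y = 1 := hy
    subst hy
    have := h2 x (hQ _ hp)
    subst this
    rfl
  let e1 := (MonoidHom.ofInjective i1).trans (MulEquiv.subgroupCongr r1)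
  let e2 := (MonoidHom.ofInjective i2).trans (MulEquiv.subgroupCongr r2)
  refine ⟨e1.symm.trans e2, fun i => ?_⟩
  have hp : (t i, g i) ∈ pairClosure t g := Subgroup.subset_closure ⟨i, rfl⟩
  have : e1 ⟨_, hp⟩ = ⟨t i, Subgroup.subset_closure ⟨i, rfl⟩⟩ := Subtype.ext rfl
  rw [← this, MulEquiv.trans_apply, MulEquiv.symm_apply_apply]
  exact Subtype.ext rfl

end Relations

/-! ### Comparing `T` with another group through a finite list of vectors. -/

section CodedRelations

set_option linter.unusedSectionVars false

variable {A : Type*} [NonUnitalNonAssocCommRing A] [Module (ZMod 5) A]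
  [IsScalarTower (ZMod 5) A A] [SMulCommClass (ZMod 5) A A]
  {φ : LinearMap.BilinForm (ZMod 5) A} {a b c : A} {P : Code4}

/-- A finite list of vectors or tuples of vectors, with a relation on it for every element of `H`,
on which words in the involutions of `a, b, c` and elements of `H` act in the same way. -/
structure CodedAction (P : Code4) {ι H σ : Type*} [Group H] (w : ι → List (Fin 3)) (g : ι → H)
    (S : List σ) (vec : σ → List (List ℕ)) (rel : H → σ → σ → Prop) : Prop where
  digits : ∀ s ∈ S, ∀ v ∈ vec s, IsDigits v
  axes : ∀ k : Fin 3, ∃ s ∈ S, unitVec k ∈ vec s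
  step : ∀ i, ∀ s ∈ S, ∃ s' ∈ S, vec s' = (vec s).map (appWord P (w i)) ∧ rel (g i) s s'
  vec_injective : ∀ s ∈ S, ∀ s' ∈ S, vec s = vec s' → s = s'
  rel_one : ∀ s ∈ S, rel 1 s s
  rel_mul : ∀ h h' s s' s'', rel h s s' → rel h' s' s'' → rel (h' * h) s s''

/-- The relation between elements of `T` and of `H` that is defined by a coded action. -/
def ActsAlike {H σ : Type*} (m : Fin 8 → A) (S : List σ) (vec : σ → List (List ℕ))
    (rel : H → σ → σ → Prop) (t : A ≃ₗ[ZMod 5] A) (h : H) : Prop :=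
  ∀ s ∈ S, ∃ s' ∈ S, (vec s').map (vect m) = (vec s).map (fun v => t (vect m v)) ∧ rel h s s'

variable {ι H σ : Type*} [Group H] {w : ι → List (Fin 3)} {g : ι → H}
  {S : List σ} {vec : σ → List (List ℕ)} {rel : H → σ → σ → Prop}

theorem CodedAction.actsAlike_one (C : CodedAction P w g S vec rel) :
    ActsAlike (monomials a b c) S vec rel 1 (1 : H) :=
  fun s hs => ⟨s, hs, rfl, C.rel_one s hs⟩

theorem CodedAction.actsAlike_mul (C : CodedAction P w g S vec rel) (h : IsTriple φ a b c P)
    (i : ι) (x : A ≃ₗ[ZMod 5] A) (y : H) (hxy : ActsAlike (monomials a b c) S vec rel x y) :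
    ActsAlike (monomials a b c) S vec rel (word a b c (w i) * x) (g i * y) := by
  intro s hs
  obtain ⟨s', hs', e', r'⟩ := hxy s hs
  obtain ⟨s'', hs'', e'', r''⟩ := C.step i s' hs'
  refine ⟨s'', hs'', ?_, C.rel_mul _ _ _ _ _ r' r''⟩
  rw [e'', List.map_map]
  have : (vec s').map (vect (monomials a b c) ∘ appWord P (w i)) =
      ((vec s').map (vect (monomials a b c))).map (word a b c (w i)) := by
    rw [List.map_map]
    refine List.map_congr_left fun v hv => ?_
    exact ((h.word_vect (w i) (C.digits s' hs' v hv)).2).symm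
  rw [this, e', List.map_map]
  rfl

theorem map_vect_injective {m : Fin 8 → A} (li : LinearIndependent (ZMod 5) m) :
    ∀ {l l' : List (List ℕ)}, (∀ v ∈ l, IsDigits v) → (∀ v ∈ l', IsDigits v) →
      l.map (vect m) = l'.map (vect m) → l = l'
  | [], [], _, _, _ => rfl
  | v :: l, v' :: l', h, h', e => by
    rw [List.map_cons, List.map_cons, List.cons.injEq] at e
    rw [List.forall_mem_cons] at h h'
    rw [vect_injective li h.1 h'.1 e.1, map_vect_injective li h.2 h'.2 e.2]
  | [], _ :: _, _, _, e => by simp at e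
  | _ :: _, [], _, _, e => by simp at e

/-- The identity of `T` relates `s` to an entry with the same vectors, and the vectors determine the
entry. -/
theorem CodedAction.fixed_of_actsAlike_one (C : CodedAction P w g S vec rel)
    (li : LinearIndependent (ZMod 5) (monomials a b c)) {y : H}
    (hy : ActsAlike (monomials a b c) S vec rel 1 y) (s : σ) (hs : s ∈ S) : rel y s s := by
  obtain ⟨s', hs', e, r⟩ := hy s hs
  have : vec s' = vec s := map_vect_injective li (C.digits s' hs') (C.digits s hs) e
  rw [C.vec_injective s' hs' s hs this] at r
  exact r

/-- The axes occur among the listed vectors, so an element which fixes all entries fixes `a, b, c`.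
-/
theorem CodedAction.eq_one_of_actsAlike (C : CodedAction P w g S vec rel) (h : IsTriple φ a b c P)
    {x : A ≃ₗ[ZMod 5] A} (hx : x ∈ miyamotoGroup (ZMod 5) a b c) {y : H}
    (hy : ∀ s ∈ S, ∀ s' ∈ S, rel y s s' → s = s')
    (hxy : ActsAlike (monomials a b c) S vec rel x y) : x = 1 := by
  refine h.ext_axes hx (one_mem _) fun k => ?_
  obtain ⟨s, hs, hk⟩ := C.axes k
  obtain ⟨s', hs', e, r⟩ := hxy s hs
  rw [← hy s hs s' hs' r] at e
  rw [axis_eq_vect]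
  exact (List.map_inj_left.1 e _ hk).symm

theorem CodedAction.nonempty_mulEquiv_quotient [Finite H] (C : CodedAction P w g S vec rel)
    (h : IsTriple φ a b c P) (li : LinearIndependent (ZMod 5) (monomials a b c))
    (N : Subgroup H) [N.Normal] (hN : ∀ y, (∀ s ∈ S, rel y s s) → y ∈ N)
    (hN' : ∀ y ∈ N, ∀ s ∈ S, ∀ s' ∈ S, rel y s s' → s = s')
    (gen : Subgroup.closure (Set.range g) ⊔ N = ⊤) :
    Nonempty (Subgroup.closure (Set.range fun i => word a b c (w i)) ≃* H ⧸ N) := by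
  have := h.finite
  refine mulEquiv_of_relation (fun i => word a b c (w i)) g N
    (fun x y => x ∈ miyamotoGroup (ZMod 5) a b c ∧ ActsAlike (monomials a b c) S vec rel x y)
    ⟨one_mem _, C.actsAlike_one⟩
    (fun i x y hxy => ⟨mul_mem (word_mem a b c _) hxy.1, C.actsAlike_mul h i x y hxy.2⟩)
    (fun y hy => hN y (C.fixed_of_actsAlike_one li hy.2))
    (fun x y hy hxy => C.eq_one_of_actsAlike h hxy.1 (hN' y hy) hxy.2) gen

theorem CodedAction.exists_mulEquiv [Finite H] (C : CodedAction P w g S vec rel)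
    (h : IsTriple φ a b c P) (li : LinearIndependent (ZMod 5) (monomials a b c))
    (hN : ∀ y, (∀ s ∈ S, rel y s s) → y = 1)
    (hN' : ∀ s ∈ S, ∀ s' ∈ S, rel 1 s s' → s = s') :
    ∃ f : Subgroup.closure (Set.range fun i => word a b c (w i)) ≃*
      Subgroup.closure (Set.range g),
      ∀ i, f ⟨word a b c (w i), Subgroup.subset_closure ⟨i, rfl⟩⟩ =
        ⟨g i, Subgroup.subset_closure ⟨i, rfl⟩⟩ := by
  have := h.finite
  exact exists_mulEquiv_of_relation (fun i => word a b c (w i)) g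
    (fun x y => x ∈ miyamotoGroup (ZMod 5) a b c ∧ ActsAlike (monomials a b c) S vec rel x y)
    ⟨one_mem _, C.actsAlike_one⟩
    (fun i x y hxy => ⟨mul_mem (word_mem a b c _) hxy.1, C.actsAlike_mul h i x y hxy.2⟩)
    (fun y hy => hN y (C.fixed_of_actsAlike_one li hy.2))
    (fun x hxy => C.eq_one_of_actsAlike h hxy.1 hN' hxy.2)

theorem miyamotoGroup_eq_words (a b c : A) : miyamotoGroup (ZMod 5) a b c =
    Subgroup.closure (Set.range fun i : Fin 3 => word a b c [i]) := by
  rw [miyamotoGroup_eq]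
  simp [word]

end CodedRelations

/-! ### Permutation groups acting on their involutions by conjugation. -/

section Permutations

/-- The `i`-th decimal digit. -/
def digit (s i : ℕ) : ℕ := s / 10 ^ i % 10

/-- The last eight decimal digits. -/
def decVec (s : ℕ) : List ℕ := (List.range 8).map (digit s)

/-- A list of decimal digits as a number. -/
def encVec (v : List ℕ) : ℕ := v.foldr (fun x n => x + 10 * n) 0

/-- The map that is given by the decimal digits of a number. -/
def funOf (n : ℕ) [NeZero n] (s : ℕ) (i : Fin n) : Fin n := Fin.ofNat n (digit s i)

/-- A permutation of order two that is given by decimal digits. -/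
def involutionOf (n : ℕ) [NeZero n] (s : ℕ) (h : ∀ i, funOf n s (funOf n s i) = i) :
    Equiv.Perm (Fin n) := Function.Involutive.toPerm (funOf n s) h

/-- The list `S` consists of vectors, and of maps that correspond to them. The vectors are mapped to
each other under `T` in the same way as the maps under the conjugation by the permutations with the
codes `x`. -/
structure ConjugationList (n : ℕ) [NeZero n] (P : Code4) (x : Fin 3 → ℕ) (S : List ℕ) : Prop where
  digits : ∀ s ∈ S, IsDigits (decVec s)
  axes : ∀ k : Fin 3, ∃ s ∈ S, decVec s = unitVec k
  step : ∀ s ∈ S, ∀ k : Fin 3, ∃ s' ∈ S, decVec s' = app (tauCode P k) (decVec s) ∧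
    ∀ i, funOf n (x k) (funOf n (s / 10 ^ 8) i) = funOf n (s' / 10 ^ 8) (funOf n (x k) i)
  vec_code : ∀ s ∈ S, encVec (decVec s) = s % 10 ^ 8
  map_code : ∀ s ∈ S, ∑ i : Fin n, (funOf n (s / 10 ^ 8) i : ℕ) * 10 ^ (i : ℕ) = s / 10 ^ 8
  nodup_vec : (S.map (· % 10 ^ 8)).Nodup
  nodup_map : (S.map (· / 10 ^ 8)).Nodup
  faithful : ∀ i j : Fin n, i ≠ j → ∃ s ∈ S, funOf n (s / 10 ^ 8) i = i ∧ funOf n (s / 10 ^ 8) j ≠ j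

variable {A : Type*} [NonUnitalNonAssocCommRing A] [Module (ZMod 5) A]
  [IsScalarTower (ZMod 5) A A] [SMulCommClass (ZMod 5) A A]
  {φ : LinearMap.BilinForm (ZMod 5) A} {a b c : A} {P : Code4}

theorem ConjugationList.nonempty_mulEquiv {n : ℕ} [NeZero n] {x : Fin 3 → ℕ} {S : List ℕ}
    (C : ConjugationList n P x S) (hx : ∀ k i, funOf n (x k) (funOf n (x k) i) = i)
    (h : IsTriple φ a b c P) (li : LinearIndependent (ZMod 5) (monomials a b c)) :
    Nonempty (miyamotoGroup (ZMod 5) a b c ≃*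
      Subgroup.closure (Set.range fun k => involutionOf n (x k) (hx k))) := by
  have act : CodedAction P (fun k : Fin 3 => [k]) (fun k => involutionOf n (x k) (hx k)) S
      (fun s => [decVec s])
      (fun (y : Equiv.Perm (Fin n)) s s' => ∀ i, y (funOf n (s / 10 ^ 8) i) =
        funOf n (s' / 10 ^ 8) (y i)) := by
    refine ⟨?_, ?_, ?_, ?_, fun s _ i => rfl, ?_⟩
    · intro s hs v hv
      rw [List.mem_singleton.1 hv]
      exact C.digits s hs
    · intro k
      obtain ⟨s, hs, e⟩ := C.axes k
      exact ⟨s, hs, List.mem_singleton.2 e.symm⟩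
    · intro k s hs
      obtain ⟨s', hs', e, e'⟩ := C.step s hs k
      exact ⟨s', hs', by rw [e]; simp [appWord], e'⟩
    · intro s hs s' hs' e
      refine List.inj_on_of_nodup_map C.nodup_vec hs hs' ?_
      rw [← C.vec_code s hs, ← C.vec_code s' hs', (List.cons.inj e).1]
    · intro y y' s s' s'' r r' i
      rw [Equiv.Perm.mul_apply, r, r', Equiv.Perm.mul_apply]
  -- If `y` commutes with a map that fixes `i`, then this map fixes `y i` as well; by `faithful`
  -- this excludes `y i ≠ i`.
  obtain ⟨f, -⟩ := act.exists_mulEquiv h li (fun y hy => by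
      ext1 i
      by_contra hi
      obtain ⟨s, hs, e, e'⟩ := C.faithful i (y i) (Ne.symm hi)
      have := hy s hs i
      rw [e] at this
      exact e' this.symm)
    (fun s hs s' hs' r => by
      refine List.inj_on_of_nodup_map C.nodup_map hs hs' ?_
      rw [← C.map_code s hs, ← C.map_code s' hs']
      exact Finset.sum_congr rfl fun i _ => by rw [show funOf n (s / 10 ^ 8) i = _ from r i]; rfl)
  exact ⟨(MulEquiv.subgroupCongr (miyamotoGroup_eq_words a b c)).trans f⟩

/-- A group of permutations which contains a cycle of length three and is transitive on triples
contains all even permutations. -/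
theorem alternatingGroup_le_of_transitive {α : Type*} [Fintype α] [DecidableEq α]
    {K : Subgroup (Equiv.Perm α)} {σ : Equiv.Perm α} (hσ : σ ∈ K) (h3 : σ.IsThreeCycle)
    {i j k : α} (hs : σ.support ⊆ {i, j, k})
    (ht : ∀ a b c : α, a ≠ b → a ≠ c → b ≠ c → ∃ g ∈ K, g i = a ∧ g j = b ∧ g k = c) :
    alternatingGroup α ≤ K := by
  rw [← Equiv.Perm.closure_three_cycles_eq_alternating, Subgroup.closure_le]
  intro τ hτ
  obtain ⟨p, hp⟩ := isConj_iff.1 ((Equiv.Perm.isConj_iff_cycleType_eq (σ := σ) (τ := τ)).2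
    (by rw [h3.cycleType, Equiv.Perm.IsThreeCycle.cycleType hτ]))
  have hc : σ.support = {i, j, k} := Finset.eq_of_subset_of_card_le hs
    (by rw [h3.card_support]; exact Finset.card_le_three)
  have c3 : ({i, j, k} : Finset α).card = 3 := by rw [← hc, h3.card_support]
  have ne := Finset.card_eq_three.1 c3
  have hij : i ≠ j := by
    rintro rfl
    have : ({i, i, k} : Finset α).card ≤ 2 := by simpa using Finset.card_le_two (a := i) (b := k)
    omega
  have hik : i ≠ k := by
    rintro rfl
    have : ({i, j, i} : Finset α).card ≤ 2 := by
      rw [Finset.pair_comm j i]; simpa using Finset.card_le_two (a := i) (b := j)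
    omega
  have hjk : j ≠ k := by
    rintro rfl
    have : ({i, j, j} : Finset α).card ≤ 2 := by simpa using Finset.card_le_two (a := i) (b := j)
    omega
  -- The conjugate of `σ` depends only on the values at its three moved points, so the arbitrary `p`
  -- can be replaced by an element `g` of `K`.
  obtain ⟨g, hg, gi, gj, gk⟩ := ht (p i) (p j) (p k) (p.injective.ne hij) (p.injective.ne hik)
    (p.injective.ne hjk)
  have agree : ∀ y ∈ σ.support, g y = p y := fun y hy => by
    rw [hc] at hy
    simp only [Finset.mem_insert, Finset.mem_singleton] at hy
    rcases hy with rfl | rfl | rfl <;> assumption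
  have e : τ = g * σ * g⁻¹ := by
    rw [← hp, eq_mul_inv_iff_mul_eq]
    have : p * σ * p⁻¹ * g = p * σ * (p⁻¹ * g) := by group
    rw [this]
    ext y
    by_cases hy : y ∈ σ.support
    · have e1 : (p⁻¹ * g) y = y := by
        rw [Equiv.Perm.mul_apply, agree y hy]; simp
      rw [Equiv.Perm.mul_apply, e1, Equiv.Perm.mul_apply, Equiv.Perm.mul_apply,
        agree _ (Equiv.Perm.apply_mem_support.2 hy)]
    · have hz : (p⁻¹ * g) y ∉ σ.support := fun hz => by
        have := agree _ hz
        rw [Equiv.Perm.mul_apply] at this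
        have h2 : p (p⁻¹ (g y)) = g y := p.apply_symm_apply _
        rw [h2] at this
        have h3 := g.injective this
        rw [Equiv.Perm.mul_apply, h3] at hz
        exact hy hz
      have e1 : (p * σ * (p⁻¹ * g)) y = p (σ ((p⁻¹ * g) y)) := rfl
      have e2 : (g * σ) y = g (σ y) := rfl
      rw [e1, e2, Equiv.Perm.notMem_support.1 hz, Equiv.Perm.notMem_support.1 hy]
      exact p.apply_symm_apply _
  rw [e]
  exact mul_mem (mul_mem hg hσ) (inv_mem hg)

/-- A list of points, each of which is the image of an earlier one under one of the maps; an entry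
`(k, p)` of the list of steps stands for the image of the point at the place `p` under `f k`. -/
def orbitList {ι β : Type*} (f : ι → β → β) (x : β) : List (ι × ℕ) → List β → List β
  | [], acc => acc
  | s :: l, acc => orbitList f x l (f s.1 (acc.getD s.2 x) :: acc)

theorem orbitList_forall {ι β : Type*} {f : ι → β → β} {x : β} {p : β → Prop} (hx : p x)
    (hf : ∀ k y, p y → p (f k y)) : ∀ (l : List (ι × ℕ)) (acc : List β), (∀ y ∈ acc, p y) →
      ∀ y ∈ orbitList f x l acc, p y
  | [], _, h => h
  | s :: l, acc, h => orbitList_forall hx hf l _ (by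
      rw [List.forall_mem_cons]
      refine ⟨hf _ _ ?_, h⟩
      rcases lt_or_ge s.2 acc.length with h' | h'
      · rw [List.getD_eq_getElem _ _ h']
        exact h _ (List.getElem_mem h')
      · rwa [List.getD_eq_default _ _ h'])

/-- The action on triples of points of a permutation that is given by decimal digits. -/
def mapTriple (n x : ℕ) (y : ℕ × ℕ × ℕ) : ℕ × ℕ × ℕ :=
  (digit x y.1 % n, digit x y.2.1 % n, digit x y.2.2 % n)

/-- `orbitList` proceeds by one generator at a time, so each of its members is the image of the base
triple under a group element. Containing all triples of distinct points, it certifies the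
transitivity. -/
theorem alternatingGroup_le_closure {n r : ℕ} [NeZero n] {x : Fin r → ℕ}
    (hx : ∀ k i, funOf n (x k) (funOf n (x k) i) = i) (w : List (Fin r)) (i j k : Fin n)
    (l : List (Fin r × ℕ))
    (h3 : (w.map fun k => involutionOf n (x k) (hx k)).prod.support.card = 3)
    (hs : (w.map fun k => involutionOf n (x k) (hx k)).prod.support ⊆ {i, j, k})
    (ht : ∀ a b c : Fin n, a ≠ b → a ≠ c → b ≠ c → ((a : ℕ), (b : ℕ), (c : ℕ)) ∈
      orbitList (fun k => mapTriple n (x k)) ((i : ℕ), (j : ℕ), (k : ℕ)) l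
        [((i : ℕ), (j : ℕ), (k : ℕ))]) :
    alternatingGroup (Fin n) ≤
      Subgroup.closure (Set.range fun k => involutionOf n (x k) (hx k)) := by
  refine alternatingGroup_le_of_transitive (list_prod_mem fun y hy => ?_)
    (card_support_eq_three_iff.1 h3) hs fun a b c hab hac hbc => ?_
  · obtain ⟨k, -, rfl⟩ := List.mem_map.1 hy
    exact Subgroup.subset_closure ⟨k, rfl⟩
  · have := orbitList_forall (f := fun k => mapTriple n (x k))
      (x := ((i : ℕ), (j : ℕ), (k : ℕ)))
      (p := fun y => ∃ g ∈ Subgroup.closure (Set.range fun k => involutionOf n (x k) (hx k)),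
        (g i : ℕ) = y.1 ∧ (g j : ℕ) = y.2.1 ∧ (g k : ℕ) = y.2.2)
      ⟨1, one_mem _, rfl, rfl, rfl⟩ (fun m y ⟨g, hg, e1, e2, e3⟩ =>
        ⟨involutionOf n (x m) (hx m) * g, mul_mem (Subgroup.subset_closure ⟨m, rfl⟩) hg, by
          rw [mapTriple, ← e1, ← e2, ← e3]
          exact ⟨rfl, rfl, rfl⟩⟩) l [((i : ℕ), (j : ℕ), (k : ℕ))]
      (by
        intro y hy
        rw [List.mem_singleton.1 hy]
        exact ⟨1, one_mem _, rfl, rfl, rfl⟩) _ (ht a b c hab hac hbc)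
    obtain ⟨g, hg, e1, e2, e3⟩ := this
    exact ⟨g, hg, Fin.ext e1, Fin.ext e2, Fin.ext e3⟩

end Permutations

/-! ### The alternating group on seven points. -/

section a7

/-- The digit at place `i`, counted from the right, is the image of `i`. These are `(0 1)(2 3)`, `(0
4)(5 6)` and `(0 5)(2 4)`. -/
def code_a7 : Fin 3 → ℕ := ![6542301, 5603214, 6023415]

theorem code_a7_involutive : ∀ k i, funOf 7 (code_a7 k) (funOf 7 (code_a7 k) i) = i := by
  decide +kernel

theorem conjugationList_a7 : ConjugationList 7 (0, 1, 3, 0) code_a7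
    [654230100000001, 560321400000010, 602341500000100, 651234000002003, 613425000200303,
      561324000002030, 24351600020130, 456301200020310, 650231400004023, 653412011101423,
      154026340111434, 564320100004032, 54312611011314, 134526004211343, 245361000010000,
      456123004112434, 623451022142102, 652041343033310, 654012304132243, 14325622412434,
      645312034334001, 314625031434022, 345621002030000, 604123511103321, 254163023144313,
      632541034433401, 254061333401244, 653401212023222, 631524023404010, 104326533144144,
      145326043300310, 645021322144311, 651304221331021, 204361521313421, 354620102000003,
      34521623413301, 354601231344003, 614305243332030, 624153042141302, 354612024241004,
      436521044210221, 652143044402134, 645231004030002, 620351433324403, 416325012203210,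
      45321610210240, 154306240024243, 53421633443323, 634501211320024, 650123430140300,
      652340114313342, 426351014302324, 406321540340300, 254360104020003, 124356030400313,
      564021321334014, 152346022411311, 645320101020002, 634512021131440, 351624003430031,
      304621511313240, 654103201423311, 54231641310313, 250361402321442, 564301234222004,
      54123613444123, 612345030434323, 564231000001022, 352641044242210, 653420141241244,
      621354041342231, 214365040011444, 150326442331344, 564312030144303, 563421014310334,
      51324614243244, 624051330044313, 651024334224011, 634520112314312, 645123032401242,
      154236013220243, 564123020410240, 562341041243231, 603421524403321, 253461010344313,
      614235042333313, 630521414013423, 650312420411242, 456320104031022, 610325413223224,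
      624350142222214, 614025332143422, 645301222231002, 153426003013140, 52341603214303,
      456021311214423, 604231514241223, 456231001024032, 350621411403314, 601324541312334,
      251364043430300, 604312520001311, 456312040214444, 234561044221240, 324651011333343] := by
  constructor <;> decide +kernel

/-- The word is the square of `(0 4)(5 6) · (0 1)(2 3)`: there `(5 6)` and `(2 3)` disappear, and a
three-cycle on `0, 1, 4` is left. In the list of steps, places are counted from the most recent
triple. -/
theorem closure_a7 : Subgroup.closure (Set.range fun k => involutionOf 7 (code_a7 k)
    (code_a7_involutive k)) = alternatingGroup (Fin 7) := by
  refine le_antisymm ?_ (alternatingGroup_le_closure code_a7_involutive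
    [1, 0, 1, 0] 0 1 4
    [(0, 0), (1, 1), (2, 2), (1, 2), (2, 3), (0, 3), (2, 4), (0, 4), (1, 5), (0, 5), (2, 6), (0,
      6), (1, 7), (2, 7), (0, 7), (1, 8), (1, 8), (0, 8), (2, 9), (2, 9), (0, 9), (1, 10), (1,
      10), (0, 10), (2, 11), (0, 11), (1, 12), (1, 12), (0, 12), (2, 13), (0, 13), (2, 14), (1,
      14), (2, 15), (0, 15), (1, 16), (0, 16), (1, 17), (1, 17), (0, 17), (2, 18), (0, 18), (2,
      19), (1, 19), (2, 20), (0, 20), (1, 21), (1, 21), (0, 21), (2, 22), (0, 22), (2, 23), (1,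
      23), (2, 24), (0, 24), (1, 25), (1, 25), (2, 26), (0, 26), (1, 27), (0, 27), (2, 28), (0,
      28), (1, 28), (0, 28), (1, 28), (0, 28), (2, 29), (0, 29), (2, 30), (1, 30), (2, 31), (0,
      31), (1, 32), (1, 32), (2, 33), (0, 33), (1, 34), (0, 34), (2, 35), (0, 35), (1, 35), (0,
      35), (1, 34), (2, 35), (0, 35), (1, 35), (1, 35), (0, 35), (2, 36), (0, 36), (1, 36), (0,
      35), (2, 36), (1, 36), (1, 36), (2, 36), (1, 36), (2, 37), (0, 37), (1, 38), (0, 37), (2,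
      38), (1, 36), (2, 37), (0, 37), (1, 36), (0, 36), (2, 37), (0, 37), (1, 37), (0, 36), (2,
      37), (1, 37), (1, 37), (2, 37), (1, 37), (2, 38), (0, 38), (1, 39), (0, 38), (0, 37), (2,
      38), (0, 38), (0, 37), (2, 37), (1, 37), (2, 38), (0, 38), (1, 39), (0, 38), (1, 38), (2,
      39), (0, 39), (0, 39), (2, 39), (0, 39), (2, 39), (0, 39), (0, 38), (1, 38), (2, 39), (0,
      39), (0, 39), (2, 40), (0, 40), (2, 39), (1, 39), (2, 40), (0, 40), (1, 41), (0, 40), (1,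
      40), (2, 41), (0, 41), (0, 41), (2, 41), (0, 41), (2, 41), (0, 41), (0, 40), (1, 40), (2,
      41), (1, 41), (2, 42), (0, 42), (1, 41), (2, 42), (0, 42), (2, 42), (0, 42), (1, 40), (2,
      41), (0, 40), (1, 41), (1, 41), (1, 41), (2, 42), (0, 42), (1, 41), (1, 41), (0, 40), (2,
      41), (1, 41), (1, 41), (1, 41), (2, 42), (0, 42), (2, 40), (0, 40), (1, 38), (2, 39), (0,
      38), (1, 39), (1, 38), (2, 39), (0, 39), (1, 38), (2, 36), (2, 35), (1, 30), (2, 29), (2,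
      26), (2, 21), (2, 18), (1, 16), (2, 15), (1, 7), (1, 3)]
    (by decide +kernel) (by decide +kernel) (by decide +kernel))
  rw [Subgroup.closure_le]
  rintro _ ⟨k, rfl⟩
  rw [SetLike.mem_coe, Equiv.Perm.mem_alternatingGroup]
  revert k
  decide +kernel

end a7

/-! ### The alternating group on six points. -/

section a6

/-- These are `(0 1)(2 3)`, `(0 1)(2 4)` and `(0 3)(4 5)`. -/
def code_a6 : Fin 3 → ℕ := ![542301, 523401, 450213]

theorem code_a6_involutive : ∀ k i, funOf 6 (code_a6 k) (funOf 6 (code_a6 k) i) = i := by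
  decide +kernel

theorem conjugationList_a6 : ConjugationList 6 (3, 3, 4, 0) code_a6
    [54230100000001, 52340100000010, 45021300000100, 53420100002033, 54103200200403,
      24153000020330, 45312000200304, 4123511111301, 51024340131214, 34501204111441,
      20351440113412, 14305240213334, 14025304121333, 50312410223421, 31524011112040,
      50231440231433, 32541010232124, 1324520034000, 51234010322131, 4312502303000,
      34512023041234, 10325433330131, 53412020043000, 23451042014301, 13425030331221,
      53401230011000, 24051331240240, 30521422341400, 52041330313122, 45231003314130,
      2341524204330, 4231520204424, 52143020240424, 45123014112344, 21354034234101,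
      45301241243313, 12345021121100, 14235032044041, 24350113044221, 45320102241424,
      3421533214000, 51304240332124, 34520140323421, 50123410422313, 54012300300101] := by
  constructor <;> decide +kernel

/-- The transposition `(0 1)`, common to the first two generators, cancels in their product; a
three-cycle on `2, 3, 4` is left. -/
theorem closure_a6 : Subgroup.closure (Set.range fun k => involutionOf 6 (code_a6 k)
    (code_a6_involutive k)) = alternatingGroup (Fin 6) := by
  refine le_antisymm ?_ (alternatingGroup_le_closure code_a6_involutive
    [1, 0] 2 3 4
    [(0, 0), (1, 1), (2, 2), (1, 2), (2, 3), (0, 3), (2, 4), (0, 4), (1, 5), (0, 5), (2, 6), (0,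
      6), (1, 7), (2, 7), (0, 7), (1, 8), (1, 8), (2, 9), (0, 9), (2, 9), (0, 9), (1, 10), (1,
      10), (2, 11), (0, 11), (0, 11), (1, 12), (1, 12), (2, 13), (0, 13), (0, 13), (2, 14), (1,
      14), (2, 14), (0, 14), (1, 15), (1, 15), (2, 16), (0, 16), (0, 16), (2, 17), (1, 17), (2,
      17), (1, 17), (2, 18), (0, 18), (0, 18), (2, 19), (1, 19), (2, 19), (2, 19), (0, 19), (1,
      20), (0, 20), (0, 20), (1, 21), (1, 21), (2, 22), (0, 22), (0, 22), (2, 23), (1, 23), (2,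
      23), (1, 22), (0, 22), (0, 22), (1, 23), (0, 23), (2, 24), (1, 24), (2, 24), (2, 24), (0,
      24), (1, 25), (0, 25), (0, 25), (1, 26), (1, 26), (1, 26), (0, 26), (1, 25), (0, 25), (0,
      25), (2, 26), (1, 26), (2, 26), (2, 26), (0, 26), (1, 27), (0, 27), (0, 27), (1, 28), (0,
      28), (1, 27), (0, 27), (1, 26), (0, 26), (1, 25), (1, 25), (0, 25), (0, 22), (0, 22), (2,
      20), (1, 19), (0, 19), (1, 18), (0, 17), (0, 11), (0, 10), (0, 10), (2, 9), (2, 9), (0,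
      9), (0, 9), (0, 8), (2, 6), (2, 6), (0, 6), (2, 3)]
    (by decide +kernel) (by decide +kernel) (by decide +kernel))
  rw [Subgroup.closure_le]
  rintro _ ⟨k, rfl⟩
  rw [SetLike.mem_coe, Equiv.Perm.mem_alternatingGroup]
  revert k
  decide +kernel

end a6

/-! ### Generation of `SL(2, p)` by two transvections. -/

section SpecialLinearTwo

/-- The upper elementary transvection. -/
def upper {R : Type*} [CommRing R] (x : R) : SL(2, R) := ⟨!![1, x; 0, 1], by simp⟩

/-- The lower elementary transvection. -/
def lower {R : Type*} [CommRing R] (x : R) : SL(2, R) := ⟨!![1, 0; x, 1], by simp⟩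

theorem coe_upper {R : Type*} [CommRing R] (x : R) : (upper x).1 = !![1, x; 0, 1] := rfl

theorem coe_lower {R : Type*} [CommRing R] (x : R) : (lower x).1 = !![1, 0; x, 1] := rfl

/-- A subgroup of `SL(2, p)` which contains the two elementary transvections is the whole group. -/
theorem eq_top_of_transvections_mem {p : ℕ} [Fact p.Prime] {K : Subgroup SL(2, ZMod p)}
    (hU : upper 1 ∈ K) (hL : lower 1 ∈ K) : K = ⊤ := by
  have of_eq : ∀ A B : SL(2, ZMod p), B ∈ K → A.1 = B.1 → A ∈ K := fun A B hB e => by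
    rwa [Subtype.ext e]
  have u : ∀ x : ZMod p, upper x ∈ K := fun x => by
    have : ∀ n : ℕ, upper (n : ZMod p) ∈ K := fun n => by
      induction n with
      | zero => exact of_eq _ _ (one_mem K) (by simp [coe_upper, Matrix.one_fin_two])
      | succ n ih => exact of_eq _ _ (mul_mem ih hU) (by simp [coe_upper, add_comm])
    simpa using this x.val
  have l : ∀ x : ZMod p, lower x ∈ K := fun x => by
    have : ∀ n : ℕ, lower (n : ZMod p) ∈ K := fun n => by
      induction n with
      | zero => exact of_eq _ _ (one_mem K) (by simp [coe_lower, Matrix.one_fin_two])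
      | succ n ih => exact of_eq _ _ (mul_mem ih hL) (by simp [coe_lower])
    simpa using this x.val
  -- A matrix whose lower left entry `c` is nonzero is a product upper · lower · upper with the
  -- middle factor `lower c`.
  have key : ∀ A : SL(2, ZMod p), A.1 1 0 ≠ 0 → A ∈ K := fun A hA => by
    have hd := A.2
    rw [Matrix.det_fin_two] at hd
    refine of_eq _ _ (mul_mem (mul_mem (u ((A.1 0 0 - 1) / A.1 1 0)) (l (A.1 1 0)))
      (u ((A.1 1 1 - 1) / A.1 1 0))) ?_
    rw [Matrix.SpecialLinearGroup.coe_mul, Matrix.SpecialLinearGroup.coe_mul, coe_upper, coe_lower,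
      coe_upper]
    ext i j
    fin_cases i <;> fin_cases j <;> simp
    · field_simp
      ring
    · field_simp
      linear_combination -hd
    · field_simp
      ring
  rw [eq_top_iff]
  intro A _
  -- If this entry is zero, the upper left one is not, and a multiplication by `lower 1` moves it
  -- into the lower left place.
  by_cases hA : A.1 1 0 = 0
  · have hd := A.2
    rw [Matrix.det_fin_two, hA, mul_zero, sub_zero] at hd
    have h := mul_mem (inv_mem (l 1)) (key (lower 1 * A) (by
      simp only [Matrix.SpecialLinearGroup.coe_mul, coe_lower, Matrix.mul_apply, Fin.sum_univ_two,
        hA]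
      intro h0
      simp at h0
      rw [h0, zero_mul] at hd
      exact zero_ne_one hd))
    rwa [inv_mul_cancel_left] at h
  · exact key A hA

end SpecialLinearTwo

/-! ### The group `PSL(2, 7)`. -/

section PSL27

/-- The matrix over the field with seven elements that is given by the decimal digits after the
eighth one. -/
def matOf (s : ℕ) : Matrix (Fin 2) (Fin 2) (ZMod 7) :=
  !![(digit s 8 : ZMod 7), (digit s 9 : ZMod 7); (digit s 10 : ZMod 7), (digit s 11 : ZMod 7)]

/-- Elements of `SL(2, 7)` to which the three involutions correspond. -/
def genPSL27 : Fin 3 → SL(2, ZMod 7) :=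
  ![⟨!![0, 1; 6, 0], by decide +kernel⟩, ⟨!![1, 1; 5, 6], by decide +kernel⟩,
    ⟨!![1, 2; 6, 6], by decide +kernel⟩]

/-- The vectors in the orbits of `a, b, c`, and the corresponding elements of `SL(2, 7)`. -/
def listPSL27 : List ℕ :=
  [61000000001, 651100000010, 662100000100, 422300002043, 455300200403, 615100002034,
    565200020430, 626100200304, 521200020340, 463311131430, 441340131234, 23011311403,
    556204311243, 32040113432, 512204113423, 436344224222, 414310422333, 634101242333,
    544200003011, 533200300101, 643100030110]

/-- Elements of `PSL(2, 7)` are matrices up to sign, so conjugates are compared up to sign. -/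
theorem codedAction_psl27 : CodedAction (4, 4, 4, 0) (fun k : Fin 3 => [k]) genPSL27 listPSL27
    (fun s => [decVec s]) (fun y s s' => y.1 * matOf s = matOf s' * y.1 ∨
      y.1 * matOf s = -(matOf s' * y.1)) := by
  have h1 : ∀ s ∈ listPSL27, IsDigits (decVec s) := by decide +kernel
  have h2 : ∀ k : Fin 3, ∃ s ∈ listPSL27, decVec s = unitVec k := by decide +kernel
  have h3 : ∀ k : Fin 3, ∀ s ∈ listPSL27, ∃ s' ∈ listPSL27, decVec s' = app (tauCode (4, 4, 4, 0) k)
      (decVec s) ∧ ((genPSL27 k).1 * matOf s = matOf s' * (genPSL27 k).1 ∨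
      (genPSL27 k).1 * matOf s = -(matOf s' * (genPSL27 k).1)) := by decide +kernel
  have h4 : ∀ s ∈ listPSL27, ∀ s' ∈ listPSL27, decVec s = decVec s' → s = s' := by decide +kernel
  refine ⟨fun s hs v hv => ?_, fun k => ?_, fun k s hs => ?_, fun s hs s' hs' e => ?_,
    fun s _ => Or.inl (by simp), fun y y' s s' s'' r r' => ?_⟩
  · rw [List.mem_singleton.1 hv]
    exact h1 s hs
  · obtain ⟨s, hs, e⟩ := h2 k
    exact ⟨s, hs, List.mem_singleton.2 e.symm⟩
  · obtain ⟨s', hs', e, e'⟩ := h3 k s hs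
    exact ⟨s', hs', by rw [e]; simp [appWord], e'⟩
  · exact h4 s hs s' hs' (List.cons.inj e).1
  · rw [Matrix.SpecialLinearGroup.coe_mul, mul_assoc, ← mul_assoc (matOf s'')]
    rcases r with r | r <;> rcases r' with r' | r' <;> rw [r]
    · exact Or.inl (by rw [← r', mul_assoc])
    · exact Or.inr (by rw [← mul_assoc, r', neg_mul])
    · exact Or.inr (by rw [← r', mul_neg, mul_assoc])
    · exact Or.inl (by rw [mul_neg, ← mul_assoc, r', neg_mul, neg_neg])

/-- Checked over all matrices: commuting up to sign with two of the listed matrices already forces a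
scalar matrix. -/
theorem center_psl27 : ∀ a b c d : ZMod 7, a * d - b * c = 1 →
    (∀ s ∈ [listPSL27.getD 0 0, listPSL27.getD 6 0],
      !![a, b; c, d] * matOf s = matOf s * !![a, b; c, d] ∨
      !![a, b; c, d] * matOf s = -(matOf s * !![a, b; c, d])) → b = 0 ∧ c = 0 ∧ a = d := by
  decide +kernel

theorem mem_center_of_diagonal {F : Type*} [Field F] {A : SL(2, F)} (h1 : A.1 0 1 = 0)
    (h2 : A.1 1 0 = 0) (h3 : A.1 0 0 = A.1 1 1) : A ∈ Subgroup.center SL(2, F) := by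
  rw [Subgroup.mem_center_iff]
  intro B
  ext i j
  fin_cases i <;> fin_cases j <;> simp [Matrix.mul_apply, h1, h2, h3, mul_comm]

theorem closure_psl27 :
    Subgroup.closure (Set.range genPSL27) ⊔ Subgroup.center SL(2, ZMod 7) = ⊤ := by
  have mem : ∀ w : List (Fin 3), (w.map genPSL27).prod ∈
      Subgroup.closure (Set.range genPSL27) ⊔ Subgroup.center SL(2, ZMod 7) := fun w =>
    list_prod_mem fun y hy => by
      obtain ⟨k, -, rfl⟩ := List.mem_map.1 hy
      exact (le_sup_left : Subgroup.closure (Set.range genPSL27) ≤ _)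
        (Subgroup.subset_closure ⟨k, rfl⟩)
  refine eq_top_of_transvections_mem ?_ ?_
  · rw [show (upper 1 : SL(2, ZMod 7)) = ([2, 1, 0, 2, 1, 0].map genPSL27).prod
      from Subtype.ext (by decide +kernel)]
    exact mem _
  · rw [show (lower 1 : SL(2, ZMod 7)) = ([1, 2, 0, 1, 2, 0].map genPSL27).prod
      from Subtype.ext (by decide +kernel)]
    exact mem _

variable {A : Type*} [NonUnitalNonAssocCommRing A] [Module (ZMod 5) A]
  [IsScalarTower (ZMod 5) A A] [SMulCommClass (ZMod 5) A A]
  {φ : LinearMap.BilinForm (ZMod 5) A} {a b c : A}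

theorem nonempty_mulEquiv_psl27 (h : IsTriple φ a b c (4, 4, 4, 0))
    (li : LinearIndependent (ZMod 5) (monomials a b c)) :
    Nonempty (miyamotoGroup (ZMod 5) a b c ≃*
      Matrix.ProjectiveSpecialLinearGroup (Fin 2) (ZMod 7)) := by
  refine (codedAction_psl27.nonempty_mulEquiv_quotient h li (Subgroup.center SL(2, ZMod 7))
    (fun y hy => ?_) (fun y hy s hs s' hs' r => ?_) closure_psl27).map
    (MulEquiv.subgroupCongr (miyamotoGroup_eq_words a b c)).trans
  · have hd := y.2
    rw [Matrix.det_fin_two] at hd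
    have hm : y.1 = !![y.1 0 0, y.1 0 1; y.1 1 0, y.1 1 1] := Matrix.eta_fin_two y.1
    have := center_psl27 _ _ _ _ hd (fun s hs => by
      rw [← hm]
      refine hy s ?_
      revert s
      decide +kernel)
    exact mem_center_of_diagonal this.1 this.2.1 this.2.2
  · have inj : ∀ s ∈ listPSL27, ∀ s' ∈ listPSL27,
        (matOf s = matOf s' ∨ matOf s = -matOf s') → s = s' := by decide +kernel
    -- A central element is a nonzero scalar, which cancels from the relation.
    obtain ⟨r0, -, e⟩ := Matrix.SpecialLinearGroup.mem_center_iff.1 hy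
    have hr : r0 ≠ 0 := by
      rintro rfl
      have := y.2
      rw [← e] at this
      simp at this
    rw [← e] at r
    refine inj s hs s' hs' ?_
    have scal : ∀ M : Matrix (Fin 2) (Fin 2) (ZMod 7), Matrix.scalar (Fin 2) r0 * M = r0 • M :=
      fun M => by rw [Matrix.scalar_apply, ← Matrix.smul_eq_diagonal_mul]
    have comm : ∀ M : Matrix (Fin 2) (Fin 2) (ZMod 7), M * Matrix.scalar (Fin 2) r0 = r0 • M :=
      fun M => by rw [Matrix.scalar_apply, ← Matrix.op_smul_eq_mul_diagonal]; simp
    rw [scal, comm] at r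
    refine r.imp (fun r => smul_right_injective _ hr r) fun r => smul_right_injective _ hr ?_
    simpa using r

end PSL27

/-! ### `T` as a group of conjugations on an eight-dimensional space of matrices. -/

section MatrixActions

set_option linter.unusedSectionVars false

variable {F : Type*} [Field F] [Algebra (ZMod 5) F]

/-- Matrices `M j` on which the conjugations by the matrices `g k` act as the involutions of the
axes act on the monomials. The matrices `D j` are dual to them with
respect to the trace form. -/
structure MatrixAction (P : Code4) (g : Fin 3 → Matrix (Fin 3) (Fin 3) F)
    (M D : Fin 8 → Matrix (Fin 3) (Fin 3) F) : Prop where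
  step : ∀ (k : Fin 3) (j : Fin 8), g k * M j = vect M (unpack ((tauCode P k).getD j 0)) * g k
  dual : ∀ i j, (D i * M j).trace = if i = j then 1 else 0
  single : ∀ p q, p ≠ q → ∑ i, D i q p • M i = Matrix.single p q 1
  axes : ∀ k : Fin 3, M (k.castLE (by norm_num)) = -g k - (2 : ZMod 5) • 1

variable {A : Type*} [NonUnitalNonAssocCommRing A] [Module (ZMod 5) A]
  [IsScalarTower (ZMod 5) A A] [SMulCommClass (ZMod 5) A A]
  {φ : LinearMap.BilinForm (ZMod 5) A} {a b c : A} {P : Code4}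
  {g : Fin 3 → Matrix (Fin 3) (Fin 3) F} {M D : Fin 8 → Matrix (Fin 3) (Fin 3) F}

theorem MatrixAction.linearIndependent (R : MatrixAction P g M D) :
    LinearIndependent (ZMod 5) M := by
  rw [Fintype.linearIndependent_iff]
  intro x hx i
  have h : (D i * ∑ j, x j • M j).trace = 0 := by rw [hx]; simp
  simpa [Finset.mul_sum, Matrix.trace_sum, R.dual] using h

theorem commute_of_mem_span {n : Type*} [Fintype n] [DecidableEq n] {ι : Type*}
    {M : ι → Matrix n n F} {X Y : Matrix n n F} (h : ∀ j, Y * M j = M j * Y)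
    (hX : X ∈ Submodule.span F (Set.range M)) : Y * X = X * Y := by
  induction hX using Submodule.span_induction with
  | mem x hx => obtain ⟨j, rfl⟩ := hx; exact h j
  | zero => simp
  | add x y _ _ hx hy => rw [mul_add, add_mul, hx, hy]
  | smul r x _ hx => rw [mul_smul_comm, smul_mul_assoc, hx]

/-- A finite group of matrices that is generated by three involutions and its center is, modulo the
center, isomorphic to the group `T` if it acts on matrices as `T` acts on the algebra. -/
theorem MatrixAction.nonempty_mulEquiv (R : MatrixAction P g M D) (h : IsTriple φ a b c P)
    (li : LinearIndependent (ZMod 5) (monomials a b c)) {H : Type*} [Group H] [Finite H]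
    (f : H →* Matrix (Fin 3) (Fin 3) F) (hf : Function.Injective f) (x : Fin 3 → H)
    (hx : ∀ k, f (x k) = g k)
    (gen : Subgroup.closure (Set.range x) ⊔ Subgroup.center H = ⊤) :
    Nonempty (miyamotoGroup (ZMod 5) a b c ≃* H ⧸ Subgroup.center H) := by
  have := h.finite
  let B := Module.Basis.mk li h.span.ge
  -- `E` embeds `A` into the matrices and intertwines the involutions with the conjugations by the
  -- `g k`.
  let E : A →ₗ[ZMod 5] Matrix (Fin 3) (Fin 3) F := B.constr (ZMod 5) M
  have hE : ∀ j, E (monomials a b c j) = M j := fun j => by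
    have := B.constr_basis (ZMod 5) M j
    rwa [Module.Basis.mk_apply] at this
  have hEv : ∀ v, E (vect (monomials a b c) v) = vect M v := fun v => by
    simp only [vect, map_sum, map_smul, hE]
  have inj : Function.Injective E := by
    rw [← LinearMap.ker_eq_bot, LinearMap.ker_eq_bot']
    intro y hy
    have hy' : ∑ i, B.repr y i • M i = 0 := by
      rw [← hy]
      exact (B.constr_apply_fintype (ZMod 5) M y).symm
    have := Fintype.linearIndependent_iff.1 R.linearIndependent _ hy'
    rw [← B.sum_repr y]
    simp [this]
  have step : ∀ (k : Fin 3) (y : A), g k * E y = E (word a b c [k] y) * g k := fun k y => by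
    have hm : ∀ j, g k * E (monomials a b c j) = E (word a b c [k] (monomials a b c j)) * g k :=
      fun j => by
        have := (h.hasCode_tau k).map j
        rw [hE, R.step, ← hEv, ← this]
        simp [word]
    rw [← B.sum_repr y]
    simp only [map_sum, map_smul, Finset.mul_sum, Finset.sum_mul, mul_smul_comm, smul_mul_assoc]
    refine Finset.sum_congr rfl fun j _ => ?_
    rw [Module.Basis.mk_apply, hm]
  rw [miyamotoGroup_eq_words]
  refine mulEquiv_of_relation (fun i => word a b c [i]) x (Subgroup.center H)
    (fun s y => s ∈ miyamotoGroup (ZMod 5) a b c ∧ ∀ v, f y * E v = E (s v) * f y)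
    ⟨one_mem _, fun v => by simp⟩
    (fun i s y hs => ⟨mul_mem (word_mem a b c _) hs.1, fun v => ?_⟩) (fun y hy => ?_)
    (fun s y hy hs => ?_) gen
  · rw [map_mul, mul_assoc, hs.2, ← mul_assoc, hx, step, mul_assoc]
    rfl
  · have comm : ∀ j, f y * M j = M j * f y := fun j => by
      rw [← hE]
      exact hy.2 _
    -- Commuting with all `M j` means, by `single`, commuting with the off-diagonal matrix units
    -- over `F`; only scalar matrices do this.
    obtain ⟨r, hr⟩ := Matrix.mem_range_scalar_of_commute_single (M := f y) fun p q hpq =>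
      (commute_of_mem_span comm (by
        rw [← R.single p q hpq]
        exact Submodule.sum_mem _ fun i _ =>
          Submodule.smul_mem _ _ (Submodule.subset_span ⟨i, rfl⟩))).symm
    rw [Subgroup.mem_center_iff]
    intro z
    refine hf ?_
    rw [map_mul, map_mul, ← hr]
    exact (Matrix.scalar_commute r (fun _ => Commute.all _ _) _).symm
  · refine h.ext_axes hs.1 (one_mem _) fun k => inj ?_
    -- An axis corresponds to `-g k - 2`, so whatever commutes with `g k` commutes with the matrix
    -- of the axis.
    have hk : E (![a, b, c] k) = -g k - (2 : ZMod 5) • 1 := by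
      rw [← R.axes k, ← hE]
      fin_cases k <;> rfl
    have hc : f y * g k = g k * f y := by
      rw [← hx, ← map_mul, ← map_mul, Subgroup.mem_center_iff.1 hy]
    have e := hs.2 (![a, b, c] k)
    have hu : f y⁻¹ * f y = 1 := by rw [← map_mul, inv_mul_cancel, map_one]
    have hu' := mul_eq_one_comm.1 hu
    have e' : f y * E (![a, b, c] k) = E (![a, b, c] k) * f y := by
      rw [hk, mul_sub, sub_mul, mul_neg, neg_mul, hc, mul_smul_comm, smul_mul_assoc, mul_one,
        one_mul]
    rw [e'] at e
    have := congrArg (· * f y⁻¹) e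
    simp only [mul_assoc, hu', mul_one] at this
    exact this.symm

end MatrixActions

/-! ### Generation of special linear groups by transvections and diagonal matrices. -/

section Transvections

/-- A subgroup of `SL(n, F)` that contains the elementary transvections and the diagonal matrices
is the whole group. -/
theorem eq_top_of_transvection_of_diagonal {n : Type*} [Fintype n] [DecidableEq n] {F : Type*}
    [Field F] {K : Subgroup (Matrix.SpecialLinearGroup n F)}
    (ht : ∀ y : Matrix.SpecialLinearGroup n F,
      (∃ i j x, i ≠ j ∧ y.1 = Matrix.transvection i j x) → y ∈ K)
    (hd : ∀ y : Matrix.SpecialLinearGroup n F, (∃ d, y.1 = Matrix.diagonal d) → y ∈ K) :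
    K = ⊤ := by
  have hL : ∀ L : List (Matrix.TransvectionStruct n F), ∃ y ∈ K,
      y.1 = (L.map Matrix.TransvectionStruct.toMatrix).prod := fun L => by
    induction L with
    | nil => exact ⟨1, one_mem K, rfl⟩
    | cons t L ih =>
      obtain ⟨y, hy, e⟩ := ih
      have hz : ∃ z ∈ K, z.1 = t.toMatrix :=
        ⟨⟨t.toMatrix, t.det⟩, ht _ ⟨t.i, t.j, t.c, t.hij, rfl⟩, rfl⟩
      obtain ⟨z, hz, ez⟩ := hz
      exact ⟨z * y, mul_mem hz hy, by
        rw [Matrix.SpecialLinearGroup.coe_mul, e, ez, List.map_cons, List.prod_cons]⟩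
  rw [eq_top_iff]
  intro y _
  -- Gaussian elimination: a diagonal matrix between two products of transvections.
  obtain ⟨L, L', d, e⟩ := Matrix.Pivot.exists_list_transvec_mul_diagonal_mul_list_transvec y.1
  obtain ⟨u, hu, eu⟩ := hL L
  obtain ⟨v, hv, ev⟩ := hL L'
  have key : u⁻¹ * y * v⁻¹ ∈ K := by
    refine hd _ ⟨d, ?_⟩
    have h1 : (u⁻¹).1 * u.1 = 1 := congrArg Subtype.val (inv_mul_cancel u)
    have h2 : v.1 * (v⁻¹).1 = 1 := congrArg Subtype.val (mul_inv_cancel v)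
    rw [Matrix.SpecialLinearGroup.coe_mul, Matrix.SpecialLinearGroup.coe_mul, e, ← eu, ← ev,
      mul_assoc, mul_assoc, h2, mul_one, ← mul_assoc, h1, one_mul]
  have := mul_mem (mul_mem hu key) hv
  simpa [mul_assoc] using this

end Transvections

/-! ### The group `PSL(3, 5)`. -/

section PSL35

/-- Elements of `SL(3, 5)` to which the three involutions correspond. -/
def genPSL35 : Fin 3 → SL(3, ZMod 5) := fun k =>
  ⟨(![!![1, 0, 0; 0, 4, 0; 0, 0, 4], !![3, 4, 3; 1, 0, 2; 1, 1, 1],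
    !![3, 1, 1; 4, 0, 1; 3, 2, 1]] :
    Fin 3 → Matrix (Fin 3) (Fin 3) (ZMod 5)) k, by revert k; decide +kernel⟩

/-- The matrices that correspond to the eight monomials. -/
def monomialPSL35 : Fin 8 → Matrix (Fin 3) (Fin 3) (ZMod 5) :=
  ![!![2, 0, 0; 0, 4, 0; 0, 0, 4], !![0, 1, 2; 4, 3, 3; 4, 4, 2],
    !![0, 4, 4; 1, 3, 4; 2, 3, 2], !![0, 3, 1; 2, 2, 2; 2, 1, 3],
    !![1, 1, 4; 1, 0, 4; 4, 4, 4], !![0, 2, 2; 3, 2, 1; 1, 2, 3],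
    !![1, 3, 2; 3, 4, 1; 2, 1, 0], !![2, 0, 1; 2, 3, 2; 2, 2, 0]]

/-- The matrices dual to the previous ones. -/
def dualPSL35 : Fin 8 → Matrix (Fin 3) (Fin 3) (ZMod 5) :=
  ![!![2, 3, 0; 3, 2, 1; 0, 1, 1], !![0, 0, 1; 4, 3, 0; 3, 3, 2],
    !![0, 4, 3; 0, 3, 3; 1, 0, 2], !![0, 0, 1; 4, 4, 0; 3, 4, 1],
    !![0, 2, 0; 2, 1, 2; 0, 2, 4], !![0, 4, 3; 0, 4, 4; 1, 0, 1],
    !![0, 3, 1; 1, 3, 1; 4, 1, 2], !![0, 2, 2; 3, 0, 0; 3, 0, 0]]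

theorem matrixAction_psl35 : MatrixAction (0, 0, 0, 3) (fun k => (genPSL35 k).1)
    monomialPSL35 dualPSL35 where
  step := by decide +kernel
  dual := by decide +kernel
  single := by decide +kernel
  axes := by decide +kernel

/-- Words in the generators that are elementary transvections. -/
def transvectionWords : Fin 3 → Fin 3 → List (Fin 3) :=
  ![![[],
      [0, 2, 0, 1, 0, 2, 1, 2, 1, 2, 0, 1, 0, 2],
      [0, 1, 0, 2, 0, 1, 0, 1, 0, 2, 0, 1]],
    ![[1, 0, 2, 0, 1, 2, 1, 2, 1, 0, 2, 0, 1, 0],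
      [],
      [1, 0, 1, 2, 1, 0, 2, 1, 2, 1, 2, 0, 1, 2, 1, 2, 0, 1]],
    ![[2, 0, 1, 0, 2, 0, 2, 0, 1, 0, 2, 0],
      [2, 0, 1, 2, 1, 2, 0, 1, 2, 1, 2, 1, 0, 2, 1, 2, 0, 2],
      []]]

/-- Words in the generators that are diagonal matrices. -/
def diagonalWords : Fin 2 → List (Fin 3) :=
  ![[1, 0, 1, 0, 2, 0, 2, 1, 0, 1, 0, 2, 0, 2, 0],
    [2, 1, 0, 1, 0, 2, 1, 2, 0, 1, 2, 0, 1, 0, 1, 0, 2, 0, 1, 0, 1]]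

theorem prod_transvectionWords : ∀ i j, i ≠ j →
    ((transvectionWords i j).map fun k => (genPSL35 k).1).prod = Matrix.transvection i j 1 := by
  decide +kernel

theorem prod_diagonalWords : ∀ i,
    ((diagonalWords i).map fun k => (genPSL35 k).1).prod =
      Matrix.diagonal ((![![2, 3, 1], ![1, 2, 3]] : Fin 2 → Fin 3 → ZMod 5) i) := by
  decide +kernel

/-- Powers of the words for elementary transvections give all transvections. The matrices `diag(2,
3, 1)` and `diag(1, 2, 3)` generate the diagonal ones of determinant `1`, because `2` and `3` are
primitive modulo `5`. -/
theorem closure_psl35 : Subgroup.closure (Set.range genPSL35) = ⊤ := by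
  have coe : ∀ w : List (Fin 3), ((w.map genPSL35).prod).1 =
      (w.map fun k => (genPSL35 k).1).prod := fun w => by
    induction w with
    | nil => rfl
    | cons k w ih =>
      rw [List.map_cons, List.map_cons, List.prod_cons, List.prod_cons,
        Matrix.SpecialLinearGroup.coe_mul, ih]
  have mem : ∀ w : List (Fin 3), (w.map genPSL35).prod ∈
      Subgroup.closure (Set.range genPSL35) := fun w =>
    list_prod_mem fun y hy => by
      obtain ⟨k, -, rfl⟩ := List.mem_map.1 hy
      exact Subgroup.subset_closure ⟨k, rfl⟩
  refine eq_top_of_transvection_of_diagonal ?_ ?_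
  · rintro y ⟨i, j, x, hij, hy⟩
    have h : ((transvectionWords i j).map genPSL35).prod.1 = Matrix.transvection i j 1 := by
      rw [coe, prod_transvectionWords i j hij]
    have : ∀ n : ℕ, (((transvectionWords i j).map genPSL35).prod ^ n).1 =
        Matrix.transvection i j (n : ZMod 5) := fun n => by
      induction n with
      | zero => simp
      | succ n ih =>
        rw [pow_succ, Matrix.SpecialLinearGroup.coe_mul, ih, h,
          Matrix.transvection_mul_transvection_same i j hij, Nat.cast_succ]
    have e : y = ((transvectionWords i j).map genPSL35).prod ^ x.val :=
      Subtype.ext (by rw [this, hy, ZMod.natCast_zmod_val])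
    rw [e]
    exact pow_mem (mem _) _
  · rintro y ⟨d, hy⟩
    have hd := y.2
    rw [hy, Matrix.det_diagonal] at hd
    have key : ∀ d : Fin 3 → ZMod 5, ∏ k, d k = 1 → ∃ i j : Fin 4,
        d = (![2, 3, 1] : Fin 3 → ZMod 5) ^ (i : ℕ) * (![1, 2, 3] : Fin 3 → ZMod 5) ^ (j : ℕ) := by
      decide +kernel
    obtain ⟨i, j, e⟩ := key d hd
    have e : y = ((diagonalWords 0).map genPSL35).prod ^ (i : ℕ) *
        ((diagonalWords 1).map genPSL35).prod ^ (j : ℕ) := Subtype.ext (by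
      rw [Matrix.SpecialLinearGroup.coe_mul, Matrix.SpecialLinearGroup.coe_pow,
        Matrix.SpecialLinearGroup.coe_pow, coe, coe, prod_diagonalWords, prod_diagonalWords,
        Matrix.diagonal_pow, Matrix.diagonal_pow, Matrix.diagonal_mul_diagonal, hy, e]
      rfl)
    rw [e]
    exact mul_mem (pow_mem (mem _) _) (pow_mem (mem _) _)

variable {A : Type*} [NonUnitalNonAssocCommRing A] [Module (ZMod 5) A]
  [IsScalarTower (ZMod 5) A A] [SMulCommClass (ZMod 5) A A]
  {φ : LinearMap.BilinForm (ZMod 5) A} {a b c : A}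

theorem nonempty_mulEquiv_psl35 (h : IsTriple φ a b c (0, 0, 0, 3))
    (li : LinearIndependent (ZMod 5) (monomials a b c)) :
    Nonempty (miyamotoGroup (ZMod 5) a b c ≃*
      Matrix.ProjectiveSpecialLinearGroup (Fin 3) (ZMod 5)) :=
  matrixAction_psl35.nonempty_mulEquiv h li Matrix.SpecialLinearGroup.coeMonoidHom
    Subtype.val_injective genPSL35 (fun _ => rfl) (by rw [closure_psl35, top_sup_eq])

end PSL35

/-! ### A computable field with 25 elements. -/

section FieldWith25Elements

/-- `2` is not a square modulo `5`, which makes the quadratic algebra a field. -/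
instance fact_two_nonsquare : Fact (∀ r : ZMod 5, r ^ 2 ≠ 2 + 0 * r) := ⟨by decide⟩

/-- The field with `25` elements as the quadratic extension by a square root of `2`. -/
abbrev K25 : Type := QuadraticAlgebra (ZMod 5) 2 0

instance fintype_K25 : Fintype K25 := Fintype.ofEquiv _ (QuadraticAlgebra.equivProd 2 0).symm

theorem K25.forall {p : K25 → Prop} (h : ∀ x y : ZMod 5, p ⟨x, y⟩) (z : K25) : p z := h z.re z.im

/-- Identifies the Frobenius map, through which `SU35` is defined, with the conjugation of the
quadratic extension. -/
theorem K25.pow_five : ∀ z : K25, z ^ 5 = star z := K25.forall (by decide +kernel)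

theorem exists_ringEquiv_K25 : Nonempty (F25 ≃+* K25) := by
  have : Fintype F25 := Fintype.ofFinite _
  refine ⟨FiniteField.ringEquivOfCardEq ?_⟩
  rw [← Nat.card_eq_fintype_card, GaloisField.card 5 2 (by norm_num),
    Fintype.card_congr (QuadraticAlgebra.equivProd 2 0)]
  simp [ZMod.card]

end FieldWith25Elements

/-! ### Unitary matrices for `PSU(3, 5)`. -/

section PSU35

/-- The matrix over the field with `25` elements with the given decimal digits. -/
def mat25 (s : ℕ) : Matrix (Fin 3) (Fin 3) K25 :=
  Matrix.of fun i j => ⟨digit s (6 * i + 2 * j), digit s (6 * i + 2 * j + 1)⟩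

/-- The matrix of the hermitian form. -/
def formJ {F : Type*} [Field F] : Matrix (Fin 3) (Fin 3) F := !![0, 0, 1; 0, 1, 0; 1, 0, 0]

/-- Unitary matrices to which the three involutions correspond. -/
def genPSU35 (k : Fin 3) : Matrix (Fin 3) (Fin 3) K25 :=
  mat25 ((![1000400010000, 400003000400030010, 121104240041033442] : Fin 3 → ℕ) k)

/-- The matrices that correspond to the eight monomials. -/
def monomialPSU35 (j : Fin 8) : Matrix (Fin 3) (Fin 3) K25 := mat25 <|
  [30004000400040003, 130002000400020043, 414401310314022111, 320003000100030022,
    343400230224033324, 243102040221000434, 404001110010004110, 1304400043031000].getD j 0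

/-- The matrices dual to the previous ones. -/
def dualPSU35 (j : Fin 8) : Matrix (Fin 3) (Fin 3) K25 := mat25 <|
  [33103140421004403, 130301000403030043, 1302230043033300, 140100020201020244,
    1402010044030100, 4302030013030300, 104320001012200, 1304430043011300].getD j 0

theorem matrixAction_psu35 : MatrixAction (0, 0, 0, 4) genPSU35 monomialPSU35 dualPSU35 where
  step := by decide +kernel
  dual := by decide +kernel
  single := by decide +kernel
  axes := by decide +kernel

theorem unitary_genPSU35 (k : Fin 3) : genPSU35 k * formJ * (genPSU35 k).conjTranspose = formJ ∧
    (genPSU35 k).det = 1 := by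
  revert k
  decide +kernel

/-- The upper unitriangular matrices. -/
def unipotent {F : Type*} [Field F] [StarRing F] (a b : F) : Matrix (Fin 3) (Fin 3) F :=
  !![1, a, b; 0, 1, -star a; 0, 0, 1]

/-- The diagonal matrices in the unitary group. -/
def torus {F : Type*} [Field F] [StarRing F] (t : F) : Matrix (Fin 3) (Fin 3) F :=
  !![t, 0, 0; 0, star t * t⁻¹, 0; 0, 0, (star t)⁻¹]

/-- Words in the generators. -/
def unitaryWords : Fin 5 → List (Fin 3) :=
  ![[0, 1, 0, 1, 2, 1, 0, 2, 0, 1, 2, 0, 1],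
    [0, 2, 0, 2, 1, 0, 2, 1, 2, 1, 2, 0, 1, 2, 0, 2, 1, 0, 1, 0, 1],
    [2, 0, 1, 2, 0, 1, 2, 1, 2, 0, 1, 0, 2, 1, 2, 1, 0, 2, 0, 2, 1, 0, 1, 2, 0],
    [0, 1, 2, 0, 2, 0, 1, 2, 0, 1, 0, 2, 1, 0, 1, 0, 2, 1, 2, 1, 0],
    [1, 0, 1, 0, 1]]

/-- These five elements are the ones that `unitary_induction_K25` requires. -/
theorem prod_unitaryWords : ∀ i, ((unitaryWords i).map genPSU35).prod =
    (![unipotent 1 2, unipotent ⟨0, 1⟩ 1, unipotent 0 ⟨0, 1⟩, torus ⟨2, 1⟩, -formJ] :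
      Fin 5 → Matrix (Fin 3) (Fin 3) K25) i := by
  decide +kernel

end PSU35

/-! ### Generation of the special unitary group by unipotents, a torus and a Weyl element. -/

section UnitaryGeneration

variable {F : Type*} [Field F] [StarRing F]

theorem unipotent_mul (a b a' b' : F) :
    unipotent a b * unipotent a' b' = unipotent (a + a') (b + b' - a * star a') := by
  ext i j
  fin_cases i <;> fin_cases j <;> simp [unipotent, Matrix.mul_apply, Fin.sum_univ_three] <;> ring

theorem unipotent_zero : unipotent (0 : F) 0 = 1 := by
  ext i j
  fin_cases i <;> fin_cases j <;> simp [unipotent]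

theorem torus_mul (s t : F) : torus s * torus t = torus (s * t) := by
  ext i j
  fin_cases i <;> fin_cases j <;> simp [torus, Matrix.mul_apply, Fin.sum_univ_three] <;> ring

omit [StarRing F] in
theorem formJ_mul (X : Matrix (Fin 3) (Fin 3) F) (i j : Fin 3) :
    ((formJ : Matrix (Fin 3) (Fin 3) F) * X) i j = X i.rev j := by
  fin_cases i <;> simp [formJ, Matrix.mul_apply, Fin.sum_univ_three]

theorem unipotent_unitary {a b : F} (h : b + star b + a * star a = 0) :
    (unipotent a b).conjTranspose * formJ * unipotent a b = formJ := by
  have e : formJ * unipotent a b = !![0, 0, 1; 0, 1, -star a; 1, a, b] := by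
    ext i j
    rw [formJ_mul]
    fin_cases i <;> fin_cases j <;> simp [unipotent, Fin.rev]
  rw [mul_assoc, e]
  ext i j
  fin_cases i <;> fin_cases j <;> simp [unipotent, formJ, Matrix.mul_apply, Fin.sum_univ_three]
  linear_combination h

theorem weyl_unitary : (-formJ : Matrix (Fin 3) (Fin 3) F).conjTranspose * formJ * (-formJ) =
    formJ := by
  have e : formJ * (-formJ : Matrix (Fin 3) (Fin 3) F) = -1 := by
    ext i j
    rw [formJ_mul]
    fin_cases i <;> fin_cases j <;> simp [formJ]
  rw [mul_assoc, e, mul_neg, mul_one, Matrix.conjTranspose_neg, neg_neg]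
  ext i j
  fin_cases i <;> fin_cases j <;> simp [formJ]

theorem torus_unitary {t : F} (ht : t ≠ 0) :
    (torus t).conjTranspose * formJ * torus t = formJ := by
  have hs : star t ≠ 0 := star_ne_zero.2 ht
  have e : formJ * torus t = !![0, 0, (star t)⁻¹; 0, star t * t⁻¹, 0; t, 0, 0] := by
    ext i j
    rw [formJ_mul]
    fin_cases i <;> fin_cases j <;> simp [torus, Fin.rev]
  rw [mul_assoc, e]
  ext i j
  fin_cases i <;> fin_cases j <;>
    simp [torus, formJ, Matrix.mul_apply, Fin.sum_univ_three, star_inv₀, ht, hs]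
  field_simp

theorem det_torus {t : F} (ht : t ≠ 0) : (torus t).det = 1 := by
  have hs : star t ≠ 0 := star_ne_zero.2 ht
  rw [Matrix.det_fin_three]
  simp [torus]
  field_simp

theorem torus_one : torus (1 : F) = 1 := by
  ext i j
  fin_cases i <;> fin_cases j <;> simp [torus]

/-- With the first column equal to the first unit vector, the first row of `X* J X = J` determines
the last row of `X`, the determinant then gives the middle entry, and the last column of the
equation gives the rest. -/
theorem eq_unipotent_of_unitary {X : Matrix (Fin 3) (Fin 3) F}
    (hX : X.conjTranspose * formJ * X = formJ) (hd : X.det = 1) (e0 : X 0 0 = 1) (e1 : X 1 0 = 0)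
    (e2 : X 2 0 = 0) : X = unipotent (X 0 1) (X 0 2) ∧
      X 0 2 + star (X 0 2) + X 0 1 * star (X 0 1) = 0 := by
  have hX' : ∀ i j, star (X 0 i) * X 2 j + star (X 1 i) * X 1 j + star (X 2 i) * X 0 j =
      (formJ : Matrix (Fin 3) (Fin 3) F) i j := fun i j => by
    rw [← hX, mul_assoc, Matrix.mul_apply, Fin.sum_univ_three, formJ_mul, formJ_mul, formJ_mul]
    rfl
  have c1 : X 2 1 = 0 := by simpa [formJ, e0, e1, e2] using hX' 0 1
  have c2 : X 2 2 = 1 := by simpa [formJ, e0, e1, e2] using hX' 0 2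
  have d1 : X 1 1 = 1 := by
    rw [Matrix.det_fin_three] at hd
    simpa [e0, e1, e2, c1, c2] using hd
  have c3 : star (X 0 1) + X 1 2 = 0 := by simpa [formJ, c1, c2, d1] using hX' 1 2
  have c4 := hX' 2 2
  have h12 : X 1 2 = -star (X 0 1) := by linear_combination c3
  refine ⟨?_, ?_⟩
  · ext i j
    fin_cases i <;> fin_cases j <;> simp [unipotent, e0, e1, e2, c1, c2, d1, h12]
  · simp [h12, c2, formJ] at c4
    linear_combination c4

theorem unitary_mul {X Z : Matrix (Fin 3) (Fin 3) F} (hX : X.conjTranspose * formJ * X = formJ)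
    (hZ : Z.conjTranspose * formJ * Z = formJ) :
    (X * Z).conjTranspose * formJ * (X * Z) = formJ := by
  rw [Matrix.conjTranspose_mul]
  calc _ = Z.conjTranspose * (X.conjTranspose * formJ * X) * Z := by simp only [mul_assoc]
    _ = formJ := by rw [hX, hZ]

/-- A group of unitary matrices contains all of them if it contains the unipotent elements, the
elements of the torus, and the element of the Weyl group. -/
theorem unitary_induction {p : Matrix (Fin 3) (Fin 3) F → Prop}
    (cancel : ∀ X Y, p X → p (X * Y) → p Y)
    (uni : ∀ a b : F, b + star b + a * star a = 0 → p (unipotent a b))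
    (tor : ∀ t : F, t ≠ 0 → p (torus t)) (weyl : p (-formJ)) {Y : Matrix (Fin 3) (Fin 3) F}
    (hY : Y.conjTranspose * formJ * Y = formJ) (hd : Y.det = 1) : p Y := by
  have tri : ∀ X : Matrix (Fin 3) (Fin 3) F, X.conjTranspose * formJ * X = formJ → X.det = 1 →
      X 1 0 = 0 → X 2 0 = 0 → p X := fun X hX hd e1 e2 => by
    have e0 : X 0 0 ≠ 0 := fun e0 => by
      rw [Matrix.det_fin_three] at hd
      simp [e0, e1, e2] at hd
    -- A matrix that stabilizes the first coordinate line becomes unipotent after multiplication by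
    -- a torus element.
    refine cancel (torus (X 0 0)⁻¹) _ (tor _ (inv_ne_zero e0)) ?_
    have h := eq_unipotent_of_unitary (unitary_mul (torus_unitary (inv_ne_zero e0)) hX)
      (by rw [Matrix.det_mul, hd, mul_one, det_torus (inv_ne_zero e0)])
      (by simp [torus, Matrix.mul_apply, Fin.sum_univ_three, e0, e1, e2])
      (by simp [torus, Matrix.mul_apply, Fin.sum_univ_three, e1, e2])
      (by simp [torus, Matrix.mul_apply, Fin.sum_univ_three, e1, e2])
    rw [h.1]
    exact uni _ _ h.2
  have h00 : star (Y 0 0) * Y 2 0 + star (Y 1 0) * Y 1 0 + star (Y 2 0) * Y 0 0 = 0 := by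
    have : (formJ : Matrix (Fin 3) (Fin 3) F) 0 0 = 0 := rfl
    rw [← this, ← hY, mul_assoc, Matrix.mul_apply, Fin.sum_univ_three, formJ_mul, formJ_mul,
      formJ_mul]
    rfl
  by_cases hz : Y 2 0 = 0
  · refine tri Y hY hd ?_ hz
    simpa [hz] using h00
  · have hs : star (Y 2 0) ≠ 0 := star_ne_zero.2 hz
    -- With these `a` and `b`, the first column of `unipotent a b * Y` is `(0, 0, Y 2 0)`, and the
    -- Weyl element moves its nonzero entry to the top. The unitary condition on `a, b` is the
    -- isotropy of the first column of `Y`.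
    obtain ⟨a, ha⟩ : ∃ a, a = star (Y 1 0) / star (Y 2 0) := ⟨_, rfl⟩
    obtain ⟨b, hb⟩ : ∃ b, b = -(Y 0 0 + a * Y 1 0) / Y 2 0 := ⟨_, rfl⟩
    have hab : b + star b + a * star a = 0 := by
      rw [hb, ha]
      simp only [star_neg, star_add, star_div₀, star_mul', star_star]
      field_simp
      linear_combination -h00
    have col : ∀ i : Fin 3, ((-formJ : Matrix (Fin 3) (Fin 3) F) * (unipotent a b * Y)) i 0 =
        -(unipotent a b * Y) i.rev 0 := fun i => by
      rw [neg_mul, Matrix.neg_apply, formJ_mul]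
    refine cancel _ _ (uni a b hab) (cancel _ _ weyl (tri _
      (unitary_mul weyl_unitary (unitary_mul (unipotent_unitary hab) hY)) ?_ ?_ ?_))
    · rw [Matrix.det_mul, Matrix.det_mul, hd, mul_one]
      have e1 : (-formJ : Matrix (Fin 3) (Fin 3) F).det = 1 := by
        rw [Matrix.det_fin_three]
        simp [formJ]
      rw [e1, one_mul, Matrix.det_fin_three]
      simp [unipotent]
    · rw [col, Matrix.mul_apply, Fin.sum_univ_three]
      have : star a = Y 1 0 / Y 2 0 := by rw [ha, star_div₀, star_star, star_star]
      simp [unipotent, this, Fin.rev]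
      field_simp
      ring
    · rw [col, Matrix.mul_apply, Fin.sum_univ_three]
      simp [unipotent, hb, Fin.rev]
      field_simp
      ring

/-- The cross term contributes `2 n b` in each step, and `n² + 2n + 1 = (n + 1)²`. -/
theorem unipotent_pow {a b : F} (hb : -(a * star a) = 2 * b) (n : ℕ) :
    unipotent a b ^ n = unipotent (n * a) (n ^ 2 * b) := by
  induction n with
  | zero => simp [unipotent_zero]
  | succ n ih =>
    rw [pow_succ, ih, unipotent_mul, mul_assoc, Nat.cast_succ, sub_eq_add_neg, ← mul_neg, hb]
    congr 1 <;> ring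

theorem unipotent_zero_pow (b : F) (n : ℕ) : unipotent 0 b ^ n = unipotent 0 (n * b) := by
  induction n with
  | zero => simp [unipotent_zero]
  | succ n ih =>
    rw [pow_succ, ih, unipotent_mul, Nat.cast_succ, zero_mul, sub_zero, add_zero, add_mul, one_mul]

theorem torus_pow (t : F) (n : ℕ) : torus t ^ n = torus (t ^ n) := by
  induction n with
  | zero => simp [torus_one]
  | succ n ih => rw [pow_succ, ih, torus_mul, pow_succ]

theorem K25.natCast_val (x : ZMod 5) : (x.val : K25) = ⟨x, 0⟩ := by
  revert x
  decide +kernel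

/-- `2 + √2` generates the multiplicative group, which is cyclic of order `24`. -/
theorem K25.exists_pow {z : K25} (hz : z ≠ 0) : ∃ k : ℕ, (⟨2, 1⟩ : K25) ^ k = z := by
  have e : ∀ x y : ZMod 5, (⟨x, y⟩ : K25) ≠ 0 → ∃ k : Fin 24, (⟨2, 1⟩ : K25) ^ (k : ℕ) = ⟨x, y⟩ := by
    decide +kernel
  obtain ⟨k, hk⟩ := e z.re z.im hz
  exact ⟨k, hk⟩

/-- The pair `(a, b)` is reached by powers of the unipotents for `(1, 2)`, `(√2, 1)` and `(0, √2)`.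
The first two powers produce `a`; the real part of `b` is then forced by the unitary condition, and
the third power corrects its imaginary part. -/
theorem K25.decomposition (a b : K25) (h : b + star b + a * star a = 0) :
    a.re.val * 1 + a.im.val * (⟨0, 1⟩ : K25) = a ∧
      a.re.val ^ 2 * 2 + a.im.val ^ 2 * 1 -
        (a.re.val * 1) * star ((a.im.val : K25) * (⟨0, 1⟩ : K25)) +
      (b.im - a.re * a.im).val * (⟨0, 1⟩ : K25) = b := by
  obtain ⟨x, y⟩ := a
  obtain ⟨z, w⟩ := b
  have two : (2 : K25) = ⟨2, 0⟩ := rfl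
  simp only [K25.natCast_val, two]
  have hre := congrArg QuadraticAlgebra.re h
  have key : ∀ x y z : ZMod 5, z + z + (x * x + -(2 * y * y)) = 0 → x ^ 2 * 2 + y ^ 2 = z := by
    decide +kernel
  have := key x y z (by simpa using hre)
  refine ⟨QuadraticAlgebra.ext (by simp) (by simp), QuadraticAlgebra.ext ?_ ?_⟩
  · rw [← this]
    simp [pow_two]
  · simp [pow_two]

/-- A group of matrices over the field with `25` elements contains all special unitary ones if it
contains some unipotent elements, an element of order `24` of the torus, and the element of the Weyl
group. -/
theorem unitary_induction_K25 {p : Matrix (Fin 3) (Fin 3) K25 → Prop} (one : p 1)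
    (mul : ∀ X Y, p X → p Y → p (X * Y)) (cancel : ∀ X Y, p X → p (X * Y) → p Y)
    (h0 : p (unipotent 1 2)) (h1 : p (unipotent ⟨0, 1⟩ 1)) (h2 : p (unipotent 0 ⟨0, 1⟩))
    (h3 : p (torus ⟨2, 1⟩)) (h4 : p (-formJ)) {Y : Matrix (Fin 3) (Fin 3) K25}
    (hY : Y.conjTranspose * formJ * Y = formJ) (hd : Y.det = 1) : p Y := by
  have pow : ∀ X, p X → ∀ n : ℕ, p (X ^ n) := fun X hX n => by
    induction n with
    | zero => simpa using one
    | succ n ih => rw [pow_succ]; exact mul _ _ ih hX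
  have e1 : -((1 : K25) * star 1) = 2 * 2 := by decide +kernel
  have e2 : -((⟨0, 1⟩ : K25) * star ⟨0, 1⟩) = 2 * 1 := by decide +kernel
  refine unitary_induction cancel (fun a b h => ?_) (fun t ht => ?_) h4 hY hd
  · have := mul _ _ (mul _ _ (pow _ h0 a.re.val) (pow _ h1 a.im.val))
      (pow _ h2 (b.im - a.re * a.im).val)
    rw [unipotent_pow e1, unipotent_pow e2, unipotent_zero_pow, unipotent_mul, unipotent_mul,
      add_zero, star_zero, mul_zero, sub_zero, (K25.decomposition a b h).1,
      (K25.decomposition a b h).2] at this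
    exact this
  · obtain ⟨k, rfl⟩ := K25.exists_pow ht
    rw [← torus_pow]
    exact pow _ h3 k

end UnitaryGeneration

/-! ### From the antidiagonal hermitian form to the standard one. -/

section UnitaryIsomorphism

/-- The matrix of a change of basis from the hermitian form `formJ` to the standard one. -/
def changeJ : Matrix (Fin 3) (Fin 3) K25 := !![1, 0, 3; 0, 1, 0; 2, 0, 4]

/-- The inverse of `changeJ`. -/
def changeJInv : Matrix (Fin 3) (Fin 3) K25 := !![3, 0, 4; 0, 1, 0; 1, 0, 2]

theorem changeJ_mul_inv : changeJ * changeJInv = 1 := by decide +kernel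

theorem changeJInv_mul : changeJInv * changeJ = 1 := by decide +kernel

theorem changeJ_formJ : changeJ * formJ * changeJ.conjTranspose = 1 := by decide +kernel

theorem changeJInv_unitary : changeJInv * changeJInv.conjTranspose = formJ := by decide +kernel

theorem formJ_mul_self : (formJ : Matrix (Fin 3) (Fin 3) K25) * formJ = 1 := by decide +kernel

/-- The group `SU(3, 5)` as a group of matrices that preserve the form `formJ`. -/
noncomputable def unitaryHom (e : F25 ≃+* K25) : SU35 →* Matrix (Fin 3) (Fin 3) K25 where
  toFun y := changeJInv * y.1.1.map e * changeJ
  map_one' := by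
    rw [show ((1 : SU35).1.1 : Matrix (Fin 3) (Fin 3) F25) = 1 from rfl,
      Matrix.map_one e (map_zero e) (map_one e), mul_one, changeJInv_mul]
  map_mul' y z := by
    rw [show (y * z).1.1 = y.1.1 * z.1.1 from rfl, Matrix.map_mul]
    calc _ = changeJInv * y.1.1.map e * 1 * z.1.1.map e * changeJ := by simp only [mul_assoc, one_mul]
      _ = _ := by rw [← changeJ_mul_inv]; simp only [mul_assoc]

theorem unitaryHom_injective (e : F25 ≃+* K25) : Function.Injective (unitaryHom e) := by
  intro y z h
  have h : changeJInv * y.1.1.map e * changeJ = changeJInv * z.1.1.map e * changeJ := h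
  have h' := congrArg (fun X => changeJ * X * changeJInv) h
  have cancel : ∀ X : Matrix (Fin 3) (Fin 3) K25,
      changeJ * (changeJInv * X * changeJ) * changeJInv = X := fun X => by
    calc _ = (changeJ * changeJInv) * X * (changeJ * changeJInv) := by simp only [mul_assoc]
      _ = X := by rw [changeJ_mul_inv, one_mul, mul_one]
  simp only [cancel] at h'
  exact Subtype.ext (Subtype.ext (Matrix.map_injective e.injective h'))

theorem map_frobenius_transpose (e : F25 ≃+* K25) (X : Matrix (Fin 3) (Fin 3) F25) :
    (X.map (frobenius F25 5)).transpose.map e = (X.map e).conjTranspose := by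
  ext1 i j
  simp only [Matrix.map_apply, Matrix.transpose_apply, Matrix.conjTranspose_apply, frobenius_def,
    map_pow, K25.pow_five]

/-- With `unitaryHom_unitary` this makes the image of `unitaryHom` the whole special unitary group
of `formJ`; in particular the three generators lift to `SU35`. -/
theorem exists_unitaryHom_eq (e : F25 ≃+* K25) {Y : Matrix (Fin 3) (Fin 3) K25}
    (hY : Y * formJ * Y.conjTranspose = formJ) (hd : Y.det = 1) : ∃ y, unitaryHom e y = Y := by
  obtain ⟨X, hX⟩ : ∃ X : Matrix (Fin 3) (Fin 3) F25, X.map e = changeJ * Y * changeJInv :=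
    ⟨(changeJ * Y * changeJInv).map e.symm, by
      ext1 i j
      rw [Matrix.map_apply, Matrix.map_apply, RingEquiv.apply_symm_apply]⟩
  have det : X.det = 1 := by
    apply e.injective
    rw [RingEquiv.map_det, map_one]
    change (X.map e).det = 1
    rw [hX, Matrix.det_mul, Matrix.det_mul, hd, mul_one, ← Matrix.det_mul, changeJ_mul_inv,
      Matrix.det_one]
  have unitary : X * (X.map (frobenius F25 5)).transpose = 1 := by
    apply Matrix.map_injective e.injective
    beta_reduce
    rw [Matrix.map_mul, map_frobenius_transpose, hX, Matrix.map_one e (map_zero e) (map_one e),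
      Matrix.conjTranspose_mul, Matrix.conjTranspose_mul]
    calc _ = changeJ * (Y * (changeJInv * changeJInv.conjTranspose) * Y.conjTranspose) *
          changeJ.conjTranspose := by simp only [mul_assoc]
      _ = 1 := by rw [changeJInv_unitary, hY, changeJ_formJ]
  refine ⟨⟨⟨X, det⟩, unitary⟩, ?_⟩
  change changeJInv * X.map e * changeJ = Y
  rw [hX]
  calc _ = (changeJInv * changeJ) * Y * (changeJInv * changeJ) := by simp only [mul_assoc]
    _ = Y := by rw [changeJInv_mul, one_mul, mul_one]

theorem unitaryHom_unitary (e : F25 ≃+* K25) (y : SU35) :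
    (unitaryHom e y).conjTranspose * formJ * unitaryHom e y = formJ ∧
      (unitaryHom e y).det = 1 := by
  have hy : y.1.1 * (y.1.1.map (frobenius F25 5)).transpose = 1 := y.2
  have hy' := congrArg (fun X => X.map e) hy
  simp only [Matrix.map_mul, map_frobenius_transpose,
    Matrix.map_one e (map_zero e) (map_one e)] at hy'
  have h : unitaryHom e y * formJ * (unitaryHom e y).conjTranspose = formJ := by
    change changeJInv * y.1.1.map e * changeJ * formJ *
      (changeJInv * y.1.1.map e * changeJ).conjTranspose = formJ
    rw [Matrix.conjTranspose_mul, Matrix.conjTranspose_mul]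
    calc _ = changeJInv * (y.1.1.map e * (changeJ * formJ * changeJ.conjTranspose) *
          (y.1.1.map e).conjTranspose) * changeJInv.conjTranspose := by simp only [mul_assoc]
      _ = formJ := by rw [changeJ_formJ, mul_one, hy', mul_one, changeJInv_unitary]
  constructor
  -- As `J² = 1`, the equation `Y J Y* = J` makes `J Y* J` a right inverse of `Y`, hence also a left
  -- inverse.
  · have h1 : unitaryHom e y * (formJ * (unitaryHom e y).conjTranspose * formJ) = 1 := by
      rw [← mul_assoc, ← mul_assoc, h, formJ_mul_self]
    have h2 := mul_eq_one_comm.1 h1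
    calc _ = formJ * formJ * (unitaryHom e y).conjTranspose * formJ * unitaryHom e y := by
          rw [formJ_mul_self, one_mul]
      _ = formJ * (formJ * (unitaryHom e y).conjTranspose * formJ * unitaryHom e y) := by
          simp only [mul_assoc]
      _ = formJ := by rw [h2, mul_one]
  · change (changeJInv * y.1.1.map e * changeJ).det = 1
    have := RingEquiv.map_det e y.1.1
    rw [y.1.2, map_one] at this
    have hd : (y.1.1.map e).det = 1 := this.symm
    rw [Matrix.det_mul, Matrix.det_mul, hd, mul_one, ← Matrix.det_mul, changeJInv_mul,
      Matrix.det_one]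

theorem closure_psu35 (e : F25 ≃+* K25) {x : Fin 3 → SU35}
    (hx : ∀ k, unitaryHom e (x k) = genPSU35 k) : Subgroup.closure (Set.range x) = ⊤ := by
  have hw : ∀ w : List (Fin 3), ∃ y ∈ Subgroup.closure (Set.range x),
      unitaryHom e y = (w.map genPSU35).prod := fun w => by
    induction w with
    | nil => exact ⟨1, one_mem _, map_one _⟩
    | cons k w ih =>
      obtain ⟨y, hy, h⟩ := ih
      exact ⟨x k * y, mul_mem (Subgroup.subset_closure ⟨k, rfl⟩) hy, by
        rw [map_mul, hx, h, List.map_cons, List.prod_cons]⟩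
  rw [eq_top_iff]
  intro y _
  suffices h : ∃ z ∈ Subgroup.closure (Set.range x), unitaryHom e z = unitaryHom e y by
    obtain ⟨z, hz, h⟩ := h
    rwa [← unitaryHom_injective e h]
  have hp := fun i => (prod_unitaryWords i) ▸ hw (unitaryWords i)
  refine unitary_induction_K25
    (p := fun Y => ∃ z ∈ Subgroup.closure (Set.range x), unitaryHom e z = Y) (hw []) ?_ ?_
    (hp 0) (hp 1) (hp 2) (hp 3) (hp 4) (unitaryHom_unitary e y).1 (unitaryHom_unitary e y).2
  · rintro _ _ ⟨z, hz, rfl⟩ ⟨z', hz', rfl⟩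
    exact ⟨z * z', mul_mem hz hz', map_mul _ _ _⟩
  · rintro _ Y ⟨z, hz, rfl⟩ ⟨z', hz', h⟩
    refine ⟨z⁻¹ * z', mul_mem (inv_mem hz) hz', ?_⟩
    rw [map_mul, h, ← mul_assoc, ← map_mul, inv_mul_cancel, map_one, one_mul]

variable {A : Type*} [NonUnitalNonAssocCommRing A] [Module (ZMod 5) A]
  [IsScalarTower (ZMod 5) A A] [SMulCommClass (ZMod 5) A A]
  {φ : LinearMap.BilinForm (ZMod 5) A} {a b c : A}

theorem nonempty_mulEquiv_psu35 (h : IsTriple φ a b c (0, 0, 0, 4))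
    (li : LinearIndependent (ZMod 5) (monomials a b c)) :
    Nonempty (miyamotoGroup (ZMod 5) a b c ≃* PSU35) := by
  obtain ⟨e⟩ := exists_ringEquiv_K25
  choose x hx using fun k : Fin 3 =>
    exists_unitaryHom_eq e (unitary_genPSU35 k).1 (unitary_genPSU35 k).2
  have : Finite (Matrix.SpecialLinearGroup (Fin 3) F25) := Subtype.finite
  exact matrixAction_psu35.nonempty_mulEquiv h li (unitaryHom e) (unitaryHom_injective e) x hx
    (by rw [closure_psu35 e hx, top_sup_eq])

end UnitaryIsomorphism

/-! ### Internal semidirect products and normalizers. -/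

section SemidirectProducts

variable {G : Type*} [Group G]

/-- The group generated by two disjoint subgroups, one of which normalizes the other one without
centralizing it, is a semidirect product with a nontrivial action. -/
theorem exists_mulEquiv_semidirectProduct {N' K' : Subgroup G} {N H : Type*} [Group N] [Group H]
    (e1 : N' ≃* N) (e2 : K' ≃* H) (hn : K' ≤ Subgroup.normalizer (N' : Set G))
    (disj : ∀ x ∈ N', x ∈ K' → x = 1) {x y : G} (hx : x ∈ N') (hy : y ∈ K') (hxy : y * x ≠ x * y) :
    ∃ θ : H →* MulAut N, θ ≠ 1 ∧ Nonempty (↥(N' ⊔ K') ≃* N ⋊[θ] H) := by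
  let θ' : K' →* MulAut N' := (N'.normalizerMonoidHom).comp (Subgroup.inclusion hn)
  let f : N' ⋊[θ'] K' →* G := SemidirectProduct.monoidHomSubgroup hn
  have hf : ∀ z, f z = z.left * z.right := fun z => by
    conv_lhs => rw [← SemidirectProduct.inl_left_mul_inr_right z, map_mul]
    simp [f, SemidirectProduct.monoidHomSubgroup]
  have inj : Function.Injective f := by
    rw [injective_iff_map_eq_one]
    intro z hz
    rw [hf] at hz
    have h1 : (z.left : G) = (z.right : G)⁻¹ := eq_inv_of_mul_eq_one_left hz
    have h2 : (z.left : G) = 1 := disj _ z.left.2 (h1 ▸ inv_mem z.right.2)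
    rw [h2, one_mul] at hz
    exact SemidirectProduct.ext (Subtype.ext h2) (Subtype.ext hz)
  have range : f.range = N' ⊔ K' := by
    apply le_antisymm
    · rintro _ ⟨z, rfl⟩
      rw [hf]
      exact Subgroup.mul_mem_sup z.left.2 z.right.2
    · refine sup_le (fun z hz => ⟨SemidirectProduct.inl ⟨z, hz⟩, ?_⟩)
        fun z hz => ⟨SemidirectProduct.inr ⟨z, hz⟩, ?_⟩ <;> simp [hf]
  refine ⟨_, fun h => hxy ?_, ⟨(MulEquiv.subgroupCongr range).symm.trans
    ((MonoidHom.ofInjective inj).symm.trans (SemidirectProduct.congr' e1 e2))⟩⟩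
  -- A trivial action would make `x` and `y` commute.
  have h1 := DFunLike.congr_fun (DFunLike.congr_fun h (e2 ⟨y, hy⟩)) (e1 ⟨x, hx⟩)
  simp only [MonoidHom.comp_apply, MonoidHom.coe_coe, MulEquiv.symm_apply_apply,
    MonoidHom.one_apply, MulAut.one_apply] at h1
  have h2 : θ' ⟨y, hy⟩ ⟨x, hx⟩ = ⟨x, hx⟩ := e1.injective (by simpa [MulAut.congr] using h1)
  have h3 : y * x * y⁻¹ = x := congrArg Subtype.val h2
  exact mul_inv_eq_iff_eq_mul.1 h3

theorem exists_mul_eq_of_mem_sup {N' K' : Subgroup G} (hn : K' ≤ Subgroup.normalizer (N' : Set G))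
    {t : G} (ht : t ∈ N' ⊔ K') : ∃ x ∈ N', ∃ y ∈ K', x * y = t := by
  have : t ∈ ((N' ⊔ K' : Subgroup G) : Set G) := ht
  rw [Subgroup.coe_mul_of_right_le_normalizer_left _ _ hn] at this
  exact this

/-- By finiteness it is enough to conjugate generators by generators in one direction, without
inverses. -/
theorem closure_le_normalizer_of_finite [Finite G] {s r : Set G}
    (h : ∀ y ∈ r, ∀ x ∈ s, y * x * y⁻¹ ∈ Subgroup.closure s) :
    Subgroup.closure r ≤ Subgroup.normalizer (Subgroup.closure s : Set G) := by
  rw [Subgroup.le_normalizer_closure_iff]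
  intro y hy
  have : ∀ x ∈ Subgroup.closure s, y * x * y⁻¹ ∈ Subgroup.closure s := by
    refine closure_induction_left_of_finite (Q := fun y => ∀ x ∈ Subgroup.closure s,
      y * x * y⁻¹ ∈ Subgroup.closure s) (fun x hx => by simpa using hx) (fun z hz y ih x hx => ?_) hy
    have hz' : ∀ x ∈ Subgroup.closure s, z * x * z⁻¹ ∈ Subgroup.closure s := fun x hx => by
      have := Subgroup.closure_le (K := (Subgroup.closure s).comap (MulAut.conj z).toMonoidHom)|>.2
        (fun x hx => h z hz x hx) hx
      exact this
    have := hz' _ (ih x hx)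
    simpa [mul_assoc] using this
  exact fun x hx => this x (Subgroup.subset_closure hx)

end SemidirectProducts

/-! ### Elementary abelian groups of translations of the triple of axes. -/

section ElementaryAbelian

set_option linter.unusedSectionVars false

variable {A : Type*} [NonUnitalNonAssocCommRing A] [Module (ZMod 5) A]
  [IsScalarTower (ZMod 5) A A] [SMulCommClass (ZMod 5) A A]
  {φ : LinearMap.BilinForm (ZMod 5) A} {a b c : A} {P : Code4}

/-- The difference between the image of the axis `k` under a word and the axis. -/
def displacement (P : Code4) (w : List (Fin 3)) (k : Fin 3) : List ℕ :=
  List.zipWith (fun x y => (x + 4 * y) % 5) (appWord P w (unitVec k)) (unitVec k)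

/-- The value of a linear form on triples of vectors that are given by their digits. -/
def pairing (D v : Fin 3 → List ℕ) : ℕ := dotList (D 0) (v 0) + dotList (D 1) (v 1) + dotList (D 2) (v 2)

/-- Words that generate an elementary abelian group which acts by translations on the triples of
axes. The linear forms `D i` are dual to the displacements. -/
structure TranslationWords (P : Code4) {n : ℕ} (w : Fin n → List (Fin 3))
    (D : Fin n → Fin 3 → List ℕ) : Prop where
  fixed : ∀ i j k, appWord P (w i) (displacement P (w j) k) = displacement P (w j) k
  length : ∀ i k, (D i k).length = 8
  dual : ∀ i j, pairing (D i) (displacement P (w j)) % 5 = if i = j then 1 else 0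

theorem isDigits_appWord (P : Code4) (w : List (Fin 3)) {v : List ℕ} (hv : IsDigits v) :
    IsDigits (appWord P w v) := by
  cases w with
  | nil => exact hv
  | cons k w => exact isDigits_app _ _

theorem isDigits_displacement (P : Code4) (w : List (Fin 3)) (k : Fin 3) :
    IsDigits (displacement P w k) := by
  refine ⟨?_, fun x hx => ?_⟩
  · have h1 : (appWord P w (unitVec k)).length = 8 := (isDigits_appWord P w (isDigits_unitVec k)).1
    have h2 : (unitVec k).length = 8 := (isDigits_unitVec k).1
    rw [displacement, List.length_zipWith, h1, h2]
    rfl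
  · obtain ⟨i, hi, rfl⟩ := List.getElem_of_mem hx
    simp only [displacement, List.getElem_zipWith]
    exact Nat.mod_lt _ (by norm_num)

/-- The linear form on triples of vectors with the given coefficients. -/
noncomputable def tripleForm (li : LinearIndependent (ZMod 5) (monomials a b c))
    (sp : Submodule.span (ZMod 5) (Set.range (monomials a b c)) = ⊤) (D : Fin 3 → List ℕ) :
    (Fin 3 → A) →ₗ[ZMod 5] ZMod 5 :=
  ∑ k : Fin 3, ((Module.Basis.mk li sp.ge).constr (ZMod 5)
    (fun i : Fin 8 => (((D k).getD i 0 : ℕ) : ZMod 5))).comp (LinearMap.proj k)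

theorem tripleForm_vect (li : LinearIndependent (ZMod 5) (monomials a b c))
    (sp : Submodule.span (ZMod 5) (Set.range (monomials a b c)) = ⊤) {D v : Fin 3 → List ℕ}
    (hD : ∀ k, (D k).length = 8) (hv : ∀ k, IsDigits (v k)) :
    tripleForm li sp D (fun k => vect (monomials a b c) (v k)) = (pairing D v : ℕ) := by
  have h : ∀ k, (Module.Basis.mk li sp.ge).constr (ZMod 5)
      (fun i : Fin 8 => (((D k).getD i 0 : ℕ) : ZMod 5)) (vect (monomials a b c) (v k)) =
      (dotList (D k) (v k) : ℕ) := fun k => by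
    rw [dotList_eq 8 _ _ (hD k) (hv k).1]
    simp only [vect, map_sum, map_smul, Nat.cast_sum, Nat.cast_mul]
    refine Finset.sum_congr rfl fun i _ => ?_
    have := (Module.Basis.mk li sp.ge).constr_basis (ZMod 5)
      (fun i : Fin 8 => (((D k).getD i 0 : ℕ) : ZMod 5)) i
    rw [Module.Basis.mk_apply] at this
    rw [this, smul_eq_mul, mul_comm]
  rw [tripleForm, LinearMap.sum_apply, Fin.sum_univ_three]
  simp only [LinearMap.comp_apply, LinearMap.proj_apply, h, pairing, Nat.cast_add]

theorem IsTriple.vect_displacement (h : IsTriple φ a b c P) (w : List (Fin 3)) (k : Fin 3) :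
    vect (monomials a b c) (displacement P w k) = word a b c w (![a, b, c] k) - ![a, b, c] k := by
  have h1 := h.word_vect w (isDigits_unitVec k)
  have l1 := h1.1.1
  have l2 : (unitVec k).length = 8 := (isDigits_unitVec k).1
  rw [axis_eq_vect, h1.2, vect, vect, vect, ← Finset.sum_sub_distrib]
  refine Finset.sum_congr rfl fun i _ => ?_
  rw [← sub_smul]
  congr 1
  have e : (displacement P w k).getD i 0 =
      ((appWord P w (unitVec k)).getD i 0 + 4 * (unitVec k).getD i 0) % 5 := by
    rw [displacement, List.getD_eq_getElem _ _ (by simp [l1, l2]), List.getElem_zipWith,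
      List.getD_eq_getElem _ _ (by simp [l1]), List.getD_eq_getElem _ _ (by simp [l2])]
  rw [e, ZMod.natCast_mod, Nat.cast_add, Nat.cast_mul, sub_eq_add_neg, neg_eq_neg_one_mul]
  rfl

variable {n : ℕ} {w : Fin n → List (Fin 3)} {D : Fin n → Fin 3 → List ℕ}

/-- The element `t` translates the axes by a combination of the displacements of the words. -/
def Translates (a b c : A) (P : Code4) (w : Fin n → List (Fin 3)) (t : A ≃ₗ[ZMod 5] A)
    (y : Fin n → ZMod 5) : Prop :=
  ∀ k, t (![a, b, c] k) =
    ![a, b, c] k + ∑ j, y j • vect (monomials a b c) (displacement P (w j) k)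

/-- The word fixes all displacements, so composing with it only adds its own displacement. -/
theorem TranslationWords.translates_mul (W : TranslationWords P w D) (h : IsTriple φ a b c P)
    (i : Fin n) {t : A ≃ₗ[ZMod 5] A} {y : Fin n → ZMod 5} (ht : Translates a b c P w t y) :
    Translates a b c P w (word a b c (w i) * t) (Pi.single i 1 + y) := by
  intro k
  have e : ∀ j, word a b c (w i) (vect (monomials a b c) (displacement P (w j) k)) =
      vect (monomials a b c) (displacement P (w j) k) := fun j => by
    rw [(h.word_vect (w i) (isDigits_displacement P (w j) k)).2, W.fixed]
  rw [LinearEquiv.mul_apply, ht k]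
  simp only [map_add, map_sum, map_smul, e, Pi.add_apply, add_smul, Finset.sum_add_distrib,
    Pi.single_apply, ite_smul, one_smul, zero_smul, Finset.sum_ite_eq', Finset.mem_univ, if_true]
  rw [h.vect_displacement (w i)]
  abel

theorem exists_translates (W : TranslationWords P w D) (h : IsTriple φ a b c P)
    {t : A ≃ₗ[ZMod 5] A} (ht : t ∈ Subgroup.closure (Set.range fun i => word a b c (w i))) :
    ∃ y, Translates a b c P w t y := by
  have := h.finite
  refine closure_induction_left_of_finite (Q := fun t => ∃ y, Translates a b c P w t y)
    ⟨0, fun k => by simp⟩ ?_ ht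
  rintro _ ⟨i, rfl⟩ t ⟨y, hy⟩
  exact ⟨_, W.translates_mul h i hy⟩

theorem Translates.tripleForm_eq {t : A ≃ₗ[ZMod 5] A} {y : Fin n → ZMod 5}
    (ht : Translates a b c P w t y) (li : LinearIndependent (ZMod 5) (monomials a b c))
    (sp : Submodule.span (ZMod 5) (Set.range (monomials a b c)) = ⊤) {E : Fin 3 → List ℕ}
    (hE : ∀ k, (E k).length = 8) :
    tripleForm li sp E (fun k => t (![a, b, c] k)) = tripleForm li sp E ![a, b, c] +
      ∑ j, y j * (pairing E (displacement P (w j)) : ℕ) := by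
  have e : (fun k => t (![a, b, c] k)) =
      ![a, b, c] + ∑ j, y j • fun k => vect (monomials a b c) (displacement P (w j) k) := by
    funext k
    rw [ht k]
    simp
  rw [e, map_add, map_sum]
  simp only [map_smul, tripleForm_vect li sp hE (fun k => isDigits_displacement P _ k), smul_eq_mul]

/-- The dual forms read off the coordinates of a translation from its action on the axes, so these
coordinates are unique. -/
theorem TranslationWords.eq_of_translates (W : TranslationWords P w D) (h : IsTriple φ a b c P)
    (li : LinearIndependent (ZMod 5) (monomials a b c)) {t : A ≃ₗ[ZMod 5] A} {y : Fin n → ZMod 5}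
    (ht : Translates a b c P w t y) (i : Fin n) :
    y i = tripleForm li h.span (D i) (fun k => t (![a, b, c] k)) -
      tripleForm li h.span (D i) ![a, b, c] := by
  have e : ∀ j, ((pairing (D i) (displacement P (w j)) : ℕ) : ZMod 5) = if i = j then 1 else 0 :=
    fun j => by
      rw [← ZMod.natCast_mod, W.dual]
      split_ifs <;> simp
  rw [ht.tripleForm_eq li h.span (W.length i)]
  simp [e]

theorem closure_range_single (n : ℕ) : Subgroup.closure (Set.range fun i : Fin n =>
    (Multiplicative.ofAdd (Pi.single i 1 : Fin n → ZMod 5) : Elem5 n)) = ⊤ := by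
  rw [eq_top_iff]
  intro v _
  have e : v = ∏ i : Fin n, (Multiplicative.ofAdd (Pi.single i 1 : Fin n → ZMod 5) : Elem5 n) ^
      (v.toAdd i).val := by
    apply Multiplicative.toAdd.injective
    rw [toAdd_prod]
    simp only [toAdd_pow, toAdd_ofAdd]
    funext j
    rw [Finset.sum_apply, Finset.sum_eq_single j (fun i _ hi => by simp [hi.symm]) (by simp)]
    rw [Pi.smul_apply, Pi.single_eq_same, nsmul_eq_mul, mul_one, ZMod.natCast_zmod_val]
  rw [e]
  exact prod_mem fun i _ => pow_mem (Subgroup.subset_closure (Set.mem_range_self i)) _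

/-- The words are paired with the unit vectors. The relation of translating by a given vector
identifies only the identities, by uniqueness of coordinates on one side and `ext_axes` on the
other. -/
theorem TranslationWords.nonempty_mulEquiv (W : TranslationWords P w D) (h : IsTriple φ a b c P)
    (li : LinearIndependent (ZMod 5) (monomials a b c)) :
    Nonempty (Subgroup.closure (Set.range fun i => word a b c (w i)) ≃* Elem5 n) := by
  have := h.finite
  have one : Translates a b c P w 1 (1 : Elem5 n).toAdd := fun k => by simp
  obtain ⟨f, -⟩ := exists_mulEquiv_of_relation (H := Elem5 n) (fun i => word a b c (w i))
    (fun i => Multiplicative.ofAdd (Pi.single i 1))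
    (fun t (y : Elem5 n) => t ∈ miyamotoGroup (ZMod 5) a b c ∧ Translates a b c P w t y.toAdd)
    ⟨one_mem _, one⟩
    (fun i x y hxy => ⟨mul_mem (word_mem a b c _) hxy.1, W.translates_mul h i hxy.2⟩)
    (fun y hy => by
      apply Multiplicative.toAdd.injective
      funext i
      rw [W.eq_of_translates h li hy.2 i]
      exact sub_self _)
    (fun x hx => h.ext_axes hx.1 (one_mem _) fun k => by
      rw [hx.2 k]
      simp)
  exact ⟨f.trans ((MulEquiv.subgroupCongr (closure_range_single n)).trans Subgroup.topEquiv)⟩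

end ElementaryAbelian

set_option linter.unusedSectionVars false

/-! ### Subgroups generated by segments of a list of words. -/

section Segments

variable {A : Type*} [NonUnitalNonAssocCommRing A] [Module (ZMod 5) A]
  [IsScalarTower (ZMod 5) A A] [SMulCommClass (ZMod 5) A A]
  {φ : LinearMap.BilinForm (ZMod 5) A} {a b c : A} {P : Code4}

/-- The subgroup generated by a segment of a list of words. -/
noncomputable def segment (a b c : A) (xs : List (List (Fin 3))) (m n : ℕ) :
    Subgroup (A ≃ₗ[ZMod 5] A) :=
  Subgroup.closure (Set.range fun i : Fin n => word a b c (xs.getD (m + i) []))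

theorem word_mem_segment {xs : List (List (Fin 3))} {m n i : ℕ} (h1 : m ≤ i) (h2 : i < m + n) :
    word a b c (xs.getD i []) ∈ segment a b c xs m n :=
  Subgroup.subset_closure ⟨⟨i - m, by omega⟩, by simp [Nat.add_sub_cancel' h1]⟩

theorem wordList_mem_segment {xs : List (List (Fin 3))} {m n : ℕ} {w : List ℕ}
    (hw : ∀ i ∈ w, m ≤ i ∧ i < m + n) : wordList a b c xs w ∈ segment a b c xs m n :=
  list_prod_mem fun t ht => by
    obtain ⟨i, hi, rfl⟩ := List.mem_map.1 ht
    exact word_mem_segment (hw i hi).1 (hw i hi).2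

theorem segment_le_miyamotoGroup (xs : List (List (Fin 3))) (m n : ℕ) :
    segment a b c xs m n ≤ miyamotoGroup (ZMod 5) a b c := by
  rw [segment, Subgroup.closure_le]
  rintro _ ⟨i, rfl⟩
  exact word_mem a b c _

theorem segment_sup (xs : List (List (Fin 3))) (m n n' : ℕ) :
    segment a b c xs m n ⊔ segment a b c xs (m + n) n' = segment a b c xs m (n + n') := by
  apply le_antisymm
  · rw [segment, segment, sup_le_iff, Subgroup.closure_le, Subgroup.closure_le]
    constructor <;> rintro _ ⟨i, rfl⟩ <;> exact word_mem_segment (by omega) (by omega)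
  · rw [segment, Subgroup.closure_le]
    rintro _ ⟨i, rfl⟩
    by_cases h : (i : ℕ) < n
    · exact Subgroup.mem_sup_left (word_mem_segment (by omega) (by omega))
    · exact Subgroup.mem_sup_right (word_mem_segment (by omega) (by omega))

/-- The words in the second segment normalize the subgroup generated by the first one. -/
def normalizes (C : List (List ℕ)) (m n m' n' : ℕ) (rel : List (List (List ℕ))) : Bool :=
  (List.range n').all fun j => (List.range n).all fun i =>
    ((rel.getD j []).getD i []).all (fun x => Nat.ble m x && Nat.blt x (m + n)) &&
      agree C ((rel.getD j []).getD i [] ++ [m' + j]) [m' + j, m + i]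

theorem IsTriple.segment_le_normalizer (h : IsTriple φ a b c P) {xs : List (List (Fin 3))}
    {m n m' n' : ℕ} {rel : List (List (List ℕ))}
    (e : normalizes (xs.map (wordCode P)) m n m' n' rel = true) :
    segment a b c xs m' n' ≤ Subgroup.normalizer (segment a b c xs m n : Set (A ≃ₗ[ZMod 5] A)) := by
  have := h.finite
  simp only [normalizes, List.all_eq_true, List.mem_range, Bool.and_eq_true, Nat.ble_eq,
    Nat.blt_eq] at e
  refine closure_le_normalizer_of_finite ?_
  rintro _ ⟨j, rfl⟩ _ ⟨i, rfl⟩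
  obtain ⟨l, r⟩ := e j j.2 i i.2
  have r' := h.wordList_eq r
  have one : ∀ k, wordList a b c xs [k] = word a b c (xs.getD k []) := fun k => by simp [wordList]
  rw [wordList_append, show [m' + (j : ℕ), m + i] = [m' + (j : ℕ)] ++ [m + (i : ℕ)] from rfl,
    wordList_append, one, one] at r'
  change word a b c (xs.getD (m' + j) []) * word a b c (xs.getD (m + i) []) *
    (word a b c (xs.getD (m' + j) []))⁻¹ ∈ segment a b c xs m n
  rw [← r', mul_inv_cancel_right]
  exact wordList_mem_segment l

theorem IsTriple.miyamotoGroup_eq_segment (h : IsTriple φ a b c P) {xs : List (List (Fin 3))}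
    {n : ℕ} {ts : Fin 3 → List ℕ} (e : ∀ k : Fin 3, xs.getD (n + k) [] = [k] ∧
      (∀ i ∈ ts k, i < n) ∧ agree (xs.map (wordCode P)) (ts k) [n + k] = true) :
    miyamotoGroup (ZMod 5) a b c = segment a b c xs 0 n := by
  refine le_antisymm ?_ (segment_le_miyamotoGroup xs 0 n)
  rw [miyamotoGroup_eq, Subgroup.closure_le]
  rintro _ ⟨k, rfl⟩
  obtain ⟨e1, e2, e3⟩ := e k
  have : axisInvolution a b c k = wordList a b c xs [n + k] := by
    simp only [wordList, List.map_cons, List.map_nil, e1]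
    simp [word]
  rw [SetLike.mem_coe, this, ← h.wordList_eq e3]
  exact wordList_mem_segment fun i hi => ⟨Nat.zero_le _, by simpa using e2 i hi⟩

theorem IsTriple.mul_ne_mul (h : IsTriple φ a b c P)
    (li : LinearIndependent (ZMod 5) (monomials a b c)) {xs : List (List (Fin 3))} {i j : ℕ}
    (e : agree (xs.map (wordCode P)) [i, j] [j, i] = false) :
    word a b c (xs.getD i []) * word a b c (xs.getD j []) ≠
      word a b c (xs.getD j []) * word a b c (xs.getD i []) := by
  have := h.wordList_ne li e
  simpa [wordList] using this

end Segments

/-! ### Regular orbits of triples, and their separation from translates. -/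

section RegularLists

/-- The triple of vectors that is given by the last 24 decimal digits. -/
def decTriple (s : ℕ) (k : Fin 3) : List ℕ := decVec (s / 10 ^ (8 * (k : ℕ)))

/-- The list `S` consists of triples of vectors and of elements of a monoid that correspond to
them: if a word `w i` is applied to a triple, then the element is multiplied by `g i`. -/
structure RegularList {M ι : Type*} [Monoid M] (P : Code4) (w : ι → List (Fin 3)) (g : ι → M)
    (val : ℕ → M) (S : List ℕ) : Prop where
  digits : ∀ s ∈ S, ∀ k, IsDigits (decTriple s k)
  one : ∃ s ∈ S, (∀ k : Fin 3, decTriple s k = unitVec k) ∧ val (s / 10 ^ 24) = 1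
  step : ∀ s ∈ S, ∀ i, ∃ s' ∈ S, (∀ k, decTriple s' k = appWord P (w i) (decTriple s k)) ∧
    val (s' / 10 ^ 24) = g i * val (s / 10 ^ 24)
  nodup_vec : (S.map (· % 10 ^ 24)).Nodup
  nodup_val : (S.map fun s => val (s / 10 ^ 24)).Nodup

theorem mod_eq_of_digit {n : ℕ} : ∀ {s s' : ℕ}, (∀ i < n, digit s i = digit s' i) →
    s % 10 ^ n = s' % 10 ^ n := by
  induction n with
  | zero => intro s s' _; simp [Nat.mod_one]
  | succ n ih =>
    intro s s' h
    have h1 := ih fun i hi => h i (by omega)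
    have h2 : s / 10 ^ n % 10 = s' / 10 ^ n % 10 := h n (by omega)
    rw [Nat.mod_pow_succ, Nat.mod_pow_succ, h1, h2]

theorem mod_eq_of_decTriple {s s' : ℕ} (h : decTriple s = decTriple s') :
    s % 10 ^ 24 = s' % 10 ^ 24 := by
  refine mod_eq_of_digit fun i hi => ?_
  have h1 := congrFun h ⟨i / 8, by omega⟩
  simp only [decTriple, decVec] at h1
  have h2 := List.map_inj_left.1 h1 (i % 8) (List.mem_range.2 (by omega))
  simp only [digit, Nat.div_div_eq_div_mul, ← pow_add] at h2
  rwa [Nat.div_add_mod] at h2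

variable {A : Type*} [NonUnitalNonAssocCommRing A] [Module (ZMod 5) A]
  [IsScalarTower (ZMod 5) A A] [SMulCommClass (ZMod 5) A A]
  {φ : LinearMap.BilinForm (ZMod 5) A} {a b c : A} {P : Code4}
  {M ι : Type*} [Monoid M] {w : ι → List (Fin 3)} {g : ι → M} {val : ℕ → M} {S : List ℕ}

theorem RegularList.exists_axes (C : RegularList P w g val S) (h : IsTriple φ a b c P)
    {t : A ≃ₗ[ZMod 5] A} (ht : t ∈ Subgroup.closure (Set.range fun i => word a b c (w i))) :
    ∃ s ∈ S, ∀ k, t (![a, b, c] k) = vect (monomials a b c) (decTriple s k) := by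
  have := h.finite
  refine closure_induction_left_of_finite (Q := fun t : A ≃ₗ[ZMod 5] A =>
    ∃ s ∈ S, ∀ k, t (![a, b, c] k) = vect (monomials a b c) (decTriple s k)) ?_ ?_ ht
  · obtain ⟨s, hs, e, -⟩ := C.one
    refine ⟨s, hs, fun k => ?_⟩
    rw [e, ← axis_eq_vect]
    rfl
  · rintro _ ⟨i, rfl⟩ t ⟨s, hs, e⟩
    obtain ⟨s', hs', e', -⟩ := C.step s hs i
    refine ⟨s', hs', fun k => ?_⟩
    rw [LinearEquiv.mul_apply, e, (h.word_vect (w i) (C.digits s hs k)).2, e']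

/-- Words act on the triples as left multiplications act on the values. An element of `H` that fixes
the value `1` is trivial, and distinct entries have distinct values. -/
theorem RegularList.nonempty_mulEquiv (C : RegularList P w g val S) {H : Type*} [Group H]
    [Finite H] {ρ : H →* M} (hρ : Function.Injective ρ) {f : ι → H} (hf : ∀ i, ρ (f i) = g i)
    (h : IsTriple φ a b c P) (li : LinearIndependent (ZMod 5) (monomials a b c)) :
    Nonempty (Subgroup.closure (Set.range fun i => word a b c (w i)) ≃*
      Subgroup.closure (Set.range f)) := by
  have act : CodedAction P w f S (fun s => List.ofFn (decTriple s))
      (fun (y : H) s s' => val (s' / 10 ^ 24) = ρ y * val (s / 10 ^ 24)) := by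
    refine ⟨?_, ?_, ?_, ?_, fun s _ => ?_, ?_⟩
    · intro s hs v hv
      obtain ⟨k, rfl⟩ := List.mem_ofFn.1 hv
      exact C.digits s hs k
    · intro k
      obtain ⟨s, hs, e, -⟩ := C.one
      exact ⟨s, hs, List.mem_ofFn.2 ⟨k, e k⟩⟩
    · intro i s hs
      obtain ⟨s', hs', e, e'⟩ := C.step s hs i
      refine ⟨s', hs', ?_, by rw [hf, e']⟩
      rw [List.map_ofFn]
      exact congrArg List.ofFn (funext e)
    · intro s hs s' hs' e
      exact List.inj_on_of_nodup_map C.nodup_vec hs hs'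
        (mod_eq_of_decTriple (List.ofFn_injective e))
    · rw [map_one, one_mul]
    · intro y y' s s' s'' r r'
      rw [r', r, map_mul, mul_assoc]
  obtain ⟨e, -⟩ := act.exists_mulEquiv h li (fun y hy => by
      obtain ⟨s, hs, -, e⟩ := C.one
      have := hy s hs
      rw [e, mul_one] at this
      exact hρ (by rw [map_one, this]))
    (fun s hs s' hs' r => by
      rw [map_one, one_mul] at r
      exact List.inj_on_of_nodup_map C.nodup_val hs hs' r.symm)
  exact ⟨e⟩

/-- The linear forms in the list `L` vanish on the displacements of the words `w`. -/
def Annihilates {n : ℕ} (P : Code4) (w : Fin n → List (Fin 3)) (L : List (Fin 3 → List ℕ)) : Prop :=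
  ∀ E ∈ L, (∀ k, (E k).length = 8) ∧ ∀ j, pairing E (displacement P (w j)) % 5 = 0

/-- The triple `v` is the triple of axes or one of the linear forms in the list `L` separates it
from the triple of axes. -/
def Separated (L : List (Fin 3 → List ℕ)) (v : Fin 3 → List ℕ) : Prop :=
  (∀ k : Fin 3, v k = unitVec k) ∨ ∃ E ∈ L, pairing E v % 5 ≠ pairing E (fun k => unitVec k) % 5

instance {n : ℕ} (P : Code4) (w : Fin n → List (Fin 3)) (L : List (Fin 3 → List ℕ)) :
    Decidable (Annihilates P w L) :=
  inferInstanceAs (Decidable (∀ E ∈ L, (∀ k, (E k).length = 8) ∧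
    ∀ j, pairing E (displacement P (w j)) % 5 = 0))

instance (L : List (Fin 3 → List ℕ)) (v : Fin 3 → List ℕ) : Decidable (Separated L v) :=
  inferInstanceAs (Decidable (_ ∨ _))

/-- A form that vanishes on the displacements takes the same value on the axes and on their
translates, so a triple separated from the axes is not a translate. -/
theorem Translates.eq_one {n : ℕ} {w : Fin n → List (Fin 3)} {t : A ≃ₗ[ZMod 5] A}
    {y : Fin n → ZMod 5} (ht : Translates a b c P w t y) (h : IsTriple φ a b c P)
    (li : LinearIndependent (ZMod 5) (monomials a b c)) {L : List (Fin 3 → List ℕ)}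
    (hL : Annihilates P w L) {v : Fin 3 → List ℕ} (hv : ∀ k, IsDigits (v k))
    (e : ∀ k, t (![a, b, c] k) = vect (monomials a b c) (v k)) (sep : Separated L v)
    (mem : t ∈ miyamotoGroup (ZMod 5) a b c) : t = 1 := by
  refine h.ext_axes mem (one_mem _) fun k => ?_
  rcases sep with hs | ⟨E, hE, ne⟩
  · rw [e, hs, ← axis_eq_vect]
    rfl
  · exfalso
    obtain ⟨l, z⟩ := hL E hE
    have h1 := ht.tripleForm_eq li h.span l
    have h2 : (![a, b, c] : Fin 3 → A) = fun k : Fin 3 => vect (monomials a b c) (unitVec k) :=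
      funext fun k => axis_eq_vect a b c k
    have h3 : ∀ j, ((pairing E (displacement P (w j)) : ℕ) : ZMod 5) = 0 := fun j =>
      (ZMod.natCast_eq_zero_iff _ _).2 (Nat.dvd_of_mod_eq_zero (z j))
    simp only [h3, mul_zero, Finset.sum_const_zero, add_zero] at h1
    rw [funext e, tripleForm_vect li h.span l hv, h2,
      tripleForm_vect li h.span l fun k => isDigits_unitVec k] at h1
    exact ne ((ZMod.natCast_eq_natCast_iff' _ _ _).1 h1)

end RegularLists

section EndPermutations

instance {n : ℕ} : DecidableEq (Function.End (Fin n)) :=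
  inferInstanceAs (DecidableEq (Fin n → Fin n))

/-- The map that is given by the decimal digits of a number, as an element of a monoid. -/
def endOf (n : ℕ) [NeZero n] (s : ℕ) : Function.End (Fin n) := funOf n s

end EndPermutations

/-! ### Certificates for `5^5 : A_5`. -/

section e5A5

/-- Words that generate a normal subgroup, words that generate a complement of it, and the
involutions. -/
def words_e5A5 : List (List (Fin 3)) :=
    [[0, 2, 0, 2], [1, 0, 2, 0, 2, 1], [0, 1, 0, 2, 0, 2, 1, 0], [2, 1, 0, 2, 0, 2, 1, 2], [1,
      0, 1, 0, 2, 0, 2, 1, 0, 1], [0, 2, 0, 2, 0, 2, 0, 2, 0], [1], [2], [0], [1], [2]]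

def code_e5A5 : Fin 3 → ℕ := ![34120, 42301, 21430]

theorem code_e5A5_involutive : ∀ k i, funOf 5 (code_e5A5 k) (funOf 5 (code_e5A5 k) i) = i := by
  decide +kernel

def dual_e5A5 : Fin 5 → Fin 3 → List ℕ :=
    ![![[0, 1, 0, 0, 0, 0, 0, 0], [2, 1, 0, 0, 0, 0, 0, 0], [4, 0, 0, 0, 0, 0, 0, 0]], ![[4, 0,
      0, 0, 0, 0, 0, 0], [3, 4, 0, 0, 0, 0, 0, 0], [4, 0, 0, 0, 0, 0, 0, 0]], ![[3, 3, 0, 0, 0,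
      0, 0, 0], [3, 2, 0, 0, 0, 0, 0, 0], [2, 0, 0, 0, 0, 0, 0, 0]], ![[1, 1, 0, 0, 0, 0, 0, 0],
      [1, 1, 0, 0, 0, 0, 0, 0], [0, 0, 0, 0, 0, 0, 0, 0]], ![[2, 2, 0, 0, 0, 0, 0, 0], [1, 3, 0,
      0, 0, 0, 0, 0], [2, 0, 0, 0, 0, 0, 0, 0]]]

theorem translationWords_e5A5 : TranslationWords (1, 1, 2, 3)
    (fun i : Fin 5 => words_e5A5.getD (0 + i) []) dual_e5A5 := by
  constructor <;> decide +kernel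

def separators_e5A5 : List (Fin 3 → List ℕ) :=
    [![[1, 2, 2, 0, 0, 0, 0, 0], [1, 3, 4, 0, 4, 0, 3, 1], [4, 0, 0, 4, 1, 4, 0, 2]], ![[1, 1,
      0, 3, 0, 0, 0, 0], [3, 4, 0, 2, 0, 0, 0, 0], [1, 1, 0, 2, 0, 0, 3, 0]]]

theorem annihilates_e5A5 : Annihilates (1, 1, 2, 3) (fun i : Fin 5 => words_e5A5.getD (0 + i) [])
    separators_e5A5 := by
  decide +kernel

def list_e5A5 : List ℕ :=
    [43210000001000000001000000001, 34120000001002012413200200203,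
      42301000203100000001000002013, 21430000001000002013000200203,
      24031000203101001200040141114, 12340000001003021143400000001,
      31402400234202012413234212114, 24103000100000002013011121213,
      30421000203100001000040141114, 13042400234202032431141312441,
      42013000100004030302104221133, 3241000203100040030300002013,
      20413304214231001200041213321, 13204102020243021143410220420,
      34012000201300001000004112433, 40312400234201020202441312441,
      10243000100000002031004221133, 2143304214230010010204030443,
      31024102020243042142320431122, 43102000201304030302131434412,
      4132400234200040030334212114, 1423000100000040030311121213, 10324403030212032431132222443,
      40231203243114030302103244203, 2314102020240040030310220420,
      43021302114341020202442003041, 12034000000100002031023424040,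
      41203304214231020202404030443, 20134102020244002342020431122,
      1342000201300000010031434412, 1234403030210010010223333132, 4321203243110010010212233110,
      34201302114343042142313042134, 21304000000101001200002030003,
      14023304214233021143441213321, 10432000201303021143404112433,
      30142100120003042142334231244, 41320001001024030302122211332,
      42130004003031020202403311222, 21043201241324002342041221340,
      3124000000100000010002030003, 32104403030210001000023333132,
      23401203243114002342012233110, 2431302114340000010013042134, 3412100120000010010221314021,
      14230001001022032431133144324, 24310004003034002342002244033,
      12403201241322032431114304210, 30214000000102012413223424040,
      23014403030210002013032222443, 32041203243112012413203244203,
      20341302114340002013042003041, 32410001001023042142333144324,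
      23140001001021001200022211332, 31240004003030001000003311222,
      4213201241320000010014304210, 14302100120000002031021314021,
      13420004003030002031002244033, 40123201241320000001041221340,
      41032100120000000001034231244]

theorem separated_e5A5 : ∀ s ∈ list_e5A5, Separated separators_e5A5 (decTriple s) := by
  decide +kernel

theorem regularList_e5A5 : RegularList (1, 1, 2, 3)
    (fun i : Fin 3 => words_e5A5.getD (5 + i) []) (fun k => endOf 5 (code_e5A5 k)) (endOf 5)
    list_e5A5 := by
  constructor <;> decide +kernel

theorem normalizes_e5A5 : normalizes (words_e5A5.map (wordCode (1, 1, 2, 3))) 0 5 5 3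
    [[[0, 0, 0, 0], [2], [1], [1, 1, 1, 1, 2, 3], [0, 0, 0, 0, 1, 2, 2, 2, 2, 4]], [[1], [0],
      [4], [0, 1, 1, 1, 1, 2, 3, 4, 4, 4, 4], [2]], [[0, 0, 0, 0], [3], [1, 1, 1, 1, 2, 3], [1],
      [0, 0, 0, 0, 4]]] = true := by
  decide +kernel

/-- Word `5` is the square of word `0` followed by `τ_a`. As word `0` has order `5`, its cube times
word `5` gives `τ_a` back. -/
theorem generates_e5A5 : ∀ k : Fin 3, words_e5A5.getD (8 + k) [] = [k] ∧
    (∀ i ∈ (![[0, 0, 0, 5], [6], [7]] : Fin 3 → List ℕ) k, i < 8) ∧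
    agree (words_e5A5.map (wordCode (1, 1, 2, 3)))
      ((![[0, 0, 0, 5], [6], [7]] : Fin 3 → List ℕ) k) [8 + k] = true := by
  decide +kernel

theorem not_commute_e5A5 : agree (words_e5A5.map (wordCode (1, 1, 2, 3))) [5, 0]
    [0, 5] = false := by
  decide +kernel

theorem alternatingGroup_le_e5A5 : alternatingGroup (Fin 5) ≤ Subgroup.closure
    (Set.range fun k => involutionOf 5 (code_e5A5 k) (code_e5A5_involutive k)) :=
  alternatingGroup_le_closure code_e5A5_involutive
    [2, 1, 0] 0 2 3
    [(0, 0), (1, 1), (2, 2), (1, 2), (2, 3), (0, 3), (2, 4), (1, 4), (0, 4), (2, 5), (1, 5), (1,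
      5), (2, 6), (1, 6), (0, 6), (2, 7), (1, 7), (2, 8), (1, 8), (0, 8), (2, 9), (0, 9), (2,
      10), (1, 10), (0, 10), (2, 11), (1, 11), (2, 12), (1, 12), (0, 12), (2, 13), (0, 12), (2,
      13), (1, 13), (1, 13), (2, 13), (1, 13), (1, 12), (2, 13), (1, 13), (0, 13), (2, 14), (0,
      13), (2, 13), (1, 13), (1, 13), (2, 14), (1, 14), (0, 14), (2, 15), (0, 15), (0, 14), (2,
      15), (0, 15), (0, 14), (2, 14), (1, 13), (0, 9), (2, 9)]
    (by decide +kernel) (by decide +kernel) (by decide +kernel)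

end e5A5

/-! ### Certificates for `5^5 : S_5`. -/

section e5S5

/-- Words that generate a normal subgroup, words that generate a complement of it, and the
involutions. -/
def words_e5S5 : List (List (Fin 3)) :=
    [[0, 2, 0, 2], [1, 0, 2, 0, 2, 1], [0, 1, 0, 2, 0, 2, 1, 0], [2, 1, 0, 2, 0, 2, 1, 2], [1,
      0, 1, 0, 2, 0, 2, 1, 0, 1], [0, 2, 0, 2, 0, 2, 0, 2, 0], [1], [2], [0], [1], [2]]

def code_e5S5 : Fin 3 → ℕ := ![42301, 34210, 41032]

theorem code_e5S5_involutive : ∀ k i, funOf 5 (code_e5S5 k) (funOf 5 (code_e5S5 k) i) = i := by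
  decide +kernel

def dual_e5S5 : Fin 5 → Fin 3 → List ℕ :=
    ![![[1, 2, 0, 0, 0, 0, 0, 0], [3, 0, 0, 0, 0, 0, 0, 0], [0, 3, 0, 0, 0, 0, 0, 0]], ![[0, 0,
      0, 0, 0, 0, 0, 0], [2, 0, 0, 0, 0, 0, 0, 0], [0, 4, 0, 0, 0, 0, 0, 0]], ![[1, 3, 0, 0, 0,
      0, 0, 0], [4, 3, 0, 0, 0, 0, 0, 0], [0, 3, 0, 0, 0, 0, 0, 0]], ![[1, 2, 0, 0, 0, 0, 0, 0],
      [2, 3, 0, 0, 0, 0, 0, 0], [0, 4, 0, 0, 0, 0, 0, 0]], ![[0, 1, 0, 0, 0, 0, 0, 0], [4, 0, 0,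
      0, 0, 0, 0, 0], [0, 4, 0, 0, 0, 0, 0, 0]]]

theorem translationWords_e5S5 : TranslationWords (0, 0, 2, 0)
    (fun i : Fin 5 => words_e5S5.getD (0 + i) []) dual_e5S5 := by
  constructor <;> decide +kernel

def separators_e5S5 : List (Fin 3 → List ℕ) :=
    [![[2, 0, 3, 0, 0, 0, 0, 0], [0, 0, 0, 0, 0, 0, 0, 0], [0, 0, 0, 0, 0, 0, 0, 0]], ![[0, 4,
      0, 3, 0, 0, 0, 0], [0, 2, 0, 1, 0, 0, 0, 4], [2, 0, 3, 0, 0, 0, 0, 0]]]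

theorem annihilates_e5S5 : Annihilates (0, 0, 2, 0) (fun i : Fin 5 => words_e5S5.getD (0 + i) [])
    separators_e5S5 := by
  decide +kernel

def list_e5S5 : List ℕ :=
    [43210000001000000001000000001, 42301000001002002403000200203,
      34210000203000000001000002003, 41032000001000002003000200203,
      32401000203004024323440141104, 40123000001003001103000000001,
      24301200043402002403014143134, 14032000403200002003011101134,
      31042000203000004023040141104, 23410200043404024323421043013,
      10423000403201021222404001003, 30124000203001032213100002003,
      23401402134444024323431204210, 4123300413403001103030014043,
      13042000403200004023004120303, 20143200043400001022021043013,
      13240000403200004023004001003, 24310402134442002403004432432,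
      1432300413401021222440120144, 10324000403201021222441303030,
      21034200043404033312114143134, 12304000403204033312111101134,
      32410302114044024323433441422, 1423102224241021222402420422, 3124103423411032213110324143,
      2143300413400001022033300040, 31240000203000004023012333030,
      20134402134440001022004432432, 2341300413400001022040120144,
      14230000403200002003041303030, 34201302114040000001012202230,
      4132102224243001103023214210, 1342103423411021222400213042, 1234300413401021222442144303,
      32104000203004024323403144323, 21043402134444033312131204210,
      3214300413401032213130014043, 12403000403204033312104120303,
      42310004003032002403022111132, 10432202144441021222444240200,
      1324102224241021222403124411, 12034303013414033312124240032,
      21304403433214033312101204032, 2134103423410001022002300000,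
      20341200043400001022011102333, 41230000001000002003003411323,
      31024302114040004023012202230, 2314102224240001022023214210, 2431103423410001022000213042,
      4321300413403001103042144303, 34012000203000000001003144323,
      43201004003030000001033144122, 14023202144440002003021412432,
      3142102224241032213112413224, 10243303013411021222431340113,
      23140403433214024323444304103, 1243103423411021222423144343,
      23014200043404024323424324000, 42103000001002002403002444333,
      30142302114041032213133441422, 3241102224241032213102420422, 4213103423413001103010324143,
      3412300413401032213133300040, 30421000203001032213112333030,
      40132004003033001103022111132, 10342303013411021222411320030,
      10234202144441021222434401234, 23104402134444024323441443234,
      12043202144444033312121134411, 30214203243011032213120342103,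
      21403403433214033312104302000, 13024303013410004023034103303,
      20314403433210001022031124333, 20431402134440001022004110401,
      40321000001003001103003411323, 43012000001000000001002444333,
      41023004003030002003033144122, 13204202144440004023021412432,
      2413102224240001022012413224, 13420303013410004023031340113,
      20413403433210001022044304103, 3421103423411032213123144343,
      24103200043402002403024324000, 21340402134444033312104110401,
      32041203243014024323430203002, 24130403433212002403031124333,
      23041403433214024323404302000, 24013402134442002403041443234,
      12340202144444033312144240200, 4231102224243001103003124411,
      14302303013410002003024240032, 24031403433212002403001204032,
      4312103423413001103002300000, 21430200043404033312111102333,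
      32140203243014024323422144333, 32014302114044024323432142431,
      30241302114041032213123403224, 40213001001023001103000100201,
      30412203243011032213122144333, 31204203243010004023043333020,
      31420302114040004023023403224, 14203303013410002003034103303,
      13402202144440004023021134411, 14320202144440002003034401234,
      31402203243010004023030203002, 12430303013414033312111320030,
      42031001001022002403000400004, 34021203243010000001043333020,
      34102302114040000001032142431, 34120203243010000001020342103,
      42130001001022002403033444323, 42013004003032002403003011120,
      40231004003033001103002044130, 41302001001020002003000400004,
      40312001001023001103033444323, 41203001001020002003022411333,
      41320004003030002003002044130, 43120001001020000001000100201,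
      43021001001020000001022411333, 43102004003030000001003011120]

theorem separated_e5S5 : ∀ s ∈ list_e5S5, Separated separators_e5S5 (decTriple s) := by
  decide +kernel

theorem regularList_e5S5 : RegularList (0, 0, 2, 0)
    (fun i : Fin 3 => words_e5S5.getD (5 + i) []) (fun k => endOf 5 (code_e5S5 k)) (endOf 5)
    list_e5S5 := by
  constructor <;> decide +kernel

theorem normalizes_e5S5 : normalizes (words_e5S5.map (wordCode (0, 0, 2, 0))) 0 5 5 3
    [[[0, 0, 0, 0], [2], [1], [1, 1, 1, 1, 2, 3], [0, 0, 0, 0, 4]], [[1], [0], [4], [0, 1, 1, 1,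
      1, 2, 3, 4, 4, 4, 4], [2]], [[0, 0, 0, 0], [3], [1, 1, 1, 1, 2, 3], [1], [0, 0, 0, 0, 1,
      3, 3, 3, 3, 4]]] = true := by
  decide +kernel

theorem generates_e5S5 : ∀ k : Fin 3, words_e5S5.getD (8 + k) [] = [k] ∧
    (∀ i ∈ (![[0, 0, 0, 5], [6], [7]] : Fin 3 → List ℕ) k, i < 8) ∧
    agree (words_e5S5.map (wordCode (0, 0, 2, 0)))
      ((![[0, 0, 0, 5], [6], [7]] : Fin 3 → List ℕ) k) [8 + k] = true := by
  decide +kernel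

theorem not_commute_e5S5 : agree (words_e5S5.map (wordCode (0, 0, 2, 0))) [5, 0]
    [0, 5] = false := by
  decide +kernel

theorem alternatingGroup_le_e5S5 : alternatingGroup (Fin 5) ≤ Subgroup.closure
    (Set.range fun k => involutionOf 5 (code_e5S5 k) (code_e5S5_involutive k)) :=
  alternatingGroup_le_closure code_e5S5_involutive
    [1, 0, 1, 0] 2 3 4
    [(0, 0), (1, 1), (2, 2), (1, 2), (2, 3), (0, 3), (2, 4), (1, 4), (0, 4), (2, 5), (1, 5), (2,
      5), (1, 5), (0, 5), (2, 6), (2, 6), (1, 6), (0, 6), (2, 7), (1, 7), (0, 7), (2, 8), (2,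
      8), (1, 8), (1, 8), (0, 8), (2, 9), (2, 9), (1, 9), (0, 9), (2, 10), (2, 10), (1, 10), (1,
      10), (0, 10), (2, 11), (0, 11), (2, 12), (2, 12), (1, 12), (1, 12), (0, 12), (2, 13), (2,
      13), (1, 13), (1, 13), (0, 13), (2, 14), (0, 14), (2, 14), (2, 13), (1, 12), (0, 11), (1,
      9), (0, 8), (1, 4), (0, 4), (0, 3), (0, 2)]
    (by decide +kernel) (by decide +kernel) (by decide +kernel)

end e5S5

/-- The matrix over the field with five elements that is given by four decimal digits. -/
def matrixOf (s : ℕ) : Matrix (Fin 2) (Fin 2) (ZMod 5) :=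
  !![(digit s 0 : ZMod 5), (digit s 1 : ZMod 5); (digit s 2 : ZMod 5), (digit s 3 : ZMod 5)]

/-! ### Certificates for `5^2 : (5^2 : (SL(2, 5) : 2))`. -/

section iterated

/-- Words that generate two normal subgroups of order 25, words that generate `SL(2, 5)`, an
involution that normalizes it, and the involutions of the axes. -/
def words_iterated : List (List (Fin 3)) :=
    [[2, 1, 2, 1, 2, 0, 2, 0, 1, 2, 1, 0, 2, 0], [2, 0, 2, 1, 2, 1, 2, 0, 2, 0, 1, 2, 1, 0], [1,
      0, 1, 0, 1, 2, 1, 2, 1, 0, 1, 0, 1, 0, 2, 1, 2, 0], [1, 2, 1, 2, 1, 0, 1, 0, 1, 0, 2, 1,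
      2, 0, 1, 0, 1, 0], [1, 2, 1, 2, 1, 2, 1, 2], [0, 1, 0, 2, 0, 1, 2, 1, 2, 0, 1, 0, 1, 2, 1,
      0, 1, 0, 1, 0], [1], [0], [1], [2]]

def dual_iterated : Fin 4 → Fin 3 → List ℕ :=
    ![![[0, 3, 0, 0, 0, 0, 0, 0], [0, 4, 0, 0, 0, 0, 0, 0], [0, 0, 0, 0, 0, 0, 0, 0]], ![[0, 0,
      0, 0, 0, 0, 0, 0], [0, 4, 0, 0, 0, 0, 0, 0], [0, 0, 0, 0, 0, 0, 0, 0]], ![[3, 1, 0, 0, 0,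
      0, 0, 0], [1, 0, 0, 0, 0, 0, 0, 0], [0, 0, 0, 0, 0, 0, 0, 0]], ![[4, 3, 0, 0, 0, 0, 0, 0],
      [1, 0, 0, 0, 0, 0, 0, 0], [0, 0, 0, 0, 0, 0, 0, 0]]]

theorem translationWords_iterated : TranslationWords (0, 2, 4, 0)
    (fun i : Fin 4 => words_iterated.getD (0 + i) []) dual_iterated := by
  constructor <;> decide +kernel

def separators_iterated : List (Fin 3 → List ℕ) :=
    [![[3, 4, 0, 0, 0, 0, 0, 0], [3, 1, 1, 0, 0, 0, 0, 0], [0, 0, 0, 0, 0, 0, 1, 4]], ![[1, 4,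
      3, 0, 0, 4, 0, 1], [4, 1, 0, 0, 0, 0, 0, 3], [0, 0, 0, 4, 0, 0, 0, 0]]]

theorem annihilates_iterated : Annihilates (0, 2, 4, 0) (fun i : Fin 4 => words_iterated.getD (0 + i) [])
    separators_iterated := by
  decide +kernel

def list_iterated : List ℕ :=
    [1001000001000000001000000001, 1011000304300002023042010142, 1101024140410434333244244220,
      1021000102100004040034040403, 2111043432420241413132143101, 1112024141310433340233401301,
      1201043234320004004030342330, 1031000400400001012021040434, 3121012224430003043023113331,
      2132043232020242433113330403, 3211024243310244414122221110, 1123024243310434324222113432,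
      2312024441410242401113440232, 1213043433320002032021221211, 1301012323230310114423304331,
      1041000203200003034013010130, 4131031011440310123412204310, 3102012323230001021041300434,
      221000202300434324211004041, 2103043234320244414144032310, 332000404000432320243223033,
      3243024441410242401142120403, 4311043232020001021012304124, 1134024441410432320211320013,
      3423043232020242433141043134, 2330024240110241404143031334, 3012000102100001012044111331,
      1220043334020000010012140032, 2013000400400003034042343212, 1314012220330314144411420322,
      1401031412140312113413220223, 141000303400122203304411143, 4122031414440310114422411344,
      2231031211340124234302231023, 3133012220330004004014002142, 3302031412140122244320400020,
      223000404000432320210423331, 2321024141310242433103213033, 2124043433320242401120244332,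
      2403012323230001021013033303, 330000101200432343244324323, 3032000304300004040023111113,
      3220024240110241404112024241, 2043000102100001012013333230, 4304043234320004004021410403,
      411000404000122244302432133, 1140024240110432343200032144, 4034000102100004040024141031,
      3402043234320244414110341402, 2303024140410241413123122431, 3042000400400003034010141334,
      4212012224430310123421014103, 1232043432420003043003004243, 2033000203200000001021333024,
      3313031011440122203314142431, 1322012420230312113404031203, 2214031414440124202324342141,
      1410031012340314121403003134, 142000000100124202301113133, 4241012220330314144440312101,
      4113031211340314144432123323, 2203031412140122244330120400, 331000000100433340241031013,
      3114012420230002032032214410, 1433031414440310114433114401, 3330031012340123232342021203,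
      3002000001000002023002141220, 220000101200432343214312341, 2023000304300004040034303033,
      2344024243310244414133304130, 4421024441410432320244240302, 2140043334020241404101411414,
      4024000400400001012032101020, 2422012220330004004040341430, 333000303400434333240440333,
      3202024140410241413132423034, 1343012224430310123430223230, 4342043433320002032030011122,
      4204012323230310114433443432, 410000101200123232300200403, 140000101200123232302244433,
      2434012224430003043031230331, 3431043433320242401134104330, 3022000203200000001031101112,
      2242031011440122203341403214, 412000202300124234304144143, 1244043232020001021044403344,
      4432024243310434324233442323, 2003000001000002023000303111, 3341031414440124202331213114,
      1330012423430314121442132024, 1424031011440310123443331040, 2410012423430000010004442424,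
      143000202300124234303340403, 4233012420230312113402221210, 4104031412140312113442330302,
      413000000100124202301331433, 2220031012340123232313014332, 334000202300434324242142413,
      3140012423430000010000431343, 4014000203200003034040131234, 1442031211340314144423442312,
      222000303400434333213221021, 4323043432420003043003233230, 4410024240110432343200043331,
      2441012420230002032022114122, 3234024141310242433102322322, 4330043334020000010044102231,
      414000303400122203303003003, 4140031012340314121402042331, 3410043334020241404103422323,
      144000404000122244300002003, 3324031211340124234303334342, 4443024141310433340222144344,
      4220012423430314121414120214, 4004000001000000001003131113, 224000000100433340212100421,
      4404024140410434333211341310, 3444043432420241413122200421, 4044000304300002023011101212]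

/-- The list covers `SL(2, 5)`, and its images under the involution cover the other coset in `SL(2,
5) : 2`; both have to be separated from the translations. -/
theorem separated_iterated : ∀ s ∈ list_iterated, Separated separators_iterated (decTriple s) ∧
    Separated separators_iterated (fun k => appWord (0, 2, 4, 0) (words_iterated.getD 6 []) (decTriple s k)) := by
  decide +kernel

theorem not_mem_iterated : ∀ s ∈ list_iterated, ∃ k, decTriple s k ≠
    appWord (0, 2, 4, 0) (words_iterated.getD 6 []) (unitVec k) := by
  decide +kernel

theorem regularList_iterated : RegularList (0, 2, 4, 0) (fun i : Fin 2 => words_iterated.getD (4 + i) [])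
    ![!![1, 1; 0, 1], !![1, 0; 1, 1]] matrixOf list_iterated := by
  constructor <;> decide +kernel

theorem normalizes_iterated_sl : normalizes (words_iterated.map (wordCode (0, 2, 4, 0))) 4 2 6 1
    [[[4, 4, 4, 4], [5, 5, 5, 5, 4, 5]]] = true := by
  decide +kernel

theorem normalizes_iterated_snd : normalizes (words_iterated.map (wordCode (0, 2, 4, 0))) 2 2 4 3
    [[[2, 3, 3, 3, 3], [3]], [[2], [2, 2, 2, 2, 3]], [[2, 3], [3, 3, 3, 3]]] = true := by
  decide +kernel

theorem normalizes_iterated_fst : normalizes (words_iterated.map (wordCode (0, 2, 4, 0))) 0 2 2 5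
    [[[0], [1]], [[0], [1]], [[0], [0, 1]], [[0, 1], [1]], [[0], [0, 1, 1, 1, 1]]] = true := by
  decide +kernel

theorem generates_iterated : ∀ k : Fin 3, words_iterated.getD (7 + k) [] = [k] ∧
    (∀ i ∈ (![[0, 1, 1, 1, 1, 2, 2, 3, 3, 3, 6, 4, 6, 5, 6], [6], [5, 5, 6, 5, 5, 5, 4]] : Fin 3 → List ℕ) k, i < 7) ∧
    agree (words_iterated.map (wordCode (0, 2, 4, 0)))
      ((![[0, 1, 1, 1, 1, 2, 2, 3, 3, 3, 6, 4, 6, 5, 6], [6], [5, 5, 6, 5, 5, 5, 4]] : Fin 3 → List ℕ) k) [7 + k] = true := by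
  decide +kernel

theorem involution_iterated : agree (words_iterated.map (wordCode (0, 2, 4, 0))) [6, 6] [] = true := by
  decide +kernel

theorem not_commute_iterated_sl : agree (words_iterated.map (wordCode (0, 2, 4, 0))) [6, 4]
    [4, 6] = false := by
  decide +kernel

theorem not_commute_iterated_snd : agree (words_iterated.map (wordCode (0, 2, 4, 0))) [4, 2]
    [2, 4] = false := by
  decide +kernel

theorem not_commute_iterated_fst : agree (words_iterated.map (wordCode (0, 2, 4, 0))) [5, 0]
    [0, 5] = false := by
  decide +kernel

end iterated

set_option linter.unusedSectionVars false

/-! ### The groups `5^5 : A_5` and `5^5 : S_5`. -/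

section Splits

variable {A : Type*} [NonUnitalNonAssocCommRing A] [Module (ZMod 5) A]
  [IsScalarTower (ZMod 5) A A] [SMulCommClass (ZMod 5) A A]
  {φ : LinearMap.BilinForm (ZMod 5) A} {a b c : A} {P : Code4}

/-- A group of translations meets a group that acts regularly on a list of triples trivially, if
all of the triples are separated from the axes. -/
theorem TranslationWords.eq_one_of_mem {n : ℕ} {w : Fin n → List (Fin 3)}
    {D : Fin n → Fin 3 → List ℕ} (W : TranslationWords P w D) (h : IsTriple φ a b c P)
    (li : LinearIndependent (ZMod 5) (monomials a b c)) {L : List (Fin 3 → List ℕ)}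
    (hL : Annihilates P w L) {M ι : Type*} [Monoid M] {w' : ι → List (Fin 3)} {g : ι → M}
    {val : ℕ → M} {S : List ℕ} (C : RegularList P w' g val S) (u : List (Fin 3))
    (sep : ∀ s ∈ S, Separated L (fun k => appWord P u (decTriple s k))) {x : A ≃ₗ[ZMod 5] A}
    (hx : x ∈ Subgroup.closure (Set.range fun i => word a b c (w' i)))
    (hx' : word a b c u * x ∈ Subgroup.closure (Set.range fun i => word a b c (w i))) :
    word a b c u * x = 1 := by
  obtain ⟨s, hs, e⟩ := C.exists_axes h hx
  obtain ⟨y, hy⟩ := exists_translates W h hx'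
  refine hy.eq_one h li hL (fun k => (h.word_vect u (C.digits s hs k)).1) (fun k => ?_) (sep s hs)
    ((Subgroup.closure_le _).2 ?_ hx')
  · rw [LinearEquiv.mul_apply, e, (h.word_vect u (C.digits s hs k)).2]
  · rintro _ ⟨i, rfl⟩
    exact word_mem a b c _

/-- Two groups of translations have a trivial intersection if the linear forms that are dual to the
displacements of the first one annihilate those of the second one. -/
theorem TranslationWords.eq_one_of_annihilates {n n' : ℕ} {w : Fin n → List (Fin 3)}
    {D : Fin n → Fin 3 → List ℕ} (W : TranslationWords P w D) {w' : Fin n' → List (Fin 3)}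
    {D' : Fin n' → Fin 3 → List ℕ} (W' : TranslationWords P w' D') (h : IsTriple φ a b c P)
    (li : LinearIndependent (ZMod 5) (monomials a b c)) (hL : Annihilates P w' (List.ofFn D))
    {x : A ≃ₗ[ZMod 5] A} (hx : x ∈ Subgroup.closure (Set.range fun i => word a b c (w i)))
    (hx' : x ∈ Subgroup.closure (Set.range fun i => word a b c (w' i))) : x = 1 := by
  obtain ⟨y, hy⟩ := exists_translates W h hx
  obtain ⟨y', hy'⟩ := exists_translates W' h hx'
  have y0 : ∀ i, y i = 0 := fun i => by
    have h3 : ∀ j, ((pairing (D i) (displacement P (w' j)) : ℕ) : ZMod 5) = 0 := fun j =>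
      (ZMod.natCast_eq_zero_iff _ _).2
        (Nat.dvd_of_mod_eq_zero ((hL _ (List.mem_ofFn.2 ⟨i, rfl⟩)).2 j))
    rw [W.eq_of_translates h li hy i, hy'.tripleForm_eq li h.span (W.length i)]
    simp [h3]
  refine h.ext_axes ((Subgroup.closure_le _).2 ?_ hx) (one_mem _) fun k => ?_
  · rintro _ ⟨i, rfl⟩
    exact word_mem a b c _
  · rw [hy k]
    simp [y0]

/-- The translations form a normal subgroup and the regular list describes a complement, which meets
it trivially by separation. A pair of words that do not commute shows that the action is not
trivial. -/
theorem isSplit_miyamotoGroup {n r : ℕ} {xs : List (List (Fin 3))} {D : Fin n → Fin 3 → List ℕ}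
    (W : TranslationWords P (fun i : Fin n => xs.getD (0 + i) []) D) {L : List (Fin 3 → List ℕ)}
    (hL : Annihilates P (fun i : Fin n => xs.getD (0 + i) []) L) {M : Type*} [Monoid M]
    {g : Fin r → M} {val : ℕ → M} {S : List ℕ}
    (C : RegularList P (fun i : Fin r => xs.getD (n + i) []) g val S)
    (sep : ∀ s ∈ S, Separated L (decTriple s)) {rel : List (List (List ℕ))}
    (norm : normalizes (xs.map (wordCode P)) 0 n n r rel = true) {ts : Fin 3 → List ℕ}
    (gen : ∀ k : Fin 3, xs.getD (n + r + k) [] = [k] ∧ (∀ i ∈ ts k, i < n + r) ∧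
      agree (xs.map (wordCode P)) (ts k) [n + r + k] = true) {i j : ℕ} (hi : i < n)
    (hj : n ≤ j) (hj' : j < n + r) (nc : agree (xs.map (wordCode P)) [j, i] [i, j] = false)
    (h : IsTriple φ a b c P) (li : LinearIndependent (ZMod 5) (monomials a b c)) {H : Type*}
    [Group H] (e : Nonempty (segment a b c xs n r ≃* H)) :
    IsSplit (Elem5 n) H (miyamotoGroup (ZMod 5) a b c) := by
  obtain ⟨e2⟩ := e
  obtain ⟨e1⟩ := W.nonempty_mulEquiv h li
  obtain ⟨θ, hθ, ⟨f⟩⟩ := exists_mulEquiv_semidirectProduct (N' := segment a b c xs 0 n) e1 e2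
    (h.segment_le_normalizer norm)
    (fun x hx hx' => by
      have := W.eq_one_of_mem h li hL C [] sep hx' (by
        rw [show word a b c [] = 1 from rfl, one_mul]
        exact hx)
      simpa [word] using this)
    (word_mem_segment (Nat.zero_le i) (by omega)) (word_mem_segment hj hj') (h.mul_ne_mul li nc)
  refine ⟨θ, hθ, ⟨(MulEquiv.subgroupCongr ?_).trans f⟩⟩
  rw [h.miyamotoGroup_eq_segment gen, ← segment_sup, Nat.zero_add]

theorem toEndHom_injective (n : ℕ) :
    Function.Injective (MulAction.toEndHom (M := Equiv.Perm (Fin n)) (α := Fin n)) := fun _ _ e =>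
  Equiv.ext fun i => congrFun e i

theorem RegularList.nonempty_mulEquiv_perm {r : ℕ} {w : Fin r → List (Fin 3)} {n : ℕ} [NeZero n]
    {x : Fin r → ℕ} {S : List ℕ} (C : RegularList P w (fun k => endOf n (x k)) (endOf n) S)
    (hx : ∀ k i, funOf n (x k) (funOf n (x k) i) = i) (h : IsTriple φ a b c P)
    (li : LinearIndependent (ZMod 5) (monomials a b c)) :
    Nonempty (Subgroup.closure (Set.range fun i => word a b c (w i)) ≃*
      Subgroup.closure (Set.range fun k => involutionOf n (x k) (hx k))) :=
  C.nonempty_mulEquiv (toEndHom_injective n) (f := fun k => involutionOf n (x k) (hx k))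
    (fun _ => rfl) h li

theorem isSplit_e5A5 (h : IsTriple φ a b c (1, 1, 2, 3))
    (li : LinearIndependent (ZMod 5) (monomials a b c)) :
    IsSplit (Elem5 5) (alternatingGroup (Fin 5)) (miyamotoGroup (ZMod 5) a b c) := by
  refine isSplit_miyamotoGroup translationWords_e5A5 annihilates_e5A5 regularList_e5A5
    separated_e5A5 normalizes_e5A5 generates_e5A5 (by norm_num) (by norm_num) (by norm_num)
    not_commute_e5A5 h li ?_
  have e : Subgroup.closure (Set.range fun k => involutionOf 5 (code_e5A5 k)
      (code_e5A5_involutive k)) = alternatingGroup (Fin 5) := by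
    refine le_antisymm ?_ alternatingGroup_le_e5A5
    rw [Subgroup.closure_le]
    rintro _ ⟨k, rfl⟩
    rw [SetLike.mem_coe, Equiv.Perm.mem_alternatingGroup]
    revert k
    decide +kernel
  obtain ⟨f⟩ := regularList_e5A5.nonempty_mulEquiv_perm code_e5A5_involutive h li
  exact ⟨f.trans (MulEquiv.subgroupCongr e)⟩

theorem eq_top_of_alternatingGroup_le {α : Type*} [Fintype α] [DecidableEq α]
    {K : Subgroup (Equiv.Perm α)} (h : alternatingGroup α ≤ K) {σ : Equiv.Perm α} (hσ : σ ∈ K)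
    (odd : Equiv.Perm.sign σ = -1) : K = ⊤ := by
  rw [eq_top_iff]
  intro τ _
  rcases Int.units_eq_one_or (Equiv.Perm.sign τ) with e | e
  · exact h (Equiv.Perm.mem_alternatingGroup.2 e)
  · have : τ * σ ∈ K := h (Equiv.Perm.mem_alternatingGroup.2 (by simp [e, odd]))
    exact (Subgroup.mul_mem_cancel_right K hσ).1 this

theorem isSplit_e5S5 (h : IsTriple φ a b c (0, 0, 2, 0))
    (li : LinearIndependent (ZMod 5) (monomials a b c)) :
    IsSplit (Elem5 5) (Equiv.Perm (Fin 5)) (miyamotoGroup (ZMod 5) a b c) := by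
  refine isSplit_miyamotoGroup translationWords_e5S5 annihilates_e5S5 regularList_e5S5
    separated_e5S5 normalizes_e5S5 generates_e5S5 (by norm_num) (by norm_num) (by norm_num)
    not_commute_e5S5 h li ?_
  have e : Subgroup.closure (Set.range fun k => involutionOf 5 (code_e5S5 k)
      (code_e5S5_involutive k)) = ⊤ :=
    eq_top_of_alternatingGroup_le alternatingGroup_le_e5S5
      -- The second generator is the transposition `(3 4)`.
      (Subgroup.subset_closure (Set.mem_range_self 1)) (by decide +kernel)
  obtain ⟨f⟩ := regularList_e5S5.nonempty_mulEquiv_perm code_e5S5_involutive h li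
  exact ⟨(f.trans (MulEquiv.subgroupCongr e)).trans Subgroup.topEquiv⟩

end Splits

/-! ### The iterated semidirect product. -/

section IteratedSplit

theorem translationWords_iterated_fst : TranslationWords (0, 2, 4, 0)
    (fun i : Fin 2 => words_iterated.getD (0 + i) []) ![dual_iterated 0, dual_iterated 1] := by
  constructor <;> decide +kernel

theorem translationWords_iterated_snd : TranslationWords (0, 2, 4, 0)
    (fun i : Fin 2 => words_iterated.getD (2 + i) []) ![dual_iterated 2, dual_iterated 3] := by
  constructor <;> decide +kernel

theorem annihilates_iterated_snd : Annihilates (0, 2, 4, 0)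
    (fun i : Fin 2 => words_iterated.getD (2 + i) [])
    (List.ofFn ![dual_iterated 0, dual_iterated 1]) := by
  decide +kernel

variable {A : Type*} [NonUnitalNonAssocCommRing A] [Module (ZMod 5) A]
  [IsScalarTower (ZMod 5) A A] [SMulCommClass (ZMod 5) A A]
  {φ : LinearMap.BilinForm (ZMod 5) A} {a b c : A}

/-- The inclusion of `SL(2, 5)` into the monoid of matrices. -/
def coeSL : SL(2, ZMod 5) →* Matrix (Fin 2) (Fin 2) (ZMod 5) where
  toFun g := g.1
  map_one' := rfl
  map_mul' _ _ := rfl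

theorem nonempty_mulEquiv_sl25 (h : IsTriple φ a b c (0, 2, 4, 0))
    (li : LinearIndependent (ZMod 5) (monomials a b c)) :
    Nonempty (segment a b c words_iterated 4 2 ≃* SL(2, ZMod 5)) := by
  have : Fact (Nat.Prime 5) := ⟨by norm_num⟩
  obtain ⟨f⟩ := regularList_iterated.nonempty_mulEquiv (ρ := coeSL) Subtype.val_injective
    (f := ![upper 1, lower 1]) (fun i => by fin_cases i <;> rfl) h li
  have e : Subgroup.closure (Set.range ![(upper 1 : SL(2, ZMod 5)), lower 1]) = ⊤ :=
    eq_top_of_transvections_mem (Subgroup.subset_closure ⟨0, rfl⟩)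
      (Subgroup.subset_closure ⟨1, rfl⟩)
  exact ⟨(f.trans (MulEquiv.subgroupCongr e)).trans Subgroup.topEquiv⟩

theorem segment_one (a b c : A) (xs : List (List (Fin 3))) (m : ℕ) :
    segment a b c xs m 1 = Subgroup.zpowers (word a b c (xs.getD m [])) := by
  rw [segment, Subgroup.zpowers_eq_closure]
  congr 1
  ext x
  simp

theorem word_iterated_sq (h : IsTriple φ a b c (0, 2, 4, 0)) :
    word a b c (words_iterated.getD 6 []) * word a b c (words_iterated.getD 6 []) = 1 := by
  simpa [wordList] using h.wordList_eq involution_iterated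

theorem eq_or_eq_of_mem_segment (h : IsTriple φ a b c (0, 2, 4, 0)) {x : A ≃ₗ[ZMod 5] A}
    (hx : x ∈ segment a b c words_iterated 6 1) :
    x = 1 ∨ x = word a b c (words_iterated.getD 6 []) := by
  rw [segment_one] at hx
  obtain ⟨n, rfl⟩ := Subgroup.mem_zpowers_iff.1 hx
  have sq := word_iterated_sq h
  rw [← pow_two] at sq
  rcases Int.even_or_odd' n with ⟨k, rfl | rfl⟩
  · left
    rw [zpow_mul, zpow_ofNat, sq, one_zpow]
  · right
    rw [zpow_add, zpow_mul, zpow_ofNat, sq, one_zpow, one_mul, zpow_one]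

theorem word_notMem_segment (h : IsTriple φ a b c (0, 2, 4, 0))
    (li : LinearIndependent (ZMod 5) (monomials a b c)) :
    word a b c (words_iterated.getD 6 []) ∉ segment a b c words_iterated 4 2 := fun hx => by
  obtain ⟨s, hs, e⟩ := regularList_iterated.exists_axes h hx
  obtain ⟨k, hk⟩ := not_mem_iterated s hs
  refine hk (vect_injective li (regularList_iterated.digits s hs k)
    (h.word_vect _ (isDigits_unitVec k)).1 ?_)
  rw [← e k, axis_eq_vect, (h.word_vect _ (isDigits_unitVec k)).2]

theorem nonempty_mulEquiv_c2 (h : IsTriple φ a b c (0, 2, 4, 0))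
    (li : LinearIndependent (ZMod 5) (monomials a b c)) :
    Nonempty (segment a b c words_iterated 6 1 ≃* C2) := by
  have := Fact.mk Nat.prime_two
  have o : orderOf (word a b c (words_iterated.getD 6 [])) = 2 :=
    orderOf_eq_prime (by rw [pow_two, word_iterated_sq h]) fun e =>
      word_notMem_segment h li (e ▸ one_mem _)
  have card : Nat.card (segment a b c words_iterated 6 1) = 2 := by
    rw [segment_one, Nat.card_zpowers, o]
  exact ⟨mulEquivOfPrimeCardEq card (by simp [C2])⟩

theorem eq_one_of_mem_segments (h : IsTriple φ a b c (0, 2, 4, 0))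
    (li : LinearIndependent (ZMod 5) (monomials a b c)) {x : A ≃ₗ[ZMod 5] A}
    (hx : x ∈ segment a b c words_iterated 0 4) (hx' : x ∈ segment a b c words_iterated 4 3) :
    x = 1 := by
  have hx' : x ∈ segment a b c words_iterated 4 2 ⊔ segment a b c words_iterated 6 1 := by
    rwa [segment_sup words_iterated 4 2 1]
  obtain ⟨y, hy, z, hz, e⟩ :=
    exists_mul_eq_of_mem_sup (h.segment_le_normalizer normalizes_iterated_sl) hx'
  have e' : x⁻¹ = z⁻¹ * y⁻¹ := by rw [← e, mul_inv_rev]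
  refine inv_eq_one.1 ?_
  -- Passing to `x⁻¹` puts the involution on the left of the `SL(2, 5)` part, as
  -- `separated_iterated` requires.
  rcases eq_or_eq_of_mem_segment h (inv_mem hz) with e1 | e1
  · rw [e1] at e'
    rw [e']
    exact translationWords_iterated.eq_one_of_mem h li annihilates_iterated regularList_iterated []
      (fun s hs => (separated_iterated s hs).1) (inv_mem hy) (by
        have := inv_mem hx
        rw [e'] at this
        exact this)
  · rw [e1] at e'
    rw [e']
    exact translationWords_iterated.eq_one_of_mem h li annihilates_iterated regularList_iterated _
      (fun s hs => (separated_iterated s hs).2) (inv_mem hy) (by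
        have := inv_mem hx
        rw [e'] at this
        exact this)

theorem isIteratedSplit_iterated (h : IsTriple φ a b c (0, 2, 4, 0))
    (li : LinearIndependent (ZMod 5) (monomials a b c)) :
    IsIteratedSplit (miyamotoGroup (ZMod 5) a b c) := by
  obtain ⟨eM⟩ := nonempty_mulEquiv_sl25 h li
  obtain ⟨eC⟩ := nonempty_mulEquiv_c2 h li
  obtain ⟨e1⟩ := translationWords_iterated_fst.nonempty_mulEquiv h li
  obtain ⟨e2⟩ := translationWords_iterated_snd.nonempty_mulEquiv h li
  have n1 := h.segment_le_normalizer normalizes_iterated_sl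
  have n2 := h.segment_le_normalizer normalizes_iterated_snd
  have n3 := h.segment_le_normalizer normalizes_iterated_fst
  have s1 : segment a b c words_iterated 4 2 ⊔ segment a b c words_iterated 6 1 =
    segment a b c words_iterated 4 3 := segment_sup words_iterated 4 2 1
  have s2 : segment a b c words_iterated 2 2 ⊔ segment a b c words_iterated 4 3 =
    segment a b c words_iterated 2 5 := segment_sup words_iterated 2 2 3
  have s3 : segment a b c words_iterated 0 2 ⊔ segment a b c words_iterated 2 5 =
    segment a b c words_iterated 0 7 := segment_sup words_iterated 0 2 5
  have s4 : segment a b c words_iterated 0 2 ⊔ segment a b c words_iterated 2 2 =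
    segment a b c words_iterated 0 4 := segment_sup words_iterated 0 2 2
  have le : segment a b c words_iterated 2 2 ≤ segment a b c words_iterated 0 4 :=
    le_sup_right.trans s4.le
  have le' : segment a b c words_iterated 0 2 ≤ segment a b c words_iterated 0 4 :=
    le_sup_left.trans s4.le
  -- The product is assembled from the inside: first `SL(2, 5) : 2`, then the two normal subgroups
  -- `5²` in turn.
  obtain ⟨θ₁, hθ₁, ⟨f1⟩⟩ := exists_mulEquiv_semidirectProduct eM eC n1
    (fun x hx hx' => (eq_or_eq_of_mem_segment h hx').resolve_right fun e =>
      word_notMem_segment h li (e ▸ hx))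
    (word_mem_segment (i := 4) (by norm_num) (by norm_num))
    (word_mem_segment (i := 6) (by norm_num) (by norm_num))
    (h.mul_ne_mul li not_commute_iterated_sl)
  rw [s1] at f1
  obtain ⟨θ₂, hθ₂, ⟨f2⟩⟩ := exists_mulEquiv_semidirectProduct (N' := segment a b c words_iterated 2 2)
    e2 f1 n2 (fun x hx hx' => eq_one_of_mem_segments h li (le hx) hx')
    (word_mem_segment (i := 2) (by norm_num) (by norm_num))
    (word_mem_segment (i := 4) (by norm_num) (by norm_num))
    (h.mul_ne_mul li not_commute_iterated_snd)
  rw [s2] at f2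
  obtain ⟨θ₃, hθ₃, ⟨f3⟩⟩ := exists_mulEquiv_semidirectProduct (N' := segment a b c words_iterated 0 2)
    e1 f2 n3 (fun x hx hx' => by
      rw [← s2] at hx'
      obtain ⟨y, hy, z, hz, e⟩ := exists_mul_eq_of_mem_sup n2 hx'
      -- All four translation words together generate a group that meets `SL(2, 5) : 2` trivially.
      -- This removes `z`, and only the two groups of translations remain to be compared.
      have hz1 : z = 1 := eq_one_of_mem_segments h li (by
        rw [eq_inv_mul_of_mul_eq e]
        exact mul_mem (inv_mem (le hy)) (le' hx)) hz
      rw [hz1, mul_one] at e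
      rw [← e] at hx ⊢
      exact translationWords_iterated_fst.eq_one_of_annihilates translationWords_iterated_snd h li
        annihilates_iterated_snd hx hy)
    (word_mem_segment (i := 0) (by norm_num) (by norm_num))
    (word_mem_segment (i := 5) (by norm_num) (by norm_num))
    (h.mul_ne_mul li not_commute_iterated_fst)
  rw [s3, ← h.miyamotoGroup_eq_segment generates_iterated] at f3
  exact ⟨θ₁, θ₂, hθ₁, hθ₂, θ₃, hθ₃, ⟨f3⟩⟩

end IteratedSplit

/-! ### Nonsolvability and orders of the listed groups. -/

section Invariants

theorem not_isSolvable_alternatingGroup_five : ¬ Group.IsSolvable (alternatingGroup (Fin 5)) :=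
    fun h => by
  refine Equiv.Perm.not_isSolvable_fin_5 (Group.isSolvable_of_ker_le_range
    (alternatingGroup (Fin 5)).subtype (Equiv.Perm.sign (α := Fin 5)) ?_)
  rw [Subgroup.range_subtype]
  exact le_rfl

/-- A diagonal matrix in `SL(2, 5)`. -/
def diagonalSL25 : SL(2, ZMod 5) := ⟨!![2, 0; 0, 3], by decide +kernel⟩

open scoped commutatorElement in
-- Conjugation by `diag(2, 3)` multiplies the off-diagonal entry of a transvection by `4`, so
-- suitable commutators are the elementary transvections and the group is perfect.
theorem not_isSolvable_sl25 : ¬ Group.IsSolvable SL(2, ZMod 5) := fun h => by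
  have mem : ∀ x y : SL(2, ZMod 5), ⁅x, y⁆ ∈ commutator SL(2, ZMod 5) := fun x y =>
    Subgroup.commutator_mem_commutator (Subgroup.mem_top x) (Subgroup.mem_top y)
  have hU : (upper 1 : SL(2, ZMod 5)) ∈ commutator SL(2, ZMod 5) := by
    have := mem diagonalSL25 (upper 2)
    rwa [show ⁅diagonalSL25, upper (2 : ZMod 5)⁆ = upper 1 from Subtype.ext (by decide +kernel)] at this
  have hL : (lower 1 : SL(2, ZMod 5)) ∈ commutator SL(2, ZMod 5) := by
    have := mem diagonalSL25 (lower 2)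
    rwa [show ⁅diagonalSL25, lower (2 : ZMod 5)⁆ = lower 1 from Subtype.ext (by decide +kernel)] at this
  have nt : Nontrivial SL(2, ZMod 5) := ⟨⟨upper 1, 1, fun e => by
    have := congrFun (congrFun (congrArg Subtype.val e) 0) 1
    revert this
    decide +kernel⟩⟩
  exact (Group.IsSolvable.commutator_lt_top_of_nontrivial SL(2, ZMod 5)).ne
    (eq_top_of_transvections_mem hU hL)

theorem card_filter_det : (Finset.univ.filter fun x : (ZMod 5 × ZMod 5) × (ZMod 5 × ZMod 5) =>
    x.1.1 * x.2.2 - x.1.2 * x.2.1 = 1).card = 120 := by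
  decide +kernel

theorem card_sl25 : Nat.card SL(2, ZMod 5) = 120 := by
  rw [← card_filter_det, ← Fintype.card_subtype, ← Nat.card_eq_fintype_card]
  refine Nat.card_congr ⟨fun g => ⟨((g.1 0 0, g.1 0 1), (g.1 1 0, g.1 1 1)), ?_⟩,
    fun x => ⟨!![x.1.1.1, x.1.1.2; x.1.2.1, x.1.2.2], ?_⟩, fun g => ?_, fun x => ?_⟩
  · exact (Matrix.det_fin_two g.1).symm.trans g.2
  · rw [Matrix.det_fin_two_of, x.2]
  · exact Subtype.ext (Matrix.eta_fin_two g.1).symm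
  · exact Subtype.ext rfl

theorem card_elem5 (n : ℕ) : Nat.card (Elem5 n) = 5 ^ n := by
  simp [Elem5]

theorem card_of_isSplit {n : ℕ} {H G : Type*} [Group H] [Group G] (h : IsSplit (Elem5 n) H G) :
    Nat.card G = 5 ^ n * Nat.card H := by
  obtain ⟨θ, -, ⟨e⟩⟩ := h
  rw [Nat.card_congr e.toEquiv, SemidirectProduct.card, card_elem5]

theorem not_isSolvable_of_isSplit {N H G : Type*} [Group N] [Group H] [Group G]
    (h : IsSplit N H G) (hH : ¬ Group.IsSolvable H) : ¬ Group.IsSolvable G := fun hG => by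
  obtain ⟨θ, -, ⟨e⟩⟩ := h
  exact hH (Group.isSolvable_of_surjective
    (f := (SemidirectProduct.rightHom (φ := θ)).comp e.toMonoidHom)
    (SemidirectProduct.rightHom_surjective.comp e.surjective))

theorem card_of_isIteratedSplit {G : Type*} [Group G] (h : IsIteratedSplit G) :
    Nat.card G = 150000 := by
  obtain ⟨θ₁, θ₂, -, -, h⟩ := h
  rw [card_of_isSplit h, SemidirectProduct.card, SemidirectProduct.card, card_elem5, card_sl25]
  simp [C2]

theorem not_isSolvable_of_isIteratedSplit {G : Type*} [Group G] (h : IsIteratedSplit G) :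
    ¬ Group.IsSolvable G := by
  obtain ⟨θ₁, θ₂, -, -, h⟩ := h
  refine not_isSolvable_of_isSplit h fun h2 => ?_
  have h1 : Group.IsSolvable (SL(2, ZMod 5) ⋊[θ₁] C2) :=
    Group.isSolvable_of_surjective (SemidirectProduct.rightHom_surjective (φ := θ₂))
  exact not_isSolvable_sl25 (Group.isSolvable_of_isSolvable_injective
    (SemidirectProduct.inl_injective (φ := θ₁)))

/-- The rank that belongs to a group of the list, in terms of its order. -/
def rankOfCard (n : ℕ) : ℕ :=
  if n = 150000 then 4 else if n = 187500 ∨ n = 375000 then 5 else 8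

theorem rankOfCard_of_dvd {p n : ℕ} (hp : p = 7 ∨ p = 31) (h : p ∣ n) : rankOfCard n = 8 := by
  rw [rankOfCard, if_neg, if_neg]
  · rintro (rfl | rfl) <;> rcases hp with rfl | rfl <;> revert h <;> decide
  · rintro rfl
    rcases hp with rfl | rfl <;> revert h <;> decide

variable {A : Type*} [NonUnitalNonAssocCommRing A] [Module (ZMod 5) A]
  [IsScalarTower (ZMod 5) A A] [SMulCommClass (ZMod 5) A A]
  {φ : LinearMap.BilinForm (ZMod 5) A} {a b c : A}

theorem IsTriple.is_listed {L : Listed} (h : IsTriple φ a b c L.params)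
    (li : LinearIndependent (ZMod 5) (monomials a b c)) :
    L.Is (miyamotoGroup (ZMod 5) a b c) := by
  cases L with
  | e5A5 => exact isSplit_e5A5 h li
  | e5S5 => exact isSplit_e5S5 h li
  | iterated => exact isIteratedSplit_iterated h li
  | psl27 => exact nonempty_mulEquiv_psl27 h li
  | psl35 => exact nonempty_mulEquiv_psl35 h li
  | psu35 => exact nonempty_mulEquiv_psu35 h li
  | a6 =>
    obtain ⟨f⟩ := conjugationList_a6.nonempty_mulEquiv code_a6_involutive h li
    exact ⟨f.trans (MulEquiv.subgroupCongr closure_a6)⟩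
  | a7 =>
    obtain ⟨f⟩ := conjugationList_a7.nonempty_mulEquiv code_a7_involutive h li
    exact ⟨f.trans (MulEquiv.subgroupCongr closure_a7)⟩

/-- The groups of the list are not solvable, and their orders determine the ranks. -/
theorem Listed.Is.not_isSolvable_and_gramRank_eq {L : Listed} {G : Type*} [Group G] (h : L.Is G) :
    ¬ Group.IsSolvable G ∧ L.gramRank = rankOfCard (Nat.card G) := by
  have transfer : ∀ {T : Type} [Group T], G ≃* T →
      (¬ Group.IsSolvable T ∧ L.gramRank = rankOfCard (Nat.card T)) →
      ¬ Group.IsSolvable G ∧ L.gramRank = rankOfCard (Nat.card G) := fun e hT =>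
    ⟨fun hG => hT.1 (Group.isSolvable_of_surjective (f := e.toMonoidHom) e.surjective),
      by rw [Nat.card_congr e.toEquiv, hT.2]⟩
  -- A model provides a group `T` that is isomorphic to `G` too. Where `G` is not a semidirect
  -- product, nonsolvability is read off from `T`, and so is a prime divisor of the order when the
  -- order is not computed directly.
  obtain ⟨A, _, _, _, _, φ, a, b, c, hg, hp, li⟩ := hasModel.{0} L.params.1 L.params.2.1
    L.params.2.2.1 L.params.2.2.2
  have t : IsTriple φ a b c L.params := ⟨hg, hp⟩
  have is := t.is_listed li
  cases L with
  | e5A5 =>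
    refine ⟨not_isSolvable_of_isSplit h not_isSolvable_alternatingGroup_five, ?_⟩
    rw [card_of_isSplit h, Nat.card_eq_fintype_card, card_alternatingGroup, Fintype.card_fin]
    rfl
  | e5S5 =>
    refine ⟨not_isSolvable_of_isSplit h Equiv.Perm.not_isSolvable_fin_5, ?_⟩
    rw [card_of_isSplit h, Nat.card_eq_fintype_card, Fintype.card_perm, Fintype.card_fin]
    rfl
  | iterated =>
    refine ⟨not_isSolvable_of_isIteratedSplit h, ?_⟩
    rw [card_of_isIteratedSplit h]
    rfl
  | psl27 =>
    obtain ⟨e⟩ := h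
    obtain ⟨f⟩ := is
    have r := t.triangle li triangle_psl27 (by norm_num) (by norm_num) (by norm_num)
    exact transfer (e.trans f.symm) ⟨r.1, (rankOfCard_of_dvd (Or.inl rfl) r.2).symm⟩
  | psl35 =>
    obtain ⟨e⟩ := h
    obtain ⟨f⟩ := is
    have r := t.triangle li triangle_psl35 (by norm_num) (by norm_num) (by norm_num)
    exact transfer (e.trans f.symm) ⟨r.1, (rankOfCard_of_dvd (Or.inr rfl) r.2).symm⟩
  | psu35 =>
    obtain ⟨e⟩ := h
    obtain ⟨f⟩ := is
    have r := t.triangle li triangle_psu35 (by norm_num) (by norm_num) (by norm_num)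
    exact transfer (e.trans f.symm) ⟨r.1, (rankOfCard_of_dvd (Or.inl rfl) r.2).symm⟩
  | a6 =>
    obtain ⟨e⟩ := h
    obtain ⟨f⟩ := is
    have r := t.triangle li triangle_a6 (by norm_num) (by norm_num) (by norm_num)
    refine transfer (e.trans f.symm) ⟨r.1, ?_⟩
    rw [Nat.card_congr f.toEquiv, Nat.card_eq_fintype_card, card_alternatingGroup,
      Fintype.card_fin]
    rfl
  | a7 =>
    obtain ⟨e⟩ := h
    obtain ⟨f⟩ := is
    have r := t.triangle li triangle_a7 (by norm_num) (by norm_num) (by norm_num)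
    exact transfer (e.trans f.symm) ⟨r.1, (rankOfCard_of_dvd (Or.inl rfl) r.2).symm⟩

end Invariants

/-! ### Assembling the classification. -/

section Conclusion

/-- The group is solvable, or it is in the list, with the corresponding rank. -/
def SolvableOrListed (G : Type u) [Group G] (r : ℕ) : Prop :=
  Group.IsSolvable G ∨ ∃ L : Listed, L.Is G ∧ r = L.gramRank

theorem holds_params (L : Listed) :
    Holds.{u} (fun G _ r => L.Is G ∧ r = L.gramRank) L.params.1 L.params.2.1 L.params.2.2.1
      L.params.2.2.2 := by
  intro A _ _ _ _ φ a b c hg hp li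
  have t : IsTriple φ a b c L.params := ⟨hg, hp⟩
  exact ⟨t.is_listed li, by rw [t.gramMatrix_eq, gramMat_rank]⟩

theorem holds_solvable_of_mem : ∀ P ∈ solvableReps,
    Holds.{u} SolvableGroup P.1 P.2.1 P.2.2.1 P.2.2.2 := by
  simp only [solvableReps, List.forall_mem_cons]
  exact ⟨solvable_0002, solvable_0010, solvable_0223, solvable_0332, solvable_0441, solvable_1111,
    solvable_1222, solvable_1333, solvable_1444, solvable_2221, solvable_2230, solvable_2244,
    solvable_2334, solvable_2343, solvable_3330, solvable_3333, solvable_4443, by simp⟩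

theorem holds_solvableOrListed (α β γ ψ : ZMod 5) : Holds.{u} SolvableOrListed α β γ ψ := by
  obtain ⟨P, hP, -, r⟩ := exists_rep.{u} α β γ ψ
  have key : Holds.{u} SolvableOrListed P.1 P.2.1 P.2.2.1 P.2.2.2 := by
    rcases List.mem_append.1 hP with hP | hP
    · obtain ⟨L, hL⟩ := exists_linked.{u} P hP
      exact hL _ fun A _ _ _ _ φ a b c hg hp li =>
        Or.inr ⟨L, holds_params L A φ a b c hg hp li⟩
    · exact fun A _ _ _ _ φ a b c hg hp li =>
        Or.inl (holds_solvable_of_mem P hP A φ a b c hg hp li)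
  have := r _ key
  simpa using this

end Conclusion

end PseudoComp

theorem mainTheorem9 :
    -- the universal algebra exists for all values of the parameters
    (∀ α β γ ψ : ZMod 5, ∃ (A : Type u) (_ : NonUnitalNonAssocCommRing A) (_ : Module (ZMod 5) A)
      (_ : IsScalarTower (ZMod 5) A A) (_ : SMulCommClass (ZMod 5) A A)
      (φ : LinearMap.BilinForm (ZMod 5) A) (a b c : A), IsUniversal φ a b c α β γ ψ) ∧
    (∀ (α β γ ψ : ZMod 5) (A : Type u) [NonUnitalNonAssocCommRing A] [Module (ZMod 5) A]
      [IsScalarTower (ZMod 5) A A] [SMulCommClass (ZMod 5) A A]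
      (φ : LinearMap.BilinForm (ZMod 5) A) (a b c : A), IsUniversal φ a b c α β γ ψ →
      -- the eight monomials form a basis of it
      (LinearIndependent (ZMod 5) (monomials a b c) ∧
        Submodule.span (ZMod 5) (Set.range (monomials a b c)) = ⊤) ∧
      -- the group is solvable or one of the eight groups
      (Group.IsSolvable (miyamotoGroup (ZMod 5) a b c) ∨
        ∃ L : Listed, L.Is (miyamotoGroup (ZMod 5) a b c)) ∧
      -- the rank of the Gram matrix for each of the eight groups
      (∀ L : Listed, L.Is (miyamotoGroup (ZMod 5) a b c) →
        (gramMatrix φ a b c).rank = L.gramRank)) ∧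
    -- each of the eight groups occurs
    (∀ L : Listed, ∃ α β γ ψ : ZMod 5, ∀ (A : Type u) [NonUnitalNonAssocCommRing A]
      [Module (ZMod 5) A] [IsScalarTower (ZMod 5) A A] [SMulCommClass (ZMod 5) A A]
      (φ : LinearMap.BilinForm (ZMod 5) A) (a b c : A), IsUniversal φ a b c α β γ ψ →
      L.Is (miyamotoGroup (ZMod 5) a b c)) := by
  refine ⟨fun α β γ ψ => ?_, fun α β γ ψ A _ _ _ _ φ a b c h => ?_, fun L =>
    ⟨L.params.1, L.params.2.1, L.params.2.2.1, L.params.2.2.2, fun A _ _ _ _ φ a b c h => ?_⟩⟩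
  · obtain ⟨A, i1, i2, i3, i4, φ, a, b, c, hg, hp, li⟩ := hasModel.{u} α β γ ψ
    exact ⟨A, i1, i2, i3, i4, φ, a, b, c, hg.isUniversal hp li⟩
  · have li := h.linearIndependent (hasModel α β γ ψ)
    have key := holds_solvableOrListed α β γ ψ A φ a b c h.generated h.parameters li
    refine ⟨⟨li, h.generated.span_monomials h.parameters⟩,
      key.imp id fun ⟨L, hL, _⟩ => ⟨L, hL⟩, fun L hL => ?_⟩
    -- A priori `T` could have been found to be another listed group `L'` than `L`; the rank is
    -- compared through the order of `T`, and the solvable case is excluded.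
    rcases key with sol | ⟨L', hL', r⟩
    · exact absurd sol hL.not_isSolvable_and_gramRank_eq.1
    · rw [r, hL.not_isSolvable_and_gramRank_eq.2, hL'.not_isSolvable_and_gramRank_eq.2]
  · exact (holds_params L A φ a b c h.generated h.parameters
      (h.linearIndependent (hasModel _ _ _ _))).1
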